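/- Let $M$ be a compact complex manifold of dimension $m\ge 1$ and let $(L,h)\to M$ be a holomorphic line bundle with a smooth Hermitian metric of positive curvature. In a local holomorphic frame $e$ of $L$ the curvature is $\Theta_h=-\partial\bar\partial\log\|e\|_h^2$; give $M$ the Kähler form $\omega=\frac i2\Theta_h$. Let $N\ge 0$ be an integer such that $H^0(M,L^N)$ is base point free (for every $x\in M$ there is a section $s\in H^0(M,L^N)$ with $s(x)\neq 0$). Give $H^0(M,L^N)$ the inner product $\langle s,t\rangle=\int_M h^N(s,t)\,\frac{\omega^m}{m!}$, let $S_1,\dots,S_d$ be an orthonormal basis of $H^0(M,L^N)$, and let $s=\sum_{j=1}^d c_jS_j$ be the Gaussian random section whose coefficient vector $c=(c_1,\dots,c_d)\in\mathbb C^d$ has law $\pi^{-d}e^{-|c|^2}\,dc$. The Szegő kernel is $\Pi_N(z,w)=\sum_j S_j(z)\otimes\overline{S_j(w)}$. Its modulus $|\Pi_N(z,w)|$ is taken with respect to $h^N$, and $\Pi_N(z,z)=\sum_j\|S_j(z)\|^2_{h^N}>0$. Put $$P_N(z,w)=\frac{|\Pi_N(z,w)|}{\Pi_N(z,z)^{1/2}\,\Pi_N(w,w)^{1/2}},\qquad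 Q_N(z,w)=\widetilde G(P_N(z,w)),\qquad \widetilde G(t)=-\frac1{4\pi^2}\int_0^{t^2}\frac{\log(1-r)}{r}\,dr\quad(0\le t\le 1).$$ Then: 1. For almost every $c$ the zero set of $s$ is a (possibly empty) closed complex submanifold of $M$ of codimension one. Hence the current of integration $Z_s$ over it is defined almost surely. 2. For every smooth $(m-1,m-1)$-form $\varphi$ on $M$ and every smooth $(2m-2,2m-2)$-form $\Phi$ on $M\times M$, the random variables $(Z_s,\varphi)$ and $(Z_s\boxtimes Z_s,\Phi)$ are integrable. Here $S\boxtimes T=\pi_1^*S\wedge\pi_2^*T$, where $\pi_1,\pi_2:M\times M\to M$ are the projections. 3. $Q_N$ is a continuous function $M\times M\to[0,\infty)$. 4. The variance current $\mathbf{Var}(Z_s)=\mathbf E(Z_s\boxtimes Z_s)-\mathbf E(Z_s)\boxtimes\mathbf E(Z_s)$ satisfies $$\mathbf{Var}(Z_s)=(i\partial\bar\partial)_z\,(i\partial\bar\partial)_w\,Q_N(z,w)$$ as an identity of $(2,2)$-currents on $M\times M$. That is, for every smooth $(2m-2,2m-2)$-form $\Phi$ on $M\times M$, $$\bigl(\mathbf{Var}(Z_s),\Phi\bigr)=\int_M\int_M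 Q_N(z,w)\,(i\partial\bar\partial)_z(i\partial\bar\partial)_w\Phi(z,w).$$ -/

import Mathlib

open scoped Manifold ContDiff Bundle TensorProduct Topology
open MeasureTheory

noncomputable section

namespace Bipot

/-! ### Differential forms, `∂` and `∂̄` on a complex vector space -/

section Flat

variable {F : Type*} [NormedAddCommGroup F] [NormedSpace ℝ F] [NormedSpace ℂ F]
  [IsScalarTower ℝ ℂ F] {k : ℕ}

/-- The part of `∂ = ∑ⱼ dzⱼ ∧ ∂/∂zⱼ` that differentiates along the range of the complex linear
projection `P`. For `P = id` this is `∂` itself; on a product `E × E` the two coordinate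
projections give `∂_z` and `∂_w`. -/
def del (P : F →L[ℂ] F) (α : F → F [⋀^Fin k]→L[ℝ] ℂ) (x : F) : F [⋀^Fin (k + 1)]→L[ℝ] ℂ :=
  ContinuousAlternatingMap.alternatizeUncurryFin
    ((1 / 2 : ℂ) • ((fderiv ℝ α x).comp (P.restrictScalars ℝ)
      - Complex.I • (fderiv ℝ α x).comp ((Complex.I • P).restrictScalars ℝ)))

/-- The part of `∂̄ = ∑ⱼ dz̄ⱼ ∧ ∂/∂z̄ⱼ` that differentiates along the range of `P`. -/
def delbar (P : F →L[ℂ] F) (α : F → F [⋀^Fin k]→L[ℝ] ℂ) (x : F) : F [⋀^Fin (k + 1)]→L[ℝ] ℂ :=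
  ContinuousAlternatingMap.alternatizeUncurryFin
    ((1 / 2 : ℂ) • ((fderiv ℝ α x).comp (P.restrictScalars ℝ)
      + Complex.I • (fderiv ℝ α x).comp ((Complex.I • P).restrictScalars ℝ)))

/-- A function, regarded as a `0`-form. -/
def zeroForm (f : F → ℂ) (x : F) : F [⋀^Fin 0]→L[ℝ] ℂ :=
  ContinuousAlternatingMap.constOfIsEmpty ℝ F (Fin 0) (f x)

/-- A real `k`-linear alternating form is of type `(p, q)`. -/
def IsOfType (p q : ℕ) (α : F [⋀^Fin k]→L[ℝ] ℂ) : Prop :=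
  ∀ (c : ℂ) (v : Fin k → F), α (fun i => c • v i) = c ^ p * (starRingEnd ℂ c) ^ q * α v

end Flat

/-! ### Forms on a manifold

The tangent space `TangentSpace I x` of a manifold modelled on `F` is by definition `F`, through
the preferred chart at `x`; so a `k`-form on `X` is a function `X → F [⋀^Fin k]→L[ℝ] ℂ`. -/

section Forms

variable {F : Type*} [NormedAddCommGroup F] [NormedSpace ℝ F]
  {H : Type*} [TopologicalSpace H] (I : ModelWithCorners ℝ F H)
  {X : Type*} [TopologicalSpace X] [ChartedSpace H X] {k : ℕ}

/-- The coordinate expression of the form `φ` in the preferred chart at `p`, i.e. its pullback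
under the inverse of that chart. -/
def formInChart (φ : X → F [⋀^Fin k]→L[ℝ] ℂ) (p : X) (u : F) : F [⋀^Fin k]→L[ℝ] ℂ :=
  (φ ((extChartAt I p).symm u)).compContinuousLinearMap
    (mfderiv 𝓘(ℝ, F) I (extChartAt I p).symm u : F →L[ℝ] F)

/-- Smooth forms. -/
def IsSmoothForm (φ : X → F [⋀^Fin k]→L[ℝ] ℂ) : Prop :=
  ∀ p : X, ContDiffOn ℝ ∞ (formInChart I φ p) (extChartAt I p).target

/-- The operator `i ∂∂̄` along the range of `P`, computed at `p` in the preferred chart at `p`. -/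
def iddbar [NormedSpace ℂ F] [IsScalarTower ℝ ℂ F] (P : F →L[ℂ] F)
    (φ : X → F [⋀^Fin k]→L[ℝ] ℂ) (p : X) : F [⋀^Fin (k + 1 + 1)]→L[ℝ] ℂ :=
  Complex.I • del P (delbar P (formInChart I φ p)) (extChartAt I p p)

end Forms

/-- The coordinate space `ℂᵐ`. -/
abbrev Cn (m : ℕ) : Type := Fin m → ℂ

/-- The positively oriented real frame `e₁, i e₁, e₂, i e₂, …` of `ℂᵐ`, dual to
`dx₁, dy₁, dx₂, dy₂, …`. -/
def stdFrame (m : ℕ) (k : Fin (2 * m)) : Cn m :=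
  Pi.single ⟨k / 2, by omega⟩ (if (k : ℕ) % 2 = 0 then 1 else Complex.I)

/-! ### Integration -/

section Integration

variable {n : ℕ} {M : Type*} [TopologicalSpace M] [CompactSpace M] [T2Space M]
  [ChartedSpace (Cn (n + 1)) M]

/-- Fields of (not necessarily multilinear) functions of `k` tangent vectors; every `k`-form is
one. The functionals below evaluate them on frames only. -/
abbrev RawForm (n k : ℕ) (M : Type*) : Type _ := M → (Fin k → Cn (n + 1)) → ℂ

theorem exists_chartPartition : ∃ ρ : PartitionOfUnity M M Set.univ,
    ρ.IsSubordinate fun x => (chartAt (Cn (n + 1)) x).source :=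
  PartitionOfUnity.exists_isSubordinate isClosed_univ _
    (fun x => (chartAt (Cn (n + 1)) x).open_source)
    (fun x _ => Set.mem_iUnion.2 ⟨x, mem_chart_source _ x⟩)

/-- A partition of unity subordinate to the preferred charts. -/
def chartPartition (n : ℕ) (M : Type*) [TopologicalSpace M] [CompactSpace M] [T2Space M]
    [ChartedSpace (Cn (n + 1)) M] : PartitionOfUnity M M Set.univ :=
  (exists_chartPartition (n := n) (M := M)).choose

/-- The integral `∫_M η` of a form of top degree over the compact complex manifold `M`. -/
def integralM (η : RawForm n (2 * (n + 1)) M) : ℂ :=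
  ∑ᶠ x : M, ∫ u in (chartAt (Cn (n + 1)) x).target,
    (chartPartition n M x ((chartAt (Cn (n + 1)) x).symm u) : ℂ) *
      η ((chartAt (Cn (n + 1)) x).symm u) (fun k =>
        (mfderiv 𝓘(ℝ, Cn (n + 1)) 𝓘(ℝ, Cn (n + 1)) (chartAt (Cn (n + 1)) x).symm u :
          Cn (n + 1) →L[ℝ] Cn (n + 1)) (stdFrame (n + 1) k))

/-- `c` is a holomorphic chart of `M` in which `Z` is the coordinate hyperplane `{u₀ = 0}`. -/
def IsStraightening (Z : Set M) (c : OpenPartialHomeomorph M (Cn (n + 1))) : Prop :=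
  c ∈ IsManifold.maximalAtlas 𝓘(ℂ, Cn (n + 1)) ω M ∧ ∀ y ∈ c.source, y ∈ Z ↔ c y 0 = 0

/-- `Z` is a closed complex submanifold of codimension one (possibly empty). -/
def IsHypersurface (n : ℕ) {M : Type*} [TopologicalSpace M] [ChartedSpace (Cn (n + 1)) M]
    (Z : Set M) : Prop :=
  IsClosed Z ∧ ∀ x : Z, ∃ c : OpenPartialHomeomorph M (Cn (n + 1)),
    (x : M) ∈ c.source ∧ IsStraightening Z c

/-- A straightening chart of the hypersurface `Z` near the point `x` of `Z`. -/
def IsHypersurface.chart {Z : Set M} (hZ : IsHypersurface n Z) (x : Z) :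
    OpenPartialHomeomorph M (Cn (n + 1)) :=
  (hZ.2 x).choose

theorem IsHypersurface.exists_partition {Z : Set M} (hZ : IsHypersurface n Z) :
    ∃ ρ : PartitionOfUnity Z M Z, ρ.IsSubordinate fun x => (hZ.chart x).source :=
  PartitionOfUnity.exists_isSubordinate hZ.1 _ (fun x => (hZ.chart x).open_source)
    (fun x hx => Set.mem_iUnion.2 ⟨⟨x, hx⟩, (hZ.2 ⟨x, hx⟩).choose_spec.1⟩)

/-- A partition of unity on `Z` subordinate to the straightening charts. -/
def IsHypersurface.partition {Z : Set M} (hZ : IsHypersurface n Z) : PartitionOfUnity Z M Z :=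
  hZ.exists_partition.choose

open Classical in
/-- The current of integration over the hypersurface `Z`: in a straightening chart, `Z` is
parametrized by `u ↦ (0, u)` with `u ∈ ℂⁿ`. (By convention `0` if `Z` is not a complex
submanifold of codimension one.) -/
def integrationCurrent (Z : Set M) (φ : RawForm n (2 * n) M) : ℂ :=
  if hZ : IsHypersurface n Z then
    ∑ᶠ x : Z, ∫ u in {u : Cn n | (Fin.cons 0 u : Cn (n + 1)) ∈ (hZ.chart x).target},
      (hZ.partition x ((hZ.chart x).symm (Fin.cons 0 u : Cn (n + 1))) : ℂ) *
        φ ((hZ.chart x).symm (Fin.cons 0 u : Cn (n + 1))) (fun k =>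
          (mfderiv 𝓘(ℝ, Cn (n + 1)) 𝓘(ℝ, Cn (n + 1)) (hZ.chart x).symm
            (Fin.cons 0 u : Cn (n + 1)) : Cn (n + 1) →L[ℝ] Cn (n + 1))
              (Fin.cons 0 (stdFrame n k) : Cn (n + 1)))
  else 0

/-- A form on `M × M` of degree `2k`, evaluated on `k` vectors tangent to the first factor
followed by `k` vectors tangent to the second one. -/
def splitForm {k l : ℕ} (h : l = k + k)
    (Φ : M × M → (Cn (n + 1) × Cn (n + 1)) [⋀^Fin l]→L[ℝ] ℂ) (z w : M)
    (v v' : Fin k → Cn (n + 1)) : ℂ :=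
  Φ (z, w) (fun i => Fin.append (fun j => (v j, (0 : Cn (n + 1))))
    (fun j => ((0 : Cn (n + 1)), v' j)) (Fin.cast h i))

/-- The product `S ⊠ T = π₁^* S ∧ π₂^* T` of two currents on `M` of the same even dimension `k`,
`(S ⊠ T)(Φ) = S_z (T_w (Φ(z, w)))`. -/
def boxtimes {k l : ℕ} (h : l = k + k) (S T : RawForm n k M → ℂ)
    (Φ : M × M → (Cn (n + 1) × Cn (n + 1)) [⋀^Fin l]→L[ℝ] ℂ) : ℂ :=
  S fun z v => T fun w v' => splitForm h Φ z w v v'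

end Integration

/-! ### Test forms and the operator `(i∂∂̄)_z (i∂∂̄)_w` on `M × M` -/

section TestForms

variable {n : ℕ} {M : Type*} [TopologicalSpace M] [ChartedSpace (Cn (n + 1)) M]

/-- Smooth forms of type `(m-1, m-1)` on `M`, where `m = n + 1` is the dimension of `M`. -/
def IsTestForm (φ : M → Cn (n + 1) [⋀^Fin (2 * n)]→L[ℝ] ℂ) : Prop :=
  IsSmoothForm 𝓘(ℝ, Cn (n + 1)) φ ∧ ∀ x, IsOfType n n (φ x)

/-- Smooth forms of type `(2m-2, 2m-2)` on `M × M`. -/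
def IsTestForm₂ (Φ : M × M → (Cn (n + 1) × Cn (n + 1)) [⋀^Fin (2 * n + 2 * n)]→L[ℝ] ℂ) : Prop :=
  IsSmoothForm (𝓘(ℝ, Cn (n + 1)).prod 𝓘(ℝ, Cn (n + 1))) Φ ∧
    ∀ p, IsOfType (2 * n) (2 * n) (Φ p)

/-- The projection of `E × E` onto the first factor. -/
def projZ (n : ℕ) : Cn (n + 1) × Cn (n + 1) →L[ℂ] Cn (n + 1) × Cn (n + 1) :=
  (ContinuousLinearMap.inl ℂ _ _).comp (ContinuousLinearMap.fst ℂ _ _)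

/-- The projection of `E × E` onto the second factor. -/
def projW (n : ℕ) : Cn (n + 1) × Cn (n + 1) →L[ℂ] Cn (n + 1) × Cn (n + 1) :=
  (ContinuousLinearMap.inr ℂ _ _).comp (ContinuousLinearMap.snd ℂ _ _)

/-- The current `(i∂∂̄)_z (i∂∂̄)_w Q` on `M × M`, in the sense of distributions: its value on `Φ`
is `∫_M ∫_M Q(z, w) (i∂∂̄)_z (i∂∂̄)_w Φ(z, w)`. -/
def bipotentialCurrent [CompactSpace M] [T2Space M] (Q : M → M → ℝ)
    (Φ : M × M → (Cn (n + 1) × Cn (n + 1)) [⋀^Fin (2 * n + 2 * n)]→L[ℝ] ℂ) : ℂ :=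
  boxtimes (k := 2 * (n + 1)) (l := 2 * n + 2 * n + 1 + 1 + 1 + 1) (by ring)
    integralM integralM (fun p => (Q p.1 p.2 : ℂ) •
      iddbar (𝓘(ℝ, Cn (n + 1)).prod 𝓘(ℝ, Cn (n + 1))) (projZ n)
        (iddbar (𝓘(ℝ, Cn (n + 1)).prod 𝓘(ℝ, Cn (n + 1))) (projW n) Φ) p)

end TestForms

/-! ### Hermitian holomorphic line bundles and sections of their powers -/

/-- For `ξ ∈ V^*`, the linear form `v₁ ⊗ ⋯ ⊗ v_N ↦ ξ(v₁) ⋯ ξ(v_N)` on the tensor power. -/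
def powEval {V : Type*} [AddCommGroup V] [Module ℂ V] (N : ℕ) (ξ : V →ₗ[ℂ] ℂ) :
    ⨂[ℂ]^N V →ₗ[ℂ] ℂ :=
  PiTensorProduct.lift ((MultilinearMap.mkPiAlgebra ℂ (Fin N) ℂ).compLinearMap fun _ => ξ)

section LineBundle

variable {n : ℕ} {M : Type*} [TopologicalSpace M] [ChartedSpace (Cn (n + 1)) M]
  (L : M → Type*) [TopologicalSpace (Bundle.TotalSpace ℂ L)] [∀ x, AddCommGroup (L x)]
  [∀ x, Module ℂ (L x)] [∀ x, TopologicalSpace (L x)] [FiberBundle ℂ L] [VectorBundle ℂ ℂ L]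

/-- The local frame of `L` given by the trivialization around `x₀`. -/
def frame (x₀ x : M) : L x := (trivializationAt ℂ L x₀).symm x 1

/-- The coordinate on `L x` dual to `frame L x₀ x`. -/
def coframe (x₀ x : M) : L x →ₗ[ℂ] ℂ := (trivializationAt ℂ L x₀).linearMapAt ℂ x

/-- The space `H⁰(M, L^N)` of holomorphic sections of the tensor power `L^N`: in each local frame
`e^{⊗N}` the coordinate of the section is a holomorphic function. -/
def H0 (n : ℕ) {M : Type*} [TopologicalSpace M] [ChartedSpace (Cn (n + 1)) M]
    (L : M → Type*) [TopologicalSpace (Bundle.TotalSpace ℂ L)] [∀ x, AddCommGroup (L x)]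
    [∀ x, Module ℂ (L x)] [∀ x, TopologicalSpace (L x)] [FiberBundle ℂ L] [VectorBundle ℂ ℂ L]
    (N : ℕ) : Submodule ℂ (∀ x, ⨂[ℂ]^N (L x)) where
  carrier := {s | ∀ x₀ : M, ContMDiffOn 𝓘(ℂ, Cn (n + 1)) 𝓘(ℂ, ℂ) ω
    (fun x => powEval N (coframe L x₀ x) (s x)) (trivializationAt ℂ L x₀).baseSet}
  zero_mem' := fun x₀ => by simpa using contMDiffOn_const
  add_mem' := fun {s t} hs ht x₀ => ((hs x₀).add (ht x₀)).congr fun x _ => by simp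
  smul_mem' := fun c s hs x₀ => by
    have h := (contMDiffOn_const (I := 𝓘(ℂ, Cn (n + 1))) (I' := 𝓘(ℂ, ℂ)) (c := c)).smul (hs x₀)
    exact h.congr fun x _ => by simp

/-- A smooth Hermitian metric on the line bundle `L`. -/
structure HermitianMetric (n : ℕ) {M : Type*} [TopologicalSpace M] [ChartedSpace (Cn (n + 1)) M]
    (L : M → Type*) [TopologicalSpace (Bundle.TotalSpace ℂ L)] [∀ x, AddCommGroup (L x)]
    [∀ x, Module ℂ (L x)] [∀ x, TopologicalSpace (L x)] [FiberBundle ℂ L]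
    [VectorBundle ℂ ℂ L] where
  /-- the Hermitian inner product on the fibres, conjugate linear in the first variable -/
  inner : ∀ x, L x →ₗ⋆[ℂ] L x →ₗ[ℂ] ℂ
  conj_symm : ∀ x (v v' : L x), starRingEnd ℂ (inner x v v') = inner x v' v
  pos : ∀ x (v : L x), v ≠ 0 → 0 < (inner x v v).re
  smooth : ∀ x₀ : M, ContMDiffOn 𝓘(ℝ, Cn (n + 1)) 𝓘(ℝ, ℝ) ∞
    (fun x => (inner x (frame L x₀ x) (frame L x₀ x)).re) (trivializationAt ℂ L x₀).baseSet

variable {L}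

namespace HermitianMetric

variable (h : HermitianMetric n L)

/-- The curvature form `Θ_h = ∂∂̄ log a`, where `a = ‖e‖_h⁻²` for a local holomorphic frame `e`. -/
def curvature (x : M) : Cn (n + 1) [⋀^Fin 2]→L[ℝ] ℂ :=
  del (ContinuousLinearMap.id ℂ _) (delbar (ContinuousLinearMap.id ℂ _) (zeroForm fun u =>
    ((Real.log ((h.inner ((chartAt (Cn (n + 1)) x).symm u)
      (frame L x ((chartAt (Cn (n + 1)) x).symm u))
      (frame L x ((chartAt (Cn (n + 1)) x).symm u))).re⁻¹) : ℝ) : ℂ)))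
    (chartAt (Cn (n + 1)) x x)

/-- The Kähler form `ω = (i/2) Θ_h`. -/
def kahlerForm (x : M) : Cn (n + 1) [⋀^Fin 2]→L[ℝ] ℂ := (Complex.I / 2) • h.curvature x

/-- `(L, h)` is positive: the real `(1,1)`-form `ω = (i/2) Θ_h` is positive definite. -/
def IsPositive : Prop :=
  ∀ (x : M) (v : Cn (n + 1)), v ≠ 0 → 0 < (h.kahlerForm x ![v, Complex.I • v]).re

/-- The volume form `ω^m / m!`, `m = n + 1`. -/
def volumeForm : RawForm n (2 * (n + 1)) M := fun x v =>
  (1 / (2 ^ (n + 1) * (Nat.factorial (n + 1) : ℂ))) *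
    ∑ σ : Equiv.Perm (Fin (2 * (n + 1))), ((Equiv.Perm.sign σ : ℤ) : ℂ) *
      ∏ i : Fin (n + 1), h.kahlerForm x
        ![v (σ ⟨2 * i, by omega⟩), v (σ ⟨2 * i + 1, by omega⟩)]

/-- A covector in `L_x^*` of norm one, i.e. a point of the circle bundle `X → M` over `x`. -/
def unitCovector (x : M) : L x →ₗ[ℂ] ℂ :=
  ((Real.sqrt (h.inner x (frame L x x) (frame L x x)).re : ℝ) : ℂ) • coframe L x x

/-- The value at `unitCovector x` of the equivariant function on the circle bundle to which the
section `s` of `L^N` lifts. -/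
def lift (N : ℕ) (s : ∀ x, ⨂[ℂ]^N (L x)) (x : M) : ℂ := powEval N (h.unitCovector x) (s x)

/-- The inner product `∫_M h^N(s, t) ω^m / m!` of sections of `L^N`. -/
def l2Inner [CompactSpace M] [T2Space M] {N : ℕ} (s t : H0 n L N) : ℂ :=
  integralM fun x v => starRingEnd ℂ (h.lift N s.1 x) * h.lift N t.1 x * h.volumeForm x v

/-- `S` is orthonormal in `H⁰(M, L^N)`. -/
def IsOrthonormal [CompactSpace M] [T2Space M] {N d : ℕ} (S : Fin d → H0 n L N) : Prop :=
  ∀ i j, h.l2Inner (S i) (S j) = if i = j then 1 else 0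

/-- The Szegő kernel `Π_N(x, y) = ∑ⱼ Ŝⱼ(x) conj(Ŝⱼ(y))` at the chosen unit covectors over `z` and
`w`; its modulus depends on `z` and `w` only. -/
def szego {N d : ℕ} (S : Fin d → H0 n L N) (z w : M) : ℂ :=
  ∑ j, h.lift N (S j).1 z * starRingEnd ℂ (h.lift N (S j).1 w)

/-- The normalized Szegő kernel `P_N(z, w) = |Π_N(z, w)| / (Π_N(z, z)^{1/2} Π_N(w, w)^{1/2})`. -/
def normalizedSzego {N d : ℕ} (S : Fin d → H0 n L N) (z w : M) : ℝ :=
  ‖h.szego S z w‖ / (Real.sqrt (h.szego S z z).re * Real.sqrt (h.szego S w w).re)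

end HermitianMetric

/-- `G̃(t) = -(1/4π²) ∫_0^{t²} log(1-s)/s ds`. -/
def Gtilde (t : ℝ) : ℝ :=
  -(1 / (4 * Real.pi ^ 2)) * ∫ s in (0 : ℝ)..t ^ 2, Real.log (1 - s) / s

/-- The function `Q_N = G̃ ∘ P_N`. -/
def HermitianMetric.bipotential (h : HermitianMetric n L) {N d : ℕ} (S : Fin d → H0 n L N)
    (z w : M) : ℝ :=
  Gtilde (h.normalizedSzego S z w)

/-- `H⁰(M, L^N)` has no base points. -/
def BasePointFree (n : ℕ) {M : Type*} [TopologicalSpace M] [ChartedSpace (Cn (n + 1)) M]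
    (L : M → Type*) [TopologicalSpace (Bundle.TotalSpace ℂ L)] [∀ x, AddCommGroup (L x)]
    [∀ x, Module ℂ (L x)] [∀ x, TopologicalSpace (L x)] [FiberBundle ℂ L] [VectorBundle ℂ ℂ L]
    (N : ℕ) : Prop :=
  ∀ x : M, ∃ s : H0 n L N, s.1 x ≠ 0

/-- The zero set of the section `∑ⱼ cⱼ Sⱼ`. -/
def zeroSet {N d : ℕ} (S : Fin d → H0 n L N) (c : Fin d → ℂ) : Set M :=
  {x | (∑ j, c j • S j : H0 n L N).1 x = 0}

end LineBundle

/-- The law `π^{-d} exp(-|c|²) dc` of `d` independent standard complex Gaussian coefficients. -/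
def gaussian (d : ℕ) : Measure (Fin d → ℂ) :=
  volume.withDensity fun c =>
    ENNReal.ofReal ((Real.pi ^ d)⁻¹ * Real.exp (-∑ j, ‖c j‖ ^ 2))

section Random

variable {n : ℕ} {M : Type*} [TopologicalSpace M] [CompactSpace M] [T2Space M]
  [ChartedSpace (Cn (n + 1)) M]
  {L : M → Type*} [TopologicalSpace (Bundle.TotalSpace ℂ L)] [∀ x, AddCommGroup (L x)]
  [∀ x, Module ℂ (L x)] [∀ x, TopologicalSpace (L x)] [FiberBundle ℂ L] [VectorBundle ℂ ℂ L]

/-- The zero current `Z_s` of `s = ∑ⱼ cⱼ Sⱼ`. -/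
def zeroCurrent {N d : ℕ} (S : Fin d → H0 n L N) (c : Fin d → ℂ) : RawForm n (2 * n) M → ℂ :=
  integrationCurrent (zeroSet S c)

/-- The expected zero current `E(Z_s)`. -/
def expectedCurrent {N d : ℕ} (S : Fin d → H0 n L N) (φ : RawForm n (2 * n) M) : ℂ :=
  ∫ c, zeroCurrent S c φ ∂gaussian d

/-- The variance current `Var(Z_s) = E(Z_s ⊠ Z_s) - E(Z_s) ⊠ E(Z_s)` on `M × M`. -/
def varianceCurrent {N d : ℕ} (S : Fin d → H0 n L N)
    (Φ : M × M → (Cn (n + 1) × Cn (n + 1)) [⋀^Fin (2 * n + 2 * n)]→L[ℝ] ℂ) : ℂ :=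
  (∫ c, boxtimes rfl (zeroCurrent S c) (zeroCurrent S c) Φ ∂gaussian d)
    - boxtimes rfl (expectedCurrent S) (expectedCurrent S) Φ

end Random

end Bipot

end

/-! In a local frame the random section is a function `∑ⱼ cⱼ fⱼ`, and by the Poincaré–Lelong formula
its zero current is `i∂∂̄` of the potential `(1/2π) log|∑ⱼ cⱼ fⱼ|²`. Hence `Z_s ⊠ Z_s` is `(i∂∂̄)_z
(i∂∂̄)_w` of the product of the potentials at `z` and at `w`, and the variance current is the same
operator applied to their covariance. A change of frame multiplies the vector `(fⱼ(z))` by a scalar,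
which adds a nonrandom term to the potential. So the potentials are only local, but their covariance
is a global function, and it remains to identify it with `Q_N`.

Covariance. For fixed `z` and `w` the two values are jointly Gaussian, and the modulus of their
normalized correlation is `P_N(z, w)`. For standard complex Gaussians `X`, `Y` with `r = |E X Ȳ|²`,
the covariance of `log|X|²` and `log|Y|²` is the dilogarithm of `r` (`integral_log_mul_log`). The
proof writes `log x = ∫₀^∞ (e^{-s} - e^{-sx}) ds/s` and uses the Laplace transform `E e^{-s|X|² -
t|Y|²} = 1/((1+s)(1+t) - rst)` (`integral_exp_neg_norm_dot`). What remains is an elementary double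
integral (`integral_Ioi_inner`, `integral_Ioi_outer`). The two factors `1/2π` turn the dilogarithm
into `Gtilde`.

Smoothness of the zero set. Where `fⱼ ≠ 0`, move the single coefficient `cⱼ`. A singular zero occurs
only when the shift is a critical value of `-F_c/fⱼ`. Critical values of holomorphic functions are
countable (`countable_criticalValues`), so the bad set is null on each line, and null by Fubini
(`ae_lincomb_regular`).

Poincaré–Lelong. A transversal zero set is a coordinate hyperplane `{u₀ = 0}` in a suitable
holomorphic chart. There the formula says that `log|u₀|²` is `4π` times the fundamental solution of
the Laplacian in `u₀`. Near a point outside the zero set `log|F|²` is the real part of a holomorphic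
function, and so is annihilated by `i∂∂̄`. The current of integration is defined by unspecified
straightening charts and an unspecified partition of unity; `PatchSystem.patchSum_eq` shows that any
compatible family of patches computes it, which turns the local formula into `poincareLelong`.

Assembly. Finitely many cutoffs, supported in charts over which `L` is trivial, bring each term to a
sum over pairs of charts of integrals over `K_p × K_q` of a weight times one continuous coefficient
`cutCoeff`. The weights are the product of random potentials (`ae_boxtimes_zeroCurrent_eq`), the
product of mean potentials (`boxtimes_expectedCurrent_eq`) and `Q_N` (`bipotentialCurrent_eq`).
Expectations and integrals are exchanged by means of a bound on the second moments of the potentials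
that is uniform on compact sets (`exists_moment_bound`); it rests on the absence of base points.
Comparing weights gives `varianceCurrent_eq`. -/

noncomputable section

namespace Bipot

set_option synthInstance.maxHeartbeats 200000
set_option linter.unusedSectionVars false

/-! ### Calculus of `∂` and `∂̄` -/

section FormCalculus

variable {F : Type*} [NormedAddCommGroup F] [NormedSpace ℝ F] [NormedSpace ℂ F]
  [IsScalarTower ℝ ℂ F]
  {G : Type*} [NormedAddCommGroup G] [NormedSpace ℝ G] [NormedSpace ℂ G]
  [IsScalarTower ℝ ℂ G] {k : ℕ}

/-- The linear map `v ↦ (A (P v) + ε A (i P v)) / 2`. For `ε = -i` it is the complex linear part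
of `A ∘ P`, for `ε = i` the antilinear part. -/
def typePart (ε : ℂ) (P : F →L[ℂ] F) {W : Type*} [NormedAddCommGroup W] [NormedSpace ℝ W]
    [NormedSpace ℂ W] [SMulCommClass ℝ ℂ W] (A : F →L[ℝ] W) : F →L[ℝ] W :=
  (1 / 2 : ℂ) • (A.comp (P.restrictScalars ℝ) + ε • A.comp ((Complex.I • P).restrictScalars ℝ))

/-- The common generalization of `del` and `delbar`. -/
def wd (ε : ℂ) (P : F →L[ℂ] F) (α : F → F [⋀^Fin k]→L[ℝ] ℂ) (x : F) :
    F [⋀^Fin (k + 1)]→L[ℝ] ℂ :=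
  ContinuousAlternatingMap.alternatizeUncurryFin (typePart ε P (fderiv ℝ α x))

theorem del_eq_wd (P : F →L[ℂ] F) (α : F → F [⋀^Fin k]→L[ℝ] ℂ) :
    del P α = wd (-Complex.I) P α := by
  funext x
  ext v
  rw [del, wd, ContinuousAlternatingMap.alternatizeUncurryFin_apply,
    ContinuousAlternatingMap.alternatizeUncurryFin_apply]
  refine Finset.sum_congr rfl fun i _ => congrArg _ ?_
  change (1 / 2 : ℂ) * (_ - Complex.I * _) = (1 / 2 : ℂ) * (_ + -Complex.I * _)
  rw [sub_eq_add_neg, neg_mul]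

theorem delbar_eq_wd (P : F →L[ℂ] F) (α : F → F [⋀^Fin k]→L[ℝ] ℂ) :
    delbar P α = wd Complex.I P α := rfl

theorem wd_apply (ε : ℂ) (P : F →L[ℂ] F) (α : F → F [⋀^Fin k]→L[ℝ] ℂ) (x : F)
    (v : Fin (k + 1) → F) :
    wd ε P α x v = ∑ i : Fin (k + 1), (-1 : ℤ) ^ (i : ℕ) •
      ((1 / 2 : ℂ) * (fderiv ℝ α x (P (v i)) (i.removeNth v)
        + ε * fderiv ℝ α x (Complex.I • P (v i)) (i.removeNth v))) := by
  rw [wd, ContinuousAlternatingMap.alternatizeUncurryFin_apply]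
  rfl

theorem wd_congr {ε : ℂ} {P : F →L[ℂ] F} {α β : F → F [⋀^Fin k]→L[ℝ] ℂ} {x : F}
    (h : α =ᶠ[𝓝 x] β) : wd ε P α x = wd ε P β x := by
  rw [wd, wd, h.fderiv_eq]

theorem wd_eventuallyEq {ε : ℂ} {P : F →L[ℂ] F} {α β : F → F [⋀^Fin k]→L[ℝ] ℂ} {x : F}
    (h : α =ᶠ[𝓝 x] β) : wd ε P α =ᶠ[𝓝 x] wd ε P β :=
  h.eventuallyEq_nhds.mono fun _ h => wd_congr h

theorem wd_sum {ι : Type*} {ε : ℂ} {P : F →L[ℂ] F} (s : Finset ι)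
    {α : ι → F → F [⋀^Fin k]→L[ℝ] ℂ} {x : F} (h : ∀ i ∈ s, DifferentiableAt ℝ (α i) x) :
    wd ε P (fun y => ∑ i ∈ s, α i y) x = ∑ i ∈ s, wd ε P (α i) x := by
  ext v
  rw [ContinuousAlternatingMap.sum_apply]
  simp only [wd_apply, fderiv_fun_sum h]
  rw [Finset.sum_comm]
  refine Finset.sum_congr rfl fun i _ => ?_
  simp only [_root_.sum_apply, ContinuousAlternatingMap.sum_apply, Finset.mul_sum,
    ← Finset.sum_add_distrib, ← Finset.smul_sum]

theorem ContDiffOn.wd {ε : ℂ} {P : F →L[ℂ] F} {α : F → F [⋀^Fin k]→L[ℝ] ℂ} {U : Set F}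
    (hU : IsOpen U) (h : ContDiffOn ℝ ∞ α U) : ContDiffOn ℝ ∞ (wd ε P α) U := by
  have h1 : ContDiffOn ℝ ∞ (fderiv ℝ α) U := h.fderiv_of_isOpen hU (by simp)
  have h2 : ContDiffOn ℝ ∞ (fun x => typePart ε P (fderiv ℝ α x)) U :=
    ((h1.clm_comp contDiffOn_const).add
      ((h1.clm_comp contDiffOn_const).const_smul ε)).const_smul (1 / 2 : ℂ)
  exact (ContinuousAlternatingMap.alternatizeUncurryFinCLM ℝ F ℂ).contDiff.comp_contDiffOn h2

/-- Naturality of `∂` and `∂̄` under holomorphic maps. -/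
theorem wd_pullback {ε : ℂ} {P : F →L[ℂ] F} {P' : G →L[ℂ] G} {κ : F → G}
    {β : G → G [⋀^Fin k]→L[ℝ] ℂ} {x : F} (hβ : DifferentiableAt ℝ β (κ x))
    (hκ : ContDiffAt ℝ 2 κ x)
    (hP : ∀ᶠ y in 𝓝 x, ∀ v, fderiv ℝ κ y (P v) = P' (fderiv ℝ κ y v))
    (hI : ∀ᶠ y in 𝓝 x, ∀ v : F, fderiv ℝ κ y (Complex.I • v) = Complex.I • fderiv ℝ κ y v) :
    wd ε P (fun y => (β (κ y)).compContinuousLinearMap (fderiv ℝ κ y)) x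
      = (wd ε P' β (κ x)).compContinuousLinearMap (fderiv ℝ κ x) := by
  have hdκ : DifferentiableAt ℝ κ x := hκ.differentiableAt (by simp)
  have hd2 : DifferentiableAt ℝ (fderiv ℝ κ) x :=
    (hκ.fderiv_right (m := 1) le_rfl).differentiableAt (by simp)
  have hsymm : ∀ u v, fderiv ℝ (fderiv ℝ κ) x u v = fderiv ℝ (fderiv ℝ κ) x v u :=
    (hκ.isSymmSndFDerivAt (by simp)).eq
  -- the second derivative commutes with `P` and with multiplication by `i`
  have key : ∀ (Q : F →L[ℂ] F) (Q' : G →L[ℂ] G),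
      (∀ᶠ y in 𝓝 x, ∀ v, fderiv ℝ κ y (Q v) = Q' (fderiv ℝ κ y v)) →
      ∀ u v, fderiv ℝ (fderiv ℝ κ) x u (Q v) = Q' (fderiv ℝ (fderiv ℝ κ) x u v) := by
    intro Q Q' hQ u v
    have e1 : (fun y => fderiv ℝ κ y (Q v)) =ᶠ[𝓝 x] fun y => Q' (fderiv ℝ κ y v) :=
      hQ.mono fun y hy => hy v
    have e2 := Filter.EventuallyEq.fderiv_eq (𝕜 := ℝ) e1
    have d1 : HasFDerivAt (fun y => fderiv ℝ κ y (Q v))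
        ((ContinuousLinearMap.apply ℝ G (Q v)).comp (fderiv ℝ (fderiv ℝ κ) x)) x :=
      (ContinuousLinearMap.apply ℝ G (Q v)).hasFDerivAt.comp x hd2.hasFDerivAt
    have d2 : HasFDerivAt (fun y => Q' (fderiv ℝ κ y v))
        ((Q'.restrictScalars ℝ).comp
          ((ContinuousLinearMap.apply ℝ G v).comp (fderiv ℝ (fderiv ℝ κ) x))) x :=
      (Q'.restrictScalars ℝ).hasFDerivAt.comp x
        ((ContinuousLinearMap.apply ℝ G v).hasFDerivAt.comp x hd2.hasFDerivAt)
    rw [d1.fderiv, d2.fderiv] at e2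
    exact congrArg (fun A => A u) e2
  have kP := key P P' hP
  have kI : ∀ u v, fderiv ℝ (fderiv ℝ κ) x u (Complex.I • P v)
      = Complex.I • P' (fderiv ℝ (fderiv ℝ κ) x u v) := by
    have := key (Complex.I • P) (Complex.I • P') (by
      filter_upwards [hP, hI] with y h1 h2 v
      simp only [_root_.smul_apply, h2, h1])
    simpa using this
  have hα := fderiv_continuousAlternatingMapCompContinuousLinearMap
    (f := fun y => β (κ y)) (g := fderiv ℝ κ) (x := x) (hβ.comp x hdκ) hd2
  have hβκ : fderiv ℝ (fun y => β (κ y)) x = (fderiv ℝ β (κ x)).comp (fderiv ℝ κ x) :=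
    fderiv_comp x hβ hdκ
  -- The product rule produces a term containing the second derivative of `κ`. That derivative is
  -- symmetric, and stays so after precomposing one slot with `P` or `iP`, because `κ` intertwines
  -- these maps near `x`. Alternatization therefore kills the term.
  have z1 := ContinuousAlternatingMap.alternatizeUncurryFin_fderivCompContinuousLinearMap_eq_zero
    (β (κ x)) (fderiv ℝ κ x) (h := (fderiv ℝ (fderiv ℝ κ) x).comp (P.restrictScalars ℝ)) (by
      intro u v
      simp only [ContinuousLinearMap.comp_apply, ContinuousLinearMap.coe_restrictScalars']
      rw [hsymm, kP, hsymm v u, ← kP, hsymm])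
  have z2 := ContinuousAlternatingMap.alternatizeUncurryFin_fderivCompContinuousLinearMap_eq_zero
    (β (κ x)) (fderiv ℝ κ x)
    (h := (fderiv ℝ (fderiv ℝ κ) x).comp ((Complex.I • P).restrictScalars ℝ)) (by
      intro u v
      simp only [ContinuousLinearMap.comp_apply, ContinuousLinearMap.coe_restrictScalars',
        _root_.smul_apply]
      rw [hsymm, kI, hsymm v u, ← kI, hsymm])
  ext v
  have w1 := congrArg (fun A => A v) z1
  have w2 := congrArg (fun A => A v) z2
  simp only [ContinuousAlternatingMap.alternatizeUncurryFin_apply,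
    ContinuousLinearMap.comp_apply, ContinuousLinearMap.coe_restrictScalars', _root_.smul_apply] at w1 w2
  rw [ContinuousAlternatingMap.compContinuousLinearMap_apply, wd_apply, wd_apply, hα, hβκ]
  have hPx := hP.self_of_nhds
  have hIx := hI.self_of_nhds
  simp only [_root_.add_apply, ContinuousLinearMap.comp_apply,
    ContinuousAlternatingMap.add_apply, Function.comp_apply, hPx, hIx,
    ContinuousAlternatingMap.compContinuousLinearMapCLM_apply,
    ContinuousAlternatingMap.compContinuousLinearMap_apply]
  have expand : ∀ (a b c d : ℂ) (i : ℕ), (-1 : ℤ) ^ i • ((1 / 2 : ℂ) * (a + b + ε * (c + d)))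
      = (-1 : ℤ) ^ i • ((1 / 2 : ℂ) * (a + ε * c)) + ((1 / 2 : ℂ) * ((-1 : ℤ) ^ i • b)
        + (1 / 2 : ℂ) * ε * ((-1 : ℤ) ^ i • d)) := by
    intros; simp only [zsmul_eq_mul]; ring
  refine (Finset.sum_congr rfl fun i _ => expand _ _ _ _ _).trans ?_
  rw [Finset.sum_add_distrib, Finset.sum_add_distrib, ← Finset.mul_sum, ← Finset.mul_sum, w1, w2]
  change _ + (_ * (0 : ℂ) + _ * (0 : ℂ)) = _
  rw [mul_zero, mul_zero, add_zero, add_zero]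
  rfl

end FormCalculus

/-! ### Partial evaluation of forms on a product -/

section Slices

variable {E : Type*} [NormedAddCommGroup E] {k k' l : ℕ}

/-- `k` vectors tangent to the first factor followed by `k'` vectors tangent to the second one. -/
def splitVec (h : l = k + k') (v : Fin k → E) (v' : Fin k' → E) (i : Fin l) : E × E :=
  Fin.append (fun j => (v j, (0 : E))) (fun j => ((0 : E), v' j)) (Fin.cast h i)

theorem splitVec_left (h : l = k + k') (v : Fin k → E) (v' : Fin k' → E) (j : Fin k) :
    splitVec h v v' (Fin.cast h.symm (Fin.castAdd k' j)) = (v j, 0) := by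
  simp [splitVec]

theorem splitVec_right (h : l = k + k') (v : Fin k → E) (v' : Fin k' → E) (j : Fin k') :
    splitVec h v v' (Fin.cast h.symm (Fin.natAdd k j)) = (0, v' j) := by
  simp [splitVec]

theorem exists_split_index (h : l = k + k') (i : Fin l) :
    (∃ j : Fin k, i = Fin.cast h.symm (Fin.castAdd k' j)) ∨
      ∃ j : Fin k', i = Fin.cast h.symm (Fin.natAdd k j) := by
  subst h
  induction i using Fin.addCases with
  | left j => exact Or.inl ⟨j, rfl⟩
  | right j => exact Or.inr ⟨j, rfl⟩

theorem splitVec_update_left (h : l = k + k') (v : Fin k → E) (v' : Fin k' → E) (j : Fin k)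
    (x : E) : splitVec h (Function.update v j x) v'
      = Function.update (splitVec h v v') (Fin.cast h.symm (Fin.castAdd k' j)) (x, 0) := by
  funext i
  obtain ⟨a, rfl⟩ | ⟨a, rfl⟩ := exists_split_index h i
  · rw [splitVec_left]
    by_cases hj : a = j
    · subst hj; simp
    · rw [Function.update_of_ne hj, Function.update_of_ne, splitVec_left]
      exact fun H => hj (by simpa using H)
  · rw [splitVec_right, Function.update_of_ne, splitVec_right]
    intro H
    have := congrArg Fin.val H
    simp at this
    omega

theorem splitVec_update_right (h : l = k + k') (v : Fin k → E) (v' : Fin k' → E) (j : Fin k')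
    (x : E) : splitVec h v (Function.update v' j x)
      = Function.update (splitVec h v v') (Fin.cast h.symm (Fin.natAdd k j)) (0, x) := by
  funext i
  obtain ⟨a, rfl⟩ | ⟨a, rfl⟩ := exists_split_index h i
  · rw [splitVec_left, Function.update_of_ne, splitVec_left]
    intro H
    have := congrArg Fin.val H
    simp at this
    omega
  · rw [splitVec_right]
    by_cases hj : a = j
    · subst hj; simp
    · rw [Function.update_of_ne hj, Function.update_of_ne, splitVec_right]
      exact fun H => hj (by simpa using H)

theorem prod_norm_splitVec (h : l = k + k') (v : Fin k → E) (v' : Fin k' → E) :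
    ∏ i, ‖splitVec h v v' i‖ = (∏ i, ‖v i‖) * ∏ i, ‖v' i‖ := by
  subst h
  rw [Fin.prod_univ_add]
  congr 1 <;> refine Finset.prod_congr rfl fun i _ => ?_
  · have := splitVec_left rfl v v' i
    simp only [Fin.cast_eq_self] at this
    rw [this]; simp
  · have := splitVec_right rfl v v' i
    simp only [Fin.cast_eq_self] at this
    rw [this]; simp

variable [NormedSpace ℝ E]

/-- Evaluation of the last `k'` slots of a form on `E × E` on vectors of the second factor. -/
def sliceFst (h : l = k + k') (v' : Fin k' → E) :
    (E × E) [⋀^Fin l]→L[ℝ] ℂ →L[ℝ] E [⋀^Fin k]→L[ℝ] ℂ :=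
  AlternatingMap.mkContinuousLinear
    { toFun := fun α =>
        { toFun := fun v => α (splitVec h v v')
          map_update_add' := fun {hd} v j x y => by
            rw [Subsingleton.elim hd (instDecidableEqFin k)]
            simp only [splitVec_update_left]
            rw [← ContinuousAlternatingMap.map_update_add, Prod.mk_add_mk, add_zero]
          map_update_smul' := fun {hd} v j c x => by
            rw [Subsingleton.elim hd (instDecidableEqFin k)]
            simp only [splitVec_update_left]
            rw [← ContinuousAlternatingMap.map_update_smul, Prod.smul_mk, smul_zero]
          map_eq_zero_of_eq' := fun v i j hv hij =>
            α.map_eq_zero_of_eq _ (i := Fin.cast h.symm (Fin.castAdd k' i))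
              (j := Fin.cast h.symm (Fin.castAdd k' j))
              (by rw [splitVec_left, splitVec_left, hv]) (by simpa using hij) }
      map_add' := fun α β => rfl
      map_smul' := fun c α => rfl } (∏ i, ‖v' i‖)
    (fun α v => by
      refine (α.le_opNorm _).trans_eq ?_
      rw [prod_norm_splitVec]; ring)

/-- Evaluation of the first `k` slots of a form on `E × E` on vectors of the first factor. -/
def sliceSnd (h : l = k + k') (v : Fin k → E) :
    (E × E) [⋀^Fin l]→L[ℝ] ℂ →L[ℝ] E [⋀^Fin k']→L[ℝ] ℂ :=
  AlternatingMap.mkContinuousLinear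
    { toFun := fun α =>
        { toFun := fun v' => α (splitVec h v v')
          map_update_add' := fun {hd} v j x y => by
            rw [Subsingleton.elim hd (instDecidableEqFin k')]
            simp only [splitVec_update_right]
            rw [← ContinuousAlternatingMap.map_update_add, Prod.mk_add_mk, add_zero]
          map_update_smul' := fun {hd} v j c x => by
            rw [Subsingleton.elim hd (instDecidableEqFin k')]
            simp only [splitVec_update_right]
            rw [← ContinuousAlternatingMap.map_update_smul, Prod.smul_mk, smul_zero]
          map_eq_zero_of_eq' := fun v i j hv hij =>
            α.map_eq_zero_of_eq _ (i := Fin.cast h.symm (Fin.natAdd k i))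
              (j := Fin.cast h.symm (Fin.natAdd k j))
              (by rw [splitVec_right, splitVec_right, hv]) (by simpa using hij) }
      map_add' := fun α β => rfl
      map_smul' := fun c α => rfl } (∏ i, ‖v i‖)
    (fun α v => by
      refine (α.le_opNorm _).trans_eq ?_
      rw [prod_norm_splitVec]; ring)

theorem sliceFst_apply (h : l = k + k') (v' : Fin k' → E) (α : (E × E) [⋀^Fin l]→L[ℝ] ℂ)
    (v : Fin k → E) : sliceFst h v' α v = α (splitVec h v v') := rfl

theorem sliceSnd_apply (h : l = k + k') (v : Fin k → E) (α : (E × E) [⋀^Fin l]→L[ℝ] ℂ)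
    (v' : Fin k' → E) : sliceSnd h v α v' = α (splitVec h v v') := rfl

theorem removeNth_splitVec_left (h : l = k + k') (h' : l + 1 = k + 1 + k') (v : Fin (k + 1) → E)
    (v' : Fin k' → E) (j : Fin (k + 1)) :
    Fin.removeNth (Fin.cast h'.symm (Fin.castAdd k' j)) (splitVec h' v v')
      = splitVec h (j.removeNth v) v' := by
  funext i
  obtain ⟨a, rfl⟩ | ⟨a, rfl⟩ := exists_split_index h i
  · rw [splitVec_left, Fin.removeNth, Fin.removeNth]
    have : (Fin.cast h'.symm (Fin.castAdd k' j)).succAbove (Fin.cast h.symm (Fin.castAdd k' a))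
        = Fin.cast h'.symm (Fin.castAdd k' (j.succAbove a)) := by
      ext
      simp [Fin.succAbove, Fin.lt_def]
      split_ifs <;> rfl
    rw [this, splitVec_left]
  · rw [splitVec_right, Fin.removeNth]
    have : (Fin.cast h'.symm (Fin.castAdd k' j)).succAbove (Fin.cast h.symm (Fin.natAdd k a))
        = Fin.cast h'.symm (Fin.natAdd (k + 1) a) := by
      ext
      simp [Fin.succAbove, Fin.lt_def]
      split_ifs <;> simp <;> omega
    rw [this, splitVec_right]

theorem removeNth_splitVec_right (h : l = k + k') (h' : l + 1 = k + (k' + 1)) (v : Fin k → E)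
    (v' : Fin (k' + 1) → E) (j : Fin (k' + 1)) :
    Fin.removeNth (Fin.cast h'.symm (Fin.natAdd k j)) (splitVec h' v v')
      = splitVec h v (j.removeNth v') := by
  funext i
  obtain ⟨a, rfl⟩ | ⟨a, rfl⟩ := exists_split_index h i
  · rw [splitVec_left, Fin.removeNth]
    have : (Fin.cast h'.symm (Fin.natAdd k j)).succAbove (Fin.cast h.symm (Fin.castAdd k' a))
        = Fin.cast h'.symm (Fin.castAdd (k' + 1) a) := by
      ext
      simp [Fin.succAbove, Fin.lt_def]
      split_ifs
      · rfl
      · omega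
    rw [this, splitVec_left]
  · rw [splitVec_right, Fin.removeNth, Fin.removeNth]
    have : (Fin.cast h'.symm (Fin.natAdd k j)).succAbove (Fin.cast h.symm (Fin.natAdd k a))
        = Fin.cast h'.symm (Fin.natAdd k (j.succAbove a)) := by
      ext
      simp [Fin.succAbove, Fin.lt_def]
      split_ifs <;> simp [add_assoc]
    rw [this, splitVec_right]

theorem sum_split_index {A : Type*} [AddCommMonoid A] (h : l = k + k') (f : Fin l → A) :
    ∑ i, f i = ∑ j : Fin k, f (Fin.cast h.symm (Fin.castAdd k' j))
      + ∑ j : Fin k', f (Fin.cast h.symm (Fin.natAdd k j)) := by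
  subst h
  rw [Fin.sum_univ_add]; rfl

variable [NormedSpace ℂ E] [IsScalarTower ℝ ℂ E]

/-- The projection annihilates the vectors tangent to the second factor, so the summands that
differentiate along one of them vanish. In the other summands the last `k'` arguments are untouched,
and the derivative is that of the slice. -/
theorem wd_fst_splitVec {ε : ℂ} (h : l = k + k') (h' : l + 1 = k + 1 + k')
    {α : E × E → (E × E) [⋀^Fin l]→L[ℝ] ℂ} {x : E × E} (hα : DifferentiableAt ℝ α x)
    (v : Fin (k + 1) → E) (v' : Fin k' → E) :
    wd ε ((ContinuousLinearMap.inl ℂ E E).comp (ContinuousLinearMap.fst ℂ E E)) α x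
        (splitVec h' v v')
      = wd ε (ContinuousLinearMap.id ℂ E) (fun u => sliceFst h v' (α (u, x.2))) x.1 v := by
  have hd : HasFDerivAt (fun u => sliceFst h v' (α (u, x.2)))
      ((sliceFst h v').comp ((fderiv ℝ α x).comp (ContinuousLinearMap.inl ℝ E E))) x.1 :=
    (sliceFst h v').hasFDerivAt.comp x.1
      (HasFDerivAt.comp x.1 (f := fun u => (u, x.2)) hα.hasFDerivAt (hasFDerivAt_prodMk_left _ _))
  rw [wd_apply, wd_apply, hd.fderiv, sum_split_index h']
  rw [Finset.sum_eq_zero (s := (Finset.univ : Finset (Fin k')))]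
  · rw [add_zero]
    refine Finset.sum_congr rfl fun j _ => ?_
    rw [removeNth_splitVec_left h h', splitVec_left]
    simp [sliceFst_apply]
  · intro j _
    rw [splitVec_right]
    simp [show ((0 : E), (0 : E)) = 0 from rfl]

/-- The mirror image of `wd_fst_splitVec`, except that the surviving slots stand behind `k` vectors
of the first factor. Every sign is then multiplied by `(-1)^k`, so `k` has to be even. -/
theorem wd_snd_splitVec {ε : ℂ} (hk : Even k) (h : l = k + k') (h' : l + 1 = k + (k' + 1))
    {α : E × E → (E × E) [⋀^Fin l]→L[ℝ] ℂ} {x : E × E} (hα : DifferentiableAt ℝ α x)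
    (v : Fin k → E) (v' : Fin (k' + 1) → E) :
    wd ε ((ContinuousLinearMap.inr ℂ E E).comp (ContinuousLinearMap.snd ℂ E E)) α x
        (splitVec h' v v')
      = wd ε (ContinuousLinearMap.id ℂ E) (fun u => sliceSnd h v (α (x.1, u))) x.2 v' := by
  have hd : HasFDerivAt (fun u => sliceSnd h v (α (x.1, u)))
      ((sliceSnd h v).comp ((fderiv ℝ α x).comp (ContinuousLinearMap.inr ℝ E E))) x.2 :=
    (sliceSnd h v).hasFDerivAt.comp x.2
      (HasFDerivAt.comp x.2 (f := fun u => (x.1, u)) hα.hasFDerivAt (hasFDerivAt_prodMk_right _ _))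
  rw [wd_apply, wd_apply, hd.fderiv, sum_split_index h']
  rw [Finset.sum_eq_zero (s := (Finset.univ : Finset (Fin k)))]
  · rw [zero_add]
    refine Finset.sum_congr rfl fun j _ => ?_
    rw [removeNth_splitVec_right h h', splitVec_right]
    simp [sliceSnd_apply, pow_add, hk.neg_one_pow]
  · intro j _
    rw [splitVec_left]
    simp [show ((0 : E), (0 : E)) = 0 from rfl]

end Slices

/-! ### The fundamental solution of the Laplacian on `ℂ` -/

section Laplacian

/-- In polar coordinates the integrand becomes `2 y log y`, which is continuous on all of `ℝ`. -/
theorem locallyIntegrable_log_norm_sq :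
    LocallyIntegrable (fun z : ℂ => Real.log (‖z‖ ^ 2)) := by
  rw [MeasureTheory.locallyIntegrable_iff]
  intro K hK
  obtain ⟨r, hr⟩ := hK.isBounded.subset_ball 0
  refine IntegrableOn.mono_set ?_ hr
  rw [integrableOn_fun_norm_addHaar volume (f := fun y => Real.log (y ^ 2))]
  have hc : Continuous fun y : ℝ => 2 * (y * Real.log y) :=
    continuous_const.mul Real.continuous_mul_log
  have : IntegrableOn (fun y : ℝ => 2 * (y * Real.log y)) (Set.Ioo 0 r) :=
    (hc.integrableOn_Icc (a := 0) (b := r)).mono_set Set.Ioo_subset_Icc_self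
  refine this.congr_fun (fun y _ => ?_) measurableSet_Ioo
  simp [Complex.finrank_real_complex, Real.log_pow]
  ring

section IBP

variable {V : Type*} [NormedAddCommGroup V] [NormedSpace ℝ V] [FiniteDimensional ℝ V]
  [MeasurableSpace V] [BorelSpace V] {μ : Measure V} [μ.IsAddHaarMeasure]

theorem integrable_mul_of_continuous {w g : V → ℂ} (hw : Continuous w) (hg : Continuous g)
    (hs : HasCompactSupport g) : Integrable (fun x => w x * g x) μ :=
  (hw.mul hg).integrable_of_hasCompactSupport hs.mul_left

theorem continuous_fderiv_apply {g : V → ℂ} (hg : ContDiff ℝ 1 g) (v : V) :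
    Continuous fun x => fderiv ℝ g x v :=
  (hg.continuous_fderiv (by simp)).clm_apply continuous_const

theorem contDiff_fderiv_apply {m : WithTop ℕ∞} {g : V → ℂ} (hg : ContDiff ℝ (m + 1) g) (v : V) :
    ContDiff ℝ m fun x => fderiv ℝ g x v :=
  (hg.fderiv_right le_rfl).clm_apply contDiff_const

theorem integral_mul_fderiv_fderiv {w g : V → ℂ} (hw : ContDiff ℝ 2 w) (hg : ContDiff ℝ 2 g)
    (hs : HasCompactSupport g) (a b : V) :
    ∫ x, w x * fderiv ℝ (fun y => fderiv ℝ g y b) x a ∂μ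
      = ∫ x, fderiv ℝ (fun y => fderiv ℝ w y a) x b * g x ∂μ := by
  have hw1 : ContDiff ℝ 1 w := hw.of_le (by norm_num)
  have hg1 : ContDiff ℝ 1 g := hg.of_le (by norm_num)
  have hga : ContDiff ℝ 1 fun y => fderiv ℝ g y b := contDiff_fderiv_apply (m := 1) hg b
  have hwa : ContDiff ℝ 1 fun y => fderiv ℝ w y a := contDiff_fderiv_apply (m := 1) hw a
  have hsb : HasCompactSupport fun y => fderiv ℝ g y b := hs.fderiv_apply ℝ b
  have h1 := integral_mul_fderiv_eq_neg_fderiv_mul_of_integrable (μ := μ) (f := w)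
    (g := fun y => fderiv ℝ g y b) (v := a)
    (integrable_mul_of_continuous (continuous_fderiv_apply hw1 a) hga.continuous hsb)
    (integrable_mul_of_continuous hw.continuous (continuous_fderiv_apply hga a)
      (hsb.fderiv_apply ℝ a))
    (integrable_mul_of_continuous hw.continuous hga.continuous hsb)
    (fun x _ => hw1.differentiable (by simp) x) (fun x _ => hga.differentiable (by simp) x)
  have h2 := integral_mul_fderiv_eq_neg_fderiv_mul_of_integrable (μ := μ)
    (f := fun y => fderiv ℝ w y a) (g := g) (v := b)
    (integrable_mul_of_continuous (continuous_fderiv_apply hwa b) hg.continuous hs)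
    (integrable_mul_of_continuous hwa.continuous (continuous_fderiv_apply hg1 b)
      (hs.fderiv_apply ℝ b))
    (integrable_mul_of_continuous hwa.continuous hg.continuous hs)
    (fun x _ => hwa.differentiable (by simp) x) (fun x _ => hg1.differentiable (by simp) x)
  rw [h1, h2, neg_neg]

end IBP

theorem hasFDerivAt_log_norm_sq_add {ε : ℝ} (hε : 0 < ε) (z : ℂ) :
    HasFDerivAt (fun z : ℂ => ((Real.log (‖z‖ ^ 2 + ε) : ℝ) : ℂ))
      (Complex.ofRealCLM.comp ((‖z‖ ^ 2 + ε)⁻¹ • (2 • innerSL ℝ z))) z := by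
  have h1 : HasFDerivAt (fun z : ℂ => ‖z‖ ^ 2 + ε) (2 • innerSL ℝ z) z :=
    (hasStrictFDerivAt_norm_sq z).hasFDerivAt.add_const ε
  exact Complex.ofRealCLM.hasFDerivAt.comp z (h1.log (by positivity))

theorem contDiff_log_norm_sq_add {ε : ℝ} (hε : 0 < ε) :
    ContDiff ℝ 2 (fun z : ℂ => ((Real.log (‖z‖ ^ 2 + ε) : ℝ) : ℂ)) :=
  Complex.ofRealCLM.contDiff.comp
    (((contDiff_norm_sq ℝ).add contDiff_const).log fun z => by positivity)

theorem fderiv_fderiv_log_norm_sq_add {ε : ℝ} (hε : 0 < ε) (z v : ℂ) :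
    fderiv ℝ (fun y => fderiv ℝ (fun z : ℂ => ((Real.log (‖z‖ ^ 2 + ε) : ℝ) : ℂ)) y v) z v
      = ((2 * inner ℝ v v / (‖z‖ ^ 2 + ε) - 4 * (inner ℝ z v) ^ 2 / (‖z‖ ^ 2 + ε) ^ 2 : ℝ) : ℂ) := by
  have e : (fun y => fderiv ℝ (fun z : ℂ => ((Real.log (‖z‖ ^ 2 + ε) : ℝ) : ℂ)) y v)
      = fun y => ((2 * inner ℝ y v * (‖y‖ ^ 2 + ε)⁻¹ : ℝ) : ℂ) := by
    funext y
    rw [(hasFDerivAt_log_norm_sq_add hε y).fderiv]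
    simp
    ring
  rw [e]
  have hpos : ‖z‖ ^ 2 + ε ≠ 0 := by positivity
  have h1 : HasFDerivAt (fun z : ℂ => ‖z‖ ^ 2 + ε) (2 • innerSL ℝ z) z :=
    (hasStrictFDerivAt_norm_sq z).hasFDerivAt.add_const ε
  have h2 : HasFDerivAt (fun y : ℂ => 2 * inner ℝ y v) ((2 : ℝ) • innerSL ℝ v) z := by
    have := (((innerSL ℝ v).hasFDerivAt (x := z)).const_smul (2 : ℝ))
    refine this.congr_of_eventuallyEq (Filter.Eventually.of_forall fun y => ?_)
    simp [real_inner_comm]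
  have h3 := h2.mul ((hasDerivAt_inv hpos).comp_hasFDerivAt z h1)
  have h4 := Complex.ofRealCLM.hasFDerivAt.comp z h3
  have h5 := h4.fderiv
  simp only [Function.comp_def, Complex.ofRealCLM_apply] at h5
  refine (congrArg (fun A => A v) h5).trans ?_
  simp
  field_simp
  ring

/-- The singularity of `log|z|²` is smoothed by adding `ε`. The Laplacian is then an approximate
identity: rescaling by `√ε` turns it into the fixed density `4/(|z|² + 1)²`. -/
theorem laplacian_log_norm_sq_add {ε : ℝ} (hε : 0 < ε) (z : ℂ) :
    fderiv ℝ (fun y => fderiv ℝ (fun z : ℂ => ((Real.log (‖z‖ ^ 2 + ε) : ℝ) : ℂ)) y 1) z 1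
      + fderiv ℝ (fun y => fderiv ℝ (fun z : ℂ => ((Real.log (‖z‖ ^ 2 + ε) : ℝ) : ℂ)) y
          Complex.I) z Complex.I
      = ((4 * ε / (‖z‖ ^ 2 + ε) ^ 2 : ℝ) : ℂ) := by
  rw [fderiv_fderiv_log_norm_sq_add hε, fderiv_fderiv_log_norm_sq_add hε, ← Complex.ofReal_add]
  congr 1
  have hpos : ‖z‖ ^ 2 + ε ≠ 0 := by positivity
  have hz : ‖z‖ ^ 2 = z.re ^ 2 + z.im ^ 2 := by
    rw [← Complex.normSq_eq_norm_sq, Complex.normSq_apply]; ring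
  simp only [Complex.inner, map_one, one_mul, Complex.one_re, mul_one, Complex.conj_I,
    Complex.conj_re, Complex.mul_re, Complex.neg_re, Complex.neg_im, Complex.I_re, Complex.I_im,
    Complex.conj_im]
  field_simp
  rw [hz]
  ring

/-- In polar coordinates `-2/(y² + 1)` is a primitive of the radial integrand. It rises by `2`, and
the circle contributes `2π`. -/
theorem integrable_and_integral_four_div :
    Integrable (fun z : ℂ => 4 / (‖z‖ ^ 2 + 1) ^ 2) ∧
      ∫ z : ℂ, 4 / (‖z‖ ^ 2 + 1) ^ 2 = 4 * Real.pi := by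
  have hd : ∀ y ∈ Set.Ioi (0 : ℝ), HasDerivAt (fun y : ℝ => -2 / (y ^ 2 + 1))
      (y * (4 / (y ^ 2 + 1) ^ 2)) y := by
    intro y _
    have h := (hasDerivAt_const y (-2 : ℝ)).div (((hasDerivAt_id y).pow 2).add_const (1 : ℝ))
      (by change y ^ 2 + 1 ≠ 0; positivity)
    refine h.congr_deriv ?_
    simp
    ring
  have hc : ContinuousWithinAt (fun y : ℝ => -2 / (y ^ 2 + 1)) (Set.Ici 0) 0 :=
    (Continuous.div continuous_const (by fun_prop) fun y => by positivity).continuousWithinAt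
  have hnn : ∀ y ∈ Set.Ioi (0 : ℝ), 0 ≤ y * (4 / (y ^ 2 + 1) ^ 2) := by
    intro y hy
    have : 0 < y := hy
    positivity
  have hlim : Filter.Tendsto (fun y : ℝ => -2 / (y ^ 2 + 1)) Filter.atTop (𝓝 0) :=
    Filter.Tendsto.div_atTop tendsto_const_nhds
      (Filter.tendsto_atTop_add_const_right _ _ (Filter.tendsto_pow_atTop (by norm_num)))
  constructor
  · rw [integrable_fun_norm_addHaar volume (f := fun y => 4 / (y ^ 2 + 1) ^ 2)]
    simpa [Complex.finrank_real_complex] using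
      integrableOn_Ioi_deriv_of_nonneg hc hd hnn hlim
  · rw [integral_fun_norm_addHaar volume (fun y => 4 / (y ^ 2 + 1) ^ 2)]
    have := integral_Ioi_of_hasDerivAt_of_nonneg hc hd hnn hlim
    simp only [Complex.finrank_real_complex, Nat.add_one_sub_one, pow_one, smul_eq_mul]
    rw [this]
    simp [Measure.real, Complex.volume_ball]
    ring

/-- `log |z|²` is `4π` times the fundamental solution of the Laplacian. -/
theorem integral_log_norm_sq_mul_laplacian {g : ℂ → ℂ} (hg : ContDiff ℝ 2 g)
    (hs : HasCompactSupport g) :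
    ∫ z, ((Real.log (‖z‖ ^ 2) : ℝ) : ℂ) * (fderiv ℝ (fun y => fderiv ℝ g y 1) z 1
      + fderiv ℝ (fun y => fderiv ℝ g y Complex.I) z Complex.I) = 4 * Real.pi * g 0 := by
  set Δg : ℂ → ℂ := fun z => fderiv ℝ (fun y => fderiv ℝ g y 1) z 1
      + fderiv ℝ (fun y => fderiv ℝ g y Complex.I) z Complex.I with hΔ
  have hga : ∀ v : ℂ, ContDiff ℝ 1 fun y => fderiv ℝ g y v :=
    fun v => contDiff_fderiv_apply (m := 1) hg v
  have hcont : Continuous Δg :=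
    (continuous_fderiv_apply (hga 1) 1).add (continuous_fderiv_apply (hga _) _)
  have hsupp : HasCompactSupport Δg :=
    ((hs.fderiv_apply ℝ 1).fderiv_apply ℝ 1).add
      ((hs.fderiv_apply ℝ Complex.I).fderiv_apply ℝ Complex.I)
  -- the regularized identity
  have hreg : ∀ ε : ℝ, 0 < ε → ∫ z, ((Real.log (‖z‖ ^ 2 + ε) : ℝ) : ℂ) * Δg z
      = ∫ z : ℂ, ((4 / (‖z‖ ^ 2 + 1) ^ 2 : ℝ) : ℂ) * g (Real.sqrt ε • z) := by
    intro ε hε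
    have hw := contDiff_log_norm_sq_add hε
    have hI : ∀ v : ℂ, Integrable fun z => ((Real.log (‖z‖ ^ 2 + ε) : ℝ) : ℂ)
        * fderiv ℝ (fun y => fderiv ℝ g y v) z v := fun v =>
      integrable_mul_of_continuous hw.continuous (continuous_fderiv_apply (hga v) v)
        ((hs.fderiv_apply ℝ v).fderiv_apply ℝ v)
    have hI' : ∀ v : ℂ, Integrable fun z => fderiv ℝ (fun y => fderiv ℝ
        (fun z : ℂ => ((Real.log (‖z‖ ^ 2 + ε) : ℝ) : ℂ)) y v) z v * g z := fun v =>
      integrable_mul_of_continuous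
        (continuous_fderiv_apply (contDiff_fderiv_apply (m := 1) hw v) v) hg.continuous hs
    simp only [hΔ, mul_add]
    rw [integral_add (hI 1) (hI _), integral_mul_fderiv_fderiv hw hg hs,
      integral_mul_fderiv_fderiv hw hg hs, ← integral_add (hI' 1) (hI' _)]
    simp only [← add_mul, laplacian_log_norm_sq_add hε]
    -- In real dimension two the substitution `z ↦ √ε z` has Jacobian `ε`. This factor, and the `ε²`
    -- coming out of the squared denominator, remove `ε` from the density and leave it only in the
    -- argument of `g`.
    have hscale := Measure.integral_comp_smul (volume : Measure ℂ)
      (fun z : ℂ => ((4 * ε / (‖z‖ ^ 2 + ε) ^ 2 : ℝ) : ℂ) * g z) (Real.sqrt ε)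
    have hsq : Real.sqrt ε ^ 2 = ε := Real.sq_sqrt hε.le
    rw [Complex.finrank_real_complex, hsq, abs_of_pos (by positivity)] at hscale
    have : ∫ z : ℂ, ((4 * ε / (‖z‖ ^ 2 + ε) ^ 2 : ℝ) : ℂ) * g z
        = ε • ∫ z : ℂ, ((4 * ε / (‖Real.sqrt ε • z‖ ^ 2 + ε) ^ 2 : ℝ) : ℂ)
          * g (Real.sqrt ε • z) := by
      rw [hscale, smul_smul, mul_inv_cancel₀ hε.ne', one_smul]
    rw [this, ← integral_smul]
    refine integral_congr_ae (Filter.Eventually.of_forall fun z => ?_)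
    have hn : ‖Real.sqrt ε • z‖ ^ 2 = ε * ‖z‖ ^ 2 := by
      rw [norm_smul, mul_pow, Real.norm_eq_abs, sq_abs, hsq]
    simp only [hn]
    rw [Complex.real_smul, ← mul_assoc, ← Complex.ofReal_mul]
    congr 2
    have : ‖z‖ ^ 2 + 1 ≠ 0 := by positivity
    field_simp
  have hL : Filter.Tendsto (fun ε : ℝ => ∫ z, ((Real.log (‖z‖ ^ 2 + ε) : ℝ) : ℂ) * Δg z)
      (𝓝[>] 0) (𝓝 (∫ z, ((Real.log (‖z‖ ^ 2) : ℝ) : ℂ) * Δg z)) := by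
    -- For `0 < ε ≤ 1` and `z ≠ 0` one has `log|z|² ≤ log(|z|² + ε) ≤ log(|z|² + 1)`, so the sum of
    -- the absolute values of the two ends dominates.
    refine tendsto_integral_filter_of_dominated_convergence
      (fun z => (|Real.log (‖z‖ ^ 2)| + Real.log (‖z‖ ^ 2 + 1)) * ‖Δg z‖) ?_ ?_ ?_ ?_
    · filter_upwards [self_mem_nhdsWithin] with ε hε
      exact ((contDiff_log_norm_sq_add hε).continuous.mul hcont).aestronglyMeasurable
    · filter_upwards [Ioc_mem_nhdsGT (zero_lt_one' ℝ)] with ε hε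
      filter_upwards [compl_mem_ae_iff.2 (measure_singleton (0 : ℂ))] with z hz
      have hz' : 0 < ‖z‖ ^ 2 := by
        have : z ≠ 0 := hz
        positivity
      rw [norm_mul, Complex.norm_real, Real.norm_eq_abs]
      refine mul_le_mul_of_nonneg_right ?_ (norm_nonneg _)
      have l1 : Real.log (‖z‖ ^ 2) ≤ Real.log (‖z‖ ^ 2 + ε) :=
        Real.log_le_log hz' (by linarith [hε.1])
      have l2 : Real.log (‖z‖ ^ 2 + ε) ≤ Real.log (‖z‖ ^ 2 + 1) :=
        Real.log_le_log (by linarith [hε.1]) (by linarith [hε.2])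
      have l3 : 0 ≤ Real.log (‖z‖ ^ 2 + 1) := Real.log_nonneg (by linarith)
      rw [abs_le]
      constructor <;> linarith [neg_abs_le (Real.log (‖z‖ ^ 2)), abs_nonneg (Real.log (‖z‖ ^ 2))]
    · simp only [add_mul]
      refine Integrable.add ?_ ?_
      · have h1 : LocallyIntegrable (fun z : ℂ => |Real.log (‖z‖ ^ 2)|) :=
          fun x => (locallyIntegrable_log_norm_sq x).imp fun s h => ⟨h.1, h.2.abs⟩
        have := h1.integrable_smul_right_of_hasCompactSupport hcont.norm hsupp.norm
        simpa using this
      · have hc : Continuous fun z : ℂ => Real.log (‖z‖ ^ 2 + 1) :=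
          Continuous.log (by fun_prop) fun z => by positivity
        exact (hc.mul hcont.norm).integrable_of_hasCompactSupport hsupp.norm.mul_left
    · filter_upwards [compl_mem_ae_iff.2 (measure_singleton (0 : ℂ))] with z hz
      have hz' : ‖z‖ ^ 2 ≠ 0 := by
        have : z ≠ 0 := hz
        positivity
      have hc : ContinuousAt (fun ε : ℝ => ((Real.log (‖z‖ ^ 2 + ε) : ℝ) : ℂ) * Δg z) 0 := by
        refine ContinuousAt.mul (Complex.continuous_ofReal.continuousAt.comp ?_) continuousAt_const
        exact (continuousAt_const.add continuousAt_id).log (by simpa using hz')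
      have := hc.tendsto
      simp only [add_zero] at this
      exact this.mono_left nhdsWithin_le_nhds
  obtain ⟨hi4, h4⟩ := integrable_and_integral_four_div
  have hR : Filter.Tendsto (fun ε : ℝ => ∫ z : ℂ, ((4 / (‖z‖ ^ 2 + 1) ^ 2 : ℝ) : ℂ)
      * g (Real.sqrt ε • z)) (𝓝[>] 0)
      (𝓝 (∫ z : ℂ, ((4 / (‖z‖ ^ 2 + 1) ^ 2 : ℝ) : ℂ) * g 0)) := by
    obtain ⟨C, hC⟩ := hs.exists_bound_of_continuous hg.continuous
    refine tendsto_integral_filter_of_dominated_convergence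
      (fun z : ℂ => 4 / (‖z‖ ^ 2 + 1) ^ 2 * C) ?_ ?_ (hi4.mul_const C) ?_
    · refine Filter.Eventually.of_forall fun ε => (Continuous.mul ?_ ?_).aestronglyMeasurable
      · exact Complex.continuous_ofReal.comp
          (Continuous.div continuous_const (by fun_prop) fun y => by positivity)
      · exact hg.continuous.comp (continuous_const_smul _)
    · refine Filter.Eventually.of_forall fun ε => Filter.Eventually.of_forall fun z => ?_
      rw [norm_mul, Complex.norm_real, Real.norm_of_nonneg (by positivity)]
      exact mul_le_mul_of_nonneg_left (hC _) (by positivity)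
    · refine Filter.Eventually.of_forall fun z => ?_
      refine Filter.Tendsto.mul tendsto_const_nhds ?_
      have hc : Continuous fun ε : ℝ => g (Real.sqrt ε • z) := by
        have := hg.continuous
        fun_prop
      have := hc.tendsto 0
      simp only [Real.sqrt_zero, zero_smul] at this
      exact this.mono_left nhdsWithin_le_nhds
  have heq : Filter.Tendsto (fun ε : ℝ => ∫ z, ((Real.log (‖z‖ ^ 2 + ε) : ℝ) : ℂ) * Δg z)
      (𝓝[>] 0) (𝓝 (∫ z : ℂ, ((4 / (‖z‖ ^ 2 + 1) ^ 2 : ℝ) : ℂ) * g 0)) :=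
    hR.congr' (by filter_upwards [self_mem_nhdsWithin] with ε hε using (hreg ε hε).symm)
  rw [tendsto_nhds_unique hL heq, integral_mul_const, integral_complex_ofReal, h4]
  push_cast
  ring

end Laplacian

/-! ### Scalar Wirtinger derivatives -/

section Wirtinger

variable {V : Type*} [NormedAddCommGroup V] [NormedSpace ℝ V] [NormedSpace ℂ V]
  [IsScalarTower ℝ ℂ V]

/-- The derivative `(∂_v g + ε ∂_{iv} g) / 2` of a function; `ε = -i` gives the complex linear
part, `ε = i` the antilinear part. -/
def wirt (ε : ℂ) (v : V) (g : V → ℂ) (u : V) : ℂ :=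
  (1 / 2 : ℂ) * (fderiv ℝ g u v + ε * fderiv ℝ g u (Complex.I • v))

theorem ContDiffAt.fderiv_apply_const {m : WithTop ℕ∞} {g : V → ℂ} {u : V}
    (hg : ContDiffAt ℝ (m + 1) g u) (v : V) : ContDiffAt ℝ m (fun x => fderiv ℝ g x v) u :=
  (hg.fderiv_right le_rfl).clm_apply contDiffAt_const

theorem ContDiffAt.wirt {m : WithTop ℕ∞} {g : V → ℂ} {u : V}
    (hg : ContDiffAt ℝ (m + 1) g u) (ε : ℂ) (v : V) : ContDiffAt ℝ m (wirt ε v g) u :=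
  contDiffAt_const.mul ((ContDiffAt.fderiv_apply_const hg v).add
    (contDiffAt_const.mul (ContDiffAt.fderiv_apply_const hg _)))

theorem ContDiff.wirt {m : WithTop ℕ∞} {g : V → ℂ} (hg : ContDiff ℝ (m + 1) g) (ε : ℂ) (v : V) :
    ContDiff ℝ m (wirt ε v g) :=
  contDiff_iff_contDiffAt.2 fun _ => ContDiffAt.wirt hg.contDiffAt ε v

theorem HasCompactSupport.wirt {g : V → ℂ} (hg : HasCompactSupport g) (ε : ℂ) (v : V) :
    HasCompactSupport (wirt ε v g) :=
  HasCompactSupport.mul_left ((hg.fderiv_apply ℝ v).add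
    (HasCompactSupport.mul_left (f := fun _ => ε) (hg.fderiv_apply ℝ (Complex.I • v))))

theorem tsupport_wirt_subset (g : V → ℂ) (ε : ℂ) (v : V) :
    tsupport (wirt ε v g) ⊆ tsupport g := by
  refine closure_minimal (fun u hu => ?_) (isClosed_tsupport g)
  by_contra h
  have : fderiv ℝ g u = 0 := by
    by_contra h'
    exact h (support_fderiv_subset ℝ h')
  exact hu (by simp [Bipot.wirt, this])

theorem wirt_wirt {g : V → ℂ} {u : V} (hg : ContDiffAt ℝ 2 g u) (ε₁ ε₂ : ℂ) (a b : V) :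
    wirt ε₂ a (wirt ε₁ b g) u = (1 / 4 : ℂ) * (fderiv ℝ (fderiv ℝ g) u a b
      + ε₁ * fderiv ℝ (fderiv ℝ g) u a (Complex.I • b)
      + ε₂ * fderiv ℝ (fderiv ℝ g) u (Complex.I • a) b
      + ε₂ * ε₁ * fderiv ℝ (fderiv ℝ g) u (Complex.I • a) (Complex.I • b)) := by
  have hd : DifferentiableAt ℝ (fderiv ℝ g) u :=
    (hg.fderiv_right (m := 1) le_rfl).differentiableAt (by simp)
  have h : ∀ x : V, HasFDerivAt (fun y => fderiv ℝ g y x)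
      ((ContinuousLinearMap.apply ℝ ℂ x).comp (fderiv ℝ (fderiv ℝ g) u)) u := fun x =>
    (ContinuousLinearMap.apply ℝ ℂ x).hasFDerivAt.comp u hd.hasFDerivAt
  have h2 : HasFDerivAt (wirt ε₁ b g) ((1 / 2 : ℂ) •
      ((ContinuousLinearMap.apply ℝ ℂ b).comp (fderiv ℝ (fderiv ℝ g) u)
        + ε₁ • (ContinuousLinearMap.apply ℝ ℂ (Complex.I • b)).comp (fderiv ℝ (fderiv ℝ g) u))) u :=
    (((h b).add ((h (Complex.I • b)).const_mul ε₁)).const_mul (1 / 2 : ℂ))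
  rw [wirt, h2.fderiv]
  simp
  ring

theorem fderiv_fderiv_comm {g : V → ℂ} {u : V} (hg : ContDiffAt ℝ 2 g u) (a b : V) :
    fderiv ℝ (fderiv ℝ g) u a b = fderiv ℝ (fderiv ℝ g) u b a :=
  (hg.isSymmSndFDerivAt (by simp)).eq a b

theorem wirt_comm {g : V → ℂ} {u : V} (hg : ContDiffAt ℝ 2 g u) (ε₁ ε₂ : ℂ) (a b : V) :
    wirt ε₂ a (wirt ε₁ b g) u = wirt ε₁ b (wirt ε₂ a g) u := by
  rw [wirt_wirt hg, wirt_wirt hg, fderiv_fderiv_comm hg a b,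
    fderiv_fderiv_comm hg a (Complex.I • b), fderiv_fderiv_comm hg (Complex.I • a) b,
    fderiv_fderiv_comm hg (Complex.I • a) (Complex.I • b)]
  ring

/-- This reduces second order operators on forms to scalar Wirtinger derivatives of coefficient
functions, which is where integration by parts is available. -/
theorem wd_wd_apply {k : ℕ} {ψ : V → V [⋀^Fin k]→L[ℝ] ℂ} {u : V} (hψ : ContDiffAt ℝ 2 ψ u)
    (ε₁ ε₂ : ℂ) (v : Fin (k + 1 + 1) → V) :
    wd ε₂ (ContinuousLinearMap.id ℂ V) (wd ε₁ (ContinuousLinearMap.id ℂ V) ψ) u v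
      = ∑ a : Fin (k + 1 + 1), ∑ b : Fin (k + 1), (-1 : ℂ) ^ (a : ℕ) * (-1 : ℂ) ^ (b : ℕ) *
        wirt ε₂ (v a) (wirt ε₁ (a.removeNth v b)
          (fun y => ψ y (b.removeNth (a.removeNth v)))) u := by
  have hev : ∀ᶠ y in 𝓝 u, ContDiffAt ℝ 2 ψ y := hψ.eventually (by simp)
  have happ : ∀ (w : Fin k → V) (y : V), ContDiffAt ℝ 2 ψ y →
      HasFDerivAt (fun y => ψ y w)
        ((ContinuousAlternatingMap.apply ℝ V ℂ w).comp (fderiv ℝ ψ y)) y := fun w y hy =>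
    (ContinuousAlternatingMap.apply ℝ V ℂ w).hasFDerivAt.comp y
      (hy.differentiableAt (by simp)).hasFDerivAt
  have hwd : ContDiffAt ℝ 1 (wd ε₁ (ContinuousLinearMap.id ℂ V) ψ) u := by
    have h1 : ContDiffAt ℝ 1 (fderiv ℝ ψ) u := hψ.fderiv_right le_rfl
    have h2 : ContDiffAt ℝ 1
        (fun x => typePart ε₁ (ContinuousLinearMap.id ℂ V) (fderiv ℝ ψ x)) u :=
      ((h1.clm_comp contDiffAt_const).add
        ((h1.clm_comp contDiffAt_const).const_smul ε₁)).const_smul (1 / 2 : ℂ)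
    exact (ContinuousAlternatingMap.alternatizeUncurryFinCLM ℝ V ℂ).contDiff.contDiffAt.comp u h2
  have hdwd := (hwd.differentiableAt (by simp)).hasFDerivAt
  have key : ∀ (w : Fin (k + 1) → V) (x : V),
      fderiv ℝ (wd ε₁ (ContinuousLinearMap.id ℂ V) ψ) u x w
        = ∑ b : Fin (k + 1), (-1 : ℂ) ^ (b : ℕ) *
          fderiv ℝ (wirt ε₁ (w b) (fun y => ψ y (b.removeNth w))) u x := by
    intro w x
    have e1 : HasFDerivAt (fun y => wd ε₁ (ContinuousLinearMap.id ℂ V) ψ y w)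
        ((ContinuousAlternatingMap.apply ℝ V ℂ w).comp
          (fderiv ℝ (wd ε₁ (ContinuousLinearMap.id ℂ V) ψ) u)) u :=
      (ContinuousAlternatingMap.apply ℝ V ℂ w).hasFDerivAt.comp u hdwd
    have e2 : (fun y => wd ε₁ (ContinuousLinearMap.id ℂ V) ψ y w) =ᶠ[𝓝 u]
        fun y => ∑ b : Fin (k + 1), (-1 : ℂ) ^ (b : ℕ) *
          wirt ε₁ (w b) (fun y => ψ y (b.removeNth w)) y := by
      filter_upwards [hev] with y hy
      rw [wd_apply]
      refine Finset.sum_congr rfl fun b _ => ?_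
      rw [wirt, (happ _ y hy).fderiv]
      simp [zsmul_eq_mul]
    have e3 : HasFDerivAt (fun y => ∑ b : Fin (k + 1), (-1 : ℂ) ^ (b : ℕ) *
          wirt ε₁ (w b) (fun y => ψ y (b.removeNth w)) y)
        (∑ b : Fin (k + 1), (-1 : ℂ) ^ (b : ℕ) •
          fderiv ℝ (wirt ε₁ (w b) (fun y => ψ y (b.removeNth w))) u) u := by
      refine HasFDerivAt.fun_sum fun b _ => HasFDerivAt.const_mul ?_ _
      have hs : ContDiffAt ℝ 2 (fun y => ψ y (b.removeNth w)) u :=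
        (ContinuousAlternatingMap.apply ℝ V ℂ (b.removeNth w)).contDiff.contDiffAt.comp u hψ
      exact ((ContDiffAt.wirt (m := 1) hs ε₁ (w b)).differentiableAt (by simp)).hasFDerivAt
    have e4 := e1.unique (e3.congr_of_eventuallyEq e2)
    have e5 := congrArg (fun A => A x) e4
    simpa using e5
  rw [wd_apply]
  refine Finset.sum_congr rfl fun a _ => ?_
  rw [key, key]
  simp only [zsmul_eq_mul, Finset.mul_sum, ← Finset.sum_add_distrib, Bipot.wirt]
  refine Finset.sum_congr rfl fun b _ => ?_
  simp
  ring

variable [FiniteDimensional ℝ V] [MeasurableSpace V] [BorelSpace V] {μ : Measure V}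
  [μ.IsAddHaarMeasure]

/-- Integration by parts needs only the line derivative of `w` along `v`, which is zero by
invariance. So `w` may be singular, as `log|u₀|²` is. -/
theorem integral_mul_fderiv_eq_zero_of_invariant {w h : V → ℂ} (hw : LocallyIntegrable w μ)
    (hh : ContDiff ℝ 1 h) (hs : HasCompactSupport h) {v : V} (hv : ∀ u (t : ℝ), w (u + t • v) = w u) :
    Integrable (fun u => w u * fderiv ℝ h u v) μ ∧ ∫ u, w u * fderiv ℝ h u v ∂μ = 0 := by
  have i1 : Integrable (fun u => w u * fderiv ℝ h u v) μ :=
    hw.integrable_smul_right_of_hasCompactSupport (continuous_fderiv_apply hh v)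
      (hs.fderiv_apply ℝ v)
  refine ⟨i1, ?_⟩
  have i2 : Integrable (fun u => w u * h u) μ :=
    hw.integrable_smul_right_of_hasCompactSupport hh.continuous hs
  have := integral_bilinear_hasLineDerivAt_right_eq_neg_left_of_integrable (μ := μ)
    (f := w) (f' := fun _ => 0) (g := h) (g' := fun u => fderiv ℝ h u v) (v := v)
    (B := ContinuousLinearMap.mul ℝ ℂ) (by simp) i1 i2
    (fun x _ => by
      have : (fun t : ℝ => w (x + t • v)) = fun _ => w x := funext fun t => hv x t
      rw [HasLineDerivAt, this]
      exact hasDerivAt_const _ _)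
    (fun x _ => (hh.differentiable (by simp) x).hasFDerivAt.hasLineDerivAt v)
  simpa using this

theorem integral_mul_wirt_eq_zero_of_invariant {w h : V → ℂ} (hw : LocallyIntegrable w μ)
    (hh : ContDiff ℝ 1 h) (hs : HasCompactSupport h) {v : V} (ε : ℂ)
    (hv : ∀ u (t : ℂ), w (u + t • v) = w u) : ∫ u, w u * wirt ε v h u ∂μ = 0 := by
  obtain ⟨i1, h1⟩ := integral_mul_fderiv_eq_zero_of_invariant hw hh hs (v := v) (fun u t => by
    rw [← hv u t]; congr 2; exact (algebraMap_smul ℂ t v).symm)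
  obtain ⟨i2, h2⟩ := integral_mul_fderiv_eq_zero_of_invariant hw hh hs (v := Complex.I • v)
    (fun u t => by
      rw [← hv u (t * Complex.I)]; congr 2
      rw [mul_smul]; exact (algebraMap_smul ℂ t _).symm)
  have : ∀ u, w u * wirt ε v h u = (1 / 2 : ℂ) * (w u * fderiv ℝ h u v)
      + (1 / 2 * ε) * (w u * fderiv ℝ h u (Complex.I • v)) := by
    intro u; rw [wirt]; ring
  simp only [this]
  rw [integral_add (i1.const_mul _) (i2.const_mul _), integral_const_mul, integral_const_mul, h1,
    h2]
  simp

/-- Integration by parts for Wirtinger derivatives. -/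
theorem integral_mul_wirt {F h : V → ℂ} {U : Set V} (hU : IsOpen U) (hF : ContDiffOn ℝ 1 F U)
    (hh : ContDiff ℝ 1 h) (hs : HasCompactSupport h) (hsU : tsupport h ⊆ U) (ε : ℂ) (v : V) :
    ∫ u, F u * wirt ε v h u ∂μ = - ∫ u, wirt ε v F u * h u ∂μ := by
  have hFd : ∀ x ∈ tsupport h, DifferentiableAt ℝ F x := fun x hx =>
    (hF.contDiffAt (hU.mem_nhds (hsU hx))).differentiableAt (by simp)
  have int1 : ∀ {A B : V → ℂ}, ContinuousOn A U → Continuous B → tsupport B ⊆ tsupport h →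
      Integrable (fun u => A u * B u) μ := by
    intro A B hA hB hBs
    have hBc : HasCompactSupport B := hs.of_isClosed_subset (isClosed_tsupport B) hBs
    refine Continuous.integrable_of_hasCompactSupport ?_ hBc.mul_left
    refine continuous_of_tsupport fun x hx => ?_
    have hx' : x ∈ U := hsU (hBs (tsupport_mul_subset_right hx))
    exact (hA.continuousAt (hU.mem_nhds hx')).mul hB.continuousAt
  have hFc : ∀ x, ContinuousOn (fun u => fderiv ℝ F u x) U := fun x =>
    (hF.continuousOn_fderiv_of_isOpen hU (by simp)).clm_apply continuousOn_const
  have hsd : ∀ x, tsupport (fun u => fderiv ℝ h u x) ⊆ tsupport h := fun x =>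
    tsupport_fderiv_apply_subset ℝ x
  have main : ∀ x, ∫ u, F u * fderiv ℝ h u x ∂μ = - ∫ u, fderiv ℝ F u x * h u ∂μ := fun x =>
    integral_mul_fderiv_eq_neg_fderiv_mul_of_integrable
      (int1 (hFc x) hh.continuous subset_rfl)
      (int1 hF.continuousOn (continuous_fderiv_apply hh x) (hsd x))
      (int1 hF.continuousOn hh.continuous subset_rfl) hFd
      (fun x _ => hh.differentiable (by simp) x)
  have e1 : ∀ u, F u * wirt ε v h u = (1 / 2 : ℂ) * (F u * fderiv ℝ h u v)
      + (1 / 2 * ε) * (F u * fderiv ℝ h u (Complex.I • v)) := by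
    intro u; rw [wirt]; ring
  have e2 : ∀ u, wirt ε v F u * h u = (1 / 2 : ℂ) * (fderiv ℝ F u v * h u)
      + (1 / 2 * ε) * (fderiv ℝ F u (Complex.I • v) * h u) := by
    intro u; rw [wirt]; ring
  have i1 : ∀ x, Integrable (fun u => F u * fderiv ℝ h u x) μ := fun x =>
    int1 hF.continuousOn (continuous_fderiv_apply hh x) (hsd x)
  have i2 : ∀ x, Integrable (fun u => fderiv ℝ F u x * h u) μ := fun x =>
    int1 (hFc x) hh.continuous subset_rfl
  simp only [e1, e2]
  rw [integral_add ((i1 _).const_mul _) ((i1 _).const_mul _),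
    integral_add ((i2 _).const_mul _) ((i2 _).const_mul _)]
  simp only [integral_const_mul, main]
  ring

end Wirtinger

/-! ### The Poincaré–Lelong formula for a coordinate hyperplane -/

section Straight

variable {n : ℕ}

theorem two_le_infty : (2 : WithTop ℕ∞) ≤ ∞ := by
  have : ((2 : ℕ∞) : WithTop ℕ∞) ≤ ((⊤ : ℕ∞) : WithTop ℕ∞) := WithTop.coe_le_coe.2 le_top
  exact this

/-- In the expansion of `∂∂̄`, the index `a` is the slot differentiated by `∂` and `b` the slot of
`∂̄` among those left. Slots `0` and `1` of the standard frame are `e₁` and `i e₁`. The two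
remaining pairs are those in which both derivatives lie in the first complex direction. -/
theorem sum_sum_eq_two_terms {k : ℕ} (c J : Fin (k + 1 + 1) → Fin (k + 1) → ℂ)
    (h0 : ∀ a : Fin (k + 1 + 1), 2 ≤ (a : ℕ) → ∀ b, J a b = 0)
    (h1 : ∀ a (b : Fin k), J a b.succ = 0) :
    ∑ a, ∑ b, c a b * J a b
      = c 0 0 * J 0 0 + c (0 : Fin (k + 1)).succ 0 * J (0 : Fin (k + 1)).succ 0 := by
  have hin : ∀ a, ∑ b, c a b * J a b = c a 0 * J a 0 := fun a => by
    rw [Fin.sum_univ_succ]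
    simp [h1]
  simp only [hin]
  rw [Fin.sum_univ_succ, Fin.sum_univ_succ, Finset.sum_eq_zero, add_zero]
  intro i _
  rw [h0 _ (by simp), mul_zero]

/-- The coefficient of the top degree form `i∂∂̄ψ` on `ℂ^{n+1}`. -/
def ddcTop (ψ : Cn (n + 1) → Cn (n + 1) [⋀^Fin (2 * n)]→L[ℝ] ℂ) (u : Cn (n + 1)) : ℂ :=
  (Complex.I • del (ContinuousLinearMap.id ℂ _) (delbar (ContinuousLinearMap.id ℂ _) ψ) u)
    (stdFrame (n + 1))

theorem ddcTop_eq_sum {ψ : Cn (n + 1) → Cn (n + 1) [⋀^Fin (2 * n)]→L[ℝ] ℂ} {u : Cn (n + 1)}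
    (hψ : ContDiffAt ℝ 2 ψ u) :
    ddcTop ψ u = Complex.I * ∑ a : Fin (2 * n + 1 + 1), ∑ b : Fin (2 * n + 1),
      (-1 : ℂ) ^ (a : ℕ) * (-1 : ℂ) ^ (b : ℕ) *
        wirt (-Complex.I) (stdFrame (n + 1) a) (wirt Complex.I
          (a.removeNth (α := fun _ => Cn (n + 1)) (stdFrame (n + 1)) b)
          (fun y => ψ y (b.removeNth (a.removeNth (α := fun _ => Cn (n + 1))
            (stdFrame (n + 1)))))) u := by
  rw [ddcTop, del_eq_wd, delbar_eq_wd]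
  refine (congrArg (Complex.I * ·) (wd_wd_apply hψ Complex.I (-Complex.I)
    (stdFrame (n + 1)))).trans rfl

theorem cons_eq_single_add (z : ℂ) (u : Cn n) :
    (Fin.cons z u : Cn (n + 1)) = Pi.single 0 z + Fin.cons 0 u := by
  funext i
  refine Fin.cases ?_ (fun j => ?_) i <;> simp

theorem stdFrame_apply_zero_of_two_le {k : Fin (2 * (n + 1))} (hk : 2 ≤ (k : ℕ)) :
    stdFrame (n + 1) k 0 = 0 := by
  rw [stdFrame, Pi.single_eq_of_ne]
  intro h
  have := congrArg Fin.val h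
  simp at this
  omega

theorem stdFrame_zero : stdFrame (n + 1) (0 : Fin (2 * n + 1 + 1)) = Pi.single 0 1 := by
  simp [stdFrame]

theorem stdFrame_one : stdFrame (n + 1) (1 : Fin (2 * n + 1 + 1)) = Pi.single 0 Complex.I := by
  have h : (1 : Fin (2 * n + 1 + 1)) = ⟨1, by omega⟩ := by
    ext; simp
  rw [h]
  simp [stdFrame]

theorem stdFrame_add_two (k : Fin (2 * n)) :
    stdFrame (n + 1) (k.succ.succ : Fin (2 * n + 1 + 1)) = Fin.cons 0 (stdFrame n k) := by
  have hv : ((k.succ.succ : Fin (2 * n + 1 + 1)) : ℕ) = k + 2 := by simp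
  funext i
  have h2 : ((k : ℕ) + 2) / 2 = k / 2 + 1 := by omega
  refine Fin.cases ?_ (fun j => ?_) i
  · rw [Fin.cons_zero, stdFrame_apply_zero_of_two_le (by rw [hv]; omega)]
  · rw [Fin.cons_succ]
    simp only [stdFrame, Pi.single_apply]
    have e1 : (j.succ = (⟨((k.succ.succ : Fin (2 * n + 1 + 1)) : ℕ) / 2, by omega⟩ : Fin (n + 1))) ↔
        j = (⟨(k : ℕ) / 2, by omega⟩ : Fin n) := by
      rw [Fin.ext_iff, Fin.ext_iff]
      simp only [Fin.val_succ]
      omega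
    have e2 : (((k.succ.succ : Fin (2 * n + 1 + 1)) : ℕ) % 2 = 0) ↔ ((k : ℕ) % 2 = 0) := by
      rw [hv]; omega
    simp only [e1, e2]

/-- The splitting `ℂ^{n+1} = ℂ × ℂⁿ` as a measure preserving equivalence. -/
theorem measurePreserving_cons : MeasurePreserving
    (fun p : ℂ × Cn n => (Fin.cons p.1 p.2 : Cn (n + 1))) (volume.prod volume) volume := by
  have h := (volume_preserving_piFinSuccAbove (fun _ : Fin (n + 1) => ℂ) 0).symm
  have e : ⇑(MeasurableEquiv.piFinSuccAbove (fun _ : Fin (n + 1) => ℂ) 0).symm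
      = fun p : ℂ × Cn n => (Fin.cons p.1 p.2 : Cn (n + 1)) := by
    funext p
    rw [MeasurableEquiv.piFinSuccAbove_symm_apply]
    simp [Fin.insertNthEquiv]
  rw [e] at h
  exact h

theorem measurableEmbedding_cons : MeasurableEmbedding
    (fun p : ℂ × Cn n => (Fin.cons p.1 p.2 : Cn (n + 1))) := by
  have e : ⇑(MeasurableEquiv.piFinSuccAbove (fun _ : Fin (n + 1) => ℂ) 0).symm
      = fun p : ℂ × Cn n => (Fin.cons p.1 p.2 : Cn (n + 1)) := by
    funext p
    rw [MeasurableEquiv.piFinSuccAbove_symm_apply]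
    simp [Fin.insertNthEquiv]
  rw [← e]
  exact MeasurableEquiv.measurableEmbedding _

theorem locallyIntegrable_log_coord :
    LocallyIntegrable (fun u : Cn (n + 1) => ((Real.log (‖u 0‖ ^ 2) : ℝ) : ℂ)) := by
  rw [MeasureTheory.locallyIntegrable_iff]
  intro K hK
  obtain ⟨r, hr⟩ := hK.isBounded.subset_ball 0
  refine IntegrableOn.mono_set ?_ hr
  rw [← measurePreserving_cons.integrableOn_comp_preimage measurableEmbedding_cons]
  have hsub : (fun p : ℂ × Cn n => (Fin.cons p.1 p.2 : Cn (n + 1))) ⁻¹' Metric.ball 0 r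
      ⊆ Metric.closedBall (0 : ℂ) r ×ˢ Metric.closedBall (0 : Cn n) r := by
    intro p hp
    have hp' : ‖(Fin.cons p.1 p.2 : Cn (n + 1))‖ < r := by simpa using hp
    have hr0 : 0 ≤ r := (norm_nonneg _).trans hp'.le
    rw [pi_norm_lt_iff ((norm_nonneg _).trans_lt hp')] at hp'
    refine ⟨?_, ?_⟩
    · simpa using (hp' 0).le
    · rw [mem_closedBall_zero_iff, pi_norm_le_iff_of_nonneg hr0]
      intro i
      simpa using (hp' i.succ).le
  refine IntegrableOn.mono_set ?_ hsub
  have h1 : IntegrableOn (fun z : ℂ => ((Real.log (‖z‖ ^ 2) : ℝ) : ℂ)) (Metric.closedBall 0 r) :=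
    (locallyIntegrable_log_norm_sq.integrableOn_isCompact (isCompact_closedBall 0 r)).ofReal
  have : IsFiniteMeasure (volume.restrict (Metric.closedBall (0 : Cn n) r)) :=
    isFiniteMeasure_restrict.2 (isCompact_closedBall 0 r).measure_lt_top.ne
  have h2 := Integrable.comp_fst h1 (volume.restrict (Metric.closedBall (0 : Cn n) r))
  rw [Measure.prod_restrict] at h2
  exact h2

/-- By Fubini, for fixed values of the last `n` coordinates this is the one variable formula
`integral_log_norm_sq_mul_laplacian` in `u₀`. -/
theorem integral_log_coord_mul_laplacian {g : Cn (n + 1) → ℂ} (hg : ContDiff ℝ 2 g)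
    (hs : HasCompactSupport g) :
    ∫ u : Cn (n + 1), ((Real.log (‖u 0‖ ^ 2) : ℝ) : ℂ) *
        (fderiv ℝ (fderiv ℝ g) u (Pi.single 0 1) (Pi.single 0 1)
          + fderiv ℝ (fderiv ℝ g) u (Pi.single 0 Complex.I) (Pi.single 0 Complex.I))
      = 4 * Real.pi * ∫ u : Cn n, g (Fin.cons 0 u) := by
  set D : Cn (n + 1) → ℂ := fun u => fderiv ℝ (fderiv ℝ g) u (Pi.single 0 1) (Pi.single 0 1)
          + fderiv ℝ (fderiv ℝ g) u (Pi.single 0 Complex.I) (Pi.single 0 Complex.I) with hD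
  have hc2 : Continuous (fderiv ℝ (fderiv ℝ g)) :=
    (hg.fderiv_right (m := 1) le_rfl).continuous_fderiv (by simp)
  have hDc : Continuous D :=
    ((hc2.clm_apply continuous_const).clm_apply continuous_const).add
      ((hc2.clm_apply continuous_const).clm_apply continuous_const)
  have hs2 : HasCompactSupport (fderiv ℝ (fderiv ℝ g)) := (hs.fderiv ℝ).fderiv ℝ
  have hDs : HasCompactSupport D := by
    refine hs2.mono fun u hu hu' => hu ?_
    simp [hD, hu']
  have hInt : Integrable (fun u : Cn (n + 1) => ((Real.log (‖u 0‖ ^ 2) : ℝ) : ℂ) * D u) :=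
    locallyIntegrable_log_coord.integrable_smul_right_of_hasCompactSupport hDc hDs
  have hInt' := (measurePreserving_cons.integrable_comp_emb measurableEmbedding_cons).2 hInt
  rw [← measurePreserving_cons.integral_comp measurableEmbedding_cons]
  refine (integral_prod_symm _ hInt').trans ?_
  rw [← integral_const_mul]
  refine integral_congr_ae (Filter.Eventually.of_forall fun u' => ?_)
  set j : ℂ → Cn (n + 1) := fun z => Fin.cons z u' with hj
  have hjd : ∀ z, HasFDerivAt j (ContinuousLinearMap.single ℝ (fun _ : Fin (n + 1) => ℂ) 0) z := by
    intro z
    have h1 := (ContinuousLinearMap.single ℝ (fun _ : Fin (n + 1) => ℂ) 0).hasFDerivAt (x := z)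
    have h2 := h1.add_const (Fin.cons 0 u' : Cn (n + 1))
    refine h2.congr_of_eventuallyEq (Filter.Eventually.of_forall fun y => ?_)
    exact cons_eq_single_add y u'
  have hjc : ContDiff ℝ 2 j := by
    have : j = fun z => ContinuousLinearMap.single ℝ (fun _ : Fin (n + 1) => ℂ) 0 z
        + (Fin.cons 0 u' : Cn (n + 1)) := funext fun z => cons_eq_single_add z u'
    rw [this]
    exact (ContinuousLinearMap.contDiff _).add contDiff_const
  have hd1 : ∀ v z, fderiv ℝ (fun z => g (j z)) z v = fderiv ℝ g (j z) (Pi.single 0 v) := by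
    intro v z
    have : HasFDerivAt (fun z => g (j z)) _ z :=
      ((hg.differentiable (by simp)) (j z)).hasFDerivAt.comp z (hjd z)
    rw [this.fderiv]
    simp
  have hd2 : ∀ v z, fderiv ℝ (fun y => fderiv ℝ (fun z => g (j z)) y v) z v
      = fderiv ℝ (fderiv ℝ g) (j z) (Pi.single 0 v) (Pi.single 0 v) := by
    intro v z
    simp only [hd1]
    have hdd : HasFDerivAt (fderiv ℝ g) (fderiv ℝ (fderiv ℝ g) (j z)) (j z) :=
      ((hg.fderiv_right (m := 1) le_rfl).differentiable (by simp) (j z)).hasFDerivAt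
    have : HasFDerivAt (fun y => fderiv ℝ g (j y) (Pi.single 0 v)) _ z :=
      (ContinuousLinearMap.apply ℝ ℂ (Pi.single 0 v : Cn (n + 1))).hasFDerivAt.comp z
        (hdd.comp z (hjd z))
    rw [this.fderiv]
    simp
  have hGs : HasCompactSupport fun z => g (j z) := by
    obtain ⟨r, hr⟩ := hs.isBounded.subset_closedBall 0
    refine HasCompactSupport.intro (isCompact_closedBall (0 : ℂ) r) fun z hz => ?_
    by_contra hne
    have h1 : ‖j z‖ ≤ r := by simpa using hr (subset_tsupport g hne)
    have h2 : ‖z‖ ≤ ‖j z‖ := by simpa [hj] using norm_le_pi_norm (j z) 0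
    exact hz (by simpa using h2.trans h1)
  have := integral_log_norm_sq_mul_laplacian (g := fun z => g (j z)) (hg.comp hjc) hGs
  refine Eq.trans ?_ this
  refine integral_congr_ae (Filter.Eventually.of_forall fun z => ?_)
  beta_reduce
  rw [hd2, hd2]
  rfl

theorem wirt_I_smul (v : Cn (n + 1)) (g : Cn (n + 1) → ℂ) :
    wirt Complex.I (Complex.I • v) g = fun u => -Complex.I * wirt Complex.I v g u := by
  funext u
  simp only [wirt, smul_smul, Complex.I_mul_I, neg_smul, one_smul, map_neg]
  linear_combination (1 / 2 * fderiv ℝ g u (Complex.I • v)) * Complex.I_sq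

theorem wirt_neg_I_smul (v : Cn (n + 1)) (g : Cn (n + 1) → ℂ) (u : Cn (n + 1)) :
    wirt (-Complex.I) (Complex.I • v) g u = Complex.I * wirt (-Complex.I) v g u := by
  simp only [wirt, smul_smul, Complex.I_mul_I, neg_smul, one_smul, map_neg]
  linear_combination (1 / 2 * fderiv ℝ g u (Complex.I • v)) * Complex.I_sq

/-- The Poincaré–Lelong formula for the coordinate hyperplane `{u₀ = 0}`. -/
theorem integral_log_coord_mul_ddcTop {ψ : Cn (n + 1) → Cn (n + 1) [⋀^Fin (2 * n)]→L[ℝ] ℂ}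
    (hψ : ContDiff ℝ ∞ ψ) (hs : HasCompactSupport ψ) :
    ∫ u : Cn (n + 1), ((Real.log (‖u 0‖ ^ 2) : ℝ) : ℂ) * ddcTop ψ u
      = 2 * Real.pi * ∫ u : Cn n, ψ (Fin.cons 0 u) (fun k => Fin.cons 0 (stdFrame n k)) := by
  have hgs : ∀ w : Fin (2 * n) → Cn (n + 1), ContDiff ℝ ∞ fun y => ψ y w := fun w =>
    (ContinuousAlternatingMap.apply ℝ (Cn (n + 1)) ℂ w).contDiff.comp hψ
  have hgc : ∀ w : Fin (2 * n) → Cn (n + 1), HasCompactSupport fun y => ψ y w := fun w =>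
    hs.mono fun u hu hu' => hu (by simp [hu'])
  have hW : ∀ w x y, ContDiff ℝ ∞ (wirt (-Complex.I) x (wirt Complex.I y fun u => ψ u w)) :=
    fun w x y => ContDiff.wirt (m := ∞) (ContDiff.wirt (m := ∞) (hgs w) _ _) _ _
  have hWs : ∀ w x y, HasCompactSupport (wirt (-Complex.I) x (wirt Complex.I y fun u => ψ u w)) :=
    fun w x y => HasCompactSupport.wirt (HasCompactSupport.wirt (hgc w) _ _) _ _
  have hInt : ∀ w x y, Integrable fun u : Cn (n + 1) => ((Real.log (‖u 0‖ ^ 2) : ℝ) : ℂ)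
      * wirt (-Complex.I) x (wirt Complex.I y fun u => ψ u w) u := fun w x y =>
    locallyIntegrable_log_coord.integrable_smul_right_of_hasCompactSupport (hW w x y).continuous
      (hWs w x y)
  have hinv : ∀ x : Cn (n + 1), x 0 = 0 → ∀ (u : Cn (n + 1)) (t : ℂ),
      (fun u : Cn (n + 1) => ((Real.log (‖u 0‖ ^ 2) : ℝ) : ℂ)) (u + t • x)
        = (fun u : Cn (n + 1) => ((Real.log (‖u 0‖ ^ 2) : ℝ) : ℂ)) u := by
    intro x hx u t; simp [hx]
  have hz1 : ∀ w x y, x 0 = 0 → ∫ u : Cn (n + 1), ((Real.log (‖u 0‖ ^ 2) : ℝ) : ℂ)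
      * wirt (-Complex.I) x (wirt Complex.I y fun u => ψ u w) u = 0 := fun w x y hx =>
    integral_mul_wirt_eq_zero_of_invariant locallyIntegrable_log_coord
      ((ContDiff.wirt (m := 1) ((hgs w).of_le two_le_infty) _ _))
      (HasCompactSupport.wirt (hgc w) _ _) _ (hinv x hx)
  -- Wirtinger derivatives commute, so the derivative along `y` can be made the outer one and the
  -- argument of `hz1` applies.
  have hz2 : ∀ w x y, y 0 = 0 → ∫ u : Cn (n + 1), ((Real.log (‖u 0‖ ^ 2) : ℝ) : ℂ)
      * wirt (-Complex.I) x (wirt Complex.I y fun u => ψ u w) u = 0 := fun w x y hy => by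
    have h2 : ∀ u, ContDiffAt ℝ 2 (fun u => ψ u w) u := fun u =>
      ((hgs w).of_le two_le_infty).contDiffAt
    simp only [fun u => wirt_comm (h2 u) Complex.I (-Complex.I) x y]
    exact integral_mul_wirt_eq_zero_of_invariant locallyIntegrable_log_coord
      ((ContDiff.wirt (m := 1) ((hgs w).of_le two_le_infty) _ _))
      (HasCompactSupport.wirt (hgc w) _ _) _ (hinv y hy)
  have hexp : ∀ u, ((Real.log (‖u 0‖ ^ 2) : ℝ) : ℂ) * ddcTop ψ u
      = ∑ a : Fin (2 * n + 1 + 1), ∑ b : Fin (2 * n + 1),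
      (Complex.I * (-1 : ℂ) ^ (a : ℕ) * (-1 : ℂ) ^ (b : ℕ)) *
        (((Real.log (‖u 0‖ ^ 2) : ℝ) : ℂ) *
        wirt (-Complex.I) (stdFrame (n + 1) a) (wirt Complex.I
          (a.removeNth (α := fun _ => Cn (n + 1)) (stdFrame (n + 1)) b)
          (fun y => ψ y (b.removeNth (a.removeNth (α := fun _ => Cn (n + 1))
            (stdFrame (n + 1)))))) u) := by
    intro u
    rw [ddcTop_eq_sum (hψ.of_le two_le_infty).contDiffAt]
    simp only [Finset.mul_sum]
    refine Finset.sum_congr rfl fun a _ => Finset.sum_congr rfl fun b _ => ?_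
    ring
  simp only [hexp]
  rw [integral_finsetSum _ fun a _ => integrable_finsetSum _ fun b _ => (hInt _ _ _).const_mul _]
  simp only [fun a : Fin (2 * n + 1 + 1) => integral_finsetSum (μ := (volume : Measure (Cn (n + 1))))
    Finset.univ
    (f := fun (b : Fin (2 * n + 1)) u => (Complex.I * (-1 : ℂ) ^ (a : ℕ) * (-1 : ℂ) ^ (b : ℕ)) *
        (((Real.log (‖u 0‖ ^ 2) : ℝ) : ℂ) *
        wirt (-Complex.I) (stdFrame (n + 1) a) (wirt Complex.I
          (a.removeNth (α := fun _ => Cn (n + 1)) (stdFrame (n + 1)) b)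
          (fun y => ψ y (b.removeNth (a.removeNth (α := fun _ => Cn (n + 1))
            (stdFrame (n + 1)))))) u)) fun b _ => (hInt _ _ _).const_mul _, integral_const_mul]
  -- only the terms with both derivatives in the direction of `u₀` contribute
  have hinner0 : ∀ a : Fin (2 * n + 1 + 1), 2 ≤ (a : ℕ) → ∀ b : Fin (2 * n + 1),
      ∫ u : Cn (n + 1), ((Real.log (‖u 0‖ ^ 2) : ℝ) : ℂ) *
        wirt (-Complex.I) (stdFrame (n + 1) a) (wirt Complex.I
          (a.removeNth (α := fun _ => Cn (n + 1)) (stdFrame (n + 1)) b)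
          (fun y => ψ y (b.removeNth (a.removeNth (α := fun _ => Cn (n + 1))
            (stdFrame (n + 1)))))) u = 0 := fun a ha b =>
    hz1 _ _ _ (stdFrame_apply_zero_of_two_le ha)
  have hinner1 : ∀ a : Fin (2 * n + 1 + 1), ∀ b : Fin (2 * n),
      ∫ u : Cn (n + 1), ((Real.log (‖u 0‖ ^ 2) : ℝ) : ℂ) *
        wirt (-Complex.I) (stdFrame (n + 1) a) (wirt Complex.I
          (a.removeNth (α := fun _ => Cn (n + 1)) (stdFrame (n + 1)) b.succ)
          (fun y => ψ y (b.succ.removeNth (a.removeNth (α := fun _ => Cn (n + 1))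
            (stdFrame (n + 1)))))) u = 0 := fun a b => by
    by_cases ha : 2 ≤ (a : ℕ)
    · exact hinner0 a ha b.succ
    · refine hz2 _ _ _ (stdFrame_apply_zero_of_two_le ?_)
      have hne : ¬ ((b.succ.castSucc : Fin (2 * n + 1 + 1)) < a) := by
        rw [Fin.lt_def]
        simp
        omega
      rw [Fin.succAbove, if_neg hne]
      simp
  rw [sum_sum_eq_two_terms (fun a b => Complex.I * (-1 : ℂ) ^ (a : ℕ) * (-1 : ℂ) ^ (b : ℕ)) _
    hinner0 hinner1]
  set w : Fin (2 * n) → Cn (n + 1) := fun k => Fin.cons 0 (stdFrame n k) with hw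
  have hw0 : (0 : Fin (2 * n + 1)).removeNth ((0 : Fin (2 * n + 1 + 1)).removeNth
      (α := fun _ => Cn (n + 1)) (stdFrame (n + 1))) = w := by
    funext k
    simp only [Fin.removeNth, Fin.zero_succAbove]
    exact stdFrame_add_two k
  have hw1 : (0 : Fin (2 * n + 1)).removeNth ((0 : Fin (2 * n + 1)).succ.removeNth
      (α := fun _ => Cn (n + 1)) (stdFrame (n + 1))) = w := by
    funext k
    simp only [Fin.removeNth, Fin.zero_succAbove, Fin.succ_succAbove_succ]
    exact stdFrame_add_two k
  have hv0 : stdFrame (n + 1) (0 : Fin (2 * n + 1 + 1)) = Pi.single 0 1 := stdFrame_zero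
  have hv1 : stdFrame (n + 1) ((0 : Fin (2 * n + 1)).succ : Fin (2 * n + 1 + 1))
      = Complex.I • (Pi.single 0 1 : Cn (n + 1)) := by
    rw [← Pi.single_smul, smul_eq_mul, mul_one]
    exact stdFrame_one
  have hr0 : (0 : Fin (2 * n + 1 + 1)).removeNth (α := fun _ => Cn (n + 1)) (stdFrame (n + 1)) 0
      = Complex.I • (Pi.single 0 1 : Cn (n + 1)) := by
    rw [← hv1]; rfl
  have hr1 : ((0 : Fin (2 * n + 1)).succ : Fin (2 * n + 1 + 1)).removeNth
      (α := fun _ => Cn (n + 1)) (stdFrame (n + 1)) 0 = (Pi.single 0 1 : Cn (n + 1)) := by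
    rw [← hv0]; rfl
  rw [hw0, hw1, hv0, hv1, hr0, hr1]
  have hg2 : ContDiff ℝ 2 fun u => ψ u w := (hgs w).of_le two_le_infty
  rw [← integral_const_mul, ← integral_const_mul,
    ← integral_add ((hInt _ _ _).const_mul _) ((hInt _ _ _).const_mul _)]
  have hfin := integral_log_coord_mul_laplacian hg2 (hgc w)
  -- Since `∂̄` along `i e₁` is `-i` times `∂̄` along `e₁`, and `∂` along `i e₁` is `i` times `∂`
  -- along `e₁`, the two remaining terms add up to `2∂∂̄`. This is half the Laplacian in `u₀`, so
  -- the constant is `4π/2`.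
  have : (2 * Real.pi * ∫ u : Cn n, ψ (Fin.cons 0 u) w : ℂ)
      = (1 / 2 : ℂ) * (4 * Real.pi * ∫ u : Cn n, ψ (Fin.cons 0 u) w) := by ring
  rw [this, ← hfin, ← integral_const_mul]
  refine integral_congr_ae (Filter.Eventually.of_forall fun u => ?_)
  simp only
  rw [wirt_I_smul, wirt_neg_I_smul]
  have hsm : ∀ (c : ℂ) (G : Cn (n + 1) → ℂ) (v : Cn (n + 1)), DifferentiableAt ℝ G u →
      wirt (-Complex.I) v (fun y => c * G y) u = c * wirt (-Complex.I) v G u := by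
    intro c G v hG
    simp only [wirt, fderiv_const_mul hG c]
    simp
    ring
  rw [hsm _ _ _ ((ContDiff.wirt (m := 1) hg2 _ _).differentiable (by simp) u),
    wirt_wirt hg2.contDiffAt]
  have hsI : Complex.I • (Pi.single 0 1 : Cn (n + 1)) = Pi.single 0 Complex.I := by
    rw [← Pi.single_smul, smul_eq_mul, mul_one]
  rw [hsI, fderiv_fderiv_comm hg2.contDiffAt (Pi.single 0 Complex.I) (Pi.single 0 1)]
  simp only [Fin.val_zero, pow_zero, Fin.val_succ, zero_add, pow_one]
  linear_combination (((Real.log (‖u 0‖ ^ 2) : ℝ) : ℂ) * (-(1 / 2 : ℂ)) *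
    (fderiv ℝ (fderiv ℝ fun u => ψ u w) u (Pi.single 0 1) (Pi.single 0 1)
      + (1 - Complex.I ^ 2) * fderiv ℝ (fderiv ℝ fun u => ψ u w) u (Pi.single 0 Complex.I) (Pi.single 0 Complex.I))) * Complex.I_sq

end Straight

/-! ### Smoothness of families of alternating forms on a finite dimensional space -/

section SmoothForms

variable {F : Type*} [NormedAddCommGroup F] [NormedSpace ℝ F] [FiniteDimensional ℝ F] {k : ℕ}
  {X : Type*} [NormedAddCommGroup X] [NormedSpace ℝ X]

theorem alternating_apply_eq_sum (α : F [⋀^Fin k]→L[ℝ] ℂ) (v : Fin k → F) :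
    α v = ∑ r : Fin k → Fin (Module.finrank ℝ F),
      (∏ i, (((Module.finBasis ℝ F).repr (v i) (r i) : ℝ) : ℂ)) *
        α (fun i => Module.finBasis ℝ F (r i)) := by
  conv_lhs => rw [show v = fun i => ∑ j, (Module.finBasis ℝ F).repr (v i) j • Module.finBasis ℝ F j
    from funext fun i => ((Module.finBasis ℝ F).sum_repr (v i)).symm]
  rw [← ContinuousAlternatingMap.coe_toAlternatingMap, ← AlternatingMap.coe_multilinearMap,
    MultilinearMap.map_sum]
  refine Finset.sum_congr rfl fun r _ => ?_
  rw [MultilinearMap.map_smul_univ, Complex.real_smul, Complex.ofReal_prod]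

/-- Evaluation on all tuples of vectors of a basis. -/
def basisEval (F : Type*) [NormedAddCommGroup F] [NormedSpace ℝ F] [FiniteDimensional ℝ F]
    (k : ℕ) : F [⋀^Fin k]→L[ℝ] ℂ →L[ℝ] ((Fin k → Fin (Module.finrank ℝ F)) → ℂ) :=
  ContinuousLinearMap.pi fun r =>
    ContinuousAlternatingMap.apply ℝ F ℂ fun i => Module.finBasis ℝ F (r i)

theorem basisEval_injective : Function.Injective (basisEval F k) := by
  intro α β h
  ext v
  rw [alternating_apply_eq_sum α, alternating_apply_eq_sum β]
  refine Finset.sum_congr rfl fun r _ => congrArg _ ?_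
  exact congrFun h r

/-- A left inverse of an injective linear map always exists. This one is defined on a finite
dimensional space, hence continuous. Thus regularity of a family of forms can be tested on its
values at fixed vectors. -/
theorem exists_basisEval_leftInverse :
    ∃ R : ((Fin k → Fin (Module.finrank ℝ F)) → ℂ) →L[ℝ] F [⋀^Fin k]→L[ℝ] ℂ,
      ∀ α, R (basisEval F k α) = α := by
  obtain ⟨R, hR⟩ := LinearMap.exists_leftInverse_of_injective (basisEval F k).toLinearMap
    (LinearMap.ker_eq_bot.2 basisEval_injective)
  exact ⟨LinearMap.toContinuousLinearMap R, fun α => LinearMap.congr_fun hR α⟩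

theorem contDiffOn_form_of_apply {m : WithTop ℕ∞} {f : X → F [⋀^Fin k]→L[ℝ] ℂ} {s : Set X}
    (h : ∀ v, ContDiffOn ℝ m (fun x => f x v) s) : ContDiffOn ℝ m f s := by
  obtain ⟨R, hR⟩ := exists_basisEval_leftInverse (F := F) (k := k)
  have : f = fun x => R (basisEval F k (f x)) := funext fun x => (hR _).symm
  rw [this]
  exact R.contDiff.comp_contDiffOn (contDiffOn_pi.2 fun r => h _)

theorem ContDiffOn.form_apply {m : WithTop ℕ∞} {f : X → F [⋀^Fin k]→L[ℝ] ℂ}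
    {g : X → Fin k → F} {s : Set X} (hf : ContDiffOn ℝ m f s)
    (hg : ∀ i, ContDiffOn ℝ m (fun x => g x i) s) : ContDiffOn ℝ m (fun x => f x (g x)) s := by
  simp only [fun x => alternating_apply_eq_sum (f x) (g x)]
  refine ContDiffOn.sum fun r _ => ContDiffOn.mul (contDiffOn_prod fun i _ => ?_) ?_
  · exact Complex.ofRealCLM.contDiff.comp_contDiffOn
      ((LinearMap.toContinuousLinearMap
        ((Module.finBasis ℝ F).coord (r i))).contDiff.comp_contDiffOn (hg i))
  · exact (ContinuousAlternatingMap.apply ℝ F ℂ _).contDiff.comp_contDiffOn hf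

theorem ContinuousOn.form_apply {Y : Type*} [TopologicalSpace Y] {f : Y → F [⋀^Fin k]→L[ℝ] ℂ}
    {g : Y → Fin k → F} {s : Set Y} (hf : ContinuousOn f s)
    (hg : ∀ i, ContinuousOn (fun x => g x i) s) : ContinuousOn (fun x => f x (g x)) s := by
  simp only [fun x => alternating_apply_eq_sum (f x) (g x)]
  refine continuousOn_finsetSum _ fun r _ =>
    ContinuousOn.mul (continuousOn_finsetProd _ fun i _ => ?_) ?_
  · exact Complex.continuous_ofReal.comp_continuousOn
      ((LinearMap.toContinuousLinearMap
        ((Module.finBasis ℝ F).coord (r i))).continuous.comp_continuousOn (hg i))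
  · exact (ContinuousAlternatingMap.apply ℝ F ℂ _).continuous.comp_continuousOn hf

theorem ContDiffOn.form_pullback {G : Type*} [NormedAddCommGroup G] [NormedSpace ℝ G]
    [FiniteDimensional ℝ G] {m : WithTop ℕ∞} {f : X → F [⋀^Fin k]→L[ℝ] ℂ}
    {A : X → G →L[ℝ] F} {s : Set X} (hf : ContDiffOn ℝ m f s) (hA : ContDiffOn ℝ m A s) :
    ContDiffOn ℝ m (fun x => (f x).compContinuousLinearMap (A x)) s :=
  contDiffOn_form_of_apply fun v =>
    ContDiffOn.form_apply (g := fun x i => A x (v i)) hf fun _ => hA.clm_apply contDiffOn_const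

theorem ContinuousOn.form_of_apply {Y : Type*} [TopologicalSpace Y]
    {f : Y → F [⋀^Fin k]→L[ℝ] ℂ} {s : Set Y} (h : ∀ v, ContinuousOn (fun x => f x v) s) :
    ContinuousOn f s := by
  obtain ⟨R, hR⟩ := exists_basisEval_leftInverse (F := F) (k := k)
  have : f = fun x => R (basisEval F k (f x)) := funext fun x => (hR _).symm
  rw [this]
  exact R.continuous.comp_continuousOn (continuousOn_pi.2 fun r => h _)

end SmoothForms

/-! ### Determinants -/

section Det

variable {m : ℕ}

theorem finrank_real_Cn : Module.finrank ℝ (Cn m) = 2 * m := by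
  rw [Module.finrank_pi_fintype]
  simp [Complex.finrank_real_complex, mul_comm]

/-- The real and the imaginary part of `α` are real top forms, hence multiples of the determinant
form of a real basis. -/
theorem top_form_comp (α : Cn m [⋀^Fin (2 * m)]→L[ℝ] ℂ) (A : Cn m →L[ℝ] Cn m)
    (v : Fin (2 * m) → Cn m) : α (fun i => A (v i)) = (A.det : ℂ) * α v := by
  set e := Module.finBasisOfFinrankEq ℝ (Cn m) finrank_real_Cn
  have key : ∀ f : Cn m [⋀^Fin (2 * m)]→ₗ[ℝ] ℝ, f (fun i => A (v i)) = A.det * f v := by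
    intro f
    have h := f.eq_smul_basis_det e
    rw [h, AlternatingMap.smul_apply, AlternatingMap.smul_apply]
    have := e.det_comp (A : Cn m →ₗ[ℝ] Cn m) v
    simp only [Function.comp_def, ContinuousLinearMap.coe_coe] at this
    rw [this, smul_eq_mul, smul_eq_mul, ContinuousLinearMap.det]
    ring
  apply Complex.ext
  · have := key (Complex.reLm.compAlternatingMap α.toAlternatingMap)
    simpa using this
  · have := key (Complex.imLm.compAlternatingMap α.toAlternatingMap)
    simpa using this

/-- The real determinant is the squared modulus of the complex one. This is why holomorphic changes
of variables need no absolute value of the Jacobian and preserve integrals of forms. -/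
theorem det_nonneg_of_complex_linear (A : Cn m →L[ℝ] Cn m)
    (hA : ∀ v, A (Complex.I • v) = Complex.I • A v) : 0 ≤ A.det := by
  set B : Cn m →ₗ[ℂ] Cn m :=
    { toFun := A
      map_add' := A.map_add
      map_smul' := fun c v => by
        have : c • v = c.re • v + c.im • (Complex.I • v) := by
          funext i
          simp only [Pi.add_apply, Pi.smul_apply, smul_eq_mul, Complex.real_smul]
          rw [← mul_assoc, ← add_mul]
          simp
        rw [this, map_add, map_smul, map_smul, hA]
        funext i
        simp only [Pi.add_apply, Pi.smul_apply, smul_eq_mul, Complex.real_smul, RingHom.id_apply]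
        rw [← mul_assoc, ← add_mul]
        simp } with hB
  have h1 : (A : Cn m →ₗ[ℝ] Cn m) = B.restrictScalars ℝ := rfl
  rw [ContinuousLinearMap.det, h1, LinearMap.det_restrictScalars]
  rw [Algebra.norm_complex_eq]
  exact Complex.normSq_nonneg _

end Det

/-! ### The local Poincaré–Lelong formula -/

section Holomorphic

variable {F : Type*} [NormedAddCommGroup F] [NormedSpace ℝ F] [NormedSpace ℂ F]
  [IsScalarTower ℝ ℂ F]
  {G : Type*} [NormedAddCommGroup G] [NormedSpace ℝ G] [NormedSpace ℂ G]
  [IsScalarTower ℝ ℂ G]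

theorem contDiffOn_real_of_complex {κ : F → G} {U : Set F} (h : ContDiffOn ℂ ω κ U) :
    ContDiffOn ℝ ∞ κ U :=
  (h.restrict_scalars ℝ).of_le le_top

theorem fderiv_real_I_smul {κ : F → G} {x : F} (h : DifferentiableAt ℂ κ x) (v : F) :
    fderiv ℝ κ x (Complex.I • v) = Complex.I • fderiv ℝ κ x v := by
  rw [h.fderiv_restrictScalars ℝ]
  simp

theorem differentiableAt_of_contDiffOn {κ : F → G} {U : Set F} (hU : IsOpen U)
    (h : ContDiffOn ℂ ω κ U) {x : F} (hx : x ∈ U) : DifferentiableAt ℂ κ x :=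
  (h.contDiffAt (hU.mem_nhds hx)).differentiableAt (by simp)

end Holomorphic

section Extension

variable {X W : Type*} [NormedAddCommGroup X] [NormedSpace ℝ X] [NormedAddCommGroup W]
  [NormedSpace ℝ W]

theorem contDiff_indicator {f : X → W} {O K : Set X} (hO : IsOpen O) (hK : IsClosed K)
    (hf : ContDiffOn ℝ ∞ f O) (h0 : ∀ x ∈ O \ K, f x = 0) (hKO : K ⊆ O) :
    ContDiff ℝ ∞ (O.indicator f) := by
  rw [contDiff_iff_contDiffAt]
  intro x
  by_cases hx : x ∈ O
  · refine (hf.contDiffAt (hO.mem_nhds hx)).congr_of_eventuallyEq ?_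
    filter_upwards [hO.mem_nhds hx] with y hy using Set.indicator_of_mem hy f
  · refine (contDiffAt_const (c := (0 : W))).congr_of_eventuallyEq ?_
    filter_upwards [hK.isOpen_compl.mem_nhds fun h => hx (hKO h)] with y hy
    by_cases hyO : y ∈ O
    · rw [Set.indicator_of_mem hyO, h0 y ⟨hyO, hy⟩]
    · exact Set.indicator_of_notMem hyO f

theorem support_indicator_subset {f : X → W} {O K : Set X} (h0 : ∀ x ∈ O \ K, f x = 0) :
    Function.support (O.indicator f) ⊆ K := by
  intro x hx
  by_contra hxK
  refine hx ?_
  by_cases hxO : x ∈ O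
  · rw [Set.indicator_of_mem hxO, h0 x ⟨hxO, hxK⟩]
  · exact Set.indicator_of_notMem hxO f

end Extension

section LocalPoincareLelong

variable {n : ℕ}

theorem ddcTop_eq_wd (ψ : Cn (n + 1) → Cn (n + 1) [⋀^Fin (2 * n)]→L[ℝ] ℂ) (u : Cn (n + 1)) :
    ddcTop ψ u = Complex.I *
      (wd (-Complex.I) (ContinuousLinearMap.id ℂ _) (wd Complex.I (ContinuousLinearMap.id ℂ _) ψ) u)
      (stdFrame (n + 1)) := by
  rw [ddcTop, del_eq_wd, delbar_eq_wd]
  rfl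

theorem ddcTop_congr {ψ ψ' : Cn (n + 1) → Cn (n + 1) [⋀^Fin (2 * n)]→L[ℝ] ℂ} {u : Cn (n + 1)}
    (h : ψ =ᶠ[𝓝 u] ψ') : ddcTop ψ u = ddcTop ψ' u := by
  rw [ddcTop_eq_wd, ddcTop_eq_wd, wd_congr (wd_eventuallyEq h)]

theorem ddcTop_zero (u : Cn (n + 1)) :
    ddcTop (fun _ => (0 : Cn (n + 1) [⋀^Fin (2 * n)]→L[ℝ] ℂ)) u = 0 := by
  have h0 : ∀ (ε : ℂ) (v : Cn (n + 1)), wirt ε v (fun _ => (0 : ℂ)) = fun _ => 0 :=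
    fun ε v => funext fun y => by simp [wirt]
  rw [ddcTop_eq_sum contDiffAt_const]
  simp [h0]

theorem ddcTop_eq_zero_of_notMem_tsupport {ψ : Cn (n + 1) → Cn (n + 1) [⋀^Fin (2 * n)]→L[ℝ] ℂ}
    {u : Cn (n + 1)} (h : u ∉ tsupport ψ) : ddcTop ψ u = 0 := by
  rw [ddcTop_congr (notMem_tsupport_iff_eventuallyEq.1 h)]
  exact ddcTop_zero u

theorem ddcTop_sum {ι : Type*} (s : Finset ι)
    {ψ : ι → Cn (n + 1) → Cn (n + 1) [⋀^Fin (2 * n)]→L[ℝ] ℂ} {u : Cn (n + 1)}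
    (h : ∀ i ∈ s, ContDiffAt ℝ ∞ (ψ i) u) :
    ddcTop (fun y => ∑ i ∈ s, ψ i y) u = ∑ i ∈ s, ddcTop (ψ i) u := by
  have h2 : ∀ i ∈ s, ∀ᶠ y in 𝓝 u, ContDiffAt ℝ 2 (ψ i) y := fun i hi =>
    ((h i hi).of_le two_le_infty).eventually (by simp)
  have hev : wd Complex.I (ContinuousLinearMap.id ℂ _) (fun y => ∑ i ∈ s, ψ i y) =ᶠ[𝓝 u]
      fun y => ∑ i ∈ s, wd Complex.I (ContinuousLinearMap.id ℂ _) (ψ i) y := by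
    filter_upwards [(Filter.eventually_all_finset s).2 h2] with y hy
    exact wd_sum s fun i hi => (hy i hi).differentiableAt (by simp)
  simp only [ddcTop_eq_wd]
  rw [wd_congr hev, wd_sum s]
  · rw [← Finset.mul_sum]
    congr 1
    exact ContinuousAlternatingMap.sum_apply ..
  · intro i hi
    have h1 : ContDiffAt ℝ 1 (fderiv ℝ (ψ i)) u :=
      ((h i hi).of_le two_le_infty).fderiv_right le_rfl
    have h2 : ContDiffAt ℝ 1
        (fun x => typePart Complex.I (ContinuousLinearMap.id ℂ _) (fderiv ℝ (ψ i) x)) u :=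
      ((h1.clm_comp contDiffAt_const).add
        ((h1.clm_comp contDiffAt_const).const_smul Complex.I)).const_smul (1 / 2 : ℂ)
    exact ((ContinuousAlternatingMap.alternatizeUncurryFinCLM ℝ _ ℂ).contDiff.contDiffAt.comp u
      h2).differentiableAt (by simp)

theorem continuousOn_ddcTop {ψ : Cn (n + 1) → Cn (n + 1) [⋀^Fin (2 * n)]→L[ℝ] ℂ}
    {U : Set (Cn (n + 1))} (hU : IsOpen U) (h : ContDiffOn ℝ ∞ ψ U) :
    ContinuousOn (ddcTop ψ) U := by
  have h1 := (ContDiffOn.wd (ε := -Complex.I) (P := ContinuousLinearMap.id ℂ _) hU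
    (ContDiffOn.wd (ε := Complex.I) (P := ContinuousLinearMap.id ℂ _) hU h)).continuousOn
  have h2 := ContinuousOn.form_apply (g := fun _ => stdFrame (n + 1)) h1
    fun i => continuousOn_const
  have h3 := continuousOn_const (c := Complex.I).mul h2
  refine h3.congr fun u _ => ?_
  simp only [ddcTop, del_eq_wd, delbar_eq_wd]
  rfl

/-- The operators `∂` and `∂̄` commute with holomorphic pullback, and pullback of a form of top
degree multiplies its coefficient by the real Jacobian. -/
theorem ddcTop_pullback {κ : Cn (n + 1) → Cn (n + 1)} {U W : Set (Cn (n + 1))} (hU : IsOpen U)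
    (hW : IsOpen W) (hκ : ContDiffOn ℂ ω κ U)
    {ψ : Cn (n + 1) → Cn (n + 1) [⋀^Fin (2 * n)]→L[ℝ] ℂ} (hψ : ContDiffOn ℝ ∞ ψ W)
    {u : Cn (n + 1)} (hu : u ∈ U) (hκu : κ u ∈ W) :
    ddcTop (fun y => (ψ (κ y)).compContinuousLinearMap (fderiv ℝ κ y)) u
      = (fderiv ℝ κ u).det * ddcTop ψ (κ u) := by
  have hκr := contDiffOn_real_of_complex hκ
  have hd : ∀ y ∈ U, DifferentiableAt ℂ κ y := fun y hy => differentiableAt_of_contDiffOn hU hκ hy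
  have hcomm : ∀ {k : ℕ} (ε : ℂ) (β : Cn (n + 1) → Cn (n + 1) [⋀^Fin k]→L[ℝ] ℂ),
      ContDiffOn ℝ ∞ β W → ∀ y ∈ U, κ y ∈ W →
      wd ε (ContinuousLinearMap.id ℂ _)
        (fun y => (β (κ y)).compContinuousLinearMap (fderiv ℝ κ y)) y
      = (wd ε (ContinuousLinearMap.id ℂ _) β (κ y)).compContinuousLinearMap (fderiv ℝ κ y) := by
    intro k ε β hβ y hy hκy
    refine wd_pullback ((hβ.contDiffAt (hW.mem_nhds hκy)).differentiableAt (by simp))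
      ((hκr.contDiffAt (hU.mem_nhds hy)).of_le two_le_infty) (Filter.Eventually.of_forall ?_) ?_
    · intro y v; rfl
    · filter_upwards [hU.mem_nhds hy] with z hz v using fderiv_real_I_smul (hd z hz) v
  have hev : wd Complex.I (ContinuousLinearMap.id ℂ _)
        (fun y => (ψ (κ y)).compContinuousLinearMap (fderiv ℝ κ y)) =ᶠ[𝓝 u]
      fun y => (wd Complex.I (ContinuousLinearMap.id ℂ _) ψ (κ y)).compContinuousLinearMap
        (fderiv ℝ κ y) := by
    have hopen : U ∩ κ ⁻¹' W ∈ 𝓝 u :=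
      Filter.inter_mem (hU.mem_nhds hu)
        ((hd u hu).continuousAt.preimage_mem_nhds (hW.mem_nhds hκu))
    filter_upwards [hopen] with y hy using hcomm _ ψ hψ y hy.1 hy.2
  have h := congrArg (fun A => A (stdFrame (n + 1)))
    (hcomm (-Complex.I) _ (ContDiffOn.wd (ε := Complex.I) (P := ContinuousLinearMap.id ℂ _) hW hψ)
      u hu hκu)
  have ht := top_form_comp (m := n + 1) (wd (-Complex.I) (ContinuousLinearMap.id ℂ _)
    (wd Complex.I (ContinuousLinearMap.id ℂ _) ψ) (κ u)) (fderiv ℝ κ u) (stdFrame (n + 1))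
  rw [ddcTop_eq_wd, ddcTop_eq_wd, wd_congr hev, mul_left_comm]
  exact congrArg (Complex.I * ·) (h.trans ht)

/-- The real part of a holomorphic function is pluriharmonic. -/
theorem integral_pluriharmonic_mul_ddcTop {G : Cn (n + 1) → ℂ} {U : Set (Cn (n + 1))}
    (hU : IsOpen U) (hG : ContDiffOn ℂ ω G U)
    {ψ : Cn (n + 1) → Cn (n + 1) [⋀^Fin (2 * n)]→L[ℝ] ℂ} (hψ : ContDiff ℝ ∞ ψ)
    (hs : HasCompactSupport ψ) (hsub : tsupport ψ ⊆ U) :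
    ∫ u, (G u + starRingEnd ℂ (G u)) * ddcTop ψ u = 0 := by
  have hGr : ContDiffOn ℝ 1 G U := (contDiffOn_real_of_complex hG).of_le (by simp)
  have hGc : ContDiffOn ℝ 1 (fun u => starRingEnd ℂ (G u)) U :=
    Complex.conjCLE.contDiff.comp_contDiffOn hGr
  have hgs : ∀ w : Fin (2 * n) → Cn (n + 1), ContDiff ℝ ∞ fun y => ψ y w := fun w =>
    (ContinuousAlternatingMap.apply ℝ (Cn (n + 1)) ℂ w).contDiff.comp hψ
  have hg2 : ∀ w : Fin (2 * n) → Cn (n + 1), ContDiff ℝ 2 fun y => ψ y w := fun w =>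
    (hgs w).of_le two_le_infty
  have hgsub : ∀ w : Fin (2 * n) → Cn (n + 1), tsupport (fun y => ψ y w) ⊆ tsupport ψ := fun w =>
    closure_mono fun u hu hu' => hu (by simp [hu'])
  have hgc : ∀ w : Fin (2 * n) → Cn (n + 1), HasCompactSupport fun y => ψ y w := fun w =>
    hs.mono fun u hu hu' => hu (by simp [hu'])
  have hW : ∀ w x y, ContDiff ℝ ∞ (wirt (-Complex.I) x (wirt Complex.I y fun u => ψ u w)) :=
    fun w x y => ContDiff.wirt (m := ∞) (ContDiff.wirt (m := ∞) (hgs w) _ _) _ _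
  have hWs : ∀ w x y, tsupport (wirt (-Complex.I) x (wirt Complex.I y fun u => ψ u w))
      ⊆ tsupport ψ := fun w x y =>
    (tsupport_wirt_subset _ _ _).trans ((tsupport_wirt_subset _ _ _).trans (hgsub w))
  have hInt : ∀ {A B : Cn (n + 1) → ℂ}, ContinuousOn A U → Continuous B →
      tsupport B ⊆ tsupport ψ → Integrable (fun u => A u * B u) := by
    intro A B hA hB hBs
    have hBc : HasCompactSupport B := hs.of_isClosed_subset (isClosed_tsupport B) hBs
    refine Continuous.integrable_of_hasCompactSupport ?_ hBc.mul_left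
    refine continuous_of_tsupport fun x hx => ?_
    have hx' : x ∈ U := hsub (hBs (tsupport_mul_subset_right hx))
    exact (hA.continuousAt (hU.mem_nhds hx')).mul hB.continuousAt
  have hzero : ∀ {A h : Cn (n + 1) → ℂ} (ε : ℂ) (v : Cn (n + 1)), ContDiffOn ℝ 1 A U →
      ContDiff ℝ 1 h → tsupport h ⊆ tsupport ψ → (∀ u ∈ U, wirt ε v A u = 0) →
      ∫ u, A u * wirt ε v h u = 0 := by
    intro A h ε v hA hh hhs h0
    rw [integral_mul_wirt hU hA hh (hs.of_isClosed_subset (isClosed_tsupport h) hhs)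
      (hhs.trans hsub), neg_eq_zero]
    refine integral_eq_zero_of_ae (Filter.Eventually.of_forall fun u => ?_)
    by_cases hu : u ∈ U
    · simp [h0 u hu]
    · have : h u = 0 := by
        by_contra hne
        exact hu (hsub (hhs (subset_tsupport h hne)))
      simp [this]
  have hG0 : ∀ v, ∀ u ∈ U, wirt Complex.I v G u = 0 := by
    intro v u hu
    rw [wirt, fderiv_real_I_smul (differentiableAt_of_contDiffOn hU hG hu), smul_eq_mul,
      ← mul_assoc, Complex.I_mul_I]
    ring
  have hGc0 : ∀ v, ∀ u ∈ U, wirt (-Complex.I) v (fun u => starRingEnd ℂ (G u)) u = 0 := by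
    intro v u hu
    have hd : HasFDerivAt (fun u => starRingEnd ℂ (G u))
        ((Complex.conjCLE : ℂ →L[ℝ] ℂ).comp (fderiv ℝ G u)) u :=
      (Complex.conjCLE : ℂ →L[ℝ] ℂ).hasFDerivAt.comp u
        ((hGr.contDiffAt (hU.mem_nhds hu)).differentiableAt (by simp)).hasFDerivAt
    rw [wirt, hd.fderiv]
    simp only [ContinuousLinearMap.comp_apply,
      fderiv_real_I_smul (differentiableAt_of_contDiffOn hU hG hu)]
    simp only [ContinuousLinearEquiv.coe_coe, Complex.conjCLE_apply, smul_eq_mul, map_mul,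
      Complex.conj_I]
    linear_combination (1 / 2 * starRingEnd ℂ (fderiv ℝ G u v)) * Complex.I_sq
  -- One integration by parts is enough. In the summand with the conjugate of `G`, the outer `∂` is
  -- moved onto it. In the summand with `G`, the two derivatives are first exchanged and `∂̄` is
  -- moved. Both vanish by the Cauchy–Riemann equations.
  have hterm : ∀ w x y, ∫ u, (G u + starRingEnd ℂ (G u)) *
      wirt (-Complex.I) x (wirt Complex.I y fun u => ψ u w) u = 0 := by
    intro w x y
    have e : ∀ u, (G u + starRingEnd ℂ (G u)) *
        wirt (-Complex.I) x (wirt Complex.I y fun u => ψ u w) u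
        = G u * wirt (-Complex.I) x (wirt Complex.I y fun u => ψ u w) u
          + starRingEnd ℂ (G u) * wirt (-Complex.I) x (wirt Complex.I y fun u => ψ u w) u :=
      fun u => add_mul _ _ _
    simp only [e]
    rw [integral_add (hInt hGr.continuousOn (hW w x y).continuous (hWs w x y))
      (hInt hGc.continuousOn (hW w x y).continuous (hWs w x y))]
    rw [hzero (-Complex.I) x hGc (ContDiff.wirt (m := 1) (hg2 w) _ _)
      ((tsupport_wirt_subset _ _ _).trans (hgsub w)) (hGc0 x), add_zero]
    simp only [fun u => wirt_comm (hg2 w).contDiffAt (u := u) Complex.I (-Complex.I) x y]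
    exact hzero Complex.I y hGr (ContDiff.wirt (m := 1) (hg2 w) _ _)
      ((tsupport_wirt_subset _ _ _).trans (hgsub w)) (hG0 y)
  have hexp : ∀ u, (G u + starRingEnd ℂ (G u)) * ddcTop ψ u
      = ∑ a : Fin (2 * n + 1 + 1), ∑ b : Fin (2 * n + 1),
      (Complex.I * (-1 : ℂ) ^ (a : ℕ) * (-1 : ℂ) ^ (b : ℕ)) *
        ((G u + starRingEnd ℂ (G u)) *
        wirt (-Complex.I) (stdFrame (n + 1) a) (wirt Complex.I
          (a.removeNth (α := fun _ => Cn (n + 1)) (stdFrame (n + 1)) b)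
          (fun y => ψ y (b.removeNth (a.removeNth (α := fun _ => Cn (n + 1))
            (stdFrame (n + 1)))))) u) := by
    intro u
    rw [ddcTop_eq_sum (hψ.of_le two_le_infty).contDiffAt]
    simp only [Finset.mul_sum]
    refine Finset.sum_congr rfl fun a _ => Finset.sum_congr rfl fun b _ => ?_
    ring
  have hI : ∀ w x y, Integrable fun u => (G u + starRingEnd ℂ (G u)) *
      wirt (-Complex.I) x (wirt Complex.I y fun u => ψ u w) u := fun w x y =>
    hInt (hGr.continuousOn.add hGc.continuousOn) (hW w x y).continuous (hWs w x y)
  simp only [hexp]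
  rw [integral_finsetSum _ fun a _ => integrable_finsetSum _ fun b _ => (hI _ _ _).const_mul _]
  refine Finset.sum_eq_zero fun a _ => ?_
  rw [integral_finsetSum _ fun b _ => (hI _ _ _).const_mul _]
  refine Finset.sum_eq_zero fun b _ => ?_
  rw [integral_const_mul, hterm, mul_zero]

theorem isOpen_slice {O : Set (Cn (n + 1))} (hO : IsOpen O) :
    IsOpen {u : Cn n | (Fin.cons 0 u : Cn (n + 1)) ∈ O} :=
  hO.preimage (continuous_pi fun i => by
    refine Fin.cases ?_ (fun j => ?_) i
    · simpa using continuous_const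
    · simpa using continuous_apply j)

/-- The Poincaré–Lelong formula for a function that is the first coordinate of a chart. -/
theorem integral_log_mul_ddcTop_of_straightening
    (e : OpenPartialHomeomorph (Cn (n + 1)) (Cn (n + 1))) (he : ContDiffOn ℂ ω e.symm e.target)
    {ψ : Cn (n + 1) → Cn (n + 1) [⋀^Fin (2 * n)]→L[ℝ] ℂ} (hψ : ContDiff ℝ ∞ ψ)
    (hs : HasCompactSupport ψ) (hsub : tsupport ψ ⊆ e.source) :
    ∫ x, ((Real.log (‖e x 0‖ ^ 2) : ℝ) : ℂ) * ddcTop ψ x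
      = 2 * Real.pi * ∫ u in {u : Cn n | (Fin.cons 0 u : Cn (n + 1)) ∈ e.target},
        ψ (e.symm (Fin.cons 0 u))
          (fun k => fderiv ℝ e.symm (Fin.cons 0 u) (Fin.cons 0 (stdFrame n k))) := by
  set β : Cn (n + 1) → Cn (n + 1) [⋀^Fin (2 * n)]→L[ℝ] ℂ :=
    fun y => (ψ (e.symm y)).compContinuousLinearMap (fderiv ℝ e.symm y) with hβ
  have her := contDiffOn_real_of_complex he
  have hβs : ContDiffOn ℝ ∞ β e.target :=
    ContDiffOn.form_pullback (hψ.comp_contDiffOn her) (her.fderiv_of_isOpen e.open_target (by simp))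
  set K : Set (Cn (n + 1)) := e '' tsupport ψ with hK
  have hKc : IsCompact K := hs.isCompact.image_of_continuousOn (e.continuousOn.mono hsub)
  have hKt : K ⊆ e.target := by
    rintro _ ⟨x, hx, rfl⟩
    exact e.map_source (hsub hx)
  have h0 : ∀ y ∈ e.target \ K, β y = 0 := by
    rintro y ⟨hy, hyK⟩
    have : ψ (e.symm y) = 0 := by
      by_contra hne
      exact hyK ⟨e.symm y, subset_tsupport ψ hne, e.right_inv hy⟩
    ext v
    simp [hβ, this]
  -- The pullback `β` is defined only on `e.target`, but it vanishes off the compact image `K` of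
  -- the support, so its extension by zero is a test form on the whole space.
  have hγ := contDiff_indicator e.open_target hKc.isClosed hβs h0 hKt
  have hγs : HasCompactSupport (e.target.indicator β) :=
    hKc.of_isClosed_subset (isClosed_tsupport _)
      (closure_minimal (support_indicator_subset h0) hKc.isClosed)
  have hPL := integral_log_coord_mul_ddcTop hγ hγs
  have hL : ∫ x, ((Real.log (‖e x 0‖ ^ 2) : ℝ) : ℂ) * ddcTop ψ x
      = ∫ x in e.symm '' e.target, ((Real.log (‖e x 0‖ ^ 2) : ℝ) : ℂ) * ddcTop ψ x := by
    rw [e.symm_image_target_eq_source]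
    refine (setIntegral_eq_integral_of_forall_compl_eq_zero fun x hx => ?_).symm
    rw [ddcTop_eq_zero_of_notMem_tsupport fun h => hx (hsub h), mul_zero]
  rw [hL, integral_image_eq_integral_abs_det_fderiv_smul volume e.open_target.measurableSet
    (fun x hx => ((differentiableAt_of_contDiffOn e.open_target he hx).restrictScalars
      ℝ).hasFDerivAt.hasFDerivWithinAt) e.symm.injOn]
  -- The Jacobian in the change of variables equals the factor produced by `ddcTop_pullback`,
  -- because the determinant is nonnegative.
  have hR : ∫ u : Cn (n + 1), ((Real.log (‖u 0‖ ^ 2) : ℝ) : ℂ) * ddcTop (e.target.indicator β) u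
      = ∫ u in e.target, |(fderiv ℝ e.symm u).det| •
        (((Real.log (‖e (e.symm u) 0‖ ^ 2) : ℝ) : ℂ) * ddcTop ψ (e.symm u)) := by
    rw [← setIntegral_eq_integral_of_forall_compl_eq_zero (s := e.target)]
    · refine setIntegral_congr_fun e.open_target.measurableSet fun u hu => ?_
      have hev : e.target.indicator β =ᶠ[𝓝 u] β := by
        filter_upwards [e.open_target.mem_nhds hu] with y hy using Set.indicator_of_mem hy β
      rw [ddcTop_congr hev, ddcTop_pullback e.open_target isOpen_univ he hψ.contDiffOn hu
        (Set.mem_univ _), e.right_inv hu, abs_of_nonneg (det_nonneg_of_complex_linear _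
          (fderiv_real_I_smul (differentiableAt_of_contDiffOn e.open_target he hu))),
        Complex.real_smul]
      ring
    · intro u hu
      rw [ddcTop_eq_zero_of_notMem_tsupport, mul_zero]
      exact fun h => hu (hKt ((closure_minimal (support_indicator_subset h0) hKc.isClosed) h))
  rw [← hR, hPL]
  congr 1
  rw [← integral_indicator (isOpen_slice e.open_target).measurableSet]
  refine integral_congr_ae (Filter.Eventually.of_forall fun u => ?_)
  beta_reduce
  by_cases hu : (Fin.cons 0 u : Cn (n + 1)) ∈ e.target
  · rw [Set.indicator_of_mem hu, Set.indicator_of_mem (by exact hu)]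
    rfl
  · rw [Set.indicator_of_notMem hu, Set.indicator_of_notMem (by exact hu)]
    rfl

/-- If `F` has no zeros, then `log |F|²` is pluriharmonic. -/
theorem integral_log_mul_ddcTop_of_ne_zero {F : Cn (n + 1) → ℂ} {U : Set (Cn (n + 1))}
    (hU : IsOpen U) (hF : ContDiffOn ℂ ω F U) {a : ℂ} (ha : a ≠ 0)
    (hFa : ∀ u ∈ U, F u / a ∈ Complex.slitPlane)
    {ψ : Cn (n + 1) → Cn (n + 1) [⋀^Fin (2 * n)]→L[ℝ] ℂ} (hψ : ContDiff ℝ ∞ ψ)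
    (hs : HasCompactSupport ψ) (hsub : tsupport ψ ⊆ U) :
    ∫ u, ((Real.log (‖F u‖ ^ 2) : ℝ) : ℂ) * ddcTop ψ u = 0 := by
  -- Division by `a` moves the values into the slit plane, where the principal logarithm is
  -- holomorphic. Adding `log‖a‖` back makes the real part of `G` equal to `log‖F‖`.
  set G : Cn (n + 1) → ℂ := fun u => Complex.log (F u / a) + (Real.log ‖a‖ : ℝ) with hG
  have hGs : ContDiffOn ℂ ω G U := by
    refine ContDiffOn.add ?_ contDiffOn_const
    intro u hu
    have h1 : ContDiffWithinAt ℂ ω (fun u => F u / a) U u := (hF u hu).div_const a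
    exact (Complex.contDiffAt_log (hFa u hu)).comp_contDiffWithinAt u h1
  rw [← integral_pluriharmonic_mul_ddcTop hU hGs hψ hs hsub]
  refine integral_congr_ae (Filter.Eventually.of_forall fun u => ?_)
  beta_reduce
  by_cases hu : u ∈ U
  · congr 1
    have hFu : F u ≠ 0 := by
      intro h
      have := hFa u hu
      simp [h] at this
    have hre : (G u).re = Real.log ‖F u‖ := by
      rw [hG]
      simp only [Complex.add_re, Complex.log_re, Complex.ofReal_re, norm_div]
      rw [Real.log_div (norm_ne_zero_iff.2 hFu) (norm_ne_zero_iff.2 ha)]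
      ring
    rw [Complex.add_conj, hre, Real.log_pow]
    norm_num
  · rw [ddcTop_eq_zero_of_notMem_tsupport fun h => hu (hsub h), mul_zero, mul_zero]

end LocalPoincareLelong

/-! ### Straightening, critical values and the Bertini theorem -/

section Straightening

variable {k : ℕ}

theorem exists_single_ne_zero {A : Cn k →L[ℂ] ℂ} (h : A ≠ 0) : ∃ i, A (Pi.single i 1) ≠ 0 := by
  by_contra! hc
  refine h (ContinuousLinearMap.coe_injective (LinearMap.pi_ext' fun i => ?_))
  ext
  simpa using hc i

/-- A holomorphic function with nonzero differential is the first coordinate of a holomorphic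
chart. -/
theorem exists_straightening {g : Cn (k + 1) → ℂ} {z : Cn (k + 1)} {W : Set (Cn (k + 1))}
    (hW : W ∈ 𝓝 z) (hg : ContDiffAt ℂ ω g z) (hd : fderiv ℂ g z ≠ 0) :
    ∃ e : OpenPartialHomeomorph (Cn (k + 1)) (Cn (k + 1)), z ∈ e.source ∧ e.source ⊆ W ∧
      ContDiffOn ℂ ω e e.source ∧ ContDiffOn ℂ ω e.symm e.target ∧
      ∀ y ∈ e.source, e y 0 = g y := by
  obtain ⟨i, hi⟩ := exists_single_ne_zero hd
  -- The partial derivative of `g` in direction `i` is nonzero, so `g` can replace the `i`-th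
  -- coordinate, and it is put in first place. The differential is then injective, as the inverse
  -- function theorem requires.
  set φ : Cn (k + 1) → Cn (k + 1) := fun y => Fin.cons (g y) fun j => y (i.succAbove j) with hφ
  set A : Cn (k + 1) →L[ℂ] Cn (k + 1) := ContinuousLinearMap.pi
    (Fin.cons (fderiv ℂ g z) fun j => ContinuousLinearMap.proj (i.succAbove j)) with hA
  have hφd : HasFDerivAt φ A z := by
    rw [hA, hasFDerivAt_pi]
    intro j
    refine Fin.cases ?_ (fun j => ?_) j
    · simpa [hφ] using (hg.differentiableAt (by simp)).hasFDerivAt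
    · simpa [hφ] using (hasFDerivAt_apply (𝕜 := ℂ) (i.succAbove j) z)
  have hφs : ContDiffAt ℂ ω φ z := by
    rw [contDiffAt_pi]
    intro j
    refine Fin.cases ?_ (fun j => ?_) j
    · simpa [hφ] using hg
    · simpa [hφ] using (contDiff_apply ℂ ℂ (n := ω) (i.succAbove j)).contDiffAt (x := z)
  have hinj : Function.Injective (A : Cn (k + 1) →ₗ[ℂ] Cn (k + 1)) := by
    rw [← LinearMap.ker_eq_bot, LinearMap.ker_eq_bot']
    intro v hv
    have h1 : ∀ j, v (i.succAbove j) = 0 := fun j => by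
      have := congrFun hv j.succ
      simpa [hA] using this
    have h0 : fderiv ℂ g z v = 0 := by
      have := congrFun hv 0
      simpa [hA] using this
    have hvs : v = v i • Pi.single i 1 := by
      funext l
      by_cases hl : l = i
      · subst hl; simp
      · obtain ⟨j, rfl⟩ := Fin.exists_succAbove_eq hl
        simp [h1, hl]
    rw [hvs, map_smul, smul_eq_mul, mul_eq_zero] at h0
    rw [hvs, h0.resolve_right hi, zero_smul]
  set A' : Cn (k + 1) ≃L[ℂ] Cn (k + 1) :=
    (LinearEquiv.ofInjectiveEndo (A : Cn (k + 1) →ₗ[ℂ] Cn (k + 1)) hinj).toContinuousLinearEquiv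
    with hA'
  have hφd' : HasFDerivAt φ (A' : Cn (k + 1) →L[ℂ] Cn (k + 1)) z := by
    have : (A' : Cn (k + 1) →L[ℂ] Cn (k + 1)) = A := by
      ext1 v
      rfl
    rw [this]
    exact hφd
  have hω : (ω : WithTop ℕ∞) ≠ 0 := by simp
  set e₀ := hφs.toOpenPartialHomeomorph φ hφd' hω with he₀
  have hz₀ : z ∈ e₀.source := hφs.mem_toOpenPartialHomeomorph_source hφd' hω
  have he₀s : ContDiffAt ℂ ω e₀.symm (e₀ z) := hφs.to_localInverse hφd' hω
  have h1 : ∀ᶠ y in 𝓝 z, ContDiffAt ℂ ω φ y := hφs.eventually (by simp)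
  have h2 : ∀ᶠ y in 𝓝 z, ContDiffAt ℂ ω e₀.symm (e₀ y) :=
    (e₀.continuousAt hz₀).eventually (he₀s.eventually (by simp))
  -- The inverse function theorem gives analyticity of the inverse at the base point only. Being
  -- analytic is an open condition, so the source is shrunk until both directions are analytic at
  -- every point.
  set s : Set (Cn (k + 1)) :=
    {y | y ∈ W ∧ ContDiffAt ℂ ω φ y ∧ ContDiffAt ℂ ω e₀.symm (e₀ y)} with hs
  have hsz : s ∈ 𝓝 z := by
    filter_upwards [hW, h1, h2] with y a b c using ⟨a, b, c⟩
  have hsrc : ∀ y ∈ (e₀.restr s).source, y ∈ e₀.source ∧ y ∈ s := by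
    intro y hy
    rw [e₀.restr_source] at hy
    exact ⟨hy.1, interior_subset hy.2⟩
  refine ⟨e₀.restr s, ?_, fun y hy => (hsrc y hy).2.1, fun y hy => ?_, fun y hy => ?_,
    fun y hy => ?_⟩
  · rw [e₀.restr_source]
    exact ⟨hz₀, mem_interior_iff_mem_nhds.2 hsz⟩
  · exact (hsrc y hy).2.2.1.contDiffWithinAt
  · have hy' := (e₀.restr s).map_target hy
    have h3 := (hsrc _ hy').2.2.2
    have h4 : e₀ ((e₀.restr s).symm y) = y := (e₀.restr s).right_inv hy
    rw [h4] at h3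
    exact h3.contDiffWithinAt
  · change φ y 0 = g y
    simp [hφ]

theorem contDiff_cons_zero : ContDiff ℂ ω fun v : Cn k => (Fin.cons 0 v : Cn (k + 1)) := by
  rw [contDiff_pi]
  intro i
  refine Fin.cases ?_ (fun j => ?_) i
  · simpa using contDiff_const
  · simpa using contDiff_apply ℂ ℂ j

/-- A holomorphic function all of whose derivatives vanish at a point is constant nearby. -/
theorem eventually_eq_of_iteratedFDeriv_eq_zero {F : Cn k → ℂ} {u : Cn k}
    (hF : ContDiffAt ℂ ω F u) (h : ∀ n, 1 ≤ n → iteratedFDeriv ℂ n F u = 0) :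
    ∀ᶠ y in 𝓝 u, F y = F u := by
  obtain ⟨p, r, hp⟩ := hF.analyticAt
  filter_upwards [Metric.eball_mem_nhds u hp.r_pos] with y hy
  have hy' : y - u ∈ Metric.eball (0 : Cn k) r := by
    simpa [edist_eq_enorm_sub] using hy
  have hsum := hp.hasSum_iteratedFDeriv hy'
  rw [add_sub_cancel] at hsum
  refine hsum.unique ?_
  convert hasSum_single (0 : ℕ) ?_ using 1
  · simp
  · intro n hn
    rw [h n (Nat.one_le_iff_ne_zero.2 hn)]
    simp

/-- By the Lindelöf property countably many of the given neighbourhoods already cover `s`. -/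
theorem countable_image_of_locally {X Y : Type*} [TopologicalSpace X] [SecondCountableTopology X]
    {f : X → Y} {s : Set X} (h : ∀ x ∈ s, ∃ O ∈ 𝓝 x, (f '' (s ∩ O)).Countable) :
    (f '' s).Countable := by
  choose! O hO hc using h
  obtain ⟨t, hts, htc, hcov⟩ := TopologicalSpace.countable_cover_nhdsWithin
    (fun x hx => mem_nhdsWithin_of_mem_nhds (hO x hx))
  refine (htc.biUnion fun x hx => hc x (hts hx)).mono ?_
  rintro _ ⟨x, hx, rfl⟩
  obtain ⟨y, hy, hxy⟩ := Set.mem_iUnion₂.1 (hcov hx)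
  exact Set.mem_iUnion₂.2 ⟨y, hy, ⟨x, ⟨hx, hxy⟩, rfl⟩⟩

theorem exists_iteratedFDeriv_single_ne_zero {F : Cn k → ℂ} {u : Cn k} {n : ℕ}
    (h : iteratedFDeriv ℂ n F u ≠ 0) :
    ∃ m : Fin n → Fin k, iteratedFDeriv ℂ n F u (fun j => Pi.single (m j) 1) ≠ 0 := by
  by_contra! hc
  refine h ?_
  apply ContinuousMultilinearMap.toMultilinearMap_injective
  refine Module.Basis.ext_multilinear (fun _ => Pi.basisFun ℂ (Fin k)) fun v => ?_
  simpa using hc v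

/-- The critical values of a holomorphic function form a countable set. -/
theorem countable_criticalValues : ∀ {k : ℕ} {U : Set (Cn k)} (_ : IsOpen U) {F : Cn k → ℂ}
    (_ : ContDiffOn ℂ ω F U), (F '' {u | u ∈ U ∧ fderiv ℂ F u = 0}).Countable := by
  intro k
  induction k with
  | zero => intro U _ F _; exact (Set.toFinite _).countable
  | succ k ih =>
    intro U hU F hF
    have hFat : ∀ u ∈ U, ContDiffAt ℂ ω F u := fun u hu => hF.contDiffAt (hU.mem_nhds hu)
    set g : ∀ n, (Fin n → Fin (k + 1)) → Cn (k + 1) → ℂ :=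
      fun n m u => iteratedFDeriv ℂ n F u (fun j => Pi.single (m j) 1) with hg
    have hgs : ∀ n m, ∀ u ∈ U, ContDiffAt ℂ ω (g n m) u := fun n m u hu =>
      (ContinuousMultilinearMap.apply ℂ (fun _ : Fin n => Cn (k + 1)) ℂ
        (fun j => Pi.single (m j) 1)).contDiff.contDiffAt.comp u
        ((hFat u hu).iteratedFDeriv_right (m := ω) (by simp))
    set A : (n : ℕ) → (Fin n → Fin (k + 1)) → Set (Cn (k + 1)) := fun n m =>
      {u | u ∈ U ∧ fderiv ℂ F u = 0 ∧ g n m u = 0 ∧ fderiv ℂ (g n m) u ≠ 0} with hA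
    set B : Set (Cn (k + 1)) := {u | u ∈ U ∧ ∀ n, 1 ≤ n → iteratedFDeriv ℂ n F u = 0} with hB
    -- Suppose some derivative of positive order is nonzero at the critical point, and let `n` be
    -- the least such order. Since `dF = 0`, `n ≥ 2`. Then some partial derivative of order `n - 1 ≥
    -- 1` vanishes there with nonzero differential, which puts the point in some `A (n - 1) m`.
    have hcov : {u | u ∈ U ∧ fderiv ℂ F u = 0} ⊆ (⋃ n, ⋃ m, A n m) ∪ B := by
      rintro u ⟨hu, hdu⟩
      by_cases hall : ∀ n, 1 ≤ n → iteratedFDeriv ℂ n F u = 0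
      · exact Or.inr ⟨hu, hall⟩
      left
      push Not at hall
      classical
      obtain ⟨h1, h2⟩ := Nat.find_spec hall
      set n := Nat.find hall with hn
      have hmin : ∀ l, 1 ≤ l → l < n → iteratedFDeriv ℂ l F u = 0 := fun l hl hln => by
        by_contra hne
        exact Nat.find_min hall hln ⟨hl, hne⟩
      obtain ⟨m, hm⟩ := exists_iteratedFDeriv_single_ne_zero h2
      obtain ⟨n', hn'⟩ : ∃ n', n = n' + 1 := ⟨n - 1, by omega⟩
      clear_value n
      subst hn'
      rw [iteratedFDeriv_succ_apply_left] at hm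
      have hn'0 : 1 ≤ n' := by
        rcases Nat.eq_zero_or_pos n' with h0 | h0
        · subst h0
          exfalso
          apply hm
          have : (iteratedFDeriv ℂ 0 F) = fun x =>
            (continuousMultilinearCurryFin0 ℂ (Cn (k + 1)) ℂ).symm (F x) := rfl
          rw [this]
          have hd : HasFDerivAt F (0 : Cn (k + 1) →L[ℂ] ℂ) u := hdu ▸
            ((hFat u hu).differentiableAt (by simp)).hasFDerivAt
          have hc := ((continuousMultilinearCurryFin0 ℂ (Cn (k + 1)) ℂ).symm : ℂ →L[ℂ]
            (Cn (k + 1) [×0]→L[ℂ] ℂ)).hasFDerivAt.comp u hd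
          have := hc.fderiv
          simp only [Function.comp_def] at this
          erw [this]
          simp
        · exact h0
      refine Set.mem_iUnion.2 ⟨n', Set.mem_iUnion.2 ⟨Fin.tail m, hu, hdu, ?_, ?_⟩⟩
      · simp [hg, hmin n' hn'0 (Nat.lt_succ_self _)]
      · intro h0
        apply hm
        have hdd : DifferentiableAt ℂ (iteratedFDeriv ℂ n' F) u :=
          ((hFat u hu).iteratedFDeriv_right (m := 1) (i := n') le_top).differentiableAt (by simp)
        have hc := (ContinuousMultilinearMap.apply ℂ (fun _ : Fin n' => Cn (k + 1)) ℂ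
          (fun j => Pi.single (Fin.tail m j) 1)).hasFDerivAt.comp u hdd.hasFDerivAt
        have h3 : fderiv ℂ (g n' (Fin.tail m)) u = _ := hc.fderiv
        rw [h3] at h0
        exact DFunLike.congr_fun h0 (Pi.single (m 0) 1)
    refine Set.Countable.mono (Set.image_mono hcov) ?_
    rw [Set.image_union, Set.image_iUnion]
    simp only [Set.image_iUnion]
    refine (Set.countable_iUnion fun n => Set.countable_iUnion fun m => ?_).union ?_
    -- Near a point of `A n m` the zero set of the partial derivative `g n m` is a coordinate
    -- hyperplane of a holomorphic chart. Critical points of `F` on it are critical for the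
    -- restriction of `F`, a function of one variable less, so the induction hypothesis applies.
    · refine countable_image_of_locally fun z hz => ?_
      obtain ⟨e, hze, heU, -, hes, he0⟩ :=
        exists_straightening (hU.mem_nhds hz.1) (hgs n m z hz.1) hz.2.2.2
      refine ⟨e.source, e.open_source.mem_nhds hze, ?_⟩
      set V : Set (Cn k) := {v | (Fin.cons 0 v : Cn (k + 1)) ∈ e.target} with hV
      set G : Cn k → ℂ := fun v => F (e.symm (Fin.cons 0 v)) with hG
      have hVo : IsOpen V := isOpen_slice e.open_target
      have hGs : ContDiffOn ℂ ω G V := by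
        refine (hF.comp (hes.comp contDiff_cons_zero.contDiffOn fun v hv => hv) ?_)
        exact fun v hv => heU (e.map_target hv)
      refine (ih hVo hGs).mono ?_
      rintro _ ⟨y, ⟨hy, hye⟩, rfl⟩
      have hcons : (Fin.cons 0 (Fin.tail (e y)) : Cn (k + 1)) = e y := by
        conv_rhs => rw [← Fin.cons_self_tail (e y), he0 y hye, hy.2.2.1]
      refine ⟨Fin.tail (e y), ⟨?_, ?_⟩, ?_⟩
      · rw [hV, Set.mem_ofPred_eq, hcons]
        exact e.map_source hye
      · have hin : e.symm (Fin.cons 0 (Fin.tail (e y))) = y := by rw [hcons, e.left_inv hye]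
        have hd1 : HasFDerivAt F (0 : Cn (k + 1) →L[ℂ] ℂ)
            ((fun v => e.symm (Fin.cons 0 v)) (Fin.tail (e y))) := by
          beta_reduce
          rw [hin, ← hy.2.1]
          exact ((hFat y hy.1).differentiableAt (by simp)).hasFDerivAt
        have hmem : Fin.tail (e y) ∈ V := by
          rw [hV, Set.mem_ofPred_eq, hcons]
          exact e.map_source hye
        have hd2 : DifferentiableAt ℂ (fun v : Cn k => e.symm (Fin.cons 0 v))
            (Fin.tail (e y)) :=
          ((hes.comp contDiff_cons_zero.contDiffOn fun v hv => hv).contDiffAt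
            (hVo.mem_nhds hmem)).differentiableAt (by simp)
        have := (HasFDerivAt.comp (Fin.tail (e y)) hd1 hd2.hasFDerivAt).fderiv
        rw [ContinuousLinearMap.zero_comp] at this
        exact this
      · rw [hG]
        beta_reduce
        rw [hcons, e.left_inv hye]
    -- Here all derivatives vanish, and the power series shows that `F` is constant near the point.
    · refine countable_image_of_locally fun z hz => ?_
      have hev := eventually_eq_of_iteratedFDeriv_eq_zero (hFat z hz.1) hz.2
      refine ⟨_, hev, (Set.countable_singleton (F z)).mono ?_⟩
      rintro _ ⟨y, ⟨-, hy⟩, rfl⟩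
      exact hy

end Straightening

section Bertini

variable {k d : ℕ}

/-- The linear combination `∑ⱼ cⱼ fⱼ`. -/
def lincomb (f : Fin d → Cn k → ℂ) (c : Fin d → ℂ) (u : Cn k) : ℂ := ∑ j, c j * f j u

theorem contDiffOn_lincomb {f : Fin d → Cn k → ℂ} {U : Set (Cn k)}
    (hf : ∀ j, ContDiffOn ℂ ω (f j) U) (c : Fin d → ℂ) : ContDiffOn ℂ ω (lincomb f c) U :=
  ContDiffOn.sum fun j _ => contDiffOn_const.mul (hf j)

theorem fderiv_lincomb {f : Fin d → Cn k → ℂ} {U : Set (Cn k)} (hU : IsOpen U)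
    (hf : ∀ j, ContDiffOn ℂ ω (f j) U) (c : Fin d → ℂ) {u : Cn k} (hu : u ∈ U) :
    fderiv ℂ (lincomb f c) u = ∑ j, c j • fderiv ℂ (f j) u := by
  have hd : ∀ j, DifferentiableAt ℂ (f j) u := fun j =>
    ((hf j).contDiffAt (hU.mem_nhds hu)).differentiableAt (by simp)
  exact (HasFDerivAt.fun_sum fun j _ => (hd j).hasFDerivAt.const_mul (c j)).fderiv

theorem measurableSet_of_isSigmaCompact {X : Type*} [TopologicalSpace X] [T2Space X]
    [MeasurableSpace X] [BorelSpace X] {s : Set X} (h : IsSigmaCompact s) : MeasurableSet s := by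
  obtain ⟨K, hK, rfl⟩ := h
  exact MeasurableSet.iUnion fun n => (hK n).isClosed.measurableSet

/-- Almost every member of a base point free linear system is nonsingular. -/
theorem ae_lincomb_regular {U : Set (Cn k)} (hU : IsOpen U) {f : Fin d → Cn k → ℂ}
    (hf : ∀ j, ContDiffOn ℂ ω (f j) U) (h0 : ∀ u ∈ U, ∃ j, f j u ≠ 0) :
    ∀ᵐ c : Fin d → ℂ, ∀ u ∈ U, lincomb f c u = 0 → fderiv ℂ (lincomb f c) u ≠ 0 := by
  have key : ∀ j, ∀ᵐ c : Fin d → ℂ,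
      c ∈ {c | ∃ u ∈ U, f j u ≠ 0 ∧ lincomb f c u = 0 ∧ fderiv ℂ (lincomb f c) u = 0}ᶜ := by
    intro j
    set V : Set (Cn k) := {u | u ∈ U ∧ f j u ≠ 0} with hV
    have hVo : IsOpen V := (hf j).continuousOn.isOpen_inter_preimage hU isOpen_ne
    -- The bad set is the projection of a closed subset of the σ-compact space `ℂᵈ × V`, hence
    -- σ-compact. The Fubini argument below requires its measurability.
    have hmeas : MeasurableSet
        {c | ∃ u ∈ U, f j u ≠ 0 ∧ lincomb f c u = 0 ∧ fderiv ℂ (lincomb f c) u = 0} := by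
      have : LocallyCompactSpace V := hVo.locallyCompactSpace
      have hfc : ∀ i, Continuous fun u : V => f i u := fun i =>
        ((hf i).continuousOn.mono fun u hu => hu.1).comp_continuous continuous_subtype_val
          fun u => u.2
      have hdc : ∀ i, Continuous fun u : V => fderiv ℂ (f i) u := fun i =>
        (((hf i).continuousOn_fderiv_of_isOpen hU (by simp)).mono fun u hu =>
          hu.1).comp_continuous continuous_subtype_val fun u => u.2
      have hcl : IsClosed {q : (Fin d → ℂ) × V | ∑ i, q.1 i * f i q.2 = 0 ∧
          ∑ i, q.1 i • fderiv ℂ (f i) q.2 = 0} := by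
        refine IsClosed.inter (isClosed_eq ?_ continuous_const) (isClosed_eq ?_ continuous_const)
        · exact continuous_finsetSum _ fun i _ => ((continuous_apply i).comp continuous_fst).mul
            ((hfc i).comp continuous_snd)
        · exact continuous_finsetSum _ fun i _ => ((continuous_apply i).comp continuous_fst).smul
            ((hdc i).comp continuous_snd)
      have hs := (isSigmaCompact_univ.of_isClosed_subset hcl (Set.subset_univ _)).image
        continuous_fst
      convert measurableSet_of_isSigmaCompact hs using 1
      ext c
      simp only [Set.mem_ofPred_eq, Set.mem_image, Prod.exists, exists_and_right, exists_eq_right]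
      constructor
      · rintro ⟨u, hu, hju, h1, h2⟩
        rw [fderiv_lincomb hU hf c hu] at h2
        exact ⟨⟨u, hu, hju⟩, h1, h2⟩
      · rintro ⟨⟨u, hu, hju⟩, h1, h2⟩
        refine ⟨u, hu, hju, h1, ?_⟩
        rw [fderiv_lincomb hU hf c hu]
        exact h2
    -- By Fubini it suffices that every line in the `j`-th coordinate direction meets the bad set in
    -- a null set. On `V` the equation `F_c + t fⱼ = 0` reads `H = t` with `H = -F_c/fⱼ`. A zero is
    -- singular exactly when `dH = 0` there, so bad values `t` are critical values of `H`.
    refine ae_mem_of_ae_add_linearMap_mem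
      (LinearMap.single ℝ (fun _ : Fin d => ℂ) j) (volume : Measure ℂ) volume hmeas.compl
      fun c => ?_
    set H : Cn k → ℂ := fun u => -lincomb f c u / f j u with hH
    have hHs : ContDiffOn ℂ ω H V :=
      ((contDiffOn_lincomb hf c).neg.mono fun u hu => hu.1).div ((hf j).mono fun u hu => hu.1)
        fun u hu => hu.2
    have hcount := countable_criticalValues hVo hHs
    refine measure_mono_null (fun t ht => ?_) (hcount.measure_zero volume)
    have ht' : ∃ u ∈ U, f j u ≠ 0 ∧ lincomb f (c + Pi.single j t) u = 0 ∧
        fderiv ℂ (lincomb f (c + Pi.single j t)) u = 0 := by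
      by_contra hne
      exact ht hne
    obtain ⟨u, hu, hju, h1, h2⟩ := ht'
    have hsplit : ∀ y, lincomb f (c + Pi.single j t) y = lincomb f c y + t * f j y := by
      intro y
      simp only [lincomb, Pi.add_apply, add_mul, Finset.sum_add_distrib]
      congr 1
      rw [Finset.sum_eq_single j]
      · simp
      · intro i _ hi
        simp [hi]
      · simp
    have hHu : H u = t := by
      rw [hsplit] at h1
      rw [hH]
      beta_reduce
      rw [div_eq_iff hju]
      linear_combination -h1
    refine ⟨u, ⟨⟨hu, hju⟩, ?_⟩, hHu⟩
    have hdc : HasFDerivAt (lincomb f c) (fderiv ℂ (lincomb f c) u) u :=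
      (((contDiffOn_lincomb hf c).contDiffAt (hU.mem_nhds hu)).differentiableAt
        (by simp)).hasFDerivAt
    have hdj : HasFDerivAt (f j) (fderiv ℂ (f j) u) u :=
      (((hf j).contDiffAt (hU.mem_nhds hu)).differentiableAt (by simp)).hasFDerivAt
    have hdH : HasFDerivAt H (fderiv ℂ H u) u :=
      ((hHs.contDiffAt (hVo.mem_nhds ⟨hu, hju⟩)).differentiableAt (by simp)).hasFDerivAt
    have h3 : fderiv ℂ (lincomb f c) u + t • fderiv ℂ (f j) u = 0 := by
      rw [← h2, ← (hdc.add (hdj.const_mul t)).fderiv]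
      exact congrArg (fun G => fderiv ℂ G u) (funext hsplit).symm
    have h4 : HasFDerivAt (fun y => -lincomb f c y) (H u • fderiv ℂ (f j) u + f j u • fderiv ℂ H u)
        u := by
      refine (hdH.mul hdj).congr_of_eventuallyEq ?_
      filter_upwards [hVo.mem_nhds ⟨hu, hju⟩] with y hy
      simp only [Pi.mul_apply, hH]
      rw [div_mul_cancel₀ _ hy.2]
    have h5 := h4.unique hdc.neg
    rw [hHu] at h5
    have h6 : f j u • fderiv ℂ H u = 0 := by
      have : f j u • fderiv ℂ H u
          = (t • fderiv ℂ (f j) u + f j u • fderiv ℂ H u) - t • fderiv ℂ (f j) u := by abel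
      rw [this, h5, ← neg_add', h3, neg_zero]
    exact (smul_eq_zero.1 h6).resolve_left hju
  filter_upwards [ae_all_iff.2 key] with c hc u hu hFu hdu
  obtain ⟨j, hj⟩ := h0 u hu
  exact hc j ⟨u, hu, hj, hFu, hdu⟩

theorem gaussian_absolutelyContinuous (d : ℕ) : gaussian d ≪ volume :=
  withDensity_absolutelyContinuous _ _

end Bertini

/-! ### Charts of the maximal atlas -/

section Charts

variable {n : ℕ} {M : Type*} [TopologicalSpace M] [ChartedSpace (Cn (n + 1)) M]

/-- The tangent map of the inverse of a chart. -/
def tan (κ : OpenPartialHomeomorph M (Cn (n + 1))) (u : Cn (n + 1)) :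
    Cn (n + 1) →L[ℝ] Cn (n + 1) :=
  mfderiv 𝓘(ℝ, Cn (n + 1)) 𝓘(ℝ, Cn (n + 1)) κ.symm u

/-- The holomorphic charts of `M`. -/
abbrev hcharts (n : ℕ) (M : Type*) [TopologicalSpace M] [ChartedSpace (Cn (n + 1)) M] :
    Set (OpenPartialHomeomorph M (Cn (n + 1))) :=
  IsManifold.maximalAtlas 𝓘(ℂ, Cn (n + 1)) ω M

variable [IsManifold 𝓘(ℂ, Cn (n + 1)) ω M]
  {κ κ' : OpenPartialHomeomorph M (Cn (n + 1))}

theorem chartAt_mem_hcharts (x : M) : chartAt (Cn (n + 1)) x ∈ hcharts n M :=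
  IsManifold.chart_mem_maximalAtlas x

theorem contDiffOn_transition (h : κ ∈ hcharts n M) (h' : κ' ∈ hcharts n M) :
    ContDiffOn ℂ ω (κ' ∘ κ.symm) (κ.target ∩ κ.symm ⁻¹' κ'.source) := by
  have hc := IsManifold.compatible_of_mem_maximalAtlas h h'
  rw [contDiffGroupoid, mem_groupoid_of_pregroupoid] at hc
  simpa [contDiffPregroupoid] using hc.1

theorem isOpen_transition (κ κ' : OpenPartialHomeomorph M (Cn (n + 1))) :
    IsOpen (κ.target ∩ κ.symm ⁻¹' κ'.source) :=
  (κ.symm.trans κ').open_source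

theorem differentiableAt_transition (h : κ ∈ hcharts n M) (h' : κ' ∈ hcharts n M)
    {u : Cn (n + 1)} (hu : u ∈ κ.target) (hu' : κ.symm u ∈ κ'.source) :
    DifferentiableAt ℂ (κ' ∘ κ.symm) u :=
  differentiableAt_of_contDiffOn (isOpen_transition κ κ') (contDiffOn_transition h h') ⟨hu, hu'⟩

/-- The tangent space at a point is read in the preferred chart at that point. That is why the chart
composed on the left itself depends on `u`. -/
theorem tan_eq_fderiv (h : κ ∈ hcharts n M) {u : Cn (n + 1)} (hu : u ∈ κ.target) :
    tan κ u = fderiv ℝ (chartAt (Cn (n + 1)) (κ.symm u) ∘ κ.symm) u := by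
  have hd : DifferentiableAt ℝ (chartAt (Cn (n + 1)) (κ.symm u) ∘ κ.symm) u :=
    (differentiableAt_transition h (chartAt_mem_hcharts _) hu
      (mem_chart_source _ _)).restrictScalars ℝ
  have hm : HasMFDerivAt 𝓘(ℝ, Cn (n + 1)) 𝓘(ℝ, Cn (n + 1)) κ.symm u
      (fderiv ℝ (chartAt (Cn (n + 1)) (κ.symm u) ∘ κ.symm) u) := by
    refine ⟨κ.continuousAt_symm hu, ?_⟩
    exact hd.hasFDerivAt.hasFDerivWithinAt
  exact hm.mfderiv

theorem tan_trans (h : κ ∈ hcharts n M) (h' : κ' ∈ hcharts n M) {u : Cn (n + 1)}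
    (hu : u ∈ κ.target) (hu' : κ.symm u ∈ κ'.source) :
    tan κ u = (tan κ' (κ' (κ.symm u))).comp (fderiv ℝ (κ' ∘ κ.symm) u) := by
  have hinv : κ'.symm (κ' (κ.symm u)) = κ.symm u := κ'.left_inv hu'
  rw [tan_eq_fderiv h hu, tan_eq_fderiv h' (κ'.map_source hu'), hinv]
  have hd1 : HasFDerivAt (κ' ∘ κ.symm) (fderiv ℝ (κ' ∘ κ.symm) u) u :=
    ((differentiableAt_transition h h' hu hu').restrictScalars ℝ).hasFDerivAt
  have hd2 : DifferentiableAt ℝ (chartAt (Cn (n + 1)) (κ.symm u) ∘ κ'.symm) (κ' (κ.symm u)) :=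
    (differentiableAt_transition h' (chartAt_mem_hcharts (κ.symm u)) (κ'.map_source hu')
      (by rw [hinv]; exact mem_chart_source _ _)).restrictScalars ℝ
  have hc := HasFDerivAt.comp u (f := κ' ∘ κ.symm) hd2.hasFDerivAt hd1
  rw [← hc.fderiv]
  refine Filter.EventuallyEq.fderiv_eq ?_
  filter_upwards [(isOpen_transition κ κ').mem_nhds ⟨hu, hu'⟩] with y hy
  simp only [Function.comp_apply]
  rw [κ'.left_inv hy.2]

theorem tan_chartAt_self (z : M) :
    tan (chartAt (Cn (n + 1)) z) (chartAt (Cn (n + 1)) z z) = ContinuousLinearMap.id ℝ _ := by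
  have hz := mem_chart_source (Cn (n + 1)) z
  rw [tan_eq_fderiv (chartAt_mem_hcharts z) ((chartAt (Cn (n + 1)) z).map_source hz),
    (chartAt (Cn (n + 1)) z).left_inv hz, ← fderiv_id (𝕜 := ℝ)]
  refine Filter.EventuallyEq.fderiv_eq ?_
  filter_upwards [(chartAt (Cn (n + 1)) z).open_target.mem_nhds
    ((chartAt (Cn (n + 1)) z).map_source hz)] with y hy
  exact (chartAt (Cn (n + 1)) z).right_inv hy

/-- Composing a holomorphic chart with a local biholomorphism gives a holomorphic chart. -/
theorem trans_mem_hcharts (h : κ ∈ hcharts n M)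
    (e : OpenPartialHomeomorph (Cn (n + 1)) (Cn (n + 1))) (he : ContDiffOn ℂ ω e e.source)
    (he' : ContDiffOn ℂ ω e.symm e.target) : κ.trans e ∈ hcharts n M := by
  have heG : e ∈ contDiffGroupoid ω 𝓘(ℂ, Cn (n + 1)) := by
    rw [contDiffGroupoid, mem_groupoid_of_pregroupoid]
    simp only [contDiffPregroupoid, modelWithCornersSelf_coe, modelWithCornersSelf_coe_symm,
      Function.id_comp, Function.comp_id, Set.preimage_id, Set.range_id, Set.inter_univ]
    exact ⟨he, he'⟩
  have hM := h
  rw [hcharts, IsManifold.maximalAtlas, mem_maximalAtlas_iff] at hM ⊢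
  intro e' he'
  refine ⟨?_, ?_⟩
  · rw [OpenPartialHomeomorph.trans_symm_eq_symm_trans_symm, OpenPartialHomeomorph.trans_assoc]
    exact (contDiffGroupoid ω 𝓘(ℂ, Cn (n + 1))).trans
      ((contDiffGroupoid ω 𝓘(ℂ, Cn (n + 1))).symm heG) (hM e' he').1
  · rw [← OpenPartialHomeomorph.trans_assoc]
    exact (contDiffGroupoid ω 𝓘(ℂ, Cn (n + 1))).trans (hM e' he').2 heG

end Charts

/-! ### Integration over patches -/

section Patches

variable {m n : ℕ} {M : Type*} [TopologicalSpace M]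

/-- A parametrized piece of a submanifold, with its tangent map. -/
structure Patch (m n : ℕ) (M : Type*) where
  /-- the parameter domain -/
  dom : Set (Cn m)
  /-- the parametrization -/
  map : Cn m → M
  /-- the tangent map of the parametrization -/
  dmap : Cn m → Cn m →L[ℝ] Cn (n + 1)

namespace Patch

/-- The coefficient of a form in a patch. -/
def coeff (a : Patch m n M) (R : RawForm n (2 * m) M) (u : Cn m) : ℂ :=
  R (a.map u) fun k => a.dmap u (stdFrame m k)

/-- The points of the patch `a` that lie in the patch `b`. -/
def overlap (a b : Patch m n M) : Set (Cn m) := {u | u ∈ a.dom ∧ a.map u ∈ b.map '' b.dom}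

/-- The domain is open and the parametrization is a continuous injection. -/
structure IsRegular (a : Patch m n M) : Prop where
  isOpen : IsOpen a.dom
  continuousOn : ContinuousOn a.map a.dom
  injOn : Set.InjOn a.map a.dom

/-- The change of parameters between two patches is holomorphic. -/
def Compatible (a b : Patch m n M) : Prop :=
  IsOpen (a.overlap b) ∧ ∃ θ : Cn m → Cn m, ∀ u ∈ a.overlap b, θ u ∈ b.dom ∧ b.map (θ u) = a.map u ∧
    DifferentiableAt ℂ θ u ∧ a.dmap u = (b.dmap (θ u)).comp (fderiv ℝ θ u)

theorem image_overlap {a b : Patch m n M} (hb : b.IsRegular) {θ : Cn m → Cn m}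
    (hθ : ∀ u ∈ a.overlap b, θ u ∈ b.dom ∧ b.map (θ u) = a.map u) :
    θ '' a.overlap b = b.overlap a := by
  ext y
  constructor
  · rintro ⟨u, hu, rfl⟩
    exact ⟨(hθ u hu).1, u, hu.1, (hθ u hu).2.symm⟩
  · rintro ⟨hy, u, hu, huy⟩
    have hu' : u ∈ a.overlap b := ⟨hu, y, hy, huy.symm⟩
    exact ⟨u, hu', hb.injOn (hθ u hu').1 hy ((hθ u hu').2.trans huy)⟩

/-- Integration over a patch does not depend on the parametrization. -/
theorem integral_overlap {a b : Patch m n M} (ha : a.IsRegular) (hb : b.IsRegular)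
    (hab : a.Compatible b) (g : M → ℂ) (R : M → Cn (n + 1) [⋀^Fin (2 * m)]→L[ℝ] ℂ) :
    (IntegrableOn (fun u => g (b.map u) * b.coeff (fun x v => R x v) u) (b.overlap a) →
      IntegrableOn (fun u => g (a.map u) * a.coeff (fun x v => R x v) u) (a.overlap b)) ∧
    ∫ u in a.overlap b, g (a.map u) * a.coeff (fun x v => R x v) u
      = ∫ u in b.overlap a, g (b.map u) * b.coeff (fun x v => R x v) u := by
  obtain ⟨hopen, θ, hθ⟩ := hab
  have hθ' : ∀ u ∈ a.overlap b, θ u ∈ b.dom ∧ b.map (θ u) = a.map u := fun u hu =>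
    ⟨(hθ u hu).1, (hθ u hu).2.1⟩
  have hd : ∀ u ∈ a.overlap b, HasFDerivWithinAt θ (fderiv ℝ θ u) (a.overlap b) u := fun u hu =>
    ((hθ u hu).2.2.1.restrictScalars ℝ).hasFDerivAt.hasFDerivWithinAt
  have hinj : Set.InjOn θ (a.overlap b) := fun u hu u' hu' h =>
    ha.injOn hu.1 hu'.1 (by rw [← (hθ' u hu).2, ← (hθ' u' hu').2, h])
  -- The form pulls back by the determinant of `dθ`, the measure by its absolute value. As `θ` is
  -- holomorphic the two agree.
  have hval : ∀ u ∈ a.overlap b, |(fderiv ℝ θ u).det| •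
      (g (b.map (θ u)) * b.coeff (fun x v => R x v) (θ u))
      = g (a.map u) * a.coeff (fun x v => R x v) u := by
    intro u hu
    obtain ⟨-, h2, h3, h4⟩ := hθ u hu
    have ht := top_form_comp ((R (a.map u)).compContinuousLinearMap (b.dmap (θ u))) (fderiv ℝ θ u)
      (stdFrame m)
    rw [abs_of_nonneg (det_nonneg_of_complex_linear _ (fderiv_real_I_smul h3)), Complex.real_smul,
      h2]
    simp only [coeff, h2, h4, ContinuousLinearMap.comp_apply]
    simp only [ContinuousAlternatingMap.compContinuousLinearMap_apply, Function.comp_def] at ht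
    rw [ht]
    ring
  rw [← image_overlap hb hθ']
  constructor
  · intro h
    rw [integrableOn_image_iff_integrableOn_abs_det_fderiv_smul volume hopen.measurableSet hd hinj]
      at h
    exact h.congr_fun hval hopen.measurableSet
  · rw [integral_image_eq_integral_abs_det_fderiv_smul volume hopen.measurableSet hd hinj]
    exact (setIntegral_congr_fun hopen.measurableSet hval).symm

end Patch

/-- The integral of a form by means of patches and a partition of unity. -/
def patchSum {ι : Type*} (a : ι → Patch m n M) (ρ : ι → M → ℝ) (R : RawForm n (2 * m) M) : ℂ :=
  ∑ᶠ x, ∫ u in (a x).dom, (ρ x ((a x).map u) : ℂ) * (a x).coeff R u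

/-- A family of mutually compatible patches of `Z` with a partition of unity on `Z`. -/
structure PatchSystem {ι : Type*} (Z : Set M) (a : ι → Patch m n M) (ρ : ι → M → ℝ) : Prop where
  regular : ∀ x, (a x).IsRegular
  maps : ∀ x, ∀ u ∈ (a x).dom, (a x).map u ∈ Z
  continuous : ∀ x, Continuous (ρ x)
  bounded : ∀ x z, ‖ρ x z‖ ≤ 1
  finite : {x | ρ x ≠ 0}.Finite
  sum_eq_one : ∀ z ∈ Z, ∑ᶠ x, ρ x z = 1
  support : ∀ x, ∀ z ∈ Z, ρ x z ≠ 0 → z ∈ (a x).map '' (a x).dom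
  compact : ∀ x, ∃ C ⊆ (a x).dom, IsCompact C ∧ ∀ u ∈ (a x).dom, ρ x ((a x).map u) ≠ 0 → u ∈ C

variable {ι : Type*} {Z : Set M} {a : ι → Patch m n M} {ρ : ι → M → ℝ}

theorem PatchSystem.patchSum_eq_sum (h : PatchSystem Z a ρ) (R : RawForm n (2 * m) M) :
    patchSum a ρ R = ∑ x ∈ h.finite.toFinset,
      ∫ u in (a x).dom, (ρ x ((a x).map u) : ℂ) * (a x).coeff R u := by
  rw [patchSum, finsum_eq_sum_of_support_subset]
  intro x hx
  simp only [Set.Finite.coe_toFinset, Set.mem_ofPred_eq]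
  intro h0
  apply hx
  simp [h0]

theorem PatchSystem.patchSum_congr (h : PatchSystem Z a ρ) {R R' : RawForm n (2 * m) M}
    (hR : ∀ z ∈ Z, ∀ v, R z v = R' z v) : patchSum a ρ R = patchSum a ρ R' := by
  refine finsum_congr fun x => setIntegral_congr_fun (h.regular x).isOpen.measurableSet fun u hu => ?_
  simp only [Patch.coeff]
  rw [hR _ (h.maps x u hu)]

/-- A form that is a sum of forms supported in patches is integrated patch by patch. -/
theorem PatchSystem.patchSum_eq (h : PatchSystem Z a ρ) {β : Type*} (s : Finset β)
    (b : β → Patch m n M) (hb : ∀ i ∈ s, (b i).IsRegular)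
    (hbZ : ∀ i ∈ s, ∀ u ∈ (b i).dom, (b i).map u ∈ Z)
    (hab : ∀ i ∈ s, ∀ x, (a x).Compatible (b i))
    (R : β → M → Cn (n + 1) [⋀^Fin (2 * m)]→L[ℝ] ℂ)
    (hR : ∀ i ∈ s, ∀ z ∈ Z, R i z ≠ 0 → z ∈ (b i).map '' (b i).dom)
    (hInt : ∀ i ∈ s, IntegrableOn ((b i).coeff fun z v => R i z v) (b i).dom)
    (Q : RawForm n (2 * m) M) (hQ : ∀ z ∈ Z, ∀ v, Q z v = ∑ i ∈ s, R i z v) :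
    patchSum a ρ Q = ∑ i ∈ s, ∫ u in (b i).dom, (b i).coeff (fun z v => R i z v) u := by
  have hρ1 : ∀ z ∈ Z, ∑ x ∈ h.finite.toFinset, ρ x z = 1 := fun z hz => by
    rw [← h.sum_eq_one z hz, finsum_eq_sum_of_support_subset]
    intro x hx
    simp only [Set.Finite.coe_toFinset, Set.mem_ofPred_eq]
    intro h0
    exact hx (by simp [h0])
  have hintb : ∀ i ∈ s, ∀ x, IntegrableOn
      (fun u => (ρ x ((b i).map u) : ℂ) * (b i).coeff (fun z v => R i z v) u) (b i).dom := by
    intro i hi x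
    refine Integrable.bdd_mul (c := 1) (hInt i hi) ?_ ?_
    · refine ContinuousOn.aestronglyMeasurable ?_ (hb i hi).isOpen.measurableSet
      exact Complex.continuous_ofReal.comp_continuousOn
        ((h.continuous x).comp_continuousOn (hb i hi).continuousOn)
    · refine (ae_restrict_iff' (hb i hi).isOpen.measurableSet).2 (Filter.Eventually.of_forall ?_)
      intro u _
      rw [Complex.norm_real]
      exact h.bounded x _
  -- The product of `ρ x` and `R i` is carried by both patches, so in either parametrization the
  -- integral reduces to the overlap, where `Patch.integral_overlap` compares the two.
  have hpiece : ∀ i ∈ s, ∀ x,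
      IntegrableOn (fun u => (ρ x ((a x).map u) : ℂ) * (a x).coeff (fun z v => R i z v) u)
        (a x).dom ∧
      ∫ u in (a x).dom, (ρ x ((a x).map u) : ℂ) * (a x).coeff (fun z v => R i z v) u
        = ∫ u in (b i).dom, (ρ x ((b i).map u) : ℂ) * (b i).coeff (fun z v => R i z v) u := by
    intro i hi x
    have hch := Patch.integral_overlap (h.regular x) (hb i hi) (hab i hi x)
      (fun z => (ρ x z : ℂ)) (R i)
    have hza : ∀ u ∈ (a x).dom \ (a x).overlap (b i),
        (ρ x ((a x).map u) : ℂ) * (a x).coeff (fun z v => R i z v) u = 0 := by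
      rintro u ⟨hu, hu'⟩
      have : R i ((a x).map u) = 0 := by
        by_contra hne
        exact hu' ⟨hu, hR i hi _ (h.maps x u hu) hne⟩
      simp [Patch.coeff, this]
    have hzb : ∀ u ∈ (b i).dom \ (b i).overlap (a x),
        (ρ x ((b i).map u) : ℂ) * (b i).coeff (fun z v => R i z v) u = 0 := by
      rintro u ⟨hu, hu'⟩
      have : ρ x ((b i).map u) = 0 := by
        by_contra hne
        exact hu' ⟨hu, h.support x _ (hbZ i hi u hu) hne⟩
      simp [this]
    refine ⟨?_, ?_⟩
    · refine IntegrableOn.of_forall_sdiff_eq_zero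
        (hch.1 ((hintb i hi x).mono_set fun u hu => hu.1))
        (h.regular x).isOpen.measurableSet hza
    · rw [setIntegral_eq_of_subset_of_forall_sdiff_eq_zero (h.regular x).isOpen.measurableSet
        (fun u hu => hu.1) hza, setIntegral_eq_of_subset_of_forall_sdiff_eq_zero
        (hb i hi).isOpen.measurableSet (fun u hu => hu.1) hzb]
      exact hch.2
  rw [h.patchSum_congr hQ, h.patchSum_eq_sum]
  have hstep : ∀ x, ∫ u in (a x).dom, (ρ x ((a x).map u) : ℂ) *
      (a x).coeff (fun z v => ∑ i ∈ s, R i z v) u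
      = ∑ i ∈ s, ∫ u in (b i).dom, (ρ x ((b i).map u) : ℂ) *
        (b i).coeff (fun z v => R i z v) u := by
    intro x
    rw [← Finset.sum_congr rfl fun i hi => (hpiece i hi x).2,
      ← integral_finsetSum _ fun i hi => (hpiece i hi x).1]
    simp only [Patch.coeff, Finset.mul_sum]
  simp only [hstep]
  -- With the sum over `x` inside, the partition of unity adds up to `1` on each patch `b i` and
  -- disappears.
  rw [Finset.sum_comm]
  refine Finset.sum_congr rfl fun i hi => ?_
  rw [← integral_finsetSum _ fun x _ => hintb i hi x]
  refine setIntegral_congr_fun (hb i hi).isOpen.measurableSet fun u hu => ?_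
  rw [← Finset.sum_mul, ← Complex.ofReal_sum, hρ1 _ (hbZ i hi u hu), Complex.ofReal_one, one_mul]

end Patches

/-! ### Exchange of a current given by patches with an integral over parameters. -/

section PatchFubini

variable {m n : ℕ} {M : Type*} [TopologicalSpace M]
  {ι : Type*} {Z : Set M} {a : ι → Patch m n M} {ρ : ι → M → ℝ}

/-- The parameter `y` will be a chart coordinate on the second factor of `M × M`. The exchange turns
an iterated pairing, first over `w` and then over `z`, into an integral over `w` of pairings over
`z`. -/
theorem PatchSystem.patchSum_integral (h : PatchSystem Z a ρ) {β Y : Type*} [MeasurableSpace Y]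
    (s : Finset β) (μ : β → Measure Y) [∀ i, SFinite (μ i)] (R : β → Y → RawForm n (2 * m) M)
    (hInt : ∀ i ∈ s, ∀ x, Integrable (fun q : Cn m × Y =>
      (ρ x ((a x).map q.1) : ℂ) * (a x).coeff (R i q.2) q.1)
      ((volume.restrict (a x).dom).prod (μ i))) :
    patchSum a ρ (fun z v => ∑ i ∈ s, ∫ y, R i y z v ∂μ i)
      = ∑ i ∈ s, ∫ y, patchSum a ρ (R i y) ∂μ i := by
  simp only [h.patchSum_eq_sum]
  have h1 : ∀ x, ∫ u in (a x).dom, (ρ x ((a x).map u) : ℂ) *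
      (a x).coeff (fun z v => ∑ i ∈ s, ∫ y, R i y z v ∂μ i) u
      = ∑ i ∈ s, ∫ y, (∫ u in (a x).dom, (ρ x ((a x).map u) : ℂ) * (a x).coeff (R i y) u)
        ∂μ i := by
    intro x
    have h2 : ∀ u, (ρ x ((a x).map u) : ℂ) *
        (a x).coeff (fun z v => ∑ i ∈ s, ∫ y, R i y z v ∂μ i) u
        = ∑ i ∈ s, ∫ y, (ρ x ((a x).map u) : ℂ) * (a x).coeff (R i y) u ∂μ i := by
      intro u
      simp only [Patch.coeff, Finset.mul_sum, integral_const_mul]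
    simp only [h2]
    rw [integral_finsetSum _ fun i hi => (hInt i hi x).integral_prod_left]
    exact Finset.sum_congr rfl fun i hi => integral_integral_swap (hInt i hi x)
  simp only [h1]
  rw [Finset.sum_comm]
  refine Finset.sum_congr rfl fun i hi => ?_
  rw [integral_finsetSum _ fun x _ => (hInt i hi x).integral_prod_right]

theorem patchSum_const_mul (c : ℂ) (R : RawForm n (2 * m) M) :
    patchSum a ρ (fun z v => c * R z v) = c * patchSum a ρ R := by
  rw [patchSum, patchSum, mul_finsum]
  refine finsum_congr fun x => ?_
  rw [← integral_const_mul]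
  simp only [Patch.coeff, mul_left_comm c]

/-- The cutoff `r` confines the first variable to a compact set, on which the continuous factors are
bounded. The only factor that may be unbounded is `b`, a logarithm in the applications, and it is
integrable by assumption. -/
theorem integrable_prod_of_continuousOn {k l : ℕ} {D C : Set (Cn k)} {O K : Set (Cn l)}
    (hD : MeasurableSet D) (hC : IsCompact C) (hCD : C ⊆ D) (hK : IsCompact K) (hKO : K ⊆ O)
    {r : Cn k → ℂ} (hr : ContinuousOn r D) (hr0 : ∀ u ∈ D, r u ≠ 0 → u ∈ C)
    {b : Cn l → ℂ} (hb : IntegrableOn b K) {G : Cn k × Cn l → ℂ} (hG : ContinuousOn G (D ×ˢ O)) :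
    Integrable (fun q : Cn k × Cn l => r q.1 * (b q.2 * G q))
      ((volume.restrict D).prod (volume.restrict K)) := by
  rw [Measure.prod_restrict]
  refine IntegrableOn.of_forall_sdiff_eq_zero (s := C ×ˢ K) ?_ (hD.prod hK.measurableSet) ?_
  · have hfin : IsFiniteMeasure ((volume : Measure (Cn k)).restrict C) :=
      isFiniteMeasure_restrict.2 hC.measure_lt_top.ne
    have hb' : Integrable (fun q : Cn k × Cn l => b q.2)
        ((volume.restrict C).prod (volume.restrict K)) := Integrable.comp_snd hb _
    have hcont : ContinuousOn (fun q : Cn k × Cn l => r q.1 * G q) (C ×ˢ K) :=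
      (hr.comp continuousOn_fst fun q hq => hCD hq.1).mul
        (hG.mono (Set.prod_mono hCD hKO))
    obtain ⟨B, hB⟩ := (hC.prod hK).exists_bound_of_continuousOn hcont
    rw [Measure.prod_restrict] at hb'
    have := hb'.bdd_mul (c := B) (hcont.aestronglyMeasurable (hC.prod hK).measurableSet)
      ((ae_restrict_iff' (hC.prod hK).measurableSet).2 (Filter.Eventually.of_forall hB))
    refine this.congr (Filter.Eventually.of_forall fun q => ?_)
    beta_reduce
    ring
  · rintro q ⟨⟨hq1, hq2⟩, hq⟩
    have : r q.1 = 0 := by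
      by_contra hne
      exact hq ⟨hr0 _ hq1 hne, hq2⟩
    simp [this]

end PatchFubini

/-! ### The patches of a chart -/

section ChartPatch

variable {n : ℕ} {M : Type*} [TopologicalSpace M] [ChartedSpace (Cn (n + 1)) M]

/-- The inclusion `u ↦ (0, u)`. -/
def consZero (n : ℕ) : Cn n →L[ℂ] Cn (n + 1) where
  toFun u := Fin.cons 0 u
  map_add' u v := by
    funext i
    refine Fin.cases ?_ (fun j => ?_) i <;> simp
  map_smul' c u := by
    funext i
    refine Fin.cases ?_ (fun j => ?_) i <;> simp
  cont := continuous_pi fun i => by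
    refine Fin.cases ?_ (fun j => ?_) i
    · simpa using continuous_const
    · simpa using continuous_apply j

theorem consZero_apply (u : Cn n) : consZero n u = Fin.cons 0 u := rfl

theorem isClosedEmbedding_consZero : Topology.IsClosedEmbedding (consZero n) := by
  refine (consZero n).toLinearMap.isClosedEmbedding_of_injective ?_
  rw [LinearMap.ker_eq_bot]
  exact Fin.cons_right_injective (α := fun _ => ℂ) 0

/-- The patch given by a chart. -/
def chartPatch (κ : OpenPartialHomeomorph M (Cn (n + 1))) : Patch (n + 1) n M where
  dom := κ.target
  map := κ.symm
  dmap := tan κ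

/-- The patch of the hypersurface `{u₀ = 0}` in a chart. -/
def hyperPatch (κ : OpenPartialHomeomorph M (Cn (n + 1))) : Patch n n M where
  dom := {u | (Fin.cons 0 u : Cn (n + 1)) ∈ κ.target}
  map u := κ.symm (Fin.cons 0 u)
  dmap u := (tan κ (Fin.cons 0 u)).comp ((consZero n).restrictScalars ℝ)

theorem chartPatch_isRegular (κ : OpenPartialHomeomorph M (Cn (n + 1))) :
    (chartPatch κ).IsRegular where
  isOpen := κ.open_target
  continuousOn := κ.continuousOn_symm
  injOn := κ.symm.injOn

theorem hyperPatch_isRegular (κ : OpenPartialHomeomorph M (Cn (n + 1))) :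
    (hyperPatch κ).IsRegular where
  isOpen := isOpen_slice κ.open_target
  continuousOn := κ.continuousOn_symm.comp (consZero n).continuous.continuousOn fun _ hu => hu
  injOn _ hu _ hu' h := Fin.cons_right_injective (α := fun _ => ℂ) 0 (κ.symm.injOn hu hu' h)

variable [IsManifold 𝓘(ℂ, Cn (n + 1)) ω M] {κ κ' : OpenPartialHomeomorph M (Cn (n + 1))}

theorem chartPatch_compatible (h : κ ∈ hcharts n M) (h' : κ' ∈ hcharts n M) :
    (chartPatch κ).Compatible (chartPatch κ') := by
  have hov : (chartPatch κ).overlap (chartPatch κ') = κ.target ∩ κ.symm ⁻¹' κ'.source := by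
    ext u
    have : κ'.symm '' κ'.target = κ'.source := κ'.symm_image_target_eq_source
    simp only [Patch.overlap, chartPatch, this]
    rfl
  rw [Patch.Compatible, hov]
  refine ⟨isOpen_transition κ κ', κ' ∘ κ.symm, fun u hu => ⟨κ'.map_source hu.2,
    κ'.left_inv hu.2, differentiableAt_transition h h' hu.1 hu.2, tan_trans h h' hu.1 hu.2⟩⟩

theorem IsStraightening.cons_tail {Z : Set M} (h : IsStraightening Z κ) {y : M}
    (hy : y ∈ κ.source) (hyZ : y ∈ Z) : (Fin.cons 0 (Fin.tail (κ y)) : Cn (n + 1)) = κ y := by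
  conv_rhs => rw [← Fin.cons_self_tail (κ y), (h.2 y hy).1 hyZ]

theorem IsStraightening.symm_mem {Z : Set M} (h : IsStraightening Z κ) {u : Cn n}
    (hu : (Fin.cons 0 u : Cn (n + 1)) ∈ κ.target) : κ.symm (Fin.cons 0 u) ∈ Z := by
  rw [h.2 _ (κ.map_target hu), κ.right_inv hu]
  simp

theorem IsStraightening.image_hyperPatch {Z : Set M} (h : IsStraightening Z κ) :
    (hyperPatch κ).map '' (hyperPatch κ).dom = Z ∩ κ.source := by
  ext y
  constructor
  · rintro ⟨u, hu, rfl⟩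
    exact ⟨h.symm_mem hu, κ.map_target hu⟩
  · rintro ⟨hyZ, hy⟩
    have hc := h.cons_tail hy hyZ
    refine ⟨Fin.tail (κ y), ?_, ?_⟩
    · change (Fin.cons 0 (Fin.tail (κ y)) : Cn (n + 1)) ∈ κ.target
      rw [hc]
      exact κ.map_source hy
    · change κ.symm (Fin.cons 0 (Fin.tail (κ y)) : Cn (n + 1)) = y
      rw [hc, κ.left_inv hy]

/-- The transition between two straightening charts maps `{u₀ = 0}` into itself, since both describe
`Z`. Deleting the first coordinate therefore gives a holomorphic change of parameters, and its
differential is the restriction of that of the transition. -/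
theorem hyperPatch_compatible {Z : Set M} (h : IsStraightening Z κ) (h' : IsStraightening Z κ') :
    (hyperPatch κ).Compatible (hyperPatch κ') := by
  have hov : (hyperPatch κ).overlap (hyperPatch κ')
      = {u : Cn n | (Fin.cons 0 u : Cn (n + 1)) ∈ κ.target ∩ κ.symm ⁻¹' κ'.source} := by
    ext u
    simp only [Patch.overlap, h'.image_hyperPatch]
    constructor
    · rintro ⟨hu, -, hu'⟩
      exact ⟨hu, hu'⟩
    · rintro ⟨hu, hu'⟩
      exact ⟨hu, h.symm_mem hu, hu'⟩
  rw [Patch.Compatible, hov]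
  have hopen : IsOpen {u : Cn n | (Fin.cons 0 u : Cn (n + 1)) ∈ κ.target ∩ κ.symm ⁻¹' κ'.source} :=
    isOpen_slice (isOpen_transition κ κ')
  set θ : Cn n → Cn n := fun u => Fin.tail ((κ' ∘ κ.symm) (Fin.cons 0 u)) with hθ
  refine ⟨hopen, θ, fun u hu => ?_⟩
  have hcons : ∀ u ∈ {u : Cn n | (Fin.cons 0 u : Cn (n + 1)) ∈ κ.target ∩ κ.symm ⁻¹' κ'.source},
      (Fin.cons 0 (θ u) : Cn (n + 1)) = κ' (κ.symm (Fin.cons 0 u)) := fun u hu =>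
    h'.cons_tail hu.2 (h.symm_mem hu.1)
  have hτd := differentiableAt_transition h.1 h'.1 hu.1 hu.2
  have hcd : HasFDerivAt (fun u => (κ' ∘ κ.symm) (consZero n u))
      ((fderiv ℂ (κ' ∘ κ.symm) (Fin.cons 0 u)).comp (consZero n)) u :=
    HasFDerivAt.comp u (f := consZero n) hτd.hasFDerivAt (consZero n).hasFDerivAt
  have hθd : DifferentiableAt ℂ θ u := by
    rw [differentiableAt_pi]
    intro i
    have := (differentiableAt_pi.1 hcd.differentiableAt) i.succ
    exact this
  have hdd : (consZero n).comp (fderiv ℂ θ u)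
      = (fderiv ℂ (κ' ∘ κ.symm) (Fin.cons 0 u)).comp (consZero n) := by
    have h1 : HasFDerivAt (fun u => consZero n (θ u)) ((consZero n).comp (fderiv ℂ θ u)) u :=
      HasFDerivAt.comp u (consZero n).hasFDerivAt hθd.hasFDerivAt
    refine h1.unique (hcd.congr_of_eventuallyEq ?_)
    filter_upwards [hopen.mem_nhds hu] with y hy using hcons y hy
  refine ⟨?_, ?_, hθd, ?_⟩
  · change (Fin.cons 0 (θ u) : Cn (n + 1)) ∈ κ'.target
    rw [hcons u hu]
    exact κ'.map_source hu.2
  · change κ'.symm (Fin.cons 0 (θ u) : Cn (n + 1)) = _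
    rw [hcons u hu]
    exact κ'.left_inv hu.2
  · ext1 v
    change tan κ (Fin.cons 0 u) (consZero n v)
      = tan κ' (Fin.cons 0 (θ u)) (consZero n (fderiv ℝ θ u v))
    rw [hcons u hu, tan_trans h.1 h'.1 hu.1 hu.2, ContinuousLinearMap.comp_apply]
    congr 1
    rw [hτd.fderiv_restrictScalars ℝ, hθd.fderiv_restrictScalars ℝ]
    exact (DFunLike.congr_fun hdd v).symm

end ChartPatch

/-! ### The patch systems of `M` and of a hypersurface. -/

section Systems

variable {n : ℕ} {M : Type*} [TopologicalSpace M] [CompactSpace M] [T2Space M]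
  [ChartedSpace (Cn (n + 1)) M] [IsManifold 𝓘(ℂ, Cn (n + 1)) ω M]

theorem finite_partition {ι : Type*} {Z : Set M} (ρ : PartitionOfUnity ι M Z) :
    {x | (ρ x : M → ℝ) ≠ 0}.Finite := by
  refine ρ.locallyFinite.finite_nonempty_of_compact.subset fun x hx => ?_
  exact Function.support_nonempty_iff.2 hx

theorem norm_partition_le {ι : Type*} {Z : Set M} (ρ : PartitionOfUnity ι M Z) (x : ι) (z : M) :
    ‖ρ x z‖ ≤ 1 := by
  rw [Real.norm_of_nonneg (ρ.nonneg x z)]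
  exact ρ.le_one x z

theorem patchSystem_charts : PatchSystem (Set.univ : Set M)
    (fun x : M => chartPatch (chartAt (Cn (n + 1)) x)) (fun x => chartPartition n M x) where
  regular _ := chartPatch_isRegular _
  maps _ _ _ := Set.mem_univ _
  continuous x := (chartPartition n M x).continuous
  bounded := norm_partition_le _
  finite := finite_partition _
  sum_eq_one z hz := (chartPartition n M).sum_eq_one hz
  support x z _ hz := by
    have hx : z ∈ (chartAt (Cn (n + 1)) x).source :=
      (exists_chartPartition (n := n) (M := M)).choose_spec x (subset_tsupport _ hz)
    exact ⟨_, (chartAt (Cn (n + 1)) x).map_source hx, (chartAt (Cn (n + 1)) x).left_inv hx⟩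
  compact x := by
    have hsub := (exists_chartPartition (n := n) (M := M)).choose_spec x
    refine ⟨chartAt (Cn (n + 1)) x '' tsupport (chartPartition n M x), ?_, ?_, ?_⟩
    · rintro _ ⟨y, hy, rfl⟩
      exact (chartAt (Cn (n + 1)) x).map_source (hsub hy)
    · exact (isClosed_tsupport _).isCompact.image_of_continuousOn
        ((chartAt (Cn (n + 1)) x).continuousOn.mono hsub)
    · intro u hu hne
      exact ⟨_, subset_tsupport _ hne, (chartAt (Cn (n + 1)) x).right_inv hu⟩

theorem integralM_eq_patchSum (η : RawForm n (2 * (n + 1)) M) :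
    integralM η = patchSum (fun x : M => chartPatch (chartAt (Cn (n + 1)) x))
      (fun x => chartPartition n M x) η :=
  rfl

theorem isStraightening_chart {Z : Set M} (hZ : IsHypersurface n Z) (x : Z) :
    IsStraightening Z (hZ.chart x) :=
  (hZ.2 x).choose_spec.2

theorem patchSystem_hypersurface {Z : Set M} (hZ : IsHypersurface n Z) : PatchSystem Z
    (fun x : Z => hyperPatch (hZ.chart x)) (fun x => hZ.partition x) where
  regular _ := hyperPatch_isRegular _
  maps x _ hu := (isStraightening_chart hZ x).symm_mem hu
  continuous x := (hZ.partition x).continuous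
  bounded := norm_partition_le _
  finite := finite_partition _
  sum_eq_one z hz := hZ.partition.sum_eq_one hz
  support x z hzZ hz := by
    rw [(isStraightening_chart hZ x).image_hyperPatch]
    exact ⟨hzZ, hZ.exists_partition.choose_spec x (subset_tsupport _ hz)⟩
  compact x := by
    have hsub := hZ.exists_partition.choose_spec x
    refine ⟨consZero n ⁻¹' (hZ.chart x '' (tsupport (hZ.partition x))), ?_, ?_, ?_⟩
    · rintro u ⟨y, hy, hyu⟩
      change (Fin.cons 0 u : Cn (n + 1)) ∈ (hZ.chart x).target
      rw [← consZero_apply, ← hyu]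
      exact (hZ.chart x).map_source (hsub hy)
    · have hcomp : IsCompact (hZ.chart x '' (tsupport (hZ.partition x))) :=
        (isClosed_tsupport _).isCompact.image_of_continuousOn ((hZ.chart x).continuousOn.mono hsub)
      exact isClosedEmbedding_consZero.isCompact_preimage hcomp
    · intro u hu hne
      exact ⟨_, subset_tsupport _ hne, (hZ.chart x).right_inv hu⟩

theorem integrationCurrent_eq_patchSum {Z : Set M} (hZ : IsHypersurface n Z)
    (φ : RawForm n (2 * n) M) :
    integrationCurrent Z φ = patchSum (fun x : Z => hyperPatch (hZ.chart x))
      (fun x => hZ.partition x) φ :=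
  dif_pos hZ

end Systems

/-! ### The Poincaré–Lelong formula on a manifold -/

theorem integrableOn_of_continuousOn_of_compact {X W : Type*} [TopologicalSpace X] [T2Space X]
    [MeasurableSpace X] [OpensMeasurableSpace X] {μ : Measure X} [IsFiniteMeasureOnCompacts μ]
    [NormedAddCommGroup W] {D C : Set X} (hD : MeasurableSet D)
    (hC : IsCompact C) (hCD : C ⊆ D) {f : X → W} (hf : ContinuousOn f D)
    (h0 : ∀ x ∈ D, f x ≠ 0 → x ∈ C) : IntegrableOn f D μ := by
  refine IntegrableOn.of_forall_sdiff_eq_zero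
    ((hf.mono hCD).integrableOn_compact hC) hD fun x hx => ?_
  by_contra hne
  exact hx.2 (h0 x hx.1 hne)

section PL

variable {n : ℕ} {M : Type*} [TopologicalSpace M] [ChartedSpace (Cn (n + 1)) M]

theorem formInChart_eq {k : ℕ} (φ : M → Cn (n + 1) [⋀^Fin k]→L[ℝ] ℂ) (p : M) (u : Cn (n + 1)) :
    formInChart 𝓘(ℝ, Cn (n + 1)) φ p u = (φ ((chartAt (Cn (n + 1)) p).symm u)).compContinuousLinearMap
      (tan (chartAt (Cn (n + 1)) p) u) :=
  rfl

theorem extChartAt_target_eq (p : M) :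
    (extChartAt 𝓘(ℝ, Cn (n + 1)) p).target = (chartAt (Cn (n + 1)) p).target := by
  simp [extChartAt]

variable [IsManifold 𝓘(ℂ, Cn (n + 1)) ω M]

/-- The tangent map of a chart composed with a local biholomorphism. -/
theorem tan_trans_local {κ : OpenPartialHomeomorph M (Cn (n + 1))} (h : κ ∈ hcharts n M)
    (e : OpenPartialHomeomorph (Cn (n + 1)) (Cn (n + 1))) (he : ContDiffOn ℂ ω e e.source)
    (he' : ContDiffOn ℂ ω e.symm e.target) {v : Cn (n + 1)} (hv : v ∈ (κ.trans e).target) :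
    tan (κ.trans e) v = (tan κ (e.symm v)).comp (fderiv ℝ e.symm v) := by
  have hv' : v ∈ e.target ∧ e.symm v ∈ κ.target := by
    rw [OpenPartialHomeomorph.trans_target] at hv
    exact hv
  have hs : (κ.trans e).symm v = κ.symm (e.symm v) := rfl
  rw [tan_trans (trans_mem_hcharts h e he he') h hv (by rw [hs]; exact κ.map_target hv'.2), hs,
    κ.right_inv hv'.2]
  congr 1
  refine Filter.EventuallyEq.fderiv_eq ?_
  filter_upwards [(κ.trans e).open_target.mem_nhds hv] with y hy
  rw [OpenPartialHomeomorph.trans_target] at hy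
  exact κ.right_inv hy.2

-- A partition of unity cuts `φ` into pieces so small that either `F` is a coordinate on the piece,
-- and the formula for a hyperplane applies, or `F` has no zeros there, and both sides vanish. The
-- pieces `R i` are recorded separately, each in its own straightening chart, because this is the
-- input that `PatchSystem.patchSum_eq` needs to assemble the current of integration.
set_option maxHeartbeats 1000000 in
theorem exists_local_poincareLelong {Z : Set M} {p : M} {U K : Set (Cn (n + 1))} (hU : IsOpen U)
    (hUt : U ⊆ (chartAt (Cn (n + 1)) p).target) (hK : IsCompact K) (hKU : K ⊆ U)
    {F : Cn (n + 1) → ℂ} (hF : ContDiffOn ℂ ω F U)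
    (hZ : ∀ u ∈ U, (chartAt (Cn (n + 1)) p).symm u ∈ Z ↔ F u = 0)
    (hreg : ∀ u ∈ U, F u = 0 → fderiv ℂ F u ≠ 0)
    (hlog : IntegrableOn (fun u => ((Real.log (‖F u‖ ^ 2) : ℝ) : ℂ)) K)
    {φ : M → Cn (n + 1) [⋀^Fin (2 * n)]→L[ℝ] ℂ}
    (hφ : ContDiffOn ℝ ∞ (formInChart 𝓘(ℝ, Cn (n + 1)) φ p) U)
    (hφK : ∀ z, φ z ≠ 0 → z ∈ (chartAt (Cn (n + 1)) p).symm '' K) :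
    ∃ (t : Finset (Cn (n + 1))) (κ : Cn (n + 1) → OpenPartialHomeomorph M (Cn (n + 1)))
      (R : Cn (n + 1) → M → Cn (n + 1) [⋀^Fin (2 * n)]→L[ℝ] ℂ),
      (∀ i ∈ t, IsStraightening Z (κ i)) ∧ (∀ i ∈ t, ∀ z, R i z ≠ 0 → z ∈ (κ i).source) ∧
      (∀ i ∈ t, IntegrableOn ((hyperPatch (κ i)).coeff fun z v => R i z v)
        (hyperPatch (κ i)).dom) ∧
      (∀ z ∈ Z, φ z = ∑ i ∈ t, R i z) ∧
      ∑ i ∈ t, ∫ u in (hyperPatch (κ i)).dom, (hyperPatch (κ i)).coeff (fun z v => R i z v) u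
        = 1 / (2 * Real.pi) * ∫ u in K, ((Real.log (‖F u‖ ^ 2) : ℝ) : ℂ) *
          ddcTop (formInChart 𝓘(ℝ, Cn (n + 1)) φ p) u := by
  classical
  set c := chartAt (Cn (n + 1)) p with hc
  have hφK' : ∀ z, φ z ≠ 0 → c z ∈ K ∧ z ∈ c.source := by
    intro z hz
    obtain ⟨u, hu, rfl⟩ := hφK z hz
    rw [c.right_inv (hUt (hKU hu))]
    exact ⟨hu, c.map_target (hUt (hKU hu))⟩
  -- the cover
  have hcov : ∀ u ∈ K, ∃ e : OpenPartialHomeomorph (Cn (n + 1)) (Cn (n + 1)), u ∈ e.source ∧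
      e.source ⊆ U ∧ ContDiffOn ℂ ω e e.source ∧ ContDiffOn ℂ ω e.symm e.target ∧
      (F u ≠ 0 → ∀ y ∈ e.source, F y / F u ∈ Complex.slitPlane) ∧
      (F u = 0 → ∀ y ∈ e.source, e y 0 = F y) := by
    intro u hu
    have hFu : ContDiffAt ℂ ω F u := hF.contDiffAt (hU.mem_nhds (hKU hu))
    by_cases h0 : F u = 0
    · obtain ⟨e, h1, h2, h3, h4, h5⟩ :=
        exists_straightening (hU.mem_nhds (hKU hu)) hFu (hreg u (hKU hu) h0)
      exact ⟨e, h1, h2, h3, h4, fun h => absurd h0 h, fun _ => h5⟩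
    · have hcont : ContinuousOn (fun y => F y / F u) U := hF.continuousOn.div_const _
      have hO : IsOpen (U ∩ (fun y => F y / F u) ⁻¹' Complex.slitPlane) :=
        hcont.isOpen_inter_preimage hU Complex.isOpen_slitPlane
      refine ⟨OpenPartialHomeomorph.ofSet _ hO, ?_, ?_, ?_, ?_, ?_, fun h => absurd h h0⟩
      · refine ⟨hKU hu, ?_⟩
        simp [div_self h0]
      · exact fun y hy => hy.1
      · exact contDiffOn_id
      · exact contDiffOn_id
      · exact fun _ y hy => hy.2
  have : Nonempty (OpenPartialHomeomorph (Cn (n + 1)) (Cn (n + 1))) :=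
    ⟨OpenPartialHomeomorph.refl _⟩
  choose! e he1 he2 he3 he4 he5 he6 using hcov
  obtain ⟨t, htK, htc⟩ := hK.elim_nhds_subcover (fun u => (e u).source)
    fun u hu => (e u).open_source.mem_nhds (he1 u hu)
  obtain ⟨χ, hχ⟩ := SmoothPartitionOfUnity.exists_isSubordinate 𝓘(ℝ, Cn (n + 1)) hK.isClosed
    (fun i : t => (e i).source) (fun i => (e i).open_source) (by
      intro u hu
      obtain ⟨i, hi, hui⟩ := Set.mem_iUnion₂.1 (htc hu)
      exact Set.mem_iUnion.2 ⟨⟨i, hi⟩, hui⟩)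
  set g : Cn (n + 1) → Cn (n + 1) → ℝ := fun i u => if h : i ∈ t then χ ⟨i, h⟩ u else 0 with hg
  have hgs : ∀ i ∈ t, ContDiff ℝ ∞ (g i) := fun i hi => by
    have : g i = χ ⟨i, hi⟩ := by funext u; simp [hg, hi]
    rw [this]
    exact (χ ⟨i, hi⟩).contMDiff.contDiff
  have hgt : ∀ i ∈ t, tsupport (g i) ⊆ (e i).source := fun i hi => by
    have : g i = χ ⟨i, hi⟩ := by funext u; simp [hg, hi]
    rw [this]
    exact hχ ⟨i, hi⟩
  have hg1 : ∀ u ∈ K, ∑ i ∈ t, g i u = 1 := fun u hu => by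
    rw [← χ.sum_eq_one hu, finsum_eq_sum_of_fintype, ← Finset.sum_coe_sort t]
    refine Finset.sum_congr rfl fun i _ => ?_
    simp [hg]
  -- the local forms
  set α := formInChart 𝓘(ℝ, Cn (n + 1)) φ p with hα
  have hα0 : ∀ u ∈ U \ K, α u = 0 := by
    rintro u ⟨hu, huK⟩
    have : φ (c.symm u) = 0 := by
      by_contra hne
      have := (hφK' _ hne).1
      rw [c.right_inv (hUt hu)] at this
      exact huK this
    rw [hα, formInChart_eq, this]
    ext v
    simp
  set ψ := U.indicator α with hψ
  have hψs : ContDiff ℝ ∞ ψ := contDiff_indicator hU hK.isClosed hφ hα0 hKU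
  have hψK : tsupport ψ ⊆ K := closure_minimal (support_indicator_subset hα0) hK.isClosed
  set ψ' : Cn (n + 1) → Cn (n + 1) → Cn (n + 1) [⋀^Fin (2 * n)]→L[ℝ] ℂ :=
    fun i u => g i u • ψ u with hψ'
  have hψ's : ∀ i ∈ t, ContDiff ℝ ∞ (ψ' i) := fun i hi => (hgs i hi).smul hψs
  have hψ'g : ∀ i, Function.support (ψ' i) ⊆ Function.support (g i) := fun i u hu h0 =>
    hu ((congrArg (· • ψ u) h0).trans (zero_smul ℝ (ψ u)))
  have hψ'ψ : ∀ i, Function.support (ψ' i) ⊆ Function.support ψ := by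
    intro i u hu h0
    refine hu ?_
    change g i u • ψ u = 0
    rw [h0]
    exact smul_zero (A := Cn (n + 1) [⋀^Fin (2 * n)]→L[ℝ] ℂ) (g i u)
  have hψ't : ∀ i ∈ t, tsupport (ψ' i) ⊆ (e i).source ∩ K := fun i hi =>
    Set.subset_inter ((closure_mono (hψ'g i)).trans (hgt i hi))
      ((closure_mono (hψ'ψ i)).trans hψK)
  have hψ'c : ∀ i ∈ t, HasCompactSupport (ψ' i) := fun i hi =>
    hK.of_isClosed_subset (isClosed_tsupport _) ((hψ't i hi).trans Set.inter_subset_right)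
  have hψsum : ψ = fun u => ∑ i ∈ t, ψ' i u := by
    funext u
    simp only [hψ', ← Finset.sum_smul]
    by_cases hu : u ∈ K
    · rw [hg1 u hu, one_smul]
    · rw [image_eq_zero_of_notMem_tsupport fun h => hu (hψK h), smul_zero]
  have hz0 : ∀ w : Cn (n + 1) [⋀^Fin (2 * n)]→L[ℝ] ℂ, (0 : ℝ) • w = 0 := fun w => zero_smul ℝ w
  have h0z : ∀ r : ℝ, r • (0 : Cn (n + 1) [⋀^Fin (2 * n)]→L[ℝ] ℂ) = 0 := fun r =>
    smul_zero (A := Cn (n + 1) [⋀^Fin (2 * n)]→L[ℝ] ℂ) r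
  -- In a chart centred at a point where `F ≠ 0` the quotient `F/F(i)` stays in the slit plane,
  -- which omits `0`. Such a chart misses `Z`, so only the centres on the zero set are kept.
  set s := t.filter fun i => F i = 0 with hs
  have hst : ∀ i ∈ s, i ∈ t ∧ F i = 0 := fun i hi => Finset.mem_filter.1 hi
  set κ : Cn (n + 1) → OpenPartialHomeomorph M (Cn (n + 1)) := fun i => c.trans (e i) with hκ
  set R : Cn (n + 1) → M → Cn (n + 1) [⋀^Fin (2 * n)]→L[ℝ] ℂ := fun i z => g i (c z) • φ z with hR
  have hκs : ∀ i ∈ s, ∀ z, z ∈ (κ i).source ↔ z ∈ c.source ∧ c z ∈ (e i).source := by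
    intro i hi z
    rw [hκ]
    simp only [OpenPartialHomeomorph.trans_source]
    rfl
  have hκt : ∀ i ∈ s, (κ i).target = (e i).target := by
    intro i hi
    rw [hκ]
    simp only [OpenPartialHomeomorph.trans_target]
    refine Set.inter_eq_left.2 fun v hv => ?_
    exact hUt (he2 i (htK i (hst i hi).1) ((e i).map_target hv))
  have hgne : ∀ i ∈ t, ∀ u, g i u ≠ 0 → u ∈ (e i).source := fun i hi u hu =>
    hgt i hi (subset_tsupport _ hu)
  -- the coefficient in the hypersurface patch
  have hcoeff : ∀ i ∈ s, ∀ u ∈ (hyperPatch (κ i)).dom,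
      (hyperPatch (κ i)).coeff (fun z v => R i z v) u
        = ψ' i ((e i).symm (Fin.cons 0 u))
          (fun k => fderiv ℝ (e i).symm (Fin.cons 0 u) (Fin.cons 0 (stdFrame n k))) := by
    intro i hi u hu
    have hit := (hst i hi).1
    have hu' : (Fin.cons 0 u : Cn (n + 1)) ∈ (e i).target := hκt i hi ▸ hu
    have hy : (e i).symm (Fin.cons 0 u) ∈ U := he2 i (htK i hit) ((e i).map_target hu')
    have htan := tan_trans_local (chartAt_mem_hcharts p) (e i) (he3 i (htK i hit))
      (he4 i (htK i hit)) hu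
    have h1 : R i ((κ i).symm (Fin.cons 0 u)) = g i ((e i).symm (Fin.cons 0 u)) •
        φ (c.symm ((e i).symm (Fin.cons 0 u))) := by
      have : (κ i).symm (Fin.cons 0 u) = c.symm ((e i).symm (Fin.cons 0 u)) := rfl
      rw [hR, this]
      beta_reduce
      rw [c.right_inv (hUt hy)]
    change R i ((κ i).symm (Fin.cons 0 u)) (fun k => tan (κ i) (Fin.cons 0 u)
      (Fin.cons 0 (stdFrame n k))) = _
    rw [h1, hκ]
    beta_reduce
    rw [htan]
    simp only [hψ', hψ]
    rw [Set.indicator_of_mem hy]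
    rfl
  have hInt : ∀ i ∈ s, IntegrableOn ((hyperPatch (κ i)).coeff fun z v => R i z v)
      (hyperPatch (κ i)).dom := by
    intro i hi
    have hit := (hst i hi).1
    have hopen : IsOpen (hyperPatch (κ i)).dom := (hyperPatch_isRegular _).isOpen
    have hsl : (hyperPatch (κ i)).dom = {u : Cn n | (Fin.cons 0 u : Cn (n + 1)) ∈ (e i).target} := by
      rw [← hκt i hi]
      rfl
    have he4r := contDiffOn_real_of_complex (he4 i (htK i hit))
    have hcons : ContinuousOn (consZero n) (hyperPatch (κ i)).dom :=
      (consZero n).continuous.continuousOn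
    have hmaps : Set.MapsTo (consZero n) (hyperPatch (κ i)).dom (e i).target := by
      rw [hsl]
      exact fun u hu => hu
    refine integrableOn_of_continuousOn_of_compact hopen.measurableSet
      (C := consZero n ⁻¹' (e i '' tsupport (ψ' i))) ?_ ?_ ?_ ?_
    · refine isClosedEmbedding_consZero.isCompact_preimage ?_
      exact (hψ'c i hit).isCompact.image_of_continuousOn
        ((e i).continuousOn.mono ((hψ't i hit).trans Set.inter_subset_left))
    · rintro u ⟨y, hy, hyu⟩
      rw [hsl]
      change consZero n u ∈ (e i).target
      rw [← hyu]
      exact (e i).map_source ((hψ't i hit hy).1)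
    · refine ContinuousOn.congr ?_ (hcoeff i hi)
      refine ContinuousOn.form_apply ?_ fun k => ?_
      · exact (hψ's i hit).continuous.comp_continuousOn
          ((e i).continuousOn_symm.comp hcons hmaps)
      · exact ((he4r.continuousOn_fderiv_of_isOpen (e i).open_target (by simp)).comp hcons
          hmaps).clm_apply continuousOn_const
    · intro u hu hne
      rw [hcoeff i hi u hu] at hne
      refine ⟨(e i).symm (Fin.cons 0 u), subset_tsupport _ fun h0 => hne ?_,
        (e i).right_inv (hmaps hu)⟩
      rw [h0]
      simp
  refine ⟨s, κ, R, ?_, ?_, hInt, ?_, ?_⟩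
  · intro i hi
    have hit := (hst i hi).1
    refine ⟨trans_mem_hcharts (chartAt_mem_hcharts p) _ (he3 i (htK i hit)) (he4 i (htK i hit)),
      fun y hy => ?_⟩
    rw [hκs i hi] at hy
    have h6 := he6 i (htK i hit) (hst i hi).2 (c y) hy.2
    have h7 := hZ (c y) (he2 i (htK i hit) hy.2)
    rw [c.left_inv hy.1] at h7
    rw [h7, ← h6]
    rfl
  · intro i hi z hz
    have hgz : g i (c z) ≠ 0 := fun h => hz (by simp only [hR, h, hz0])
    have hφz : φ z ≠ 0 := fun h => hz (by simp only [hR, h, h0z])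
    rw [hκs i hi]
    exact ⟨(hφK' z hφz).2, hgne i (hst i hi).1 _ hgz⟩
  · intro z hz
    by_cases hφz : φ z = 0
    · simp only [hR, hφz, h0z, Finset.sum_const_zero]
    obtain ⟨hzK, hzc⟩ := hφK' z hφz
    simp only [hR]
    rw [← Finset.sum_smul, hs, Finset.sum_filter_of_ne, hg1 _ hzK, one_smul]
    intro i hi hne
    by_contra hFi
    have h5 := he5 i (htK i hi) hFi (c z) (hgne i hi _ hne)
    have h7 := hZ (c z) (hKU hzK)
    rw [c.left_inv hzc] at h7
    rw [h7.1 hz] at h5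
    simp at h5
  · have hlogint : ∀ i ∈ t, Integrable (fun u => ((Real.log (‖F u‖ ^ 2) : ℝ) : ℂ) *
        ddcTop (ψ' i) u) := by
      intro i hi
      have hcont : Continuous (ddcTop (ψ' i)) := by
        rw [← continuousOn_univ]
        exact continuousOn_ddcTop isOpen_univ (hψ's i hi).contDiffOn
      obtain ⟨B, hB⟩ := hK.exists_bound_of_continuousOn hcont.continuousOn
      have h1 : IntegrableOn (fun u => ((Real.log (‖F u‖ ^ 2) : ℝ) : ℂ) * ddcTop (ψ' i) u) K :=
        Integrable.mul_bdd (c := B) hlog hcont.aestronglyMeasurable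
          ((ae_restrict_iff' hK.measurableSet).2 (Filter.Eventually.of_forall hB))
      refine integrableOn_univ.1 (h1.of_forall_sdiff_eq_zero MeasurableSet.univ fun u hu => ?_)
      rw [ddcTop_eq_zero_of_notMem_tsupport fun h => hu.2 ((hψ't i hi h).2), mul_zero]
    have hK1 : ∫ u in K, ((Real.log (‖F u‖ ^ 2) : ℝ) : ℂ) * ddcTop α u
        = ∑ i ∈ t, ∫ u, ((Real.log (‖F u‖ ^ 2) : ℝ) : ℂ) * ddcTop (ψ' i) u := by
      rw [← integral_finsetSum _ hlogint]
      have hE := setIntegral_eq_integral_of_forall_compl_eq_zero (μ := volume) (s := K)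
        (f := fun u => ∑ i ∈ t, ((Real.log (‖F u‖ ^ 2) : ℝ) : ℂ) * ddcTop (ψ' i) u) ?_
      · rw [← hE]
        refine setIntegral_congr_fun hK.measurableSet fun u hu => ?_
        have hev : α =ᶠ[𝓝 u] fun u => ∑ i ∈ t, ψ' i u := by
          rw [← hψsum]
          filter_upwards [hU.mem_nhds (hKU hu)] with y hy using (Set.indicator_of_mem hy α).symm
        rw [ddcTop_congr hev, ddcTop_sum t fun i hi => (hψ's i hi).contDiffAt, Finset.mul_sum]
      · intro u hu
        refine Finset.sum_eq_zero fun i hi => ?_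
        rw [ddcTop_eq_zero_of_notMem_tsupport fun h => hu ((hψ't i hi h).2), mul_zero]
    rw [hK1, Finset.mul_sum, hs, Finset.sum_filter]
    refine Finset.sum_congr rfl fun i hi => ?_
    split_ifs with hFi
    · have his : i ∈ s := Finset.mem_filter.2 ⟨hi, hFi⟩
      have hPL := integral_log_mul_ddcTop_of_straightening (e i) (he4 i (htK i hi)) (hψ's i hi)
        (hψ'c i hi) ((hψ't i hi).trans Set.inter_subset_left)
      have h1 : ∫ u, ((Real.log (‖F u‖ ^ 2) : ℝ) : ℂ) * ddcTop (ψ' i) u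
          = ∫ u, ((Real.log (‖e i u 0‖ ^ 2) : ℝ) : ℂ) * ddcTop (ψ' i) u := by
        refine integral_congr_ae (Filter.Eventually.of_forall fun u => ?_)
        beta_reduce
        by_cases hu : u ∈ tsupport (ψ' i)
        · rw [he6 i (htK i hi) hFi u (hψ't i hi hu).1]
        · rw [ddcTop_eq_zero_of_notMem_tsupport hu, mul_zero, mul_zero]
      have h2 : (hyperPatch (κ i)).dom
          = {u : Cn n | (Fin.cons 0 u : Cn (n + 1)) ∈ (e i).target} := by
        rw [← hκt i his]
        rfl
      rw [h1, hPL, setIntegral_congr_fun (hyperPatch_isRegular _).isOpen.measurableSet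
        (hcoeff i his), h2]
      have hpi : (2 * Real.pi : ℂ) ≠ 0 := by
        simp [Real.pi_ne_zero]
      rw [← mul_assoc, one_div, inv_mul_cancel₀ hpi, one_mul]
    · have h0 := integral_log_mul_ddcTop_of_ne_zero (e i).open_source
        (hF.mono (he2 i (htK i hi))) hFi (he5 i (htK i hi) hFi) (hψ's i hi) (hψ'c i hi)
        ((hψ't i hi).trans Set.inter_subset_left)
      rw [h0, mul_zero]

end PL

/-! ### Forms on `M × M` -/

section SliceDdc

variable {n k l : ℕ}

theorem wd_fst_slice {k' : ℕ} {ε : ℂ} (h : l = k + k') (h' : l + 1 = k + 1 + k')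
    {α : Cn (n + 1) × Cn (n + 1) → (Cn (n + 1) × Cn (n + 1)) [⋀^Fin l]→L[ℝ] ℂ}
    {x : Cn (n + 1) × Cn (n + 1)} (hα : DifferentiableAt ℝ α x) (v' : Fin k' → Cn (n + 1)) :
    sliceFst h' v' (wd ε (projZ n) α x)
      = wd ε (ContinuousLinearMap.id ℂ _) (fun u => sliceFst h v' (α (u, x.2))) x.1 := by
  ext v
  exact wd_fst_splitVec h h' hα v v'

theorem wd_snd_slice {k' : ℕ} {ε : ℂ} (hk : Even k) (h : l = k + k') (h' : l + 1 = k + (k' + 1))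
    {α : Cn (n + 1) × Cn (n + 1) → (Cn (n + 1) × Cn (n + 1)) [⋀^Fin l]→L[ℝ] ℂ}
    {x : Cn (n + 1) × Cn (n + 1)} (hα : DifferentiableAt ℝ α x) (v : Fin k → Cn (n + 1)) :
    sliceSnd h' v (wd ε (projW n) α x)
      = wd ε (ContinuousLinearMap.id ℂ _) (fun u => sliceSnd h v (α (x.1, u))) x.2 := by
  ext v'
  exact wd_snd_splitVec hk h h' hα v v'

/-- The operator `i∂∂̄` along the range of `P` in the flat case. -/
def ddc (P : Cn (n + 1) × Cn (n + 1) →L[ℂ] Cn (n + 1) × Cn (n + 1))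
    (α : Cn (n + 1) × Cn (n + 1) → (Cn (n + 1) × Cn (n + 1)) [⋀^Fin l]→L[ℝ] ℂ)
    (x : Cn (n + 1) × Cn (n + 1)) : (Cn (n + 1) × Cn (n + 1)) [⋀^Fin (l + 1 + 1)]→L[ℝ] ℂ :=
  Complex.I • wd (-Complex.I) P (wd Complex.I P α) x

theorem ContDiffOn.ddc {P : Cn (n + 1) × Cn (n + 1) →L[ℂ] Cn (n + 1) × Cn (n + 1)}
    {α : Cn (n + 1) × Cn (n + 1) → (Cn (n + 1) × Cn (n + 1)) [⋀^Fin l]→L[ℝ] ℂ}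
    {U : Set (Cn (n + 1) × Cn (n + 1))} (hU : IsOpen U) (h : ContDiffOn ℝ ∞ α U) :
    ContDiffOn ℝ ∞ (ddc P α) U :=
  (ContDiffOn.wd hU (ContDiffOn.wd hU h)).const_smul Complex.I

theorem ddc_congr {P : Cn (n + 1) × Cn (n + 1) →L[ℂ] Cn (n + 1) × Cn (n + 1)}
    {α β : Cn (n + 1) × Cn (n + 1) → (Cn (n + 1) × Cn (n + 1)) [⋀^Fin l]→L[ℝ] ℂ}
    {x : Cn (n + 1) × Cn (n + 1)} (h : α =ᶠ[𝓝 x] β) : ddc P α x = ddc P β x := by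
  rw [ddc, ddc, wd_congr (wd_eventuallyEq h)]

theorem ddc_sum {P : Cn (n + 1) × Cn (n + 1) →L[ℂ] Cn (n + 1) × Cn (n + 1)} {ι : Type*}
    (s : Finset ι)
    {α : ι → Cn (n + 1) × Cn (n + 1) → (Cn (n + 1) × Cn (n + 1)) [⋀^Fin l]→L[ℝ] ℂ}
    {U : Set (Cn (n + 1) × Cn (n + 1))} (hU : IsOpen U) (h : ∀ i ∈ s, ContDiffOn ℝ ∞ (α i) U)
    {x : Cn (n + 1) × Cn (n + 1)} (hx : x ∈ U) :
    ddc P (fun y => ∑ i ∈ s, α i y) x = ∑ i ∈ s, ddc P (α i) x := by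
  have hd : ∀ {k : ℕ} {β : Cn (n + 1) × Cn (n + 1) → (Cn (n + 1) × Cn (n + 1)) [⋀^Fin k]→L[ℝ] ℂ},
      ContDiffOn ℝ ∞ β U → ∀ y ∈ U, DifferentiableAt ℝ β y := fun hβ y hy =>
    (hβ.contDiffAt (hU.mem_nhds hy)).differentiableAt (by simp)
  have hev : wd Complex.I P (fun y => ∑ i ∈ s, α i y) =ᶠ[𝓝 x]
      fun y => ∑ i ∈ s, wd Complex.I P (α i) y := by
    filter_upwards [hU.mem_nhds hx] with y hy
    exact wd_sum s fun i hi => hd (h i hi) y hy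
  simp only [ddc]
  rw [wd_congr hev, wd_sum s fun i hi => hd (ContDiffOn.wd hU (h i hi)) x hx, Finset.smul_sum]

theorem ddc_zero (P : Cn (n + 1) × Cn (n + 1) →L[ℂ] Cn (n + 1) × Cn (n + 1))
    (x : Cn (n + 1) × Cn (n + 1)) :
    ddc P (fun _ => (0 : (Cn (n + 1) × Cn (n + 1)) [⋀^Fin l]→L[ℝ] ℂ)) x = 0 := by
  have := ddc_sum (P := P) (l := l) (∅ : Finset ℕ) (α := fun _ _ => 0) isOpen_univ
    (fun i hi => absurd hi (Finset.notMem_empty i)) (Set.mem_univ x)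
  simpa using this

/-- Contracting the slots of the second factor with fixed vectors turns `(i∂∂̄)_z` into the ordinary
operator in `x` at a frozen `y`. The Poincaré–Lelong formula on one copy of `M` can then be applied.
-/
theorem ddcTop_sliceFst {k' : ℕ} (h : l = 2 * n + k') (h' : l + 1 + 1 = 2 * (n + 1) + k')
    {α : Cn (n + 1) × Cn (n + 1) → (Cn (n + 1) × Cn (n + 1)) [⋀^Fin l]→L[ℝ] ℂ}
    {U : Set (Cn (n + 1) × Cn (n + 1))} (hU : IsOpen U) (hα : ContDiffOn ℝ ∞ α U)
    {x y : Cn (n + 1)} (hx : (x, y) ∈ U) (v' : Fin k' → Cn (n + 1)) :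
    ddc (projZ n) α (x, y) (splitVec h' (stdFrame (n + 1)) v')
      = ddcTop (fun u => sliceFst h v' (α (u, y))) x := by
  have hd : ∀ {k : ℕ} {β : Cn (n + 1) × Cn (n + 1) → (Cn (n + 1) × Cn (n + 1)) [⋀^Fin k]→L[ℝ] ℂ},
      ContDiffOn ℝ ∞ β U → ∀ y ∈ U, DifferentiableAt ℝ β y := fun hβ y hy =>
    (hβ.contDiffAt (hU.mem_nhds hy)).differentiableAt (by simp)
  have h1 : l + 1 = 2 * n + 1 + k' := by omega
  have h2 : l + 1 + 1 = 2 * n + 1 + 1 + k' := by omega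
  have hev : (fun u => sliceFst h1 v' (wd Complex.I (projZ n) α (u, y))) =ᶠ[𝓝 x]
      wd Complex.I (ContinuousLinearMap.id ℂ _) (fun u => sliceFst h v' (α (u, y))) := by
    have hc : ContinuousAt (fun u : Cn (n + 1) => (u, y)) x := by fun_prop
    filter_upwards [hc.preimage_mem_nhds (hU.mem_nhds hx)] with u hu
    exact wd_fst_slice h h1 (hd hα (u, y) hu) v'
  have h3 := wd_fst_slice (ε := -Complex.I) h1 h2
    (hd (ContDiffOn.wd (ε := Complex.I) (P := projZ n) hU hα) (x, y) hx) v'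
  rw [wd_congr hev] at h3
  rw [ddcTop_eq_wd, ← h3]
  rfl

theorem ddcTop_sliceSnd (hk : Even k) (h : l = k + 2 * n) (h' : l + 1 + 1 = k + 2 * (n + 1))
    {α : Cn (n + 1) × Cn (n + 1) → (Cn (n + 1) × Cn (n + 1)) [⋀^Fin l]→L[ℝ] ℂ}
    {U : Set (Cn (n + 1) × Cn (n + 1))} (hU : IsOpen U) (hα : ContDiffOn ℝ ∞ α U)
    {x y : Cn (n + 1)} (hx : (x, y) ∈ U) (v : Fin k → Cn (n + 1)) :
    ddc (projW n) α (x, y) (splitVec h' v (stdFrame (n + 1)))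
      = ddcTop (fun u => sliceSnd h v (α (x, u))) y := by
  have hd : ∀ {k : ℕ} {β : Cn (n + 1) × Cn (n + 1) → (Cn (n + 1) × Cn (n + 1)) [⋀^Fin k]→L[ℝ] ℂ},
      ContDiffOn ℝ ∞ β U → ∀ y ∈ U, DifferentiableAt ℝ β y := fun hβ y hy =>
    (hβ.contDiffAt (hU.mem_nhds hy)).differentiableAt (by simp)
  have h1 : l + 1 = k + (2 * n + 1) := by omega
  have h2 : l + 1 + 1 = k + (2 * n + 1 + 1) := by omega
  have hev : (fun u => sliceSnd h1 v (wd Complex.I (projW n) α (x, u))) =ᶠ[𝓝 y]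
      wd Complex.I (ContinuousLinearMap.id ℂ _) (fun u => sliceSnd h v (α (x, u))) := by
    have hc : ContinuousAt (fun u : Cn (n + 1) => (x, u)) y := by fun_prop
    filter_upwards [hc.preimage_mem_nhds (hU.mem_nhds hx)] with u hu
    exact wd_snd_slice hk h h1 (hd hα (x, u) hu) v
  have h3 := wd_snd_slice (ε := -Complex.I) hk h1 h2
    (hd (ContDiffOn.wd (ε := Complex.I) (P := projW n) hU hα) (x, y) hx) v
  rw [wd_congr hev] at h3
  rw [ddcTop_eq_wd, ← h3]
  rfl

end SliceDdc

/-! ### Invariance of `(i∂∂̄)_z` and `(i∂∂̄)_w` under changes of product charts. -/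

section BiForms

variable {n : ℕ} {M : Type*} [TopologicalSpace M] [ChartedSpace (Cn (n + 1)) M]

/-- The model of `M × M`. -/
abbrev I₂ (n : ℕ) : ModelWithCorners ℝ (Cn (n + 1) × Cn (n + 1))
    (ModelProd (Cn (n + 1)) (Cn (n + 1))) :=
  𝓘(ℝ, Cn (n + 1)).prod 𝓘(ℝ, Cn (n + 1))

/-- The domain of the inverse of a product chart. -/
def target₂ (p q : M) : Set (Cn (n + 1) × Cn (n + 1)) :=
  (chartAt (Cn (n + 1)) p).target ×ˢ (chartAt (Cn (n + 1)) q).target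

theorem isOpen_target₂ (p q : M) : IsOpen (target₂ (n := n) p q) :=
  (chartAt (Cn (n + 1)) p).open_target.prod (chartAt (Cn (n + 1)) q).open_target

theorem extChartAt_prod_target (p q : M) : (extChartAt (I₂ n) (p, q)).target = target₂ p q := by
  rw [extChartAt_prod]
  change (extChartAt 𝓘(ℝ, Cn (n + 1)) p).target ×ˢ (extChartAt 𝓘(ℝ, Cn (n + 1)) q).target = _
  rw [extChartAt_target_eq, extChartAt_target_eq]
  rfl

variable [IsManifold 𝓘(ℂ, Cn (n + 1)) ω M]

theorem mfderiv_prod_symm {p q : M} {x y : Cn (n + 1)} (hx : (x, y) ∈ target₂ p q) :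
    (mfderiv 𝓘(ℝ, Cn (n + 1) × Cn (n + 1)) (I₂ n) (extChartAt (I₂ n) (p, q)).symm (x, y) :
      Cn (n + 1) × Cn (n + 1) →L[ℝ] Cn (n + 1) × Cn (n + 1))
      = (tan (chartAt (Cn (n + 1)) p) x).prodMap (tan (chartAt (Cn (n + 1)) q) y) := by
  have hd1 := ((differentiableAt_transition (chartAt_mem_hcharts p) (chartAt_mem_hcharts _) hx.1
      (mem_chart_source _ _)).restrictScalars ℝ).hasFDerivAt
  have hd2 := ((differentiableAt_transition (chartAt_mem_hcharts q) (chartAt_mem_hcharts _) hx.2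
      (mem_chart_source _ _)).restrictScalars ℝ).hasFDerivAt
  rw [← tan_eq_fderiv (chartAt_mem_hcharts p) hx.1] at hd1
  rw [← tan_eq_fderiv (chartAt_mem_hcharts q) hx.2] at hd2
  have hm : HasMFDerivAt 𝓘(ℝ, Cn (n + 1) × Cn (n + 1)) (I₂ n) (extChartAt (I₂ n) (p, q)).symm
      (x, y) ((tan (chartAt (Cn (n + 1)) p) x).prodMap (tan (chartAt (Cn (n + 1)) q) y)) := by
    refine ⟨?_, ?_⟩
    · exact ContinuousAt.prodMap ((chartAt (Cn (n + 1)) p).continuousAt_symm hx.1)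
        ((chartAt (Cn (n + 1)) q).continuousAt_symm hx.2)
    · exact (hd1.prodMap (x, y) hd2).hasFDerivWithinAt
  exact hm.mfderiv

variable {k : ℕ} {Φ : M × M → (Cn (n + 1) × Cn (n + 1)) [⋀^Fin k]→L[ℝ] ℂ}

theorem formInChart_prod_eq (Φ : M × M → (Cn (n + 1) × Cn (n + 1)) [⋀^Fin k]→L[ℝ] ℂ) {p q : M}
    {x y : Cn (n + 1)} (hx : (x, y) ∈ target₂ p q) :
    formInChart (I₂ n) Φ (p, q) (x, y)
      = (Φ ((chartAt (Cn (n + 1)) p).symm x, (chartAt (Cn (n + 1)) q).symm y)).compContinuousLinearMap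
        ((tan (chartAt (Cn (n + 1)) p) x).prodMap (tan (chartAt (Cn (n + 1)) q) y)) := by
  rw [formInChart, mfderiv_prod_symm hx]
  rfl

/-- The product of two changes of charts. -/
def transition₂ (p q p' q' : M) (u : Cn (n + 1) × Cn (n + 1)) : Cn (n + 1) × Cn (n + 1) :=
  ((chartAt (Cn (n + 1)) p' ∘ (chartAt (Cn (n + 1)) p).symm) u.1,
    (chartAt (Cn (n + 1)) q' ∘ (chartAt (Cn (n + 1)) q).symm) u.2)

/-- The domain of a product of two changes of charts. -/
def transitionDom₂ (p q p' q' : M) : Set (Cn (n + 1) × Cn (n + 1)) :=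
  ((chartAt (Cn (n + 1)) p).target ∩ (chartAt (Cn (n + 1)) p).symm ⁻¹'
      (chartAt (Cn (n + 1)) p').source) ×ˢ
    ((chartAt (Cn (n + 1)) q).target ∩ (chartAt (Cn (n + 1)) q).symm ⁻¹'
      (chartAt (Cn (n + 1)) q').source)

theorem isOpen_transitionDom₂ (p q p' q' : M) : IsOpen (transitionDom₂ (n := n) p q p' q') :=
  (isOpen_transition _ _).prod (isOpen_transition _ _)

theorem contDiffOn_transition₂ (p q p' q' : M) :
    ContDiffOn ℂ ω (transition₂ p q p' q') (transitionDom₂ (n := n) p q p' q') :=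
  ((contDiffOn_transition (chartAt_mem_hcharts p) (chartAt_mem_hcharts p')).comp
      contDiffOn_fst fun _ hu => hu.1).prodMk
    ((contDiffOn_transition (chartAt_mem_hcharts q) (chartAt_mem_hcharts q')).comp
      contDiffOn_snd fun _ hu => hu.2)

theorem fderiv_transition₂ {p q p' q' : M} {u : Cn (n + 1) × Cn (n + 1)}
    (hu : u ∈ transitionDom₂ p q p' q') :
    fderiv ℝ (transition₂ p q p' q') u
      = (fderiv ℝ (chartAt (Cn (n + 1)) p' ∘ (chartAt (Cn (n + 1)) p).symm) u.1).prodMap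
        (fderiv ℝ (chartAt (Cn (n + 1)) q' ∘ (chartAt (Cn (n + 1)) q).symm) u.2) := by
  have hd1 := ((differentiableAt_transition (chartAt_mem_hcharts p) (chartAt_mem_hcharts p') hu.1.1
      hu.1.2).restrictScalars ℝ).hasFDerivAt
  have hd2 := ((differentiableAt_transition (chartAt_mem_hcharts q) (chartAt_mem_hcharts q') hu.2.1
      hu.2.2).restrictScalars ℝ).hasFDerivAt
  exact (hd1.prodMap u hd2).fderiv

theorem formInChart_prod_transition (Φ : M × M → (Cn (n + 1) × Cn (n + 1)) [⋀^Fin k]→L[ℝ] ℂ)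
    {p q p' q' : M} {u : Cn (n + 1) × Cn (n + 1)} (hu : u ∈ transitionDom₂ p q p' q') :
    formInChart (I₂ n) Φ (p, q) u
      = (formInChart (I₂ n) Φ (p', q') (transition₂ p q p' q' u)).compContinuousLinearMap
        (fderiv ℝ (transition₂ p q p' q') u) := by
  obtain ⟨x, y⟩ := u
  have h1 : transition₂ p q p' q' (x, y) ∈ target₂ p' q' :=
    ⟨(chartAt (Cn (n + 1)) p').map_source hu.1.2, (chartAt (Cn (n + 1)) q').map_source hu.2.2⟩
  have h2 : (chartAt (Cn (n + 1)) p').symm (transition₂ p q p' q' (x, y)).1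
      = (chartAt (Cn (n + 1)) p).symm x := (chartAt (Cn (n + 1)) p').left_inv hu.1.2
  have h3 : (chartAt (Cn (n + 1)) q').symm (transition₂ p q p' q' (x, y)).2
      = (chartAt (Cn (n + 1)) q).symm y := (chartAt (Cn (n + 1)) q').left_inv hu.2.2
  rw [formInChart_prod_eq Φ ⟨hu.1.1, hu.2.1⟩]
  have h4 := formInChart_prod_eq Φ (x := (transition₂ p q p' q' (x, y)).1)
    (y := (transition₂ p q p' q' (x, y)).2) h1
  rw [h2, h3] at h4
  rw [fderiv_transition₂ hu, show transition₂ p q p' q' (x, y)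
    = ((transition₂ p q p' q' (x, y)).1, (transition₂ p q p' q' (x, y)).2) from rfl, h4,
    tan_trans (chartAt_mem_hcharts p) (chartAt_mem_hcharts p') hu.1.1 hu.1.2,
    tan_trans (chartAt_mem_hcharts q) (chartAt_mem_hcharts q') hu.2.1 hu.2.2]
  rfl

/-- The projection commutes with products of linear maps. -/
def IsFactorProj (P : Cn (n + 1) × Cn (n + 1) →L[ℂ] Cn (n + 1) × Cn (n + 1)) : Prop :=
  ∀ (A B : Cn (n + 1) →L[ℝ] Cn (n + 1)) v, A.prodMap B (P v) = P (A.prodMap B v)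

theorem isFactorProj_projZ : IsFactorProj (projZ n) := fun A B v => by
  simp [projZ]

theorem isFactorProj_projW : IsFactorProj (projW n) := fun A B v => by
  simp [projW]

variable {P : Cn (n + 1) × Cn (n + 1) →L[ℂ] Cn (n + 1) × Cn (n + 1)}

theorem IsSmoothForm.contDiffOn_target₂ (hΦ : IsSmoothForm (I₂ n) Φ) (p q : M) :
    ContDiffOn ℝ ∞ (formInChart (I₂ n) Φ (p, q)) (target₂ p q) := by
  rw [← extChartAt_prod_target]
  exact hΦ (p, q)

/-- By definition `iddbar` uses another chart at each point. Product transitions are holomorphic and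
respect the two factors, so naturality (`wd_pullback`) identifies the result with the flat operator
in one fixed product chart. Smoothness of the resulting form, and the possibility of applying a
second operator, follow from this. -/
theorem formInChart_iddbar (hP : IsFactorProj P) (hΦ : IsSmoothForm (I₂ n) Φ) {p q : M}
    {u : Cn (n + 1) × Cn (n + 1)} (hu : u ∈ target₂ p q) :
    formInChart (I₂ n) (iddbar (I₂ n) P Φ) (p, q) u = ddc P (formInChart (I₂ n) Φ (p, q)) u := by
  obtain ⟨x, y⟩ := u
  set z := (chartAt (Cn (n + 1)) p).symm x with hz
  set w := (chartAt (Cn (n + 1)) q).symm y with hw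
  set τ := transition₂ (n := n) p q z w with hτ
  have hdom : (x, y) ∈ transitionDom₂ (n := n) p q z w :=
    ⟨⟨hu.1, mem_chart_source _ _⟩, ⟨hu.2, mem_chart_source _ _⟩⟩
  have hopen := isOpen_transitionDom₂ (n := n) p q z w
  have hτs := contDiffOn_transition₂ (n := n) p q z w
  have hτr := contDiffOn_real_of_complex hτs
  have hcomm : ∀ {k : ℕ} (ε : ℂ)
      (β : Cn (n + 1) × Cn (n + 1) → (Cn (n + 1) × Cn (n + 1)) [⋀^Fin k]→L[ℝ] ℂ),
      ContDiffOn ℝ ∞ β (target₂ z w) → ∀ u ∈ transitionDom₂ (n := n) p q z w,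
      wd ε P (fun u => (β (τ u)).compContinuousLinearMap (fderiv ℝ τ u)) u
        = (wd ε P β (τ u)).compContinuousLinearMap (fderiv ℝ τ u) := by
    intro k ε β hβ u hu
    have hmem : τ u ∈ target₂ z w := ⟨(chartAt (Cn (n + 1)) z).map_source hu.1.2,
      (chartAt (Cn (n + 1)) w).map_source hu.2.2⟩
    refine wd_pullback ((hβ.contDiffAt ((isOpen_target₂ z w).mem_nhds hmem)).differentiableAt
      (by simp)) ((hτr.contDiffAt (hopen.mem_nhds hu)).of_le two_le_infty) ?_ ?_
    · filter_upwards [hopen.mem_nhds hu] with y hy v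
      rw [hτ, fderiv_transition₂ hy]
      exact hP _ _ v
    · filter_upwards [hopen.mem_nhds hu] with y hy v
      exact fderiv_real_I_smul (differentiableAt_of_contDiffOn hopen hτs hy) v
  have hev0 : formInChart (I₂ n) Φ (p, q) =ᶠ[𝓝 (x, y)]
      fun u => (formInChart (I₂ n) Φ (z, w) (τ u)).compContinuousLinearMap (fderiv ℝ τ u) := by
    filter_upwards [hopen.mem_nhds hdom] with u hu using formInChart_prod_transition Φ hu
  have hs := hΦ.contDiffOn_target₂ z w
  have hev1 : wd Complex.I P (formInChart (I₂ n) Φ (p, q)) =ᶠ[𝓝 (x, y)]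
      fun u => (wd Complex.I P (formInChart (I₂ n) Φ (z, w)) (τ u)).compContinuousLinearMap
        (fderiv ℝ τ u) := by
    refine (wd_eventuallyEq hev0).trans ?_
    filter_upwards [hopen.mem_nhds hdom] with u hu using hcomm _ _ hs u hu
  rw [ddc, wd_congr hev1, hcomm _ _ (ContDiffOn.wd (isOpen_target₂ z w) hs) _ hdom,
    formInChart_prod_eq _ hu, fderiv_transition₂ hdom,
    tan_eq_fderiv (chartAt_mem_hcharts p) hu.1, tan_eq_fderiv (chartAt_mem_hcharts q) hu.2,
    iddbar, del_eq_wd, delbar_eq_wd]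
  rfl

theorem IsSmoothForm.iddbar_prod (hP : IsFactorProj P) (hΦ : IsSmoothForm (I₂ n) Φ) :
    IsSmoothForm (I₂ n) (iddbar (I₂ n) P Φ) := by
  rintro ⟨p, q⟩
  rw [extChartAt_prod_target]
  exact (ContDiffOn.ddc (isOpen_target₂ p q) (hΦ.contDiffOn_target₂ p q)).congr
    fun u hu => formInChart_iddbar hP hΦ hu

theorem iddbar_prod_eq (Φ : M × M → (Cn (n + 1) × Cn (n + 1)) [⋀^Fin k]→L[ℝ] ℂ) (z w : M) :
    iddbar (I₂ n) P Φ (z, w) = ddc P (formInChart (I₂ n) Φ (z, w))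
      (chartAt (Cn (n + 1)) z z, chartAt (Cn (n + 1)) w w) := by
  rw [iddbar, del_eq_wd, delbar_eq_wd]
  rfl

theorem mem_target₂_self (z w : M) :
    (chartAt (Cn (n + 1)) z z, chartAt (Cn (n + 1)) w w) ∈ target₂ (n := n) z w :=
  ⟨mem_chart_target _ z, mem_chart_target _ w⟩

theorem formInChart_prod_sum {ι : Type*} (s : Finset ι)
    (Ψ : ι → M × M → (Cn (n + 1) × Cn (n + 1)) [⋀^Fin k]→L[ℝ] ℂ) (p : M × M)
    (u : Cn (n + 1) × Cn (n + 1)) :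
    formInChart (I₂ n) (fun z => ∑ i ∈ s, Ψ i z) p u
      = ∑ i ∈ s, formInChart (I₂ n) (Ψ i) p u := by
  ext v
  rw [ContinuousAlternatingMap.sum_apply]
  exact ContinuousAlternatingMap.sum_apply ..

theorem iddbar_sum {ι : Type*} (s : Finset ι)
    {Ψ : ι → M × M → (Cn (n + 1) × Cn (n + 1)) [⋀^Fin k]→L[ℝ] ℂ}
    (h : ∀ i ∈ s, IsSmoothForm (I₂ n) (Ψ i)) (z : M × M) :
    iddbar (I₂ n) P (fun z => ∑ i ∈ s, Ψ i z) z = ∑ i ∈ s, iddbar (I₂ n) P (Ψ i) z := by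
  obtain ⟨z, w⟩ := z
  simp only [iddbar_prod_eq]
  rw [← ddc_sum s (isOpen_target₂ z w) (fun i hi => (h i hi).contDiffOn_target₂ z w)
    (mem_target₂_self z w)]
  exact congrArg (fun α => ddc P α _) (funext fun u => formInChart_prod_sum s Ψ (z, w) u)

/-- The operator `i∂∂̄` is local. -/
theorem iddbar_eq_zero {z w : M} (h : ∀ᶠ x in 𝓝 (z, w), Φ x = 0) :
    iddbar (I₂ n) P Φ (z, w) = 0 := by
  rw [iddbar_prod_eq]
  have hc : ContinuousAt (fun u : Cn (n + 1) × Cn (n + 1) =>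
      ((chartAt (Cn (n + 1)) z).symm u.1, (chartAt (Cn (n + 1)) w).symm u.2))
      (chartAt (Cn (n + 1)) z z, chartAt (Cn (n + 1)) w w) :=
    ContinuousAt.prodMap ((chartAt (Cn (n + 1)) z).continuousAt_symm (mem_chart_target _ z))
      ((chartAt (Cn (n + 1)) w).continuousAt_symm (mem_chart_target _ w))
  have hcz : ((chartAt (Cn (n + 1)) z).symm (chartAt (Cn (n + 1)) z z),
      (chartAt (Cn (n + 1)) w).symm (chartAt (Cn (n + 1)) w w)) = (z, w) := by
    rw [(chartAt (Cn (n + 1)) z).left_inv (mem_chart_source _ z),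
      (chartAt (Cn (n + 1)) w).left_inv (mem_chart_source _ w)]
  have hev : formInChart (I₂ n) Φ (z, w) =ᶠ[𝓝 (chartAt (Cn (n + 1)) z z, chartAt (Cn (n + 1)) w w)]
      fun _ => 0 := by
    have h' := hc.eventually (p := fun x => Φ x = 0) (by beta_reduce; rw [hcz]; exact h)
    filter_upwards [h'] with u hu
    ext v
    change Φ ((chartAt (Cn (n + 1)) z).symm u.1, (chartAt (Cn (n + 1)) w).symm u.2) _ = 0
    rw [hu]
    rfl
  rw [ddc_congr hev, ddc_zero]

/-- A smooth function on `M`. -/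
def IsSmoothFun (n : ℕ) {M : Type*} [TopologicalSpace M] [ChartedSpace (Cn (n + 1)) M]
    (χ : M → ℝ) : Prop :=
  ∀ p : M, ContDiffOn ℝ ∞ (χ ∘ (chartAt (Cn (n + 1)) p).symm) (chartAt (Cn (n + 1)) p).target

theorem IsSmoothForm.smul_fst {χ : M → ℝ} (hχ : IsSmoothFun n χ) (hΦ : IsSmoothForm (I₂ n) Φ) :
    IsSmoothForm (I₂ n) (fun z => χ z.1 • Φ z) := by
  rintro ⟨p, q⟩
  rw [extChartAt_prod_target]
  have h1 : ContDiffOn ℝ ∞ (fun u : Cn (n + 1) × Cn (n + 1) =>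
      χ ((chartAt (Cn (n + 1)) p).symm u.1)) (target₂ p q) :=
    (hχ p).comp contDiffOn_fst fun u hu => hu.1
  exact h1.smul (hΦ.contDiffOn_target₂ p q)

theorem IsSmoothForm.smul_snd {χ : M → ℝ} (hχ : IsSmoothFun n χ) (hΦ : IsSmoothForm (I₂ n) Φ) :
    IsSmoothForm (I₂ n) (fun z => χ z.2 • Φ z) := by
  rintro ⟨p, q⟩
  rw [extChartAt_prod_target]
  have h1 : ContDiffOn ℝ ∞ (fun u : Cn (n + 1) × Cn (n + 1) =>
      χ ((chartAt (Cn (n + 1)) q).symm u.2)) (target₂ p q) :=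
    (hχ q).comp contDiffOn_snd fun u hu => hu.2
  exact h1.smul (hΦ.contDiffOn_target₂ p q)

end BiForms

/-! ### The dilogarithm -/

section Dilog

/-- The dilogarithm `-∫₀ˣ log(1 - v)/v dv`. -/
def dilog (x : ℝ) : ℝ := ∫ v in (0 : ℝ)..x, -(Real.log (1 - v) / v)

theorem neg_log_div_nonneg {v : ℝ} (h0 : 0 ≤ v) (h1 : v ≤ 1) : 0 ≤ -(Real.log (1 - v) / v) := by
  rw [← neg_div]
  exact div_nonneg (neg_nonneg.2 (Real.log_nonpos (by linarith) (by linarith))) h0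

/-- For `v ≤ 1/2` the quotient is at most `2`, because `-log(1 - v) ≤ 2v`; for `v ≥ 1/2` the
division by `v` costs at most a factor `2`. The sum of the two bounds is integrable up to `v = 1`.
-/
theorem neg_log_div_le {v : ℝ} (h0 : 0 < v) (h1 : v < 1) :
    -(Real.log (1 - v) / v) ≤ 2 - 2 * Real.log (1 - v) := by
  have hlog : Real.log (1 - v) ≤ 0 := Real.log_nonpos (by linarith) (by linarith)
  rw [← neg_div, div_le_iff₀ h0]
  rcases le_total v (1 / 2) with hv | hv
  · have h := Real.one_sub_inv_le_log_of_pos (show 0 < 1 - v by linarith)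
    have h2 : (1 - v)⁻¹ ≤ 1 + 2 * v := by
      rw [inv_le_iff_one_le_mul₀ (by linarith)]
      nlinarith
    nlinarith
  · nlinarith

theorem integrableOn_neg_log_div :
    IntegrableOn (fun v : ℝ => -(Real.log (1 - v) / v)) (Set.uIcc 0 1) := by
  have h1 : IntervalIntegrable (fun v : ℝ => 2 - 2 * Real.log (1 - v)) volume 0 1 := by
    have h := (intervalIntegral.intervalIntegrable_log' (a := 1) (b := 0)).comp_sub_left 1
    simp only [sub_self, sub_zero] at h
    exact intervalIntegrable_const.sub (h.const_mul 2)
  rw [Set.uIcc_of_le zero_le_one, integrableOn_Icc_iff_integrableOn_Ioo]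
  rw [intervalIntegrable_iff_integrableOn_Ioo_of_le zero_le_one] at h1
  refine Integrable.mono' h1 ?_ ?_
  · exact ((Real.measurable_log.comp (measurable_const.sub measurable_id)).div
      measurable_id).neg.aestronglyMeasurable
  · refine (ae_restrict_iff' measurableSet_Ioo).2 (Filter.Eventually.of_forall fun v hv => ?_)
    rw [Real.norm_of_nonneg (neg_log_div_nonneg hv.1.le hv.2.le)]
    exact neg_log_div_le hv.1 hv.2

theorem continuousOn_dilog : ContinuousOn dilog (Set.Icc 0 1) := by
  have := intervalIntegral.continuousOn_primitive_interval integrableOn_neg_log_div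
  rwa [Set.uIcc_of_le zero_le_one] at this

theorem dilog_zero : dilog 0 = 0 := intervalIntegral.integral_same

theorem dilog_nonneg {x : ℝ} (h0 : 0 ≤ x) (h1 : x ≤ 1) : 0 ≤ dilog x :=
  intervalIntegral.integral_nonneg h0 fun _ hv => neg_log_div_nonneg hv.1 (hv.2.trans h1)

theorem hasDerivAt_dilog {x : ℝ} (h0 : 0 < x) (h1 : x < 1) :
    HasDerivAt dilog (-(Real.log (1 - x) / x)) x := by
  have hc : ContinuousAt (fun v : ℝ => -(Real.log (1 - v) / v)) x := by
    refine ((ContinuousAt.log (by fun_prop) (by linarith)).div continuousAt_id h0.ne').neg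
  have hInt : IntervalIntegrable (fun v : ℝ => -(Real.log (1 - v) / v)) volume 0 x := by
    rw [intervalIntegrable_iff]
    refine integrableOn_neg_log_div.mono_set ?_
    rw [Set.uIoc_of_le h0.le, Set.uIcc_of_le zero_le_one]
    exact fun v hv => ⟨hv.1.le, hv.2.trans h1.le⟩
  refine intervalIntegral.integral_hasDerivAt_right hInt ?_ hc
  have hm : Measurable fun v : ℝ => -(Real.log (1 - v) / v) :=
    ((Real.measurable_log.comp (measurable_const.sub measurable_id)).div measurable_id).neg
  exact hm.stronglyMeasurable.stronglyMeasurableAtFilter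

theorem Gtilde_eq (t : ℝ) : Gtilde t = 1 / (4 * Real.pi ^ 2) * dilog (t ^ 2) := by
  rw [Gtilde, dilog, intervalIntegral.integral_neg]
  ring

/-- Partial fractions in `t` give the primitive `(log(1+t) - log((1+s)(1+t) - rst))/(s(1+s))`. It
tends to `-log(1+s-rs)/(s(1+s))` at infinity, where the leading terms in `t` cancel. -/
theorem integral_Ioi_inner {r s : ℝ} (hr0 : 0 ≤ r) (hr1 : r ≤ 1) (hs : 0 < s) :
    ∫ t in Set.Ioi (0 : ℝ), r / ((1 + s) * (1 + t) * ((1 + s) * (1 + t) - r * s * t))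
      = -Real.log (1 - r * s / (1 + s)) / (s * (1 + s)) := by
  have hB : 0 < 1 + s - r * s := by nlinarith
  have hden : ∀ t : ℝ, 0 ≤ t → 0 < (1 + s) * (1 + t) - r * s * t := fun t ht => by
    nlinarith [mul_nonneg hs.le ht, mul_nonneg (sub_nonneg.2 hr1) (mul_nonneg hs.le ht)]
  have hder : ∀ t ∈ Set.Ici (0 : ℝ), HasDerivAt
      (fun t => (Real.log (1 + t) - Real.log ((1 + s) * (1 + t) - r * s * t)) / (s * (1 + s)))
      (r / ((1 + s) * (1 + t) * ((1 + s) * (1 + t) - r * s * t))) t := by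
    intro t ht
    have ht0 : (0 : ℝ) ≤ t := ht
    have h1 : HasDerivAt (fun t : ℝ => 1 + t) 1 t := (hasDerivAt_id t).const_add 1
    have h2 : HasDerivAt (fun t : ℝ => (1 + s) * (1 + t) - r * s * t)
        ((1 + s) * 1 - r * s * 1) t :=
      (h1.const_mul (1 + s)).sub ((hasDerivAt_id t).const_mul (r * s))
    have h3 := ((h1.log (by linarith)).sub (h2.log (hden t ht0).ne')).div_const (s * (1 + s))
    refine HasDerivAt.congr_deriv (f := fun t => (Real.log (1 + t) -
      Real.log ((1 + s) * (1 + t) - r * s * t)) / (s * (1 + s))) h3 ?_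
    have := (hden t ht0).ne'
    have h4 : (1 + t) ≠ 0 := by linarith
    have h5 : (1 + s) ≠ 0 := by linarith
    rw [div_sub_div _ _ h4 this, div_div, div_eq_div_iff (by positivity) (by positivity)]
    ring
  have hlim : Filter.Tendsto
      (fun t => (Real.log (1 + t) - Real.log ((1 + s) * (1 + t) - r * s * t)) / (s * (1 + s)))
      Filter.atTop (𝓝 ((-Real.log (1 + s - r * s)) / (s * (1 + s)))) := by
    refine Filter.Tendsto.div_const ?_ _
    have h1 : Filter.Tendsto (fun t : ℝ => -Real.log ((1 + s - r * s) + r * s * (1 + t)⁻¹))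
        Filter.atTop (𝓝 (-Real.log ((1 + s - r * s) + r * s * 0))) := by
      refine (Filter.Tendsto.log ?_ (by rw [mul_zero, add_zero]; exact hB.ne')).neg
      refine tendsto_const_nhds.add (tendsto_const_nhds.mul ?_)
      exact tendsto_inv_atTop_zero.comp (Filter.tendsto_atTop_add_const_left _ _ Filter.tendsto_id)
    rw [mul_zero, add_zero] at h1
    refine h1.congr' ?_
    filter_upwards [Filter.eventually_ge_atTop (0 : ℝ)] with t ht
    have h4 : 0 < 1 + t := by linarith
    rw [← Real.log_div h4.ne' (hden t ht).ne', ← Real.log_inv, inv_eq_one_div]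
    congr 1
    rw [div_eq_div_iff (by have := mul_nonneg (mul_nonneg hr0 hs.le) (inv_nonneg.2 h4.le); positivity) (hden t ht).ne']
    field_simp
    ring
  rw [integral_Ioi_of_hasDerivAt_of_nonneg' hder (fun t ht => ?_) hlim]
  · have h5 : (1 + s) ≠ 0 := by linarith
    have h6 : 1 - r * s / (1 + s) = (1 + s - r * s) / (1 + s) := by field_simp
    rw [h6, Real.log_div hB.ne' h5]
    simp only [add_zero, Real.log_one, mul_one, mul_zero, sub_zero]
    ring
  · have ht0 : (0 : ℝ) ≤ t := (Set.mem_Ioi.1 ht).le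
    have := hden t ht0
    positivity

/-- Under `v = rs/(1+s)` one has `dv/v = ds/(s(1+s))`, so the integrand is the derivative of `dilog
(r * s / (1 + s))`, which runs from `0` to `dilog r`. At `r = 1` the endpoint is reached by
continuity of `dilog` on `[0, 1]` alone. -/
theorem integral_Ioi_outer {r : ℝ} (hr0 : 0 ≤ r) (hr1 : r ≤ 1) :
    ∫ s in Set.Ioi (0 : ℝ), -Real.log (1 - r * s / (1 + s)) / (s * (1 + s)) = dilog r := by
  rcases hr0.eq_or_lt with rfl | hr
  · simp [dilog_zero]
  have hmem : ∀ s : ℝ, 0 ≤ s → r * s / (1 + s) ∈ Set.Icc (0 : ℝ) 1 := fun s hs => by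
    refine ⟨by positivity, ?_⟩
    rw [div_le_one (by linarith)]
    nlinarith
  have hder : ∀ s ∈ Set.Ioi (0 : ℝ), HasDerivAt (fun s => dilog (r * s / (1 + s)))
      (-Real.log (1 - r * s / (1 + s)) / (s * (1 + s))) s := by
    intro s hs
    have hs0 : 0 < s := hs
    have h1 : HasDerivAt (fun s : ℝ => r * s / (1 + s)) (r / (1 + s) ^ 2) s := by
      have h := ((hasDerivAt_id s).const_mul r).div ((hasDerivAt_id s).const_add 1)
        (show (1 : ℝ) + s ≠ 0 by linarith)
      refine HasDerivAt.congr_deriv (f := fun s : ℝ => r * s / (1 + s)) h ?_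
      simp only [id_eq]
      ring
    have hlt : r * s / (1 + s) < 1 := by
      rw [div_lt_one (by linarith)]
      nlinarith
    have h2 := (hasDerivAt_dilog (show 0 < r * s / (1 + s) by positivity) hlt).comp s h1
    refine HasDerivAt.congr_deriv (f := fun s => dilog (r * s / (1 + s))) h2 ?_
    have : 1 + s ≠ 0 := by linarith
    field_simp
  have hcont : ContinuousWithinAt (fun s => dilog (r * s / (1 + s))) (Set.Ici 0) 0 := by
    refine ContinuousWithinAt.comp (t := Set.Icc 0 1) (f := fun s : ℝ => r * s / (1 + s))
      (continuousOn_dilog _ (hmem 0 le_rfl)) ?_ fun s hs => hmem s hs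
    refine ContinuousAt.continuousWithinAt ?_
    exact (by fun_prop : ContinuousAt (fun s : ℝ => r * s) 0).div (by fun_prop) (by norm_num)
  have hlim : Filter.Tendsto (fun s => dilog (r * s / (1 + s))) Filter.atTop (𝓝 (dilog r)) := by
    have h1 : Filter.Tendsto (fun s : ℝ => r * s / (1 + s)) Filter.atTop (𝓝[Set.Icc 0 1] r) := by
      refine tendsto_nhdsWithin_iff.2 ⟨?_, ?_⟩
      · have h2 : Filter.Tendsto (fun s : ℝ => r - r * (1 + s)⁻¹) Filter.atTop (𝓝 (r - r * 0)) :=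
          tendsto_const_nhds.sub (tendsto_const_nhds.mul (tendsto_inv_atTop_zero.comp
            (Filter.tendsto_atTop_add_const_left _ _ Filter.tendsto_id)))
        rw [mul_zero, sub_zero] at h2
        refine h2.congr' ?_
        filter_upwards [Filter.eventually_ge_atTop (0 : ℝ)] with s hs
        have : (1 + s) ≠ 0 := by linarith
        field_simp
        ring
      · filter_upwards [Filter.eventually_ge_atTop (0 : ℝ)] with s hs using hmem s hs
    exact (continuousOn_dilog r ⟨hr0, hr1⟩).tendsto.comp h1
  rw [integral_Ioi_of_hasDerivAt_of_nonneg hcont hder (fun s hs => ?_) hlim]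
  · simp [dilog_zero]
  · have hs0 : 0 < s := hs
    refine div_nonneg (neg_nonneg.2 (Real.log_nonpos ?_ ?_)) (by positivity)
    · linarith [(hmem s hs0.le).2]
    · linarith [(hmem s hs0.le).1]

end Dilog

/-! ### The logarithm as an integral -/

section Frullani

/-- The kernel of the Frullani integral of the logarithm. -/
def logKernel (s x : ℝ) : ℝ := s⁻¹ * (Real.exp (-s) - Real.exp (-(s * x)))

theorem abs_exp_sub_exp_le (p q : ℝ) :
    |Real.exp (-p) - Real.exp (-q)| ≤ |p - q| * Real.exp (-min p q) := by
  wlog h : p ≤ q generalizing p q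
  · rw [abs_sub_comm, abs_sub_comm p, min_comm]
    exact this q p (le_of_not_ge h)
  rw [min_eq_left h, abs_of_nonneg (sub_nonneg.2 (Real.exp_le_exp.2 (by linarith))), abs_sub_comm,
    abs_of_nonneg (sub_nonneg.2 h)]
  have h1 := Real.add_one_le_exp (-(q - p))
  have h2 : Real.exp (-q) = Real.exp (-p) * Real.exp (-(q - p)) := by
    rw [← Real.exp_add]; congr 1; ring
  rw [h2]
  nlinarith [Real.exp_pos (-p)]

/-- The difference of exponentials is at most `s|1 - x|` times the larger one. This cancels `s⁻¹`
and leaves exponential decay of rate `min 1 x`. -/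
theorem integrableOn_logKernel {x : ℝ} (hx : 0 < x) :
    IntegrableOn (fun s => logKernel s x) (Set.Ioi 0) := by
  set m := min 1 x with hm
  have hm0 : 0 < m := lt_min one_pos hx
  have h1 : IntegrableOn (fun s : ℝ => |1 - x| * Real.exp (-m * s)) (Set.Ioi 0) :=
    (exp_neg_integrableOn_Ioi 0 hm0).const_mul _
  refine Integrable.mono' h1 ?_ ?_
  · exact (by unfold logKernel; fun_prop : Measurable fun s => logKernel s x).aestronglyMeasurable
  · refine (ae_restrict_iff' measurableSet_Ioi).2 (Filter.Eventually.of_forall fun s hs => ?_)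
    have hs0 : 0 < s := hs
    have h2 := abs_exp_sub_exp_le s (s * x)
    rw [logKernel, norm_mul, Real.norm_eq_abs, Real.norm_eq_abs, abs_of_pos (inv_pos.2 hs0)]
    have h3 : min s (s * x) = m * s := by
      conv_lhs => rw [← mul_one s, mul_assoc, one_mul]
      rw [← mul_min_of_nonneg _ _ hs0.le, mul_comm, hm]
    have h4 : |s - s * x| = s * |1 - x| := by
      rw [show s - s * x = s * (1 - x) by ring, abs_mul, abs_of_pos hs0]
    rw [h3, h4] at h2
    calc s⁻¹ * |Real.exp (-s) - Real.exp (-(s * x))|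
        ≤ s⁻¹ * (s * |1 - x| * Real.exp (-(m * s))) :=
          mul_le_mul_of_nonneg_left h2 (inv_nonneg.2 hs0.le)
      _ = |1 - x| * Real.exp (-m * s) := by
          rw [neg_mul]; field_simp

/-- This is Frullani's integral for `e^{-s}`. It trades the logarithm of a Gaussian variable for
exponentials whose expectations are explicit. -/
theorem integral_logKernel {x : ℝ} (hx : 0 < x) :
    ∫ s in Set.Ioi 0, logKernel s x = Real.log x := by
  have hc : Continuous fun s : ℝ => Real.exp (-s) := by fun_prop
  have h := Frullani.integral_Ioi_eq (f := fun s : ℝ => Real.exp (-s)) (a := 1) (b := x) (L := 1)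
    (R := 0) (hc.locallyIntegrable.locallyIntegrableOn _) one_pos hx
    (by
      have := hc.tendsto 0
      simp only [neg_zero, Real.exp_zero] at this
      exact this.mono_left nhdsWithin_le_nhds)
    (Real.tendsto_exp_neg_atTop_nhds_zero)
    (by
      refine (integrableOn_logKernel hx).congr_fun (fun s _ => ?_) measurableSet_Ioi
      simp [logKernel, mul_comm])
  simp only [one_mul, div_one, sub_zero, smul_eq_mul, mul_one] at h
  rw [← h]
  refine integral_congr_ae (Filter.Eventually.of_forall fun s => ?_)
  simp [logKernel, mul_comm]

/-- For fixed `x` the kernel has constant sign on `s > 0`, so nothing is lost by taking absolute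
values. Integrability of products of logarithms thus passes directly to products of kernels. -/
theorem integral_norm_logKernel {x : ℝ} (hx : 0 < x) :
    ∫ s in Set.Ioi 0, ‖logKernel s x‖ = |Real.log x| := by
  rcases le_total 1 x with h | h
  · rw [abs_of_nonneg (Real.log_nonneg h), ← integral_logKernel hx]
    refine setIntegral_congr_fun measurableSet_Ioi fun s hs => ?_
    have hs0 : 0 < s := hs
    refine Real.norm_of_nonneg (mul_nonneg (inv_nonneg.2 hs0.le) (sub_nonneg.2
      (Real.exp_le_exp.2 ?_)))
    nlinarith
  · rw [abs_of_nonpos (Real.log_nonpos hx.le h), ← integral_logKernel hx, ← integral_neg]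
    refine setIntegral_congr_fun measurableSet_Ioi fun s hs => ?_
    have hs0 : 0 < s := hs
    refine Real.norm_of_nonpos (mul_nonpos_of_nonneg_of_nonpos (inv_nonneg.2 hs0.le) (sub_nonpos.2
      (Real.exp_le_exp.2 ?_)))
    nlinarith

theorem measurable_logKernel : Measurable fun q : ℝ × ℝ => logKernel q.1 q.2 := by
  unfold logKernel
  fun_prop

end Frullani

/-! ### Complex Gaussian variables -/

section Gaussian

/-- The standard complex Gaussian law `π⁻¹ exp(-|z|²) dz` on `ℂ`. -/
def gaussC : Measure ℂ :=
  volume.withDensity fun z => ENNReal.ofReal (Real.pi⁻¹ * Real.exp (-‖z‖ ^ 2))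

theorem integral_gaussC {G : Type*} [NormedAddCommGroup G] [NormedSpace ℝ G] (g : ℂ → G) :
    ∫ z, g z ∂gaussC = ∫ z, (Real.pi⁻¹ * Real.exp (-‖z‖ ^ 2)) • g z := by
  rw [gaussC, integral_withDensity_eq_integral_toReal_smul
    (by fun_prop) (Filter.Eventually.of_forall fun _ => ENNReal.ofReal_lt_top)]
  refine integral_congr_ae (Filter.Eventually.of_forall fun z => ?_)
  simp only
  rw [ENNReal.toReal_ofReal (by positivity)]

/-- The Gaussian density raises `b` to `1 + b`, and in real dimension two the normalization
`π/(1+b)` has no square root. The case `k = 0` is the Laplace transform of `|z|²`, the case `b = 0`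
a characteristic function. -/
theorem integral_gaussC_cexp {b : ℝ} (hb : -1 < b) (k w : ℂ) :
    ∫ z, Complex.exp (-(b : ℂ) * (‖z‖ : ℂ) ^ 2 + k * ((inner ℝ w z : ℝ) : ℂ)) ∂gaussC
      = (1 + (b : ℂ))⁻¹ * Complex.exp (k ^ 2 * (‖w‖ : ℂ) ^ 2 / (4 * (1 + b))) := by
  have hb' : 0 < ((1 + b : ℝ) : ℂ).re := by rw [Complex.ofReal_re]; linarith
  have h := GaussianFourier.integral_cexp_neg_mul_sq_norm_add hb' k w
  have hpi : (Real.pi : ℂ) ≠ 0 := Complex.ofReal_ne_zero.2 Real.pi_ne_zero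
  rw [Complex.finrank_real_complex] at h
  push_cast at h
  rw [div_self two_ne_zero, Complex.cpow_one] at h
  rw [integral_gaussC]
  calc _ = ∫ z : ℂ, (Real.pi : ℂ)⁻¹ *
        Complex.exp (-(1 + (b : ℂ)) * (‖z‖ : ℂ) ^ 2 + k * ((inner ℝ w z : ℝ) : ℂ)) := by
        refine integral_congr_ae (Filter.Eventually.of_forall fun z => ?_)
        simp only [Complex.real_smul]
        push_cast
        rw [mul_assoc, ← Complex.exp_add]
        congr 2
        ring
    _ = _ := by
        rw [integral_const_mul, h]
        field_simp

instance : IsProbabilityMeasure gaussC := by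
  have h := integral_gaussC_cexp (b := 0) (by norm_num) 0 0
  simp only [Complex.ofReal_zero, neg_zero, zero_mul, add_zero, Complex.exp_zero, inv_one,
    ne_eq, OfNat.ofNat_ne_zero, not_false_eq_true, zero_pow, zero_div,
    integral_const, Complex.real_smul, mul_one] at h
  have h1 : gaussC.real Set.univ = 1 := by exact_mod_cast h
  exact ⟨by rwa [Measure.real, ENNReal.toReal_eq_one_iff] at h1⟩

variable {d : ℕ}

theorem integral_gaussian {G : Type*} [NormedAddCommGroup G] [NormedSpace ℝ G]
    (g : (Fin d → ℂ) → G) :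
    ∫ c, g c ∂gaussian d = ∫ c, ((Real.pi ^ d)⁻¹ * Real.exp (-∑ j, ‖c j‖ ^ 2)) • g c := by
  rw [gaussian, integral_withDensity_eq_integral_toReal_smul
    (by fun_prop) (Filter.Eventually.of_forall fun _ => ENNReal.ofReal_lt_top)]
  refine integral_congr_ae (Filter.Eventually.of_forall fun z => ?_)
  simp only
  rw [ENNReal.toReal_ofReal (by positivity)]

/-- The bilinear pairing on `ℂᵈ`. -/
def dot (c a : Fin d → ℂ) : ℂ := ∑ j, c j * a j

/-- The squared norm on `ℂᵈ`. -/
def nsq (a : Fin d → ℂ) : ℝ := ∑ j, ‖a j‖ ^ 2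

/-- The integral factors over the coordinates. The factor `2` in the exponent is chosen so that the
answer is `exp(-|w|²)` without a constant. -/
theorem integral_gaussian_cexp (w : Fin d → ℂ) :
    ∫ c, Complex.exp (2 * Complex.I * ((dot c w).re : ℂ)) ∂gaussian d
      = Complex.exp (-(nsq w : ℂ)) := by
  rw [integral_gaussian]
  calc _ = ∫ c : Fin d → ℂ, ∏ j, ((Real.pi⁻¹ * Real.exp (-‖c j‖ ^ 2)) •
        Complex.exp (-((0 : ℝ) : ℂ) * (‖c j‖ : ℂ) ^ 2 +
          2 * Complex.I * ((inner ℝ (starRingEnd ℂ (w j)) (c j) : ℝ) : ℂ))) := by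
        refine integral_congr_ae (Filter.Eventually.of_forall fun c => ?_)
        simp only [Complex.real_smul]
        rw [Finset.prod_mul_distrib, ← Complex.exp_sum]
        congr 1
        · rw [← Complex.ofReal_prod, Finset.prod_mul_distrib, ← Real.exp_sum, Finset.prod_const,
            Finset.card_univ, Fintype.card_fin, Finset.sum_neg_distrib, inv_pow]
        · congr 1
          rw [dot, Complex.re_sum, Complex.ofReal_sum, Finset.mul_sum]
          refine Finset.sum_congr rfl fun j _ => ?_
          rw [Complex.ofReal_zero, neg_zero, zero_mul, zero_add]
          congr 2
          simp [Complex.inner, mul_comm]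
    _ = _ := by
        rw [integral_fintype_prod_volume_eq_prod (fun j z => (Real.pi⁻¹ * Real.exp (-‖z‖ ^ 2)) •
          Complex.exp (-((0 : ℝ) : ℂ) * (‖z‖ : ℂ) ^ 2 +
          2 * Complex.I * ((inner ℝ (starRingEnd ℂ (w j)) z : ℝ) : ℂ)))]
        simp only [← integral_gaussC]
        simp only [integral_gaussC_cexp (b := 0) (by norm_num)]
        rw [nsq, Complex.ofReal_sum, ← Finset.sum_neg_distrib, Complex.exp_sum]
        refine Finset.prod_congr rfl fun j _ => ?_
        simp only [Complex.ofReal_zero, add_zero, inv_one, one_mul, mul_one, RCLike.norm_conj,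
          mul_pow, Complex.I_sq]
        congr 1
        push_cast
        ring

instance : IsProbabilityMeasure (gaussian d) := by
  have h := integral_gaussian_cexp (d := d) 0
  simp only [dot, nsq, Pi.zero_apply, mul_zero, Finset.sum_const_zero, Complex.zero_re,
    Complex.ofReal_zero, mul_zero, Complex.exp_zero, norm_zero, ne_eq, OfNat.ofNat_ne_zero,
    not_false_eq_true, zero_pow, neg_zero, integral_const, Complex.real_smul, mul_one] at h
  have h1 : (gaussian d).real Set.univ = 1 := by exact_mod_cast h
  exact ⟨by rwa [Measure.real, ENNReal.toReal_eq_one_iff] at h1⟩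

theorem continuous_dot (a : Fin d → ℂ) : Continuous fun c => dot c a := by
  unfold dot; fun_prop

theorem dot_smul (c : Fin d → ℂ) (r : ℂ) (a : Fin d → ℂ) : dot c (r • a) = r * dot c a := by
  simp only [dot, Pi.smul_apply, smul_eq_mul, Finset.mul_sum]
  exact Finset.sum_congr rfl fun j _ => by ring

theorem nsq_smul (r : ℂ) (a : Fin d → ℂ) : nsq (r • a) = ‖r‖ ^ 2 * nsq a := by
  simp only [nsq, Pi.smul_apply, smul_eq_mul, Finset.mul_sum, norm_mul, mul_pow]

theorem nsq_nonneg (a : Fin d → ℂ) : 0 ≤ nsq a := Finset.sum_nonneg fun _ _ => by positivity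

theorem nsq_pos {a : Fin d → ℂ} (ha : a ≠ 0) : 0 < nsq a := by
  obtain ⟨j, hj⟩ := Function.ne_iff.1 ha
  exact Finset.sum_pos' (fun _ _ => by positivity) ⟨j, Finset.mem_univ _, by
    have := norm_pos_iff.2 hj; positivity⟩

/-- The two laws have the same characteristic function `exp(-|t|²/4)`. -/
theorem map_dot_gaussian {a : Fin d → ℂ} (ha : nsq a = 1) :
    (gaussian d).map (fun c => dot c a) = gaussC := by
  have hm : Measurable fun c => dot c a := (continuous_dot a).measurable
  have : IsProbabilityMeasure ((gaussian d).map fun c => dot c a) :=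
    Measure.isProbabilityMeasure_map hm.aemeasurable
  refine Measure.ext_of_charFun (funext fun t => ?_)
  rw [charFun_apply, charFun_apply, integral_map hm.aemeasurable
    (by fun_prop : Continuous _).aestronglyMeasurable]
  have h1 := integral_gaussian_cexp ((starRingEnd ℂ t / 2) • a)
  have h2 := integral_gaussC_cexp (b := 0) (by norm_num) Complex.I t
  calc _ = ∫ c, Complex.exp (2 * Complex.I *
        ((dot c ((starRingEnd ℂ t / 2) • a)).re : ℂ)) ∂gaussian d := by
        refine integral_congr_ae (Filter.Eventually.of_forall fun c => ?_)
        simp only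
        congr 1
        rw [dot_smul, Complex.inner]
        have : starRingEnd ℂ t / 2 * dot c a = ((1 / 2 : ℝ) : ℂ) * (starRingEnd ℂ t * dot c a) := by
          push_cast; ring
        rw [this, Complex.re_ofReal_mul]
        simp only [Complex.mul_re, Complex.conj_re, Complex.conj_im]
        push_cast
        ring
    _ = _ := by
        rw [h1, nsq_smul, ha]
        simp only [real_inner_comm]
        calc _ = Complex.exp (Complex.I ^ 2 * (‖t‖ : ℂ) ^ 2 / (4 * (1 + (0 : ℝ)))) := by
              rw [norm_div, RCLike.norm_conj, Complex.I_sq]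
              congr 1
              push_cast
              rw [show ‖(2 : ℂ)‖ = 2 by norm_num]
              push_cast
              ring
          _ = _ := by
              rw [Complex.ofReal_zero, add_zero, inv_one, one_mul] at h2
              rw [Complex.ofReal_zero, add_zero, ← h2]
              refine integral_congr_ae (Filter.Eventually.of_forall fun c => ?_)
              simp only [neg_zero, zero_mul, zero_add, mul_comm]

/-- The growth `r⁻¹` at the origin is integrable in the plane, since the polar Jacobian supplies a
factor `r`. Hence the squared logarithm has finite Gaussian expectation. -/
theorem log_sq_sq_le (r : ℝ) (hr : 0 ≤ r) : Real.log (r ^ 2) ^ 2 ≤ 16 * (r + r⁻¹) := by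
  have key : ∀ x : ℝ, 1 ≤ x → Real.log x ^ 2 ≤ 4 * x := by
    intro x hx
    have h0 : 0 < √x := Real.sqrt_pos.2 (by linarith)
    have h1 := Real.log_le_sub_one_of_pos h0
    have h2 : Real.log x = 2 * Real.log √x := by
      rw [Real.log_sqrt (by linarith)]; ring
    have h3 : 0 ≤ Real.log √x := Real.log_nonneg (Real.one_le_sqrt.2 hx)
    have h4 := Real.sq_sqrt (show 0 ≤ x by linarith)
    rw [h2]
    nlinarith
  rcases hr.eq_or_lt with rfl | hr0
  · simp
  rw [Real.log_pow]
  push_cast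
  have hi : 0 < r⁻¹ := inv_pos.2 hr0
  rcases le_total 1 r with h | h
  · have := key r h
    nlinarith
  · have := key r⁻¹ (by rw [one_le_inv₀ hr0]; exact h)
    rw [Real.log_inv] at this
    nlinarith

theorem integrable_gaussC_iff {g : ℂ → ℝ} :
    Integrable g gaussC ↔ Integrable fun z => Real.pi⁻¹ * Real.exp (-‖z‖ ^ 2) * g z := by
  rw [gaussC, integrable_withDensity_iff_integrable_smul' (by fun_prop)
    (Filter.Eventually.of_forall fun _ => ENNReal.ofReal_lt_top)]
  refine integrable_congr (Filter.Eventually.of_forall fun z => ?_)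
  simp only [smul_eq_mul]
  rw [ENNReal.toReal_ofReal (by positivity)]

theorem integrable_log_sq_gaussC : Integrable (fun z => Real.log (‖z‖ ^ 2) ^ 2) gaussC := by
  have h1 : Integrable (fun z : ℂ => ‖z‖ + ‖z‖⁻¹) gaussC := by
    rw [integrable_gaussC_iff]
    refine (integrable_fun_norm_addHaar (volume : Measure ℂ) (F := ℝ)
      (f := fun y => Real.pi⁻¹ * Real.exp (-y ^ 2) * (y + y⁻¹))).2 ?_
    rw [Complex.finrank_real_complex]
    have h2 : Integrable fun y : ℝ => Real.pi⁻¹ * (y ^ (2 : ℝ) * Real.exp (-1 * y ^ 2) +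
        Real.exp (-1 * y ^ 2)) :=
      ((integrable_rpow_mul_exp_neg_mul_sq one_pos (by norm_num)).add
        (integrable_exp_neg_mul_sq one_pos)).const_mul _
    refine (h2.integrableOn (s := Set.Ioi 0)).congr_fun (fun y hy => ?_) measurableSet_Ioi
    have hy0 : (0 : ℝ) < y := hy
    simp only [smul_eq_mul, Nat.add_one_sub_one, pow_one, neg_mul, one_mul, Real.rpow_two]
    field_simp
  refine Integrable.mono' (h1.const_mul 16)
    (by fun_prop : Measurable fun z : ℂ => Real.log (‖z‖ ^ 2) ^ 2).aestronglyMeasurable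
    (Filter.Eventually.of_forall fun z => ?_)
  rw [Real.norm_of_nonneg (sq_nonneg _)]
  exact log_sq_sq_le _ (norm_nonneg z)

theorem ae_gaussC_ne_zero : ∀ᵐ z ∂gaussC, z ≠ 0 :=
  (withDensity_absolutelyContinuous _ _).ae_le (Measure.ae_ne volume 0)

/-- The mean of `log|z|²` for a standard complex Gaussian `z`. -/
def logMean : ℝ := ∫ z, Real.log (‖z‖ ^ 2) ∂gaussC

/-- The second moment of `log|z|²` for a standard complex Gaussian `z`. -/
def logMoment : ℝ := ∫ z, Real.log (‖z‖ ^ 2) ^ 2 ∂gaussC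

theorem memLp_log_gaussC : MemLp (fun z => Real.log (‖z‖ ^ 2)) 2 gaussC :=
  (memLp_two_iff_integrable_sq
    (by fun_prop : Measurable fun z : ℂ => Real.log (‖z‖ ^ 2)).aestronglyMeasurable).2
    integrable_log_sq_gaussC

variable {a b : Fin d → ℂ}

/-- The normalization of a vector. -/
def unitize (a : Fin d → ℂ) : Fin d → ℂ := (((√(nsq a))⁻¹ : ℝ) : ℂ) • a

theorem nsq_unitize (ha : a ≠ 0) : nsq (unitize a) = 1 := by
  have hn := nsq_pos ha
  rw [unitize, nsq_smul, Complex.norm_real, Real.norm_of_nonneg (by positivity), inv_pow,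
    Real.sq_sqrt hn.le, inv_mul_cancel₀ hn.ne']

theorem ae_dot_ne_zero (ha : a ≠ 0) : ∀ᵐ c ∂gaussian d, dot c a ≠ 0 := by
  have h2 := ae_gaussC_ne_zero
  rw [← map_dot_gaussian (nsq_unitize ha)] at h2
  filter_upwards [ae_of_ae_map (continuous_dot _).measurable.aemeasurable h2] with c hc h0
  exact hc (by rw [unitize, dot_smul, h0, mul_zero])

/-- Normalizing `a` splits the logarithm into a nonrandom term and the logarithm of a standard
Gaussian variable. The null set where the pairing vanishes is excluded, since there `Real.log 0 = 0`
would break the identity. -/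
theorem ae_log_dot (ha : a ≠ 0) : ∀ᵐ c ∂gaussian d,
    Real.log (‖dot c a‖ ^ 2) = Real.log (nsq a) + Real.log (‖dot c (unitize a)‖ ^ 2) := by
  have hn := nsq_pos ha
  filter_upwards [ae_dot_ne_zero ha] with c hc
  have h1 : ‖dot c (unitize a)‖ ^ 2 = (nsq a)⁻¹ * ‖dot c a‖ ^ 2 := by
    rw [unitize, dot_smul, norm_mul, Complex.norm_real, Real.norm_of_nonneg (by positivity),
      mul_pow, inv_pow, Real.sq_sqrt hn.le]
  rw [h1, Real.log_mul (inv_ne_zero hn.ne') (pow_ne_zero _ (norm_ne_zero_iff.2 hc)), Real.log_inv]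
  ring

theorem memLp_log_dot_unit (ha : nsq a = 1) :
    MemLp (fun c => Real.log (‖dot c a‖ ^ 2)) 2 (gaussian d) := by
  have h := memLp_log_gaussC
  rw [← map_dot_gaussian ha] at h
  exact (memLp_map_measure_iff h.1 (continuous_dot _).measurable.aemeasurable).1 h

theorem memLp_log_dot (ha : a ≠ 0) :
    MemLp (fun c => Real.log (‖dot c a‖ ^ 2)) 2 (gaussian d) := by
  have h1 : MemLp (fun c => Real.log (nsq a) + Real.log (‖dot c (unitize a)‖ ^ 2)) 2
      (gaussian d) := (memLp_const (Real.log (nsq a))).add (memLp_log_dot_unit (nsq_unitize ha))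
  exact h1.ae_eq ((ae_log_dot ha).mono fun c hc => hc.symm)

theorem integral_dot_unit (ha : nsq a = 1) {g : ℂ → ℝ} (hg : Measurable g) :
    ∫ c, g (dot c a) ∂gaussian d = ∫ z, g z ∂gaussC := by
  rw [← map_dot_gaussian ha, integral_map (continuous_dot _).measurable.aemeasurable
    hg.aestronglyMeasurable]

/-- The number `logMean` never has to be evaluated: it shifts the mean by a constant and drops out
of the covariance. -/
theorem integral_log_dot (ha : a ≠ 0) :
    ∫ c, Real.log (‖dot c a‖ ^ 2) ∂gaussian d = Real.log (nsq a) + logMean := by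
  rw [integral_congr_ae (ae_log_dot ha), integral_add (integrable_const _)
    ((memLp_log_dot_unit (nsq_unitize ha)).integrable (by norm_num)),
    integral_dot_unit (nsq_unitize ha) (g := fun z => Real.log (‖z‖ ^ 2)) (by fun_prop), logMean]
  simp

theorem integral_log_dot_sq (ha : a ≠ 0) :
    ∫ c, Real.log (‖dot c a‖ ^ 2) ^ 2 ∂gaussian d
      = Real.log (nsq a) ^ 2 + 2 * Real.log (nsq a) * logMean + logMoment := by
  have hu := memLp_log_dot_unit (nsq_unitize ha)
  have h1 : ∀ᵐ c ∂gaussian d, Real.log (‖dot c a‖ ^ 2) ^ 2 =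
      Real.log (nsq a) ^ 2 + 2 * Real.log (nsq a) * Real.log (‖dot c (unitize a)‖ ^ 2)
        + Real.log (‖dot c (unitize a)‖ ^ 2) ^ 2 := by
    filter_upwards [ae_log_dot ha] with c hc
    rw [hc]; ring
  have i1 := (hu.integrable (by norm_num)).const_mul (2 * Real.log (nsq a))
  have i2 : Integrable (fun c => Real.log (nsq a) ^ 2 +
      2 * Real.log (nsq a) * Real.log (‖dot c (unitize a)‖ ^ 2)) (gaussian d) :=
    (integrable_const _).add i1
  rw [integral_congr_ae h1, integral_add i2 hu.integrable_sq,
    integral_add (integrable_const _) i1, integral_const_mul,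
    integral_dot_unit (nsq_unitize ha) (g := fun z => Real.log (‖z‖ ^ 2)) (by fun_prop),
    integral_dot_unit (nsq_unitize ha) (g := fun z => Real.log (‖z‖ ^ 2) ^ 2) (by fun_prop),
    logMean, logMoment]
  simp

end Gaussian

/-! ### The covariance of the logarithms of two Gaussian variables -/

section Covariance

variable {d : ℕ} {a b : Fin d → ℂ}

/-- The Hermitian product on `ℂᵈ`, linear in the first variable. -/
def herm (a b : Fin d → ℂ) : ℂ := ∑ j, a j * starRingEnd ℂ (b j)

theorem norm_herm_sq_le (a b : Fin d → ℂ) : ‖herm a b‖ ^ 2 ≤ nsq a * nsq b := by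
  have h1 : ‖herm a b‖ ≤ ∑ j, ‖a j‖ * ‖b j‖ := by
    refine (norm_sum_le _ _).trans (Finset.sum_le_sum fun j _ => ?_)
    rw [norm_mul, RCLike.norm_conj]
  calc ‖herm a b‖ ^ 2 ≤ (∑ j, ‖a j‖ * ‖b j‖) ^ 2 := pow_le_pow_left₀ (norm_nonneg _) h1 2
    _ ≤ _ := Finset.sum_mul_sq_le_sq_mul_sq _ _ _

/-- An auxiliary Gaussian variable `ζ` linearizes the square: the characteristic function of `ζ` at
`√s x` is `exp(-s|x|²)`. Afterwards the exponent is linear in `x`, hence in the coefficients `c`. -/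
theorem cexp_neg_mul_norm_sq {s : ℝ} (hs : 0 ≤ s) (x : ℂ) :
    Complex.exp (-(s : ℂ) * (‖x‖ : ℂ) ^ 2)
      = ∫ ζ, Complex.exp (2 * Complex.I * (((√s : ℂ) * ζ * x).re : ℂ)) ∂gaussC := by
  have h := integral_gaussC_cexp (b := 0) (by norm_num) (2 * Complex.I)
    (starRingEnd ℂ ((√s : ℂ) * x))
  simp only [Complex.ofReal_zero, neg_zero, zero_mul, zero_add, add_zero, inv_one, one_mul,
    RCLike.norm_conj, norm_mul, Complex.norm_real, Real.norm_of_nonneg (Real.sqrt_nonneg s)] at h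
  rw [show -(s : ℂ) * (‖x‖ : ℂ) ^ 2 = (2 * Complex.I) ^ 2 * ((√s * ‖x‖ : ℝ) : ℂ) ^ 2 / (4 * 1) by
    rw [mul_pow, Complex.I_sq, ← Complex.ofReal_pow (√s * ‖x‖), mul_pow, Real.sq_sqrt hs]
    push_cast
    ring, ← h]
  refine integral_congr_ae (Filter.Eventually.of_forall fun ζ => ?_)
  simp only [Complex.inner, Complex.conj_conj]
  congr 4
  ring

theorem nsq_add_smul (z w : ℂ) (a b : Fin d → ℂ) :
    nsq (z • a + w • b) = ‖z‖ ^ 2 * nsq a + ‖w‖ ^ 2 * nsq b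
      + 2 * (z * starRingEnd ℂ w * herm a b).re := by
  simp only [nsq, herm, Finset.mul_sum, Complex.re_sum, ← Finset.sum_add_distrib]
  refine Finset.sum_congr rfl fun j _ => ?_
  simp only [Pi.add_apply, Pi.smul_apply, smul_eq_mul, ← Complex.normSq_eq_norm_sq]
  rw [Complex.normSq_add, Complex.normSq_mul, Complex.normSq_mul, map_mul]
  congr 3
  ring

/-- Both squares are linearized by independent auxiliary variables `ζ` and `η`. Averaging over `c`
then evaluates a characteristic function at `√s ζ a + √t η b`, and the Gaussian integrals over `η`
and `ζ` follow one after the other. The denominator is the determinant of the identity plus `diag(s,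
t)` times the covariance matrix of the two pairings. -/
theorem integral_exp_neg_norm_dot (ha : nsq a = 1) (hb : nsq b = 1) {s t : ℝ} (hs : 0 ≤ s)
    (ht : 0 ≤ t) :
    ∫ c, Real.exp (-(s * ‖dot c a‖ ^ 2)) * Real.exp (-(t * ‖dot c b‖ ^ 2)) ∂gaussian d
      = ((1 + s) * (1 + t) - ‖herm a b‖ ^ 2 * s * t)⁻¹ := by
  have hr1 : ‖herm a b‖ ^ 2 ≤ 1 := by simpa [ha, hb] using norm_herm_sq_le a b
  set r := ‖herm a b‖ ^ 2 with hr
  set f : (Fin d → ℂ) → ℂ × ℂ → ℂ := fun c q =>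
    Complex.exp (2 * Complex.I * (((√s : ℂ) * q.1 * dot c a).re : ℂ)) *
      Complex.exp (2 * Complex.I * (((√t : ℂ) * q.2 * dot c b).re : ℂ)) with hf
  have hnorm : ∀ x : ℝ, ‖Complex.exp (2 * Complex.I * (x : ℂ))‖ = 1 := fun x => by
    rw [show 2 * Complex.I * (x : ℂ) = ((2 * x : ℝ) : ℂ) * Complex.I by push_cast; ring,
      Complex.norm_exp_ofReal_mul_I]
  have hfc : Continuous (Function.uncurry f) := by
    have h1 := continuous_dot (d := d) a
    have h2 := continuous_dot (d := d) b
    simp only [hf, Function.uncurry_def]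
    fun_prop
  have hfi : Integrable (Function.uncurry f) ((gaussian d).prod (gaussC.prod gaussC)) := by
    refine Integrable.mono' (integrable_const (1 : ℝ)) hfc.aestronglyMeasurable
      (Filter.Eventually.of_forall fun q => ?_)
    simp only [hf, Function.uncurry_def, norm_mul, hnorm, mul_one, le_refl]
  have hinner : ∀ q : ℂ × ℂ, ∫ c, f c q ∂gaussian d
      = Complex.exp (-((s * ‖q.1‖ ^ 2 + t * ‖q.2‖ ^ 2
          + -(-2 * √s * √t * inner ℝ (q.1 * herm a b) q.2) : ℝ) : ℂ)) := by
    intro q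
    have h := integral_gaussian_cexp (((√s : ℂ) * q.1) • a + ((√t : ℂ) * q.2) • b)
    rw [nsq_add_smul, ha, hb] at h
    have h1 : ‖(√s : ℂ) * q.1‖ ^ 2 * 1 + ‖(√t : ℂ) * q.2‖ ^ 2 * 1 + 2 * ((√s : ℂ) * q.1 *
        starRingEnd ℂ ((√t : ℂ) * q.2) * herm a b).re = s * ‖q.1‖ ^ 2 + t * ‖q.2‖ ^ 2
          + -(-2 * √s * √t * inner ℝ (q.1 * herm a b) q.2) := by
      have h2 : (√s : ℂ) * q.1 * starRingEnd ℂ ((√t : ℂ) * q.2) * herm a b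
          = ((√s * √t : ℝ) : ℂ) * (q.1 * herm a b * starRingEnd ℂ q.2) := by
        rw [map_mul, Complex.conj_ofReal]
        push_cast
        ring
      rw [h2, Complex.re_ofReal_mul, norm_mul, norm_mul, Complex.norm_real, Complex.norm_real,
        mul_pow, mul_pow, Real.norm_of_nonneg (Real.sqrt_nonneg s),
        Real.norm_of_nonneg (Real.sqrt_nonneg t), Real.sq_sqrt hs, Real.sq_sqrt ht, Complex.inner]
      simp only [Complex.mul_re _ (starRingEnd ℂ _),
        Complex.conj_re, Complex.conj_im]
      ring
    rw [h1] at h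
    rw [← h]
    refine integral_congr_ae (Filter.Eventually.of_forall fun c => ?_)
    simp only [hf]
    rw [← Complex.exp_add]
    congr 1
    rw [← mul_add, ← Complex.ofReal_add, ← Complex.add_re]
    congr 3
    simp only [dot, Finset.mul_sum, ← Finset.sum_add_distrib, Pi.add_apply, Pi.smul_apply,
      smul_eq_mul]
    exact Finset.sum_congr rfl fun j _ => by ring
  -- After integrating over `η` the coefficient of `-|ζ|²` is `s - str/(1+t)`. It is nonnegative
  -- because `r ≤ 1`, which gives the hypothesis of `integral_gaussC_cexp`.
  have hb0 : -1 < s - s * t * r / (1 + t) := by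
    have h1 : s * t * r / (1 + t) ≤ s := by
      rw [div_le_iff₀ (by linarith)]
      nlinarith [mul_nonneg hs ht]
    linarith
  have key : ∫ c, Complex.exp (-(s : ℂ) * (‖dot c a‖ : ℂ) ^ 2) *
      Complex.exp (-(t : ℂ) * (‖dot c b‖ : ℂ) ^ 2) ∂gaussian d
      = (((1 + s) * (1 + t) - r * s * t)⁻¹ : ℝ) := by
    calc _ = ∫ c, (∫ q, f c q ∂(gaussC.prod gaussC)) ∂gaussian d := by
          refine integral_congr_ae (Filter.Eventually.of_forall fun c => ?_)
          simp only [hf]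
          rw [cexp_neg_mul_norm_sq hs, cexp_neg_mul_norm_sq ht, ← integral_prod_mul]
      _ = ∫ q, (∫ c, f c q ∂gaussian d) ∂(gaussC.prod gaussC) := integral_integral_swap hfi
      _ = ∫ ζ, (∫ η, (∫ c, f c (ζ, η) ∂gaussian d) ∂gaussC) ∂gaussC :=
          integral_prod _ hfi.integral_prod_right
      _ = ∫ ζ, (1 + (t : ℂ))⁻¹ * Complex.exp (-((s - s * t * r / (1 + t) : ℝ) : ℂ) *
            (‖ζ‖ : ℂ) ^ 2 + 0 * ((inner ℝ 0 ζ : ℝ) : ℂ)) ∂gaussC := by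
          refine integral_congr_ae (Filter.Eventually.of_forall fun ζ => ?_)
          simp only
          have h := integral_gaussC_cexp (b := t) (by linarith) ((-2 * √s * √t : ℝ) : ℂ)
            (ζ * herm a b)
          calc _ = ∫ η, Complex.exp (-(s : ℂ) * (‖ζ‖ : ℂ) ^ 2) *
                Complex.exp (-(t : ℂ) * (‖η‖ : ℂ) ^ 2 + ((-2 * √s * √t : ℝ) : ℂ) *
                  ((inner ℝ (ζ * herm a b) η : ℝ) : ℂ)) ∂gaussC := by
                refine integral_congr_ae (Filter.Eventually.of_forall fun η => ?_)
                simp only [hinner]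
                rw [← Complex.exp_add]
                congr 1
                push_cast
                ring
            _ = _ := by
                rw [integral_const_mul, h, mul_left_comm, ← Complex.exp_add]
                congr 2
                have h3 : (1 + (t : ℂ)) ≠ 0 := by
                  exact_mod_cast (show (1 + t) ≠ 0 by linarith)
                have h4 : ((-2 * √s * √t : ℝ) : ℂ) ^ 2 * (‖ζ * herm a b‖ : ℂ) ^ 2
                    = ((4 * (s * t) * (‖ζ‖ ^ 2 * r) : ℝ) : ℂ) := by
                  rw [norm_mul, ← Complex.ofReal_pow, ← Complex.ofReal_pow, ← Complex.ofReal_mul,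
                    mul_pow, mul_pow, mul_pow, Real.sq_sqrt hs, Real.sq_sqrt ht, hr]
                  congr 1
                  ring
                rw [h4]
                push_cast
                field_simp
                ring
      _ = _ := by
          rw [integral_const_mul, integral_gaussC_cexp hb0]
          simp only [ne_eq, OfNat.ofNat_ne_zero, not_false_eq_true, zero_pow, zero_mul, zero_div,
            Complex.exp_zero, mul_one]
          rw [← mul_inv]
          have h5 : (1 + t) * (1 + (s - s * t * r / (1 + t)))
              = (1 + s) * (1 + t) - r * s * t := by
            have : 1 + t ≠ 0 := by linarith
            field_simp
            ring
          rw [← h5]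
          push_cast
          rfl
  have h6 : ((∫ c, Real.exp (-(s * ‖dot c a‖ ^ 2)) * Real.exp (-(t * ‖dot c b‖ ^ 2)) ∂gaussian d
      : ℝ) : ℂ) = (((1 + s) * (1 + t) - r * s * t)⁻¹ : ℝ) := by
    rw [← key, ← integral_complex_ofReal]
    refine integral_congr_ae (Filter.Eventually.of_forall fun c => ?_)
    simp only
    push_cast
    simp only [neg_mul]
  exact_mod_cast h6

theorem integrable_logKernel_prod (ha : nsq a = 1) :
    Integrable (fun q : (Fin d → ℂ) × ℝ => logKernel q.2 (‖dot q.1 a‖ ^ 2))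
      ((gaussian d).prod (volume.restrict (Set.Ioi 0))) := by
  have hne : a ≠ 0 := fun h => by simp [h, nsq] at ha
  have hm : Measurable fun q : (Fin d → ℂ) × ℝ => logKernel q.2 (‖dot q.1 a‖ ^ 2) := by
    have := (continuous_dot a).measurable
    exact measurable_logKernel.comp (measurable_snd.prodMk (by fun_prop))
  rw [integrable_prod_iff hm.aestronglyMeasurable]
  constructor
  · filter_upwards [ae_dot_ne_zero hne] with c hc
    exact integrableOn_logKernel (pow_pos (norm_pos_iff.2 hc) 2)
  · refine ((memLp_log_dot_unit ha).integrable (by norm_num)).norm.congr ?_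
    filter_upwards [ae_dot_ne_zero hne] with c hc
    rw [integral_norm_logKernel (pow_pos (norm_pos_iff.2 hc) 2), Real.norm_eq_abs]

theorem integrable_exp_neg_dot {s : ℝ} (hs : 0 ≤ s) (a : Fin d → ℂ) :
    Integrable (fun c => Real.exp (-(s * ‖dot c a‖ ^ 2))) (gaussian d) := by
  have := continuous_dot a
  refine Integrable.mono' (integrable_const (1 : ℝ))
    (by fun_prop : Continuous _).aestronglyMeasurable (Filter.Eventually.of_forall fun c => ?_)
  rw [Real.norm_of_nonneg (Real.exp_pos _).le, Real.exp_le_one_iff, neg_nonpos]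
  positivity

theorem integrable_exp_mul_exp_neg_dot {s t : ℝ} (hs : 0 ≤ s) (ht : 0 ≤ t) (a b : Fin d → ℂ) :
    Integrable (fun c => Real.exp (-(s * ‖dot c a‖ ^ 2)) * Real.exp (-(t * ‖dot c b‖ ^ 2)))
      (gaussian d) := by
  have := continuous_dot a
  have := continuous_dot b
  refine Integrable.mono' (integrable_exp_neg_dot hs a)
    (by fun_prop : Continuous _).aestronglyMeasurable (Filter.Eventually.of_forall fun c => ?_)
  rw [Real.norm_of_nonneg (by positivity)]
  refine mul_le_of_le_one_right (Real.exp_pos _).le ?_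
  rw [Real.exp_le_one_iff, neg_nonpos]
  positivity

theorem integral_exp_neg_dot (ha : nsq a = 1) {s : ℝ} (hs : 0 ≤ s) :
    ∫ c, Real.exp (-(s * ‖dot c a‖ ^ 2)) ∂gaussian d = (1 + s)⁻¹ := by
  have h := integral_exp_neg_norm_dot ha ha hs le_rfl
  simpa using h

/-- Write `X`, `Y` for the two pairings and replace both logarithms by Frullani integrals. In the
covariance the terms with `e^{-s}` or `e^{-t}` cancel, leaving the double integral of `(E e^{-s|X|²
- t|Y|²} - E e^{-s|X|²} E e^{-t|Y|²})/(st)`. By the explicit transforms this integrand is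
`r/((1+s)(1+t)D)` with `D = (1+s)(1+t) - rst`, whose double integral is `dilog r`. -/
theorem integral_log_mul_log_unit (ha : nsq a = 1) (hb : nsq b = 1) :
    ∫ c, Real.log (‖dot c a‖ ^ 2) * Real.log (‖dot c b‖ ^ 2) ∂gaussian d
      = logMean ^ 2 + dilog (‖herm a b‖ ^ 2) := by
  have hna : a ≠ 0 := fun h => by simp [h, nsq] at ha
  have hnb : b ≠ 0 := fun h => by simp [h, nsq] at hb
  set ν : Measure ℝ := volume.restrict (Set.Ioi 0) with hν
  set r := ‖herm a b‖ ^ 2 with hr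
  have hr0 : 0 ≤ r := by positivity
  have hr1 : r ≤ 1 := by
    have := norm_herm_sq_le a b
    rwa [ha, hb, one_mul] at this
  have hma := (continuous_dot a).measurable
  have hmb := (continuous_dot b).measurable
  -- the mean
  have hmean : ∀ {a : Fin d → ℂ}, nsq a = 1 →
      Integrable (fun s => ∫ c, logKernel s (‖dot c a‖ ^ 2) ∂gaussian d) ν ∧
      ∫ s, (∫ c, logKernel s (‖dot c a‖ ^ 2) ∂gaussian d) ∂ν = logMean := by
    intro a ha
    have hna : a ≠ 0 := fun h => by simp [h, nsq] at ha
    have hi := integrable_logKernel_prod ha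
    refine ⟨hi.integral_prod_right, ?_⟩
    rw [← integral_integral_swap (f := fun c s => logKernel s (‖dot c a‖ ^ 2)) hi]
    have h1 := integral_log_dot hna
    rw [ha, Real.log_one, zero_add] at h1
    rw [← h1]
    refine integral_congr_ae ?_
    filter_upwards [ae_dot_ne_zero hna] with c hc
    exact integral_logKernel (pow_pos (norm_pos_iff.2 hc) 2)
  set g : (Fin d → ℂ) → ℝ × ℝ → ℝ := fun c q =>
    logKernel q.1 (‖dot c a‖ ^ 2) * logKernel q.2 (‖dot c b‖ ^ 2) with hg
  have hgm : Measurable (Function.uncurry g) := by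
    simp only [hg, Function.uncurry_def]
    exact (measurable_logKernel.comp ((measurable_fst.comp measurable_snd).prodMk
      ((hma.comp measurable_fst).norm.pow_const 2))).mul
      (measurable_logKernel.comp ((measurable_snd.comp measurable_snd).prodMk
      ((hmb.comp measurable_fst).norm.pow_const 2)))
  -- Integrating the absolute value over `s` and `t` gives the product of the absolute values of the
  -- two logarithms, which is integrable since both are in `L²`.
  have hgi : Integrable (Function.uncurry g) ((gaussian d).prod (ν.prod ν)) := by
    rw [integrable_prod_iff hgm.aestronglyMeasurable]
    constructor
    · filter_upwards [ae_dot_ne_zero hna, ae_dot_ne_zero hnb] with c hca hcb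
      exact (integrableOn_logKernel (pow_pos (norm_pos_iff.2 hca) 2)).mul_prod
        (integrableOn_logKernel (pow_pos (norm_pos_iff.2 hcb) 2))
    · have h1 : Integrable (fun c => Real.log (‖dot c a‖ ^ 2) * Real.log (‖dot c b‖ ^ 2))
          (gaussian d) := (memLp_log_dot_unit ha).integrable_mul (memLp_log_dot_unit hb)
      refine h1.norm.congr ?_
      filter_upwards [ae_dot_ne_zero hna, ae_dot_ne_zero hnb] with c hca hcb
      simp only [Function.uncurry_def, hg, norm_mul]
      rw [integral_prod_mul (fun s => ‖logKernel s (‖dot c a‖ ^ 2)‖)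
        (fun s => ‖logKernel s (‖dot c b‖ ^ 2)‖),
        integral_norm_logKernel (pow_pos (norm_pos_iff.2 hca) 2),
        integral_norm_logKernel (pow_pos (norm_pos_iff.2 hcb) 2)]
      rfl
  have h1 : ∫ c, Real.log (‖dot c a‖ ^ 2) * Real.log (‖dot c b‖ ^ 2) ∂gaussian d
      = ∫ q, (∫ c, g c q ∂gaussian d) ∂(ν.prod ν) := by
    rw [← integral_integral_swap hgi]
    refine integral_congr_ae ?_
    filter_upwards [ae_dot_ne_zero hna, ae_dot_ne_zero hnb] with c hca hcb
    simp only [hg]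
    rw [integral_prod_mul (fun s => logKernel s (‖dot c a‖ ^ 2))
        (fun s => logKernel s (‖dot c b‖ ^ 2)),
        integral_logKernel (pow_pos (norm_pos_iff.2 hca) 2),
        integral_logKernel (pow_pos (norm_pos_iff.2 hcb) 2)]
  have h2 : logMean ^ 2 = ∫ q : ℝ × ℝ, (∫ c, logKernel q.1 (‖dot c a‖ ^ 2) ∂gaussian d) *
      (∫ c, logKernel q.2 (‖dot c b‖ ^ 2) ∂gaussian d) ∂(ν.prod ν) := by
    rw [integral_prod_mul (fun s => ∫ c, logKernel s (‖dot c a‖ ^ 2) ∂gaussian d)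
      (fun s => ∫ c, logKernel s (‖dot c b‖ ^ 2) ∂gaussian d), (hmean ha).2, (hmean hb).2, sq]
  have hi1 : Integrable (fun q => ∫ c, g c q ∂gaussian d) (ν.prod ν) := hgi.integral_prod_right
  have hi2 : Integrable (fun q : ℝ × ℝ => (∫ c, logKernel q.1 (‖dot c a‖ ^ 2) ∂gaussian d) *
      (∫ c, logKernel q.2 (‖dot c b‖ ^ 2) ∂gaussian d)) (ν.prod ν) :=
    (hmean ha).1.mul_prod (hmean hb).1
  have hi3 : Integrable (fun q : ℝ × ℝ => (∫ c, g c q ∂gaussian d) -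
      (∫ c, logKernel q.1 (‖dot c a‖ ^ 2) ∂gaussian d) *
      (∫ c, logKernel q.2 (‖dot c b‖ ^ 2) ∂gaussian d)) (ν.prod ν) := hi1.sub hi2
  rw [h1, ← sub_eq_iff_eq_add', h2, ← integral_sub hi1 hi2, integral_prod _ hi3,
    ← integral_Ioi_outer hr0 hr1]
  refine setIntegral_congr_fun measurableSet_Ioi fun s hs => ?_
  have hs0 : 0 < s := hs
  simp only
  rw [← integral_Ioi_inner hr0 hr1 hs0]
  refine setIntegral_congr_fun measurableSet_Ioi fun t ht => ?_
  have ht0 : 0 < t := ht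
  have hden : 0 < (1 + s) * (1 + t) - r * s * t := by
    nlinarith [mul_pos hs0 ht0, mul_nonneg (sub_nonneg.2 hr1) (mul_pos hs0 ht0).le]
  have e1 := integrable_exp_neg_dot hs0.le a
  have e2 := integrable_exp_neg_dot ht0.le b
  have e3 := integrable_exp_mul_exp_neg_dot hs0.le ht0.le a b
  have m1 : ∫ c, logKernel s (‖dot c a‖ ^ 2) ∂gaussian d
      = s⁻¹ * (Real.exp (-s) - (1 + s)⁻¹) := by
    simp only [logKernel]
    rw [integral_const_mul, integral_sub (integrable_const _) e1, integral_exp_neg_dot ha hs0.le]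
    simp
  have m2 : ∫ c, logKernel t (‖dot c b‖ ^ 2) ∂gaussian d
      = t⁻¹ * (Real.exp (-t) - (1 + t)⁻¹) := by
    simp only [logKernel]
    rw [integral_const_mul, integral_sub (integrable_const _) e2, integral_exp_neg_dot hb ht0.le]
    simp
  have m3 : ∫ c, g c (s, t) ∂gaussian d = s⁻¹ * t⁻¹ * (Real.exp (-s) * Real.exp (-t)
      - Real.exp (-t) * (1 + s)⁻¹ - Real.exp (-s) * (1 + t)⁻¹
      + ((1 + s) * (1 + t) - r * s * t)⁻¹) := by
    have h3 : ∀ c, g c (s, t) = s⁻¹ * t⁻¹ * (Real.exp (-s) * Real.exp (-t)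
        - Real.exp (-t) * Real.exp (-(s * ‖dot c a‖ ^ 2))
        - Real.exp (-s) * Real.exp (-(t * ‖dot c b‖ ^ 2))
        + Real.exp (-(s * ‖dot c a‖ ^ 2)) * Real.exp (-(t * ‖dot c b‖ ^ 2))) := by
      intro c
      simp only [hg, logKernel]
      ring
    have j1 := e1.const_mul (Real.exp (-t))
    have j2 := e2.const_mul (Real.exp (-s))
    have j0 : Integrable (fun _ : Fin d → ℂ => Real.exp (-s) * Real.exp (-t)) (gaussian d) :=
      integrable_const _
    have j3 : Integrable (fun c => Real.exp (-s) * Real.exp (-t)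
        - Real.exp (-t) * Real.exp (-(s * ‖dot c a‖ ^ 2))) (gaussian d) := j0.sub j1
    have j4 : Integrable (fun c => Real.exp (-s) * Real.exp (-t)
        - Real.exp (-t) * Real.exp (-(s * ‖dot c a‖ ^ 2))
        - Real.exp (-s) * Real.exp (-(t * ‖dot c b‖ ^ 2))) (gaussian d) := j3.sub j2
    simp only [h3]
    rw [integral_const_mul, integral_add j4 e3, integral_sub j3 j2, integral_sub j0 j1,
      integral_const_mul (Real.exp (-t)),
      integral_const_mul (Real.exp (-s)) fun c => Real.exp (-(t * ‖dot c b‖ ^ 2)),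
      integral_exp_neg_dot ha hs0.le,
      integral_exp_neg_dot hb ht0.le, integral_exp_neg_norm_dot ha hb hs0.le ht0.le, ← hr]
    simp
  rw [m1, m2, m3]
  have k1 : (1 + s) ≠ 0 := by linarith
  have k2 : (1 + t) ≠ 0 := by linarith
  have k3 := hden.ne'
  set D := (1 + s) * (1 + t) - r * s * t with hD
  have k4 : s⁻¹ * t⁻¹ * (D⁻¹ - (1 + s)⁻¹ * (1 + t)⁻¹) = r / ((1 + s) * (1 + t) * D) := by
    field_simp
    rw [hD]
    ring
  rw [← k4]
  ring

/-- The covariance of `log|⟨c, a⟩|²` and `log|⟨c, b⟩|²` is the dilogarithm of the squared cosine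
of the angle between `a` and `b`. -/
theorem integral_log_mul_log (ha : a ≠ 0) (hb : b ≠ 0) :
    ∫ c, Real.log (‖dot c a‖ ^ 2) * Real.log (‖dot c b‖ ^ 2) ∂gaussian d
      = (Real.log (nsq a) + logMean) * (Real.log (nsq b) + logMean)
        + dilog (‖herm a b‖ ^ 2 / (nsq a * nsq b)) := by
  have hua := nsq_unitize ha
  have hub := nsq_unitize hb
  have hna := nsq_pos ha
  have hnb := nsq_pos hb
  have hu := memLp_log_dot_unit hua
  have hv := memLp_log_dot_unit hub
  have i1 := (hu.integrable (by norm_num)).const_mul (Real.log (nsq b))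
  have i2 := (hv.integrable (by norm_num)).const_mul (Real.log (nsq a))
  have i3 : Integrable (fun c => Real.log (‖dot c (unitize a)‖ ^ 2) *
    Real.log (‖dot c (unitize b)‖ ^ 2)) (gaussian d) := hu.integrable_mul hv
  have i0 : Integrable (fun _ : Fin d → ℂ => Real.log (nsq a) * Real.log (nsq b)) (gaussian d) :=
    integrable_const _
  have i4 : Integrable (fun c => Real.log (nsq a) * Real.log (nsq b) +
    Real.log (nsq b) * Real.log (‖dot c (unitize a)‖ ^ 2)) (gaussian d) := i0.add i1
  have i5 : Integrable (fun c => Real.log (nsq a) * Real.log (nsq b) +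
    Real.log (nsq b) * Real.log (‖dot c (unitize a)‖ ^ 2) +
    Real.log (nsq a) * Real.log (‖dot c (unitize b)‖ ^ 2)) (gaussian d) := i4.add i2
  have h1 : ∀ᵐ c ∂gaussian d, Real.log (‖dot c a‖ ^ 2) * Real.log (‖dot c b‖ ^ 2)
      = Real.log (nsq a) * Real.log (nsq b) +
        Real.log (nsq b) * Real.log (‖dot c (unitize a)‖ ^ 2) +
        Real.log (nsq a) * Real.log (‖dot c (unitize b)‖ ^ 2) +
        Real.log (‖dot c (unitize a)‖ ^ 2) * Real.log (‖dot c (unitize b)‖ ^ 2) := by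
    filter_upwards [ae_log_dot ha, ae_log_dot hb] with c h1 h2
    rw [h1, h2]; ring
  have hherm : ‖herm (unitize a) (unitize b)‖ ^ 2 = ‖herm a b‖ ^ 2 / (nsq a * nsq b) := by
    have h2 : herm (unitize a) (unitize b) = (((√(nsq a))⁻¹ * (√(nsq b))⁻¹ : ℝ) : ℂ) *
        herm a b := by
      simp only [herm, unitize, Finset.mul_sum, Pi.smul_apply, smul_eq_mul, map_mul,
        Complex.conj_ofReal]
      refine Finset.sum_congr rfl fun j _ => ?_
      push_cast
      ring
    rw [h2, norm_mul, Complex.norm_real, Real.norm_of_nonneg (by positivity), mul_pow, mul_pow,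
      inv_pow, inv_pow, Real.sq_sqrt hna.le, Real.sq_sqrt hnb.le]
    field_simp
  rw [integral_congr_ae h1, integral_add i5 i3, integral_add i4 i2, integral_add i0 i1,
    integral_const_mul (Real.log (nsq b)),
    integral_const_mul (Real.log (nsq a)) fun c => Real.log (‖dot c (unitize b)‖ ^ 2),
    integral_log_mul_log_unit hua hub, hherm,
    integral_dot_unit hua (g := fun z => Real.log (‖z‖ ^ 2)) (by fun_prop),
    integral_dot_unit hub (g := fun z => Real.log (‖z‖ ^ 2)) (by fun_prop)]
  rw [← logMean]
  simp
  ring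

end Covariance

/-! ### Sections of the tensor powers of a line bundle in local frames -/

section PowEval

variable {V : Type*} [AddCommGroup V] [Module ℂ V]

theorem powEval_tprod (N : ℕ) (ξ : V →ₗ[ℂ] ℂ) (v : Fin N → V) :
    powEval N ξ (PiTensorProduct.tprod ℂ v) = ∏ i, ξ (v i) := by
  simp [powEval]

theorem powEval_smul (N : ℕ) (k : ℂ) (ξ : V →ₗ[ℂ] ℂ) (t : ⨂[ℂ]^N V) :
    powEval N (k • ξ) t = k ^ N * powEval N ξ t := by
  induction t using PiTensorProduct.induction_on with
  | smul_tprod r v =>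
    rw [map_smul, map_smul, powEval_tprod, powEval_tprod]
    simp only [LinearMap.smul_apply, smul_eq_mul, Finset.prod_mul_distrib, Finset.prod_const,
      Finset.card_univ, Fintype.card_fin]
    ring
  | add x y hx hy => rw [map_add, map_add, hx, hy, mul_add]

/-- A tensor power of a line is the line spanned by `e ⊗ ⋯ ⊗ e`, and `powEval N ξ` is the coordinate
on it. It suffices to check this on pure tensors. -/
theorem eq_powEval_smul {ξ : V →ₗ[ℂ] ℂ} {e : V} (he : ∀ v, v = ξ v • e) (N : ℕ)
    (t : ⨂[ℂ]^N V) : t = powEval N ξ t • PiTensorProduct.tprod ℂ fun _ => e := by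
  induction t using PiTensorProduct.induction_on with
  | smul_tprod r v =>
    have h : PiTensorProduct.tprod ℂ v = (∏ i, ξ (v i)) • PiTensorProduct.tprod ℂ fun _ => e := by
      rw [← MultilinearMap.map_smul_univ]
      congr 1
      funext i
      exact he (v i)
    rw [map_smul, powEval_tprod, smul_eq_mul, mul_smul, ← h]
  | add x y hx hy => rw [map_add, add_smul, ← hx, ← hy]

theorem powEval_eq_zero_iff {ξ : V →ₗ[ℂ] ℂ} {e : V} (he : ∀ v, v = ξ v • e) {N : ℕ}
    {t : ⨂[ℂ]^N V} : powEval N ξ t = 0 ↔ t = 0 :=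
  ⟨fun h => by rw [eq_powEval_smul he N t, h, zero_smul], fun h => by rw [h, map_zero]⟩

end PowEval

section Sections

variable {n : ℕ} {M : Type*} [TopologicalSpace M] [ChartedSpace (Cn (n + 1)) M]
  [IsManifold 𝓘(ℂ, Cn (n + 1)) ω M]
  {L : M → Type*} [TopologicalSpace (Bundle.TotalSpace ℂ L)] [∀ x, AddCommGroup (L x)]
  [∀ x, Module ℂ (L x)] [∀ x, TopologicalSpace (L x)] [FiberBundle ℂ L] [VectorBundle ℂ ℂ L]
  {N d : ℕ}

/-- The components of the sections `S j` in the frame around `p`. -/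
def comps (S : Fin d → H0 n L N) (p z : M) : Fin d → ℂ :=
  fun j => powEval N (coframe L p z) ((S j).1 z)

/-- The components of the sections `S j` in the frame and the chart around `p`. -/
def localComps (S : Fin d → H0 n L N) (p : M) : Fin d → Cn (n + 1) → ℂ :=
  fun j u => comps S p ((chartAt (Cn (n + 1)) p).symm u) j

/-- The domain of the chart around `p` on which `L` is trivialized. -/
def trivSource (n : ℕ) {M : Type*} [TopologicalSpace M] [ChartedSpace (Cn (n + 1)) M]
    (L : M → Type*) [TopologicalSpace (Bundle.TotalSpace ℂ L)] [∀ x, AddCommGroup (L x)]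
    [∀ x, Module ℂ (L x)] [∀ x, TopologicalSpace (L x)] [FiberBundle ℂ L] (p : M) : Set M :=
  (chartAt (Cn (n + 1)) p).source ∩ (trivializationAt ℂ L p).baseSet

/-- The image of `trivSource` in the chart around `p`. -/
def trivTarget (n : ℕ) {M : Type*} [TopologicalSpace M] [ChartedSpace (Cn (n + 1)) M]
    (L : M → Type*) [TopologicalSpace (Bundle.TotalSpace ℂ L)] [∀ x, AddCommGroup (L x)]
    [∀ x, Module ℂ (L x)] [∀ x, TopologicalSpace (L x)] [FiberBundle ℂ L] (p : M) :
    Set (Cn (n + 1)) :=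
  (chartAt (Cn (n + 1)) p).target ∩
    (chartAt (Cn (n + 1)) p).symm ⁻¹' (trivializationAt ℂ L p).baseSet

theorem isOpen_trivTarget (p : M) : IsOpen (trivTarget n L p) :=
  (chartAt (Cn (n + 1)) p).symm.isOpen_inter_preimage (trivializationAt ℂ L p).open_baseSet

theorem eq_coframe_smul {p z : M} (hz : z ∈ (trivializationAt ℂ L p).baseSet) (v : L z) :
    v = coframe L p z v • frame L p z := by
  have h := (trivializationAt ℂ L p).symmₗ_linearMapAt (R := ℂ) hz v
  rw [coframe, frame, ← (trivializationAt ℂ L p).coe_symmₗ (R := ℂ) hz, ← map_smul, smul_eq_mul,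
    mul_one, h]

theorem coframe_frame {p z : M} (hz : z ∈ (trivializationAt ℂ L p).baseSet) :
    coframe L p z (frame L p z) = 1 := by
  rw [coframe, frame, ← (trivializationAt ℂ L p).coe_symmₗ (R := ℂ) hz]
  exact (trivializationAt ℂ L p).linearMapAt_symmₗ (R := ℂ) hz 1

theorem contMDiffOn_comps (S : Fin d → H0 n L N) (p : M) (j : Fin d) :
    ContMDiffOn 𝓘(ℂ, Cn (n + 1)) 𝓘(ℂ, ℂ) ω (fun z => comps S p z j)
      (trivializationAt ℂ L p).baseSet := (S j).2 p

theorem contDiffOn_localComps (S : Fin d → H0 n L N) (p : M) (j : Fin d) :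
    ContDiffOn ℂ ω (localComps S p j) (trivTarget n L p) := by
  rw [← contMDiffOn_iff_contDiffOn]
  exact (contMDiffOn_comps S p j).comp
    ((contMDiffOn_chart_symm (I := 𝓘(ℂ, Cn (n + 1))) (x := p)).mono Set.inter_subset_left)
    fun u hu => hu.2

theorem continuousOn_comps (S : Fin d → H0 n L N) (p : M) :
    ContinuousOn (comps S p) (trivializationAt ℂ L p).baseSet :=
  continuousOn_pi.2 fun j => (contMDiffOn_comps S p j).continuousOn

/-- The `S j` span the space of sections, so a common zero would be a base point. This keeps `nsq`
of the components positive wherever its logarithm or its inverse occurs. -/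
theorem comps_ne_zero (hN : BasePointFree n L N) (S : Module.Basis (Fin d) ℂ (H0 n L N)) {p z : M}
    (hz : z ∈ (trivializationAt ℂ L p).baseSet) : comps S p z ≠ 0 := by
  intro h
  obtain ⟨s, hs⟩ := hN z
  apply hs
  have h1 : ∀ j, (S j).1 z = 0 := fun j =>
    (powEval_eq_zero_iff (eq_coframe_smul hz)).1 (congrFun h j)
  rw [← S.sum_repr s]
  simp [h1, -Module.Basis.sum_repr]

theorem mem_zeroSet_iff (S : Fin d → H0 n L N) (c : Fin d → ℂ) {p z : M}
    (hz : z ∈ (trivializationAt ℂ L p).baseSet) :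
    z ∈ zeroSet S c ↔ dot c (comps S p z) = 0 := by
  rw [zeroSet, Set.mem_ofPred_eq, ← powEval_eq_zero_iff (eq_coframe_smul hz)]
  simp [dot, comps]

/-- Passing from the frame around `p` to the unit covector at `z` scales `L_z^*`, and hence
multiplies all components by one common `N`-th power. -/
theorem exists_lift_eq (h : HermitianMetric n L) (S : Fin d → H0 n L N) {p z : M}
    (hz : z ∈ (trivializationAt ℂ L p).baseSet) :
    ∃ k : ℂ, k ≠ 0 ∧ (fun j => h.lift N (S j).1 z) = k • comps S p z := by
  have hz' : z ∈ (trivializationAt ℂ L z).baseSet := FiberBundle.mem_baseSet_trivializationAt' z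
  set k := coframe L z z (frame L p z) with hk
  have hk0 : k ≠ 0 := by
    intro h0
    have h1 := eq_coframe_smul hz' (frame L p z)
    rw [← hk, h0, zero_smul] at h1
    have h2 := coframe_frame hz
    rw [h1, map_zero] at h2
    exact zero_ne_one h2
  have h1 : coframe L z z = k • coframe L p z := by
    ext v
    conv_lhs => rw [eq_coframe_smul hz v]
    rw [map_smul, LinearMap.smul_apply, smul_eq_mul, smul_eq_mul, mul_comm]
  have hr : 0 < √(h.inner z (frame L z z) (frame L z z)).re := by
    refine Real.sqrt_pos.2 (h.pos z _ fun h0 => ?_)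
    have h2 := coframe_frame hz'
    rw [h0, map_zero] at h2
    exact zero_ne_one h2
  refine ⟨_, mul_ne_zero (pow_ne_zero N (Complex.ofReal_ne_zero.2 hr.ne')) (pow_ne_zero N hk0), ?_⟩
  funext j
  rw [HermitianMetric.lift, HermitianMetric.unitCovector, powEval_smul, h1, powEval_smul,
    Pi.smul_apply, comps, smul_eq_mul, mul_assoc]

/-- The normalized kernel is homogeneous of degree zero in each vector of components, so the scalars
of `exists_lift_eq` cancel. The bipotential can therefore be computed in holomorphic frames, where
the metric no longer appears. -/
theorem bipotential_eq (h : HermitianMetric n L) (hN : BasePointFree n L N)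
    (S : Module.Basis (Fin d) ℂ (H0 n L N)) {p q z w : M}
    (hz : z ∈ (trivializationAt ℂ L p).baseSet) (hw : w ∈ (trivializationAt ℂ L q).baseSet) :
    h.bipotential S z w = 1 / (4 * Real.pi ^ 2) * dilog (‖herm (comps S p z) (comps S q w)‖ ^ 2 /
      (nsq (comps S p z) * nsq (comps S q w))) := by
  obtain ⟨k, hk, hkz⟩ := exists_lift_eq h S hz
  obtain ⟨l, hl, hlw⟩ := exists_lift_eq h S hw
  have hself : ∀ z, (h.szego S z z).re = nsq fun j => h.lift N (S j).1 z := by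
    intro z
    rw [HermitianMetric.szego, nsq, Complex.re_sum]
    refine Finset.sum_congr rfl fun j _ => ?_
    rw [Complex.mul_conj, Complex.ofReal_re, Complex.normSq_eq_norm_sq]
  have hzw : h.szego S z w = k * starRingEnd ℂ l * herm (comps S p z) (comps S q w) := by
    rw [HermitianMetric.szego, herm, Finset.mul_sum]
    refine Finset.sum_congr rfl fun j _ => ?_
    have h1 := congrFun hkz j
    have h2 := congrFun hlw j
    simp only [Pi.smul_apply, smul_eq_mul] at h1 h2
    rw [h1, h2, map_mul]
    ring
  have n1 := nsq_pos (comps_ne_zero hN S hz)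
  have n2 := nsq_pos (comps_ne_zero hN S hw)
  have k1 := norm_pos_iff.2 hk
  have l1 := norm_pos_iff.2 hl
  rw [HermitianMetric.bipotential, Gtilde_eq, HermitianMetric.normalizedSzego, hself, hself, hkz,
    hlw, hzw, nsq_smul, nsq_smul, div_pow, mul_pow, Real.sq_sqrt (by positivity),
    Real.sq_sqrt (by positivity), norm_mul, norm_mul, RCLike.norm_conj]
  congr 2
  field_simp

theorem corr_mem_Icc (a b : Fin d → ℂ) : ‖herm a b‖ ^ 2 / (nsq a * nsq b) ∈ Set.Icc (0 : ℝ) 1 :=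
  ⟨div_nonneg (sq_nonneg _) (mul_nonneg (nsq_nonneg a) (nsq_nonneg b)),
    div_le_one_of_le₀ (norm_herm_sq_le a b) (mul_nonneg (nsq_nonneg a) (nsq_nonneg b))⟩

theorem bipotential_nonneg (h : HermitianMetric n L) (hN : BasePointFree n L N)
    (S : Module.Basis (Fin d) ℂ (H0 n L N)) (z w : M) : 0 ≤ h.bipotential S z w := by
  rw [bipotential_eq h hN S (FiberBundle.mem_baseSet_trivializationAt' z)
    (FiberBundle.mem_baseSet_trivializationAt' w)]
  have := corr_mem_Icc (comps S z z) (comps S w w)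
  exact mul_nonneg (by positivity) (dilog_nonneg this.1 this.2)

theorem continuous_bipotential (h : HermitianMetric n L) (hN : BasePointFree n L N)
    (S : Module.Basis (Fin d) ℂ (H0 n L N)) :
    Continuous fun q : M × M => h.bipotential S q.1 q.2 := by
  rw [continuous_iff_continuousAt]
  rintro ⟨p, q⟩
  set O := (trivializationAt ℂ L p).baseSet ×ˢ (trivializationAt ℂ L q).baseSet with hO
  have hOo : IsOpen O := (trivializationAt ℂ L p).open_baseSet.prod
    (trivializationAt ℂ L q).open_baseSet
  have hmem : (p, q) ∈ O := ⟨FiberBundle.mem_baseSet_trivializationAt' p,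
    FiberBundle.mem_baseSet_trivializationAt' q⟩
  have h1 : ContinuousOn (fun x : M × M => comps S p x.1) O :=
    (continuousOn_comps S p).comp continuousOn_fst fun x hx => hx.1
  have h2 : ContinuousOn (fun x : M × M => comps S q x.2) O :=
    (continuousOn_comps S q).comp continuousOn_snd fun x hx => hx.2
  have h1' := continuousOn_pi.1 h1
  have h2' := continuousOn_pi.1 h2
  have h3 : ContinuousOn (fun x : M × M => ‖herm (comps S p x.1) (comps S q x.2)‖ ^ 2) O := by
    refine (ContinuousOn.norm ?_).pow 2
    exact continuousOn_finsetSum _ fun j _ =>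
      (h1' j).mul (Complex.continuous_conj.comp_continuousOn (h2' j))
  have h4 : ContinuousOn (fun x : M × M => nsq (comps S p x.1) * nsq (comps S q x.2)) O :=
    (continuousOn_finsetSum _ fun j _ => (h1' j).norm.pow 2).mul
      (continuousOn_finsetSum _ fun j _ => (h2' j).norm.pow 2)
  have h5 : ContinuousOn (fun x : M × M => 1 / (4 * Real.pi ^ 2) *
      dilog (‖herm (comps S p x.1) (comps S q x.2)‖ ^ 2 /
        (nsq (comps S p x.1) * nsq (comps S q x.2)))) O :=
    continuousOn_const.mul (continuousOn_dilog.comp (h3.div h4 fun x hx =>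
      (mul_pos (nsq_pos (comps_ne_zero hN S hx.1)) (nsq_pos (comps_ne_zero hN S hx.2))).ne')
      fun x _ => corr_mem_Icc _ _)
  exact (h5.congr fun x hx => bipotential_eq h hN S hx.1 hx.2).continuousAt (hOo.mem_nhds hmem)

/-- The section `∑ⱼ cⱼ Sⱼ` vanishes transversally on the charts around the points of `P`. -/
def IsRegularOn (S : Fin d → H0 n L N) (P : Finset M) (c : Fin d → ℂ) : Prop :=
  ∀ p ∈ P, ∀ u ∈ trivTarget n L p, lincomb (localComps S p) c u = 0 →
    fderiv ℂ (lincomb (localComps S p) c) u ≠ 0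

theorem ae_isRegularOn (hN : BasePointFree n L N) (S : Module.Basis (Fin d) ℂ (H0 n L N))
    (P : Finset M) : ∀ᵐ c ∂gaussian d, IsRegularOn S P c := by
  refine (gaussian_absolutelyContinuous d).ae_le ?_
  refine (Filter.eventually_all_finset P).2 fun p _ => ?_
  refine ae_lincomb_regular (isOpen_trivTarget p) (contDiffOn_localComps S p) fun u hu => ?_
  exact Function.ne_iff.1 (comps_ne_zero hN S hu.2)

theorem isClosed_zeroSet (S : Fin d → H0 n L N) (c : Fin d → ℂ) : IsClosed (zeroSet S c) := by
  rw [← isOpen_compl_iff, isOpen_iff_mem_nhds]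
  intro z hz
  have hzb : z ∈ (trivializationAt ℂ L z).baseSet := FiberBundle.mem_baseSet_trivializationAt' z
  have hb := (trivializationAt ℂ L z).open_baseSet.mem_nhds hzb
  have h1 : ContinuousOn (fun x => dot c (comps S z x)) (trivializationAt ℂ L z).baseSet :=
    continuousOn_finsetSum _ fun j _ => continuousOn_const.mul
      (continuousOn_pi.1 (continuousOn_comps S z) j)
  have h2 := (h1.continuousAt hb).eventually_ne (fun h0 => hz ((mem_zeroSet_iff S c hzb).2 h0))
  filter_upwards [h2, hb] with x hx hxb h0
  exact hx ((mem_zeroSet_iff S c hxb).1 h0)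

theorem isHypersurface_zeroSet (S : Fin d → H0 n L N) {P : Finset M}
    (hP : ∀ z, ∃ p ∈ P, z ∈ trivSource n L p) {c : Fin d → ℂ} (hc : IsRegularOn S P c) :
    IsHypersurface n (zeroSet S c) := by
  refine ⟨isClosed_zeroSet S c, fun ⟨z, hz⟩ => ?_⟩
  obtain ⟨p, hp, hzp⟩ := hP z
  set κ := chartAt (Cn (n + 1)) p with hκ
  have hu : κ z ∈ trivTarget n L p :=
    ⟨κ.map_source hzp.1, by rw [Set.mem_preimage, κ.left_inv hzp.1]; exact hzp.2⟩
  have hF := contDiffOn_lincomb (contDiffOn_localComps S p) c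
  have hO := (isOpen_trivTarget (n := n) (L := L) p).mem_nhds hu
  have hzero : ∀ u ∈ trivTarget n L p,
      κ.symm u ∈ zeroSet S c ↔ lincomb (localComps S p) c u = 0 :=
    fun u hu => mem_zeroSet_iff S c hu.2
  have h0 : lincomb (localComps S p) c (κ z) = 0 :=
    (hzero _ hu).1 (by rwa [κ.left_inv hzp.1])
  obtain ⟨e, he1, he2, he3, he4, he5⟩ :=
    exists_straightening hO (hF.contDiffAt hO) (hc p hp _ hu h0)
  refine ⟨κ.trans e, ?_, trans_mem_hcharts (chartAt_mem_hcharts p) e he3 he4, fun y hy => ?_⟩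
  · rw [OpenPartialHomeomorph.trans_source]
    exact ⟨hzp.1, he1⟩
  · rw [OpenPartialHomeomorph.trans_source] at hy
    have h7 := hzero (κ y) (he2 hy.2)
    rw [κ.left_inv hy.1] at h7
    rw [h7, ← he5 (κ y) hy.2]
    rfl

end Sections

/-! ### Smooth partitions of unity and the global Poincaré–Lelong formula -/

section Cutoffs

variable {n : ℕ} {M : Type*} [TopologicalSpace M] [ChartedSpace (Cn (n + 1)) M]

/-- A finite smooth partition of unity, with compact supports in the parts `U p` of the charts. -/
structure IsCutoff (n : ℕ) {M : Type*} [TopologicalSpace M] [ChartedSpace (Cn (n + 1)) M]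
    (U : M → Set (Cn (n + 1))) (P : Finset M) (χ : M → M → ℝ) (K : M → Set (Cn (n + 1))) :
    Prop where
  smooth : ∀ p, IsSmoothFun n (χ p)
  compact : ∀ p, IsCompact (K p)
  subset : ∀ p, K p ⊆ U p
  support : ∀ p z, χ p z ≠ 0 → z ∈ (chartAt (Cn (n + 1)) p).symm '' K p
  sum_eq_one : ∀ z, ∑ p ∈ P, χ p z = 1

theorem isManifold_real [IsManifold 𝓘(ℂ, Cn (n + 1)) ω M] :
    IsManifold 𝓘(ℝ, Cn (n + 1)) ∞ M := by
  refine isManifold_of_contDiffOn _ _ _ fun e e' he he' => ?_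
  have h := contDiffOn_transition (IsManifold.subset_maximalAtlas he)
    (IsManifold.subset_maximalAtlas (I := 𝓘(ℂ, Cn (n + 1))) (n := ω) he')
  have h1 := contDiffOn_real_of_complex h
  simp only [modelWithCornersSelf_coe, modelWithCornersSelf_coe_symm, Function.id_comp,
    Function.comp_id, Set.preimage_id, Set.range_id, Set.inter_univ]
  exact h1.of_le (by simp)

theorem exists_isCutoff [CompactSpace M] [T2Space M] [IsManifold 𝓘(ℂ, Cn (n + 1)) ω M]
    {U : M → Set (Cn (n + 1))} (hU : ∀ p, IsOpen (U p))
    (hUp : ∀ p, chartAt (Cn (n + 1)) p p ∈ U p) :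
    ∃ P χ K, IsCutoff n U P χ K := by
  have := isManifold_real (n := n) (M := M)
  obtain ⟨ρ, hρ⟩ := SmoothPartitionOfUnity.exists_isSubordinate 𝓘(ℝ, Cn (n + 1))
    (isClosed_univ (X := M)) (fun p => (chartAt (Cn (n + 1)) p).source ∩
      chartAt (Cn (n + 1)) p ⁻¹' U p)
    (fun p => (chartAt (Cn (n + 1)) p).isOpen_inter_preimage (hU p))
    (fun p _ => Set.mem_iUnion.2 ⟨p, mem_chart_source _ p, hUp p⟩)
  have hfin : {p | (ρ p : M → ℝ) ≠ 0}.Finite :=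
    ρ.locallyFinite.finite_nonempty_of_compact.subset fun x hx => Function.support_nonempty_iff.2 hx
  refine ⟨hfin.toFinset, fun p => ρ p, fun p => chartAt (Cn (n + 1)) p '' tsupport (ρ p), ?_, ?_,
    ?_, ?_, ?_⟩
  · intro p q
    rw [← contMDiffOn_iff_contDiffOn]
    exact (ρ p).contMDiff.comp_contMDiffOn contMDiffOn_chart_symm
  · intro p
    exact (isClosed_tsupport _).isCompact.image_of_continuousOn
      ((chartAt (Cn (n + 1)) p).continuousOn.mono fun z hz => (hρ p hz).1)
  · rintro p _ ⟨z, hz, rfl⟩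
    exact (hρ p hz).2
  · intro p z hz
    have h1 : z ∈ tsupport (ρ p) := subset_tsupport _ hz
    exact ⟨_, ⟨z, h1, rfl⟩, (chartAt (Cn (n + 1)) p).left_inv (hρ p h1).1⟩
  · intro z
    rw [← ρ.sum_eq_one (Set.mem_univ z), finsum_eq_sum_of_support_subset]
    intro p hp
    simp only [Set.Finite.coe_toFinset, Set.mem_ofPred_eq]
    intro h0
    exact hp (by simp [h0])

end Cutoffs

section PoincareLelong

variable {n : ℕ} {M : Type*} [TopologicalSpace M] [CompactSpace M] [T2Space M]
  [ChartedSpace (Cn (n + 1)) M] [IsManifold 𝓘(ℂ, Cn (n + 1)) ω M]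

/-- The functions `F p` are local equations of the hypersurface `Z`, and `log|F p|²` is integrable
on `K p`. -/
structure IsLocalEquation (Z : Set M) (P : Finset M) (U K : M → Set (Cn (n + 1)))
    (F : M → Cn (n + 1) → ℂ) : Prop where
  hypersurface : IsHypersurface n Z
  contDiffOn : ∀ p ∈ P, ContDiffOn ℂ ω (F p) (U p)
  mem_iff : ∀ p ∈ P, ∀ u ∈ U p, (chartAt (Cn (n + 1)) p).symm u ∈ Z ↔ F p u = 0
  regular : ∀ p ∈ P, ∀ u ∈ U p, F p u = 0 → fderiv ℂ (F p) u ≠ 0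
  integrable : ∀ p ∈ P, IntegrableOn (fun u => ((Real.log (‖F p u‖ ^ 2) : ℝ) : ℂ)) (K p)

/-- The Poincaré–Lelong formula. -/
theorem poincareLelong {Z : Set M} {P : Finset M} {U K : M → Set (Cn (n + 1))}
    (hU : ∀ p, IsOpen (U p)) (hUt : ∀ p, U p ⊆ (chartAt (Cn (n + 1)) p).target)
    (hK : ∀ p, IsCompact (K p)) (hKU : ∀ p, K p ⊆ U p) {F : M → Cn (n + 1) → ℂ}
    (hZ : IsLocalEquation Z P U K F) {φ : M → M → Cn (n + 1) [⋀^Fin (2 * n)]→L[ℝ] ℂ}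
    (hφ : ∀ p ∈ P, ContDiffOn ℝ ∞ (formInChart 𝓘(ℝ, Cn (n + 1)) (φ p) p)
      (chartAt (Cn (n + 1)) p).target)
    (hφK : ∀ p ∈ P, ∀ z, φ p z ≠ 0 → z ∈ (chartAt (Cn (n + 1)) p).symm '' K p)
    {Q : RawForm n (2 * n) M} (hQ : ∀ z v, Q z v = ∑ p ∈ P, φ p z v) :
    integrationCurrent Z Q = ∑ p ∈ P, 1 / (2 * Real.pi) * ∫ u in K p,
      ((Real.log (‖F p u‖ ^ 2) : ℝ) : ℂ) * ddcTop (formInChart 𝓘(ℝ, Cn (n + 1)) (φ p) p) u := by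
  classical
  have key := fun p : P => exists_local_poincareLelong (hU p) (hUt p) (hK p) (hKU p)
    (hZ.contDiffOn p p.2) (hZ.mem_iff p p.2) (hZ.regular p p.2) (hZ.integrable p p.2)
    ((hφ p p.2).mono (hUt p)) (hφK p p.2)
  choose t κ R hst hsupp hInt hsum hval using key
  have hsys := patchSystem_hypersurface hZ.hypersurface
  -- The local pieces for all `p` form one finite family of forms, each carried by a straightening
  -- chart. Any two straightening charts of `Z` are compatible, so this family computes the current
  -- defined by the unspecified charts.
  rw [integrationCurrent_eq_patchSum hZ.hypersurface, hsys.patchSum_eq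
    (Finset.univ.sigma fun p : P => t p) (fun i => hyperPatch (κ i.1 i.2))
    (fun i _ => hyperPatch_isRegular _)
    (fun i hi u hu => (hst i.1 i.2 (Finset.mem_sigma.1 hi).2).symm_mem hu)
    (fun i hi x => hyperPatch_compatible (isStraightening_chart _ x)
      (hst i.1 i.2 (Finset.mem_sigma.1 hi).2))
    (fun i => R i.1 i.2)
    (fun i hi z hz hne => by
      rw [(hst i.1 i.2 (Finset.mem_sigma.1 hi).2).image_hyperPatch]
      exact ⟨hz, hsupp i.1 i.2 (Finset.mem_sigma.1 hi).2 z hne⟩)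
    (fun i hi => hInt i.1 i.2 (Finset.mem_sigma.1 hi).2) Q
    (fun z hz v => by
      rw [hQ, Finset.sum_sigma, ← Finset.sum_coe_sort]
      refine Finset.sum_congr rfl fun p _ => ?_
      rw [hsum p z hz, ContinuousAlternatingMap.sum_apply])]
  rw [Finset.sum_sigma, ← Finset.sum_coe_sort P]
  exact Finset.sum_congr rfl fun p _ => hval p

end PoincareLelong

/-! ### Slices of forms on `M × M` -/

section Slices

theorem prodMap_comp_splitVec {E : Type*} [NormedAddCommGroup E] [NormedSpace ℝ E] {k k' l : ℕ}
    (h : l = k + k') (A B : E →L[ℝ] E) (v : Fin k → E) (v' : Fin k' → E) :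
    (A.prodMap B) ∘ splitVec h v v' = splitVec h (fun j => A (v j)) (fun j => B (v' j)) := by
  subst h
  funext i
  induction i using Fin.addCases <;> simp [splitVec]

theorem ContinuousOn.form_pullback {Y F G : Type*} [TopologicalSpace Y] [NormedAddCommGroup F]
    [NormedSpace ℝ F] [FiniteDimensional ℝ F] [NormedAddCommGroup G] [NormedSpace ℝ G]
    [FiniteDimensional ℝ G] {k : ℕ} {f : Y → F [⋀^Fin k]→L[ℝ] ℂ} {A : Y → G →L[ℝ] F} {s : Set Y}
    (hf : ContinuousOn f s) (hA : ContinuousOn A s) :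
    ContinuousOn (fun x => (f x).compContinuousLinearMap (A x)) s :=
  ContinuousOn.form_of_apply fun v =>
    ContinuousOn.form_apply (g := fun x i => A x (v i)) hf fun _ => hA.clm_apply continuousOn_const

variable {n : ℕ} {M : Type*} [TopologicalSpace M] [ChartedSpace (Cn (n + 1)) M]
  [IsManifold 𝓘(ℂ, Cn (n + 1)) ω M]

/-- The frame of `M` at `(chartAt q).symm y` given by the chart around `q`. -/
def tframe (q : M) (y : Cn (n + 1)) : Fin (2 * (n + 1)) → Cn (n + 1) :=
  fun k => tan (chartAt (Cn (n + 1)) q) y (stdFrame (n + 1) k)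

variable {k l : ℕ} {Φ : M × M → (Cn (n + 1) × Cn (n + 1)) [⋀^Fin l]→L[ℝ] ℂ}

/-- The first factor is read in the preferred chart at the very point `z`, where the tangent map is
the identity. So the vectors `v` are unchanged. -/
theorem formInChart_sliceSnd {k' : ℕ} (h : l = k + k') (z q : M) (v : Fin k → Cn (n + 1))
    {y : Cn (n + 1)} (hy : y ∈ (chartAt (Cn (n + 1)) q).target) :
    formInChart 𝓘(ℝ, Cn (n + 1)) (fun w => sliceSnd h v (Φ (z, w))) q y
      = sliceSnd h v (formInChart (I₂ n) Φ (z, q) (chartAt (Cn (n + 1)) z z, y)) := by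
  have hx : (chartAt (Cn (n + 1)) z z, y) ∈ target₂ (n := n) z q := ⟨mem_chart_target _ z, hy⟩
  ext v'
  rw [formInChart_prod_eq Φ hx, tan_chartAt_self,
    (chartAt (Cn (n + 1)) z).left_inv (mem_chart_source _ z), sliceSnd_apply,
    ContinuousAlternatingMap.compContinuousLinearMap_apply, prodMap_comp_splitVec]
  rfl

theorem contDiffOn_formInChart_sliceSnd {k' : ℕ} (hΦ : IsSmoothForm (I₂ n) Φ) (h : l = k + k')
    (z q : M) (v : Fin k → Cn (n + 1)) :
    ContDiffOn ℝ ∞ (formInChart 𝓘(ℝ, Cn (n + 1)) (fun w => sliceSnd h v (Φ (z, w))) q)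
      (chartAt (Cn (n + 1)) q).target := by
  have h1 : ContDiffOn ℝ ∞ (fun y => sliceSnd h v
      (formInChart (I₂ n) Φ (z, q) (chartAt (Cn (n + 1)) z z, y)))
      (chartAt (Cn (n + 1)) q).target :=
    (sliceSnd h v).contDiff.comp_contDiffOn ((hΦ.contDiffOn_target₂ z q).comp
      (contDiffOn_const.prodMk contDiffOn_id) fun y hy => ⟨mem_chart_target _ z, hy⟩)
  exact h1.congr fun y hy => formInChart_sliceSnd h z q v hy

theorem ddcTop_formInChart_sliceSnd (hΦ : IsSmoothForm (I₂ n) Φ) (hk : Even k)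
    (h : l = k + 2 * n) (h' : l + 1 + 1 = k + 2 * (n + 1)) (z q : M) (v : Fin k → Cn (n + 1))
    {y : Cn (n + 1)} (hy : y ∈ (chartAt (Cn (n + 1)) q).target) :
    ddcTop (formInChart 𝓘(ℝ, Cn (n + 1)) (fun w => sliceSnd h v (Φ (z, w))) q) y
      = iddbar (I₂ n) (projW n) Φ (z, (chartAt (Cn (n + 1)) q).symm y)
        (splitVec h' v (tframe q y)) := by
  have hx : (chartAt (Cn (n + 1)) z z, y) ∈ target₂ (n := n) z q := ⟨mem_chart_target _ z, hy⟩
  have h1 : formInChart 𝓘(ℝ, Cn (n + 1)) (fun w => sliceSnd h v (Φ (z, w))) q =ᶠ[𝓝 y]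
      fun u => sliceSnd h v (formInChart (I₂ n) Φ (z, q) (chartAt (Cn (n + 1)) z z, u)) := by
    filter_upwards [(chartAt (Cn (n + 1)) q).open_target.mem_nhds hy] with u hu
      using formInChart_sliceSnd h z q v hu
  rw [ddcTop_congr h1, ← ddcTop_sliceSnd hk h h' (isOpen_target₂ z q) (hΦ.contDiffOn_target₂ z q) hx,
    ← formInChart_iddbar isFactorProj_projW hΦ hx, formInChart_prod_eq _ hx, tan_chartAt_self,
    (chartAt (Cn (n + 1)) z).left_inv (mem_chart_source _ z),
    ContinuousAlternatingMap.compContinuousLinearMap_apply, prodMap_comp_splitVec]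
  rfl

theorem formInChart_sliceFst (h : l = k + 2 * (n + 1)) (p q : M) {x y : Cn (n + 1)}
    (hx : (x, y) ∈ target₂ p q) :
    formInChart 𝓘(ℝ, Cn (n + 1))
      (fun z => sliceFst h (tframe q y) (Φ (z, (chartAt (Cn (n + 1)) q).symm y))) p x
      = sliceFst h (stdFrame (n + 1)) (formInChart (I₂ n) Φ (p, q) (x, y)) := by
  ext v
  rw [formInChart_prod_eq Φ hx, sliceFst_apply,
    ContinuousAlternatingMap.compContinuousLinearMap_apply, prodMap_comp_splitVec]
  rfl

theorem contDiffOn_formInChart_sliceFst (hΦ : IsSmoothForm (I₂ n) Φ) (h : l = k + 2 * (n + 1))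
    (p q : M) {y : Cn (n + 1)} (hy : y ∈ (chartAt (Cn (n + 1)) q).target) :
    ContDiffOn ℝ ∞ (formInChart 𝓘(ℝ, Cn (n + 1))
      (fun z => sliceFst h (tframe q y) (Φ (z, (chartAt (Cn (n + 1)) q).symm y))) p)
      (chartAt (Cn (n + 1)) p).target := by
  have h1 : ContDiffOn ℝ ∞ (fun x => sliceFst h (stdFrame (n + 1))
      (formInChart (I₂ n) Φ (p, q) (x, y))) (chartAt (Cn (n + 1)) p).target :=
    (sliceFst h (stdFrame (n + 1))).contDiff.comp_contDiffOn ((hΦ.contDiffOn_target₂ p q).comp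
      (contDiffOn_id.prodMk contDiffOn_const) fun x hx => ⟨hx, hy⟩)
  exact h1.congr fun x hx => formInChart_sliceFst h p q ⟨hx, hy⟩

theorem ddcTop_formInChart_sliceFst (hΦ : IsSmoothForm (I₂ n) Φ) (h : l = 2 * n + 2 * (n + 1))
    (h' : l + 1 + 1 = 2 * (n + 1) + 2 * (n + 1)) (p q : M) {x y : Cn (n + 1)}
    (hx : (x, y) ∈ target₂ p q) :
    ddcTop (formInChart 𝓘(ℝ, Cn (n + 1))
      (fun z => sliceFst h (tframe q y) (Φ (z, (chartAt (Cn (n + 1)) q).symm y))) p) x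
      = formInChart (I₂ n) (iddbar (I₂ n) (projZ n) Φ) (p, q) (x, y)
        (splitVec h' (stdFrame (n + 1)) (stdFrame (n + 1))) := by
  have h1 : formInChart 𝓘(ℝ, Cn (n + 1))
      (fun z => sliceFst h (tframe q y) (Φ (z, (chartAt (Cn (n + 1)) q).symm y))) p =ᶠ[𝓝 x]
      fun u => sliceFst h (stdFrame (n + 1)) (formInChart (I₂ n) Φ (p, q) (u, y)) := by
    filter_upwards [(chartAt (Cn (n + 1)) p).open_target.mem_nhds hx.1] with u hu
      using formInChart_sliceFst h p q ⟨hu, hx.2⟩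
  rw [ddcTop_congr h1, ← ddcTop_sliceFst h h' (isOpen_target₂ p q) (hΦ.contDiffOn_target₂ p q) hx,
    ← formInChart_iddbar isFactorProj_projZ hΦ hx]

/-- A smooth form on `M × M` is continuous in the product of any two holomorphic charts. -/
theorem continuousOn_formInChart_hcharts (hΦ : IsSmoothForm (I₂ n) Φ)
    {κ : OpenPartialHomeomorph M (Cn (n + 1))} (hκ : κ ∈ hcharts n M) (q : M) :
    ContinuousOn (fun u : Cn (n + 1) × Cn (n + 1) =>
      (Φ (κ.symm u.1, (chartAt (Cn (n + 1)) q).symm u.2)).compContinuousLinearMap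
        ((tan κ u.1).prodMap (tan (chartAt (Cn (n + 1)) q) u.2)))
      (κ.target ×ˢ (chartAt (Cn (n + 1)) q).target) := by
  rintro ⟨x, y⟩ ⟨hx, hy⟩
  set p := κ.symm x with hp
  set c := chartAt (Cn (n + 1)) p with hc
  set O := κ.target ∩ κ.symm ⁻¹' c.source with hO
  have hOo : IsOpen O := isOpen_transition κ c
  have hxO : x ∈ O := ⟨hx, mem_chart_source _ p⟩
  have hdom : O ×ˢ (chartAt (Cn (n + 1)) q).target ∈ 𝓝 (x, y) :=
    (hOo.prod (chartAt (Cn (n + 1)) q).open_target).mem_nhds ⟨hxO, hy⟩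
  have hτ := contDiffOn_real_of_complex (contDiffOn_transition hκ (chartAt_mem_hcharts p))
  have h1 : ContinuousOn (fun u : Cn (n + 1) × Cn (n + 1) =>
      formInChart (I₂ n) Φ (p, q) ((c ∘ κ.symm) u.1, u.2))
      (O ×ˢ (chartAt (Cn (n + 1)) q).target) :=
    (hΦ.contDiffOn_target₂ p q).continuousOn.comp
      ((hτ.continuousOn.comp continuousOn_fst fun u hu => hu.1).prodMk continuousOn_snd)
      fun u hu => ⟨c.map_source hu.1.2, hu.2⟩
  have h2 : ContinuousOn (fun u : Cn (n + 1) × Cn (n + 1) => fderiv ℝ (c ∘ κ.symm) u.1)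
      (O ×ˢ (chartAt (Cn (n + 1)) q).target) :=
    (hτ.continuousOn_fderiv_of_isOpen hOo (by simp)).comp continuousOn_fst fun u hu => hu.1
  have h3 : ContinuousOn (fun u : Cn (n + 1) × Cn (n + 1) =>
      (formInChart (I₂ n) Φ (p, q) ((c ∘ κ.symm) u.1, u.2)).compContinuousLinearMap
        ((fderiv ℝ (c ∘ κ.symm) u.1).prodMap (ContinuousLinearMap.id ℝ (Cn (n + 1)))))
      (O ×ˢ (chartAt (Cn (n + 1)) q).target) := by
    refine ContinuousOn.form_pullback h1 ?_
    exact (ContinuousLinearMap.prodMapL ℝ (Cn (n + 1)) (Cn (n + 1)) (Cn (n + 1))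
      (Cn (n + 1))).continuous.comp_continuousOn (h2.prodMk continuousOn_const)
  suffices h4 : ∀ u ∈ O ×ˢ (chartAt (Cn (n + 1)) q).target,
      (Φ (κ.symm u.1, (chartAt (Cn (n + 1)) q).symm u.2)).compContinuousLinearMap
        ((tan κ u.1).prodMap (tan (chartAt (Cn (n + 1)) q) u.2)) =
      (formInChart (I₂ n) Φ (p, q) ((c ∘ κ.symm) u.1, u.2)).compContinuousLinearMap
        ((fderiv ℝ (c ∘ κ.symm) u.1).prodMap (ContinuousLinearMap.id ℝ (Cn (n + 1)))) from
    ((h3.congr h4).continuousAt hdom).continuousWithinAt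
  intro u hu
  have hu' : ((c ∘ κ.symm) u.1, u.2) ∈ target₂ (n := n) p q := ⟨c.map_source hu.1.2, hu.2⟩
  rw [formInChart_prod_eq Φ hu', tan_trans hκ (chartAt_mem_hcharts p) hu.1.1 hu.1.2]
  simp only [Function.comp_apply]
  rw [c.left_inv hu.1.2]
  rfl

end Slices

/-! ### Products of currents of integration -/

section ProductCurrents

variable {n : ℕ} {M : Type*} [TopologicalSpace M] [CompactSpace M] [T2Space M]
  [ChartedSpace (Cn (n + 1)) M] [IsManifold 𝓘(ℂ, Cn (n + 1)) ω M]

/-- The part around `q` of `(i∂∂̄)_w Φ`. -/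
def cutW (χ : M → M → ℝ) (Φ : M × M → (Cn (n + 1) × Cn (n + 1)) [⋀^Fin (2 * n + 2 * n)]→L[ℝ] ℂ)
    (q : M) : M × M → (Cn (n + 1) × Cn (n + 1)) [⋀^Fin (2 * n + 2 * n + 1 + 1)]→L[ℝ] ℂ :=
  iddbar (I₂ n) (projW n) fun x => χ q x.2 • Φ x

/-- The part around `(p, q)` of `(i∂∂̄)_z (i∂∂̄)_w Φ`. -/
def cutZW (χ : M → M → ℝ) (Φ : M × M → (Cn (n + 1) × Cn (n + 1)) [⋀^Fin (2 * n + 2 * n)]→L[ℝ] ℂ)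
    (p q : M) :
    M × M → (Cn (n + 1) × Cn (n + 1)) [⋀^Fin (2 * n + 2 * n + 1 + 1 + 1 + 1)]→L[ℝ] ℂ :=
  iddbar (I₂ n) (projZ n) fun x => χ p x.1 • cutW χ Φ q x

theorem degree_cutW (n : ℕ) : 2 * n + 2 * n + 1 + 1 = 2 * n + 2 * (n + 1) := by ring

theorem degree_cutZW (n : ℕ) : 2 * n + 2 * n + 1 + 1 + 1 + 1 = 2 * (n + 1) + 2 * (n + 1) := by ring

/-- The coefficient of `cutZW` in the chart around `(p, q)`. -/
def cutCoeff (χ : M → M → ℝ)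
    (Φ : M × M → (Cn (n + 1) × Cn (n + 1)) [⋀^Fin (2 * n + 2 * n)]→L[ℝ] ℂ) (p q : M)
    (u : Cn (n + 1) × Cn (n + 1)) : ℂ :=
  formInChart (I₂ n) (cutZW χ Φ p q) (p, q) u
    (splitVec (degree_cutZW n) (stdFrame (n + 1)) (stdFrame (n + 1)))

variable {U : M → Set (Cn (n + 1))} {P : Finset M} {χ : M → M → ℝ} {K : M → Set (Cn (n + 1))}
  {Φ : M × M → (Cn (n + 1) × Cn (n + 1)) [⋀^Fin (2 * n + 2 * n)]→L[ℝ] ℂ}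

theorem isSmoothForm_cutW (hχ : IsCutoff n U P χ K) (hΦ : IsSmoothForm (I₂ n) Φ) (q : M) :
    IsSmoothForm (I₂ n) (cutW χ Φ q) :=
  (hΦ.smul_snd (hχ.smooth q)).iddbar_prod isFactorProj_projW

theorem isSmoothForm_cutZW (hχ : IsCutoff n U P χ K) (hΦ : IsSmoothForm (I₂ n) Φ) (p q : M) :
    IsSmoothForm (I₂ n) (cutZW χ Φ p q) :=
  ((isSmoothForm_cutW hχ hΦ q).smul_fst (hχ.smooth p)).iddbar_prod isFactorProj_projZ

theorem IsCutoff.isClosed_image (hχ : IsCutoff n U P χ K)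
    (hUt : ∀ p, U p ⊆ (chartAt (Cn (n + 1)) p).target) (p : M) :
    IsClosed ((chartAt (Cn (n + 1)) p).symm '' K p) :=
  ((hχ.compact p).image_of_continuousOn ((chartAt (Cn (n + 1)) p).continuousOn_symm.mono
    ((hχ.subset p).trans (hUt p)))).isClosed

theorem mem_of_cutW_ne_zero (hχ : IsCutoff n U P χ K)
    (hUt : ∀ p, U p ⊆ (chartAt (Cn (n + 1)) p).target) {q z w : M} (h : cutW χ Φ q (z, w) ≠ 0) :
    w ∈ (chartAt (Cn (n + 1)) q).symm '' K q := by
  by_contra hw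
  refine h (iddbar_eq_zero ?_)
  filter_upwards [continuousAt_snd.preimage_mem_nhds
    ((hχ.isClosed_image hUt q).isOpen_compl.mem_nhds hw)] with x hx
  have h0 : χ q x.2 = 0 := by
    by_contra hne
    exact hx (hχ.support q _ hne)
  rw [h0]
  exact zero_smul ℝ (Φ x)

theorem mem_of_cutZW_ne_zero (hχ : IsCutoff n U P χ K)
    (hUt : ∀ p, U p ⊆ (chartAt (Cn (n + 1)) p).target) {p q z w : M}
    (h : cutZW χ Φ p q (z, w) ≠ 0) : z ∈ (chartAt (Cn (n + 1)) p).symm '' K p ∧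
      w ∈ (chartAt (Cn (n + 1)) q).symm '' K q := by
  constructor
  · by_contra hz
    refine h (iddbar_eq_zero ?_)
    filter_upwards [continuousAt_fst.preimage_mem_nhds
      ((hχ.isClosed_image hUt p).isOpen_compl.mem_nhds hz)] with x hx
    have h0 : χ p x.1 = 0 := by
      by_contra hne
      exact hx (hχ.support p _ hne)
    rw [h0]
    exact zero_smul ℝ (cutW χ Φ q x)
  · by_contra hw
    refine h (iddbar_eq_zero ?_)
    filter_upwards [continuousAt_snd.preimage_mem_nhds
      ((hχ.isClosed_image hUt q).isOpen_compl.mem_nhds hw)] with x hx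
    have h0 : cutW χ Φ q x = 0 := by
      by_contra hne
      exact hx (mem_of_cutW_ne_zero (z := x.1) hχ hUt hne)
    rw [h0]
    exact smul_zero (A := (Cn (n + 1) × Cn (n + 1)) [⋀^Fin (2 * n + 2 * n + 1 + 1)]→L[ℝ] ℂ) (χ p x.1)

theorem sum_smul_eq {V : Type*} [AddCommGroup V] [Module ℝ V] (hχ : IsCutoff n U P χ K) (z : M)
    (v : V) : v = ∑ p ∈ P, χ p z • v := by
  rw [← Finset.sum_smul, hχ.sum_eq_one, one_smul]

/-- The cutoff in `w` is inserted before the first operator, the cutoff in `z` between the two. They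
stay under the derivatives, so no product rule is needed, and each piece is supported in a single
product chart. -/
theorem iddbar_iddbar_eq_sum (hχ : IsCutoff n U P χ K) (hΦ : IsSmoothForm (I₂ n) Φ) (x : M × M) :
    iddbar (I₂ n) (projZ n) (iddbar (I₂ n) (projW n) Φ) x
      = ∑ i ∈ P ×ˢ P, cutZW χ Φ i.1 i.2 x := by
  have h1 : iddbar (I₂ n) (projW n) Φ = fun x => ∑ i ∈ P ×ˢ P, χ i.1 x.1 • cutW χ Φ i.2 x := by
    funext x
    rw [Finset.sum_product_right]
    rw [show Φ = fun x => ∑ q ∈ P, χ q x.2 • Φ x from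
      funext fun x => sum_smul_eq hχ x.2 (Φ x), iddbar_sum P fun q _ => hΦ.smul_snd (hχ.smooth q)]
    refine Finset.sum_congr rfl fun q _ => ?_
    rw [← show Φ = fun x => ∑ q ∈ P, χ q x.2 • Φ x from
      funext fun x => sum_smul_eq hχ x.2 (Φ x)]
    exact sum_smul_eq hχ x.1 (cutW χ Φ q x)
  rw [h1, iddbar_sum _ fun i _ => (isSmoothForm_cutW hχ hΦ i.2).smul_fst (hχ.smooth i.1)]
  rfl

/-- The current of integration on the slices `{z} × M`. -/
theorem integrationCurrent_slice (hχ : IsCutoff n U P χ K) (hU : ∀ p, IsOpen (U p))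
    (hUt : ∀ p, U p ⊆ (chartAt (Cn (n + 1)) p).target) (hΦ : IsSmoothForm (I₂ n) Φ) {Z : Set M}
    {F : M → Cn (n + 1) → ℂ} (hZ : IsLocalEquation Z P U K F) (z : M)
    (v : Fin (2 * n) → Cn (n + 1)) :
    integrationCurrent Z (fun w v' => splitForm rfl Φ z w v v')
      = ∑ q ∈ P, ∫ y in K q, (1 / (2 * Real.pi) * ((Real.log (‖F q y‖ ^ 2) : ℝ) : ℂ)) *
        cutW χ Φ q (z, (chartAt (Cn (n + 1)) q).symm y)
          (splitVec (degree_cutW n) v (tframe q y)) := by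
  have hs := fun q : M => hΦ.smul_snd (hχ.smooth q)
  rw [poincareLelong hU hUt hχ.compact hχ.subset hZ
    (φ := fun q w => sliceSnd rfl v (χ q w • Φ (z, w)))
    (fun q _ => contDiffOn_formInChart_sliceSnd (hs q) rfl z q v) ?_ ?_]
  · refine Finset.sum_congr rfl fun q _ => ?_
    rw [← integral_const_mul]
    refine setIntegral_congr_fun (hχ.compact q).measurableSet fun y hy => ?_
    have h1 := ddcTop_formInChart_sliceSnd (hs q) (even_two_mul n) rfl (degree_cutW n) z q v
      (hUt q (hχ.subset q hy))
    beta_reduce at h1 ⊢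
    rw [h1, mul_assoc]
    rfl
  · intro q _ w hw
    refine hχ.support q w fun h0 => hw ?_
    have h1 : χ q w • Φ (z, w) = 0 := by
      rw [h0]
      exact zero_smul ℝ (Φ (z, w))
    rw [h1, map_zero]
  · intro w v'
    have h1 := congrArg (fun α => sliceSnd rfl v α v') (sum_smul_eq hχ w (Φ (z, w)))
    simp only [map_sum, ContinuousAlternatingMap.sum_apply] at h1
    exact h1

theorem PatchSystem.integrable_coeff {m : ℕ} {ι : Type*} {Z : Set M} {a : ι → Patch m n M}
    {ρ : ι → M → ℝ} (h : PatchSystem Z a ρ) (x : ι) {k : ℕ} {O K : Set (Cn k)} (hK : IsCompact K)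
    (hKO : K ⊆ O) {b : Cn k → ℂ} (hb : IntegrableOn b K) {R : Cn k → RawForm n (2 * m) M}
    (hR : ContinuousOn (fun q : Cn m × Cn k => (a x).coeff (R q.2) q.1) ((a x).dom ×ˢ O)) :
    Integrable (fun q : Cn m × Cn k => (ρ x ((a x).map q.1) : ℂ) *
      (a x).coeff (fun z v => b q.2 * R q.2 z v) q.1)
      ((volume.restrict (a x).dom).prod (volume.restrict K)) := by
  obtain ⟨C, hC, hCc, hC0⟩ := h.compact x
  exact integrable_prod_of_continuousOn (r := fun u => (ρ x ((a x).map u) : ℂ))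
    (h.regular x).isOpen.measurableSet hCc hC hK hKO
    (Complex.continuous_ofReal.comp_continuousOn ((h.continuous x).comp_continuousOn
      (h.regular x).continuousOn))
    (fun u hu hne => hC0 u hu fun h0 => hne (by simp [h0])) hb hR

/-- The product of a current of integration with a current that has integrable potentials. -/
theorem integrationCurrent_integral (hχ : IsCutoff n U P χ K) (hU : ∀ p, IsOpen (U p))
    (hUt : ∀ p, U p ⊆ (chartAt (Cn (n + 1)) p).target) (hΦ : IsSmoothForm (I₂ n) Φ) {Z : Set M}
    {F : M → Cn (n + 1) → ℂ} (hZ : IsLocalEquation Z P U K F) {b : M → Cn (n + 1) → ℂ}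
    (hb : ∀ q ∈ P, IntegrableOn (b q) (K q)) :
    integrationCurrent Z (fun z v => ∑ q ∈ P, ∫ y in K q, b q y *
        cutW χ Φ q (z, (chartAt (Cn (n + 1)) q).symm y)
          (splitVec (degree_cutW n) v (tframe q y)))
      = ∑ q ∈ P, ∫ y in K q, b q y * ∑ p ∈ P, ∫ x in K p,
        (1 / (2 * Real.pi) * ((Real.log (‖F p x‖ ^ 2) : ℝ) : ℂ)) * cutCoeff χ Φ p q (x, y) := by
  have hsys := patchSystem_hypersurface hZ.hypersurface
  have hKt : ∀ q, K q ⊆ (chartAt (Cn (n + 1)) q).target := fun q =>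
    (hχ.subset q).trans (hUt q)
  set R : M → Cn (n + 1) → RawForm n (2 * n) M := fun q y z v =>
    cutW χ Φ q (z, (chartAt (Cn (n + 1)) q).symm y) (splitVec (degree_cutW n) v (tframe q y))
    with hR
  -- The charts of `Z` are arbitrary members of the maximal atlas, so joint continuity has to be
  -- known in the product of such a chart with a preferred one, and not only in preferred product
  -- charts.
  have hcont : ∀ q (x : Z), ContinuousOn (fun u : Cn n × Cn (n + 1) =>
      (hyperPatch (hZ.hypersurface.chart x)).coeff (R q u.2) u.1)
      ((hyperPatch (hZ.hypersurface.chart x)).dom ×ˢ (chartAt (Cn (n + 1)) q).target) := by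
    intro q x
    have h1 := continuousOn_formInChart_hcharts (isSmoothForm_cutW hχ hΦ q)
      (isStraightening_chart hZ.hypersurface x).1 q
    have h2 : ContinuousOn (fun u : Cn n × Cn (n + 1) => (consZero n u.1, u.2))
        ((hyperPatch (hZ.hypersurface.chart x)).dom ×ˢ (chartAt (Cn (n + 1)) q).target) :=
      (((consZero n).continuous.comp continuous_fst).prodMk continuous_snd).continuousOn
    have h3 := h1.comp h2 fun u hu => ⟨hu.1, hu.2⟩
    have h4 := ContinuousOn.form_apply (g := fun _ => splitVec (degree_cutW n)
      (fun k => consZero n (stdFrame n k)) (stdFrame (n + 1))) h3 fun _ => continuousOn_const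
    refine h4.congr fun u _ => ?_
    simp only [Function.comp_apply]
    rw [ContinuousAlternatingMap.compContinuousLinearMap_apply, prodMap_comp_splitVec]
    rfl
  -- The integral over `y` is moved outside the current. For each frozen `y` the Poincaré–Lelong
  -- formula is then applied in `z`.
  rw [integrationCurrent_eq_patchSum hZ.hypersurface,
    hsys.patchSum_integral P (fun q => volume.restrict (K q)) (fun q y z v => b q y * R q y z v)
      fun q hq x => hsys.integrable_coeff x (hχ.compact q) (hKt q) (hb q hq) (hcont q x)]
  refine Finset.sum_congr rfl fun q _ => ?_
  refine setIntegral_congr_fun (hχ.compact q).measurableSet fun y hy => ?_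
  rw [patchSum_const_mul, ← integrationCurrent_eq_patchSum hZ.hypersurface]
  congr 1
  have hs := fun p : M => (isSmoothForm_cutW hχ hΦ q).smul_fst (hχ.smooth p)
  rw [poincareLelong hU hUt hχ.compact hχ.subset hZ
    (φ := fun p z => sliceFst (degree_cutW n) (tframe q y)
      (χ p z • cutW χ Φ q (z, (chartAt (Cn (n + 1)) q).symm y)))
    (fun p _ => contDiffOn_formInChart_sliceFst (hs p) (degree_cutW n) p q (hKt q hy)) ?_ ?_]
  · refine Finset.sum_congr rfl fun p _ => ?_
    rw [← integral_const_mul]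
    refine setIntegral_congr_fun (hχ.compact p).measurableSet fun x hx => ?_
    have h1 := ddcTop_formInChart_sliceFst (hs p) (degree_cutW n) (degree_cutZW n) p q
      (x := x) (y := y) ⟨hKt p hx, hKt q hy⟩
    beta_reduce at h1 ⊢
    rw [h1, mul_assoc]
    rfl
  · intro p _ z hz
    refine hχ.support p z fun h0 => hz ?_
    have h1 : χ p z • cutW χ Φ q (z, (chartAt (Cn (n + 1)) q).symm y) = 0 := by
      rw [h0]
      exact zero_smul ℝ (cutW χ Φ q (z, (chartAt (Cn (n + 1)) q).symm y))
    rw [h1, map_zero]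
  · intro z v
    have h1 := congrArg (fun α => sliceFst (degree_cutW n) (tframe q y) α v)
      (sum_smul_eq hχ z (cutW χ Φ q (z, (chartAt (Cn (n + 1)) q).symm y)))
    simp only [map_sum, ContinuousAlternatingMap.sum_apply] at h1
    exact h1

/-- A form of top degree that is a sum of forms supported in charts is integrated chart by
chart. -/
theorem integralM_eq_sum {β : Type*} (s : Finset β) (p : β → M) (C : β → Set (Cn (n + 1)))
    (hC : ∀ i ∈ s, IsCompact (C i)) (hCt : ∀ i ∈ s, C i ⊆ (chartAt (Cn (n + 1)) (p i)).target)
    (R : β → M → Cn (n + 1) [⋀^Fin (2 * (n + 1))]→L[ℝ] ℂ)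
    (hR : ∀ i ∈ s, ∀ z, R i z ≠ 0 → z ∈ (chartAt (Cn (n + 1)) (p i)).symm '' C i)
    (hRc : ∀ i ∈ s, ContinuousOn (formInChart 𝓘(ℝ, Cn (n + 1)) (R i) (p i))
      (chartAt (Cn (n + 1)) (p i)).target)
    {η : RawForm n (2 * (n + 1)) M} (hη : ∀ z v, η z v = ∑ i ∈ s, R i z v) :
    integralM η = ∑ i ∈ s, ∫ u in C i,
      formInChart 𝓘(ℝ, Cn (n + 1)) (R i) (p i) u (stdFrame (n + 1)) := by
  have h0 : ∀ i ∈ s, ∀ u ∈ (chartAt (Cn (n + 1)) (p i)).target, u ∉ C i →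
      formInChart 𝓘(ℝ, Cn (n + 1)) (R i) (p i) u (stdFrame (n + 1)) = 0 := by
    intro i hi u hu hne
    have h1 : R i ((chartAt (Cn (n + 1)) (p i)).symm u) = 0 := by
      by_contra h
      obtain ⟨u', hu', huu⟩ := hR i hi _ h
      rw [(chartAt (Cn (n + 1)) (p i)).symm.injOn (hCt i hi hu') hu huu] at hu'
      exact hne hu'
    rw [formInChart_eq, h1]
    rfl
  rw [integralM_eq_patchSum, patchSystem_charts.patchSum_eq s
    (fun i => chartPatch (chartAt (Cn (n + 1)) (p i))) (fun i _ => chartPatch_isRegular _)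
    (fun _ _ _ _ => Set.mem_univ _)
    (fun i _ x => chartPatch_compatible (chartAt_mem_hcharts x) (chartAt_mem_hcharts (p i)))
    R (fun i hi z _ hne => Set.image_mono (hCt i hi) (hR i hi z hne)) ?_ η (fun z _ v => hη z v)]
  · refine Finset.sum_congr rfl fun i hi => ?_
    exact setIntegral_eq_of_subset_of_forall_sdiff_eq_zero
      (chartAt (Cn (n + 1)) (p i)).open_target.measurableSet (hCt i hi)
      fun u hu => h0 i hi u hu.1 hu.2
  · intro i hi
    refine integrableOn_of_continuousOn_of_compact
      (chartAt (Cn (n + 1)) (p i)).open_target.measurableSet (hC i hi) (hCt i hi)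
      (ContinuousOn.form_apply (g := fun _ => stdFrame (n + 1)) (hRc i hi)
        fun _ => continuousOn_const) fun u hu hne => ?_
    by_contra hu'
    exact hne (h0 i hi u hu hu')

theorem continuousOn_formInChart_smul {k : ℕ} {R : M → Cn (n + 1) [⋀^Fin k]→L[ℝ] ℂ} {c : M → ℂ}
    (hc : Continuous c) {q : M} (hR : ContinuousOn (formInChart 𝓘(ℝ, Cn (n + 1)) R q)
      (chartAt (Cn (n + 1)) q).target) :
    ContinuousOn (formInChart 𝓘(ℝ, Cn (n + 1)) (fun w => c w • R w) q)
      (chartAt (Cn (n + 1)) q).target := by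
  have h1 : ContinuousOn (fun y => c ((chartAt (Cn (n + 1)) q).symm y))
      (chartAt (Cn (n + 1)) q).target :=
    hc.comp_continuousOn (chartAt (Cn (n + 1)) q).continuousOn_symm
  refine (h1.smul hR).congr fun y _ => ?_
  ext v
  rfl

/-- The part around `i = (p, q)` of `Q(z, w) (i∂∂̄)_z (i∂∂̄)_w Φ`, contracted with the frame given by
the chart around `q`. -/
def cutForm (χ : M → M → ℝ)
    (Φ : M × M → (Cn (n + 1) × Cn (n + 1)) [⋀^Fin (2 * n + 2 * n)]→L[ℝ] ℂ) (Q : M → M → ℝ)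
    (i : M × M) (y : Cn (n + 1)) : RawForm n (2 * (n + 1)) M := fun z v =>
  (Q z ((chartAt (Cn (n + 1)) i.2).symm y) : ℂ) *
    cutZW χ Φ i.1 i.2 (z, (chartAt (Cn (n + 1)) i.2).symm y)
      (splitVec (degree_cutZW n) v (tframe i.2 y))

theorem integralM_slice (hχ : IsCutoff n U P χ K)
    (hUt : ∀ p, U p ⊆ (chartAt (Cn (n + 1)) p).target) (hΦ : IsSmoothForm (I₂ n) Φ)
    {Q : M → M → ℝ} (hQ : Continuous fun x : M × M => Q x.1 x.2) (z : M)
    (v : Fin (2 * (n + 1)) → Cn (n + 1)) :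
    integralM (fun w v' => splitForm (degree_cutZW n) (fun x : M × M =>
      (Q x.1 x.2 : ℂ) • iddbar (I₂ n) (projZ n) (iddbar (I₂ n) (projW n) Φ) x) z w v v')
      = ∑ i ∈ P ×ˢ P, ∫ y in K i.2, 1 * cutForm χ Φ Q i y z v := by
  have hQc : Continuous fun w : M => (Q z w : ℂ) :=
    Complex.continuous_ofReal.comp (hQ.comp (continuous_const.prodMk continuous_id))
  rw [integralM_eq_sum (P ×ˢ P) Prod.snd (fun i => K i.2) (fun i _ => hχ.compact _)
    (fun i _ => (hχ.subset _).trans (hUt _))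
    (fun i w => (Q z w : ℂ) • sliceSnd (degree_cutZW n) v (cutZW χ Φ i.1 i.2 (z, w)))]
  · refine Finset.sum_congr rfl fun i _ => ?_
    refine setIntegral_congr_fun (hχ.compact i.2).measurableSet fun y hy => ?_
    rw [one_mul]
    rfl
  · intro i _ w hne
    refine (mem_of_cutZW_ne_zero (z := z) (p := i.1) (Φ := Φ) hχ hUt fun h0 => hne ?_).2
    rw [h0, map_zero]
    exact smul_zero (A := Cn (n + 1) [⋀^Fin (2 * (n + 1))]→L[ℝ] ℂ) (Q z w : ℂ)
  · intro i _
    exact continuousOn_formInChart_smul hQc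
      (contDiffOn_formInChart_sliceSnd (isSmoothForm_cutZW hχ hΦ i.1 i.2)
        (degree_cutZW n) z i.2 v).continuousOn
  · intro w v'
    rw [splitForm, iddbar_iddbar_eq_sum hχ hΦ, ContinuousAlternatingMap.smul_apply,
      ContinuousAlternatingMap.sum_apply, Finset.smul_sum]
    rfl

theorem continuousOn_coeff_cutForm (hχ : IsCutoff n U P χ K) (hΦ : IsSmoothForm (I₂ n) Φ)
    {Q : M → M → ℝ} (hQ : Continuous fun x : M × M => Q x.1 x.2) (i : M × M) (x : M) :
    ContinuousOn (fun u : Cn (n + 1) × Cn (n + 1) =>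
      (chartPatch (chartAt (Cn (n + 1)) x)).coeff (cutForm χ Φ Q i u.2) u.1)
      ((chartPatch (chartAt (Cn (n + 1)) x)).dom ×ˢ (chartAt (Cn (n + 1)) i.2).target) := by
  have hQc : Continuous fun x : M × M => (Q x.1 x.2 : ℂ) := Complex.continuous_ofReal.comp hQ
  have h1 := continuousOn_formInChart_hcharts (isSmoothForm_cutZW hχ hΦ i.1 i.2)
    (chartAt_mem_hcharts x) i.2
  have h4 := ContinuousOn.form_apply (g := fun _ => splitVec (degree_cutZW n)
    (stdFrame (n + 1)) (stdFrame (n + 1))) h1 fun _ => continuousOn_const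
  have h2 : ContinuousOn (fun u : Cn (n + 1) × Cn (n + 1) =>
      (Q ((chartAt (Cn (n + 1)) x).symm u.1) ((chartAt (Cn (n + 1)) i.2).symm u.2) : ℂ))
      ((chartAt (Cn (n + 1)) x).target ×ˢ (chartAt (Cn (n + 1)) i.2).target) :=
    hQc.comp_continuousOn
      (((chartAt (Cn (n + 1)) x).continuousOn_symm.comp continuousOn_fst fun u hu => hu.1).prodMk
        ((chartAt (Cn (n + 1)) i.2).continuousOn_symm.comp continuousOn_snd fun u hu => hu.2))
  refine (h2.mul h4).congr fun u _ => ?_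
  rw [Pi.mul_apply]
  rw [ContinuousAlternatingMap.compContinuousLinearMap_apply, prodMap_comp_splitVec]
  rfl

theorem integralM_cutForm (hχ : IsCutoff n U P χ K)
    (hUt : ∀ p, U p ⊆ (chartAt (Cn (n + 1)) p).target) (hΦ : IsSmoothForm (I₂ n) Φ)
    {Q : M → M → ℝ} (hQ : Continuous fun x : M × M => Q x.1 x.2) (p q : M) {y : Cn (n + 1)}
    (hy : y ∈ K q) :
    integralM (cutForm χ Φ Q (p, q) y) = ∫ x in K p,
      (Q ((chartAt (Cn (n + 1)) p).symm x) ((chartAt (Cn (n + 1)) q).symm y) : ℂ) *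
        cutCoeff χ Φ p q (x, y) := by
  have hKt : ∀ q, K q ⊆ (chartAt (Cn (n + 1)) q).target := fun q =>
    (hχ.subset q).trans (hUt q)
  have hQc : Continuous fun z : M => (Q z ((chartAt (Cn (n + 1)) q).symm y) : ℂ) :=
    Complex.continuous_ofReal.comp (hQ.comp (continuous_id.prodMk continuous_const))
  rw [integralM_eq_sum {p} id K (fun i _ => hχ.compact _) (fun i _ => hKt _)
    (fun i z => (Q z ((chartAt (Cn (n + 1)) q).symm y) : ℂ) •
      sliceFst (degree_cutZW n) (tframe q y)
        (cutZW χ Φ i q (z, (chartAt (Cn (n + 1)) q).symm y))), Finset.sum_singleton]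
  · refine setIntegral_congr_fun (hχ.compact p).measurableSet fun x hx => ?_
    have h2 := congrArg (fun α => α (stdFrame (n + 1))) (formInChart_sliceFst
      (Φ := cutZW χ Φ p q) (degree_cutZW n) p q (x := x) (y := y) ⟨hKt _ hx, hKt _ hy⟩)
    beta_reduce at h2
    rw [sliceFst_apply] at h2
    rw [cutCoeff, ← h2]
    rfl
  · intro j _ z hne
    refine (mem_of_cutZW_ne_zero (w := (chartAt (Cn (n + 1)) q).symm y) (p := j) (q := q) (Φ := Φ)
      hχ hUt fun h0 => hne ?_).1
    rw [h0, map_zero]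
    exact smul_zero (A := Cn (n + 1) [⋀^Fin (2 * (n + 1))]→L[ℝ] ℂ)
      (Q z ((chartAt (Cn (n + 1)) q).symm y) : ℂ)
  · intro j _
    exact continuousOn_formInChart_smul hQc
      (contDiffOn_formInChart_sliceFst (isSmoothForm_cutZW hχ hΦ j q)
        (degree_cutZW n) j q (hKt _ hy)).continuousOn
  · intro z v
    rw [Finset.sum_singleton]
    rfl

/-- This has the shape of the expectation formulas, with weight `Q` against `cutCoeff` on each `K_p
× K_q`. The exchange of integrals is the one used for the currents of integration, with the
potential `b` replaced by `1` and the continuous `Q` absorbed into the form. -/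
theorem bipotentialCurrent_eq (hχ : IsCutoff n U P χ K)
    (hUt : ∀ p, U p ⊆ (chartAt (Cn (n + 1)) p).target) (hΦ : IsSmoothForm (I₂ n) Φ)
    {Q : M → M → ℝ} (hQ : Continuous fun x : M × M => Q x.1 x.2) :
    bipotentialCurrent Q Φ = ∑ i ∈ P ×ˢ P, ∫ y in K i.2, ∫ x in K i.1,
      (Q ((chartAt (Cn (n + 1)) i.1).symm x) ((chartAt (Cn (n + 1)) i.2).symm y) : ℂ) *
        cutCoeff χ Φ i.1 i.2 (x, y) := by
  have hsys := patchSystem_charts (n := n) (M := M)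
  have h1 : bipotentialCurrent Q Φ = integralM fun z v => ∑ i ∈ P ×ˢ P, ∫ y in K i.2,
      1 * cutForm χ Φ Q i y z v := by
    simp only [← integralM_slice hχ hUt hΦ hQ]
    rfl
  have h2 := fun (i : M × M) (x : M) => hsys.integrable_coeff x (b := fun _ => 1)
    (R := cutForm χ Φ Q i) (hχ.compact i.2) ((hχ.subset i.2).trans (hUt i.2))
    (continuousOn_const.integrableOn_compact (hχ.compact i.2))
    (continuousOn_coeff_cutForm hχ hΦ hQ i x)
  rw [h1, integralM_eq_patchSum, hsys.patchSum_integral (P ×ˢ P) (fun i => volume.restrict (K i.2))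
    (fun i y z v => 1 * cutForm χ Φ Q i y z v) fun i _ x => h2 i x]
  refine Finset.sum_congr rfl fun i _ => ?_
  refine setIntegral_congr_fun (hχ.compact i.2).measurableSet fun y hy => ?_
  rw [← integralM_cutForm hχ hUt hΦ hQ i.1 i.2 hy, integralM_eq_patchSum]
  simp only [one_mul]

end ProductCurrents

/-! ### Expectations of random potentials -/

section Potentials

variable {d k l : ℕ}

/-- The potential `(1/2π) log|∑ⱼ cⱼ fⱼ|²` of the divisor of `∑ⱼ cⱼ fⱼ`. -/
def potential (f : Fin d → Cn k → ℂ) (c : Fin d → ℂ) (u : Cn k) : ℂ :=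
  1 / (2 * Real.pi) * ((Real.log (‖lincomb f c u‖ ^ 2) : ℝ) : ℂ)

/-- The expectation of the potential. -/
def meanPotential (f : Fin d → Cn k → ℂ) (u : Cn k) : ℂ :=
  1 / (2 * Real.pi) * ((Real.log (nsq fun j => f j u) + logMean : ℝ) : ℂ)

variable {f : Fin d → Cn k → ℂ} {g : Fin d → Cn l → ℂ}

theorem potential_eq (f : Fin d → Cn k → ℂ) (c : Fin d → ℂ) (u : Cn k) :
    potential f c u = ((1 / (2 * Real.pi) * Real.log (‖dot c fun j => f j u‖ ^ 2) : ℝ) : ℂ) := by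
  rw [potential]
  push_cast
  rfl

theorem memLp_potential {u : Cn k} (hu : ∃ j, f j u ≠ 0) :
    MemLp (fun c => potential f c u) 2 (gaussian d) := by
  simp only [potential_eq]
  exact ((memLp_log_dot (a := fun j => f j u) (Function.ne_iff.2 hu)).const_mul
    (1 / (2 * Real.pi))).ofReal

theorem integrable_potential {u : Cn k} (hu : ∃ j, f j u ≠ 0) :
    Integrable (fun c => potential f c u) (gaussian d) :=
  (memLp_potential hu).integrable (by norm_num)

theorem integral_potential {u : Cn k} (hu : ∃ j, f j u ≠ 0) :
    ∫ c, potential f c u ∂gaussian d = meanPotential f u := by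
  simp only [potential_eq]
  rw [integral_complex_ofReal, integral_const_mul, integral_log_dot (Function.ne_iff.2 hu),
    meanPotential]
  push_cast
  rfl

/-- The two normalizations `1/2π` multiply to the constant `1/4π²` of `Gtilde`, so the covariance of
the potentials is the bipotential in local components. -/
theorem integral_potential_mul {u : Cn k} (hu : ∃ j, f j u ≠ 0) {w : Cn l}
    (hw : ∃ j, g j w ≠ 0) :
    ∫ c, potential f c u * potential g c w ∂gaussian d
      = meanPotential f u * meanPotential g w + ((1 / (4 * Real.pi ^ 2) *
        dilog (‖herm (fun j => f j u) fun j => g j w‖ ^ 2 /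
          (nsq (fun j => f j u) * nsq fun j => g j w)) : ℝ) : ℂ) := by
  simp only [potential_eq, ← Complex.ofReal_mul]
  rw [integral_complex_ofReal]
  have h1 : ∀ c : Fin d → ℂ, 1 / (2 * Real.pi) * Real.log (‖dot c fun j => f j u‖ ^ 2) *
      (1 / (2 * Real.pi) * Real.log (‖dot c fun j => g j w‖ ^ 2))
      = 1 / (4 * Real.pi ^ 2) * (Real.log (‖dot c fun j => f j u‖ ^ 2) *
        Real.log (‖dot c fun j => g j w‖ ^ 2)) := fun c => by
    field_simp
    ring
  simp only [h1]
  rw [integral_const_mul, integral_log_mul_log (Function.ne_iff.2 hu) (Function.ne_iff.2 hw),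
    meanPotential, meanPotential]
  push_cast
  have hpi : (Real.pi : ℂ) ≠ 0 := Complex.ofReal_ne_zero.2 Real.pi_ne_zero
  field_simp
  ring

/-- The second moment is an explicit polynomial in `log (nsq f(u))`. This is continuous on `K`
because the `fⱼ` have no common zero. Every later exchange of expectation and integral rests on this
bound. -/
theorem exists_moment_bound {K : Set (Cn k)} (hK : IsCompact K)
    (hf : ∀ j, ContinuousOn (f j) K) (h0 : ∀ u ∈ K, ∃ j, f j u ≠ 0) :
    ∃ C, ∀ u ∈ K, ∫ c, ‖potential f c u‖ ^ 2 ∂gaussian d ≤ C := by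
  have hn : ContinuousOn (fun u => Real.log (nsq fun j => f j u)) K :=
    ContinuousOn.log (continuousOn_finsetSum _ fun j _ => (hf j).norm.pow 2)
      fun u hu => (nsq_pos (Function.ne_iff.2 (h0 u hu))).ne'
  have hc : ContinuousOn (fun u => (1 / (2 * Real.pi)) ^ 2 * (Real.log (nsq fun j => f j u) ^ 2 +
      2 * Real.log (nsq fun j => f j u) * logMean + logMoment)) K := by fun_prop
  obtain ⟨C, hC⟩ := hK.exists_bound_of_continuousOn hc
  refine ⟨C, fun u hu => (le_of_eq ?_).trans ((le_abs_self _).trans (hC u hu))⟩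
  rw [← integral_log_dot_sq (a := fun j => f j u) (Function.ne_iff.2 (h0 u hu)),
    ← integral_const_mul]
  refine integral_congr_ae (Filter.Eventually.of_forall fun c => ?_)
  simp only [potential_eq, Complex.norm_real, Real.norm_eq_abs, sq_abs]
  ring

theorem aestronglyMeasurable_potential {X : Type*} [TopologicalSpace X] [MeasurableSpace X]
    [OpensMeasurableSpace X] {μ : Measure X} {s : Set X} (hs : MeasurableSet s)
    {K : Set (Cn k)} (hf : ∀ j, ContinuousOn (f j) K) {c : X → Fin d → ℂ} {u : X → Cn k}
    (hc : ContinuousOn c s) (hu : ContinuousOn u s) (hus : Set.MapsTo u s K) :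
    AEStronglyMeasurable (fun x => potential f (c x) (u x)) (μ.restrict s) := by
  have h1 : ContinuousOn (fun x => lincomb f (c x) (u x)) s :=
    continuousOn_finsetSum _ fun j _ =>
      (continuousOn_pi.1 hc j).mul ((hf j).comp hu hus)
  have h2 : AEMeasurable (fun x => ‖lincomb f (c x) (u x)‖ ^ 2) (μ.restrict s) :=
    (h1.norm.pow 2).aemeasurable hs
  exact ((Complex.measurable_ofReal.comp_aemeasurable
    (Real.measurable_log.comp_aemeasurable h2)).const_mul _).aestronglyMeasurable

theorem continuousOn_meanPotential {K : Set (Cn k)} (hf : ∀ j, ContinuousOn (f j) K)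
    (h0 : ∀ u ∈ K, ∃ j, f j u ≠ 0) : ContinuousOn (meanPotential f) K := by
  refine continuousOn_const.mul (Complex.continuous_ofReal.comp_continuousOn ?_)
  exact (ContinuousOn.log (continuousOn_finsetSum _ fun j _ => (hf j).norm.pow 2)
      fun u hu => (nsq_pos (Function.ne_iff.2 (h0 u hu))).ne').add continuousOn_const

theorem gaussian_prod_restrict {X : Type*} [MeasureSpace X] [SFinite (volume : Measure X)]
    (s : Set X) : (gaussian d).prod (volume.restrict s)
      = ((gaussian d).prod volume).restrict (Set.univ ×ˢ s) := by
  rw [← Measure.prod_restrict, Measure.restrict_univ]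

/-- A random function on a set of finite measure is integrable if its first moments are bounded. -/
theorem integrable_gaussian_prod {X : Type*} [MeasureSpace X] [SFinite (volume : Measure X)]
    {s : Set X} (hs : MeasurableSet s) (hfin : volume s ≠ ⊤) {F : (Fin d → ℂ) × X → ℂ}
    (hF : AEStronglyMeasurable F ((gaussian d).prod (volume.restrict s)))
    (hi : ∀ x ∈ s, Integrable (fun c => F (c, x)) (gaussian d)) {C : ℝ}
    (hC : ∀ x ∈ s, ∫ c, ‖F (c, x)‖ ∂gaussian d ≤ C) :
    Integrable F ((gaussian d).prod (volume.restrict s)) := by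
  have : IsFiniteMeasure ((volume : Measure X).restrict s) := isFiniteMeasure_restrict.2 hfin
  rw [integrable_prod_iff' hF]
  refine ⟨(ae_restrict_iff' hs).2 (Filter.Eventually.of_forall hi), ?_⟩
  refine Integrable.mono' (integrable_const C) hF.norm.prod_swap.integral_prod_right'
    ((ae_restrict_iff' hs).2 (Filter.Eventually.of_forall fun x hx => ?_))
  rw [Real.norm_of_nonneg (integral_nonneg fun c => norm_nonneg _)]
  exact hC x hx

theorem integral_norm_le_of_memLp {X : Type*} [MeasurableSpace X] {μ : Measure X}
    [IsProbabilityMeasure μ] {F : X → ℂ} (hF : MemLp F 2 μ) {C : ℝ} (hC : ∫ x, ‖F x‖ ^ 2 ∂μ ≤ C) :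
    ∫ x, ‖F x‖ ∂μ ≤ 1 + C := by
  have h2 := hF.norm.integrable_sq
  calc ∫ x, ‖F x‖ ∂μ ≤ ∫ x, (1 + ‖F x‖ ^ 2) ∂μ :=
        integral_mono (hF.integrable (by norm_num)).norm ((integrable_const _).add h2) fun x => by
          nlinarith [sq_nonneg (‖F x‖ - 1), norm_nonneg (F x)]
    _ ≤ 1 + C := by
        rw [integral_add (integrable_const _) h2]
        simpa using hC

theorem integral_norm_mul_le_of_memLp {X : Type*} [MeasurableSpace X] {μ : Measure X}
    {F G : X → ℂ} (hF : MemLp F 2 μ) (hG : MemLp G 2 μ) {C D : ℝ}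
    (hC : ∫ x, ‖F x‖ ^ 2 ∂μ ≤ C) (hD : ∫ x, ‖G x‖ ^ 2 ∂μ ≤ D) :
    ∫ x, ‖F x * G x‖ ∂μ ≤ C + D := by
  have h1 := hF.norm.integrable_sq
  have h2 := hG.norm.integrable_sq
  have h3 : Integrable (fun x => F x * G x) μ := hF.integrable_mul hG
  calc ∫ x, ‖F x * G x‖ ∂μ ≤ ∫ x, (‖F x‖ ^ 2 + ‖G x‖ ^ 2) ∂μ :=
        integral_mono h3.norm (h1.add h2) fun x => by
          simp only [norm_mul]
          nlinarith [sq_nonneg (‖F x‖ - ‖G x‖), sq_nonneg ‖F x‖, sq_nonneg ‖G x‖]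
    _ ≤ C + D := by
        rw [integral_add h1 h2]
        exact add_le_add hC hD

variable {K : Set (Cn k)} {K' : Set (Cn l)}

theorem integrable_potential_mul (hK : IsCompact K) (hf : ∀ j, ContinuousOn (f j) K)
    (h0 : ∀ u ∈ K, ∃ j, f j u ≠ 0) {H : Cn k → ℂ} (hH : ContinuousOn H K) :
    Integrable (fun q : (Fin d → ℂ) × Cn k => potential f q.1 q.2 * H q.2)
      ((gaussian d).prod (volume.restrict K)) := by
  obtain ⟨C, hC⟩ := exists_moment_bound hK hf h0
  obtain ⟨B, hB⟩ := hK.exists_bound_of_continuousOn hH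
  refine integrable_gaussian_prod (C := (1 + |C|) * |B|) hK.measurableSet hK.measure_lt_top.ne ?_
    ?_ ?_
  · rw [gaussian_prod_restrict]
    have hm : MeasurableSet ((Set.univ : Set (Fin d → ℂ)) ×ˢ K) :=
      MeasurableSet.univ.prod hK.measurableSet
    refine (aestronglyMeasurable_potential hm hf continuousOn_fst continuousOn_snd
      fun q hq => hq.2).mul ?_
    exact (hH.comp continuousOn_snd fun q hq => hq.2).aestronglyMeasurable hm
  · intro x hx
    exact (integrable_potential (h0 x hx)).mul_const (H x)
  · intro x hx
    simp only [norm_mul]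
    rw [integral_mul_const]
    refine mul_le_mul (integral_norm_le_of_memLp (memLp_potential (h0 x hx))
      ((hC x hx).trans (le_abs_self C))) ((hB x hx).trans (le_abs_self B)) (norm_nonneg _)
      (by positivity)

/-- Joint integrability in `(c, u)` gives integrability in `u` for almost every `c`. The singularity
of `log|F|²` along the zero set never has to be analysed. -/
theorem ae_integrableOn_potential (hK : IsCompact K) (hf : ∀ j, ContinuousOn (f j) K)
    (h0 : ∀ u ∈ K, ∃ j, f j u ≠ 0) : ∀ᵐ c ∂gaussian d,
    IntegrableOn (fun u => ((Real.log (‖lincomb f c u‖ ^ 2) : ℝ) : ℂ)) K := by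
  -- The constant `2π` undoes the normalization of the potential.
  have h := integrable_potential_mul (d := d) hK hf h0 (H := fun _ => 2 * Real.pi)
    continuousOn_const
  filter_upwards [h.prod_right_ae] with c hc
  refine hc.congr (Filter.Eventually.of_forall fun u => ?_)
  have hpi : (Real.pi : ℂ) ≠ 0 := Complex.ofReal_ne_zero.2 Real.pi_ne_zero
  simp only [potential]
  field_simp

theorem integral_potential_pairing (hK : IsCompact K) (hf : ∀ j, ContinuousOn (f j) K)
    (h0 : ∀ u ∈ K, ∃ j, f j u ≠ 0) {H : Cn k → ℂ} (hH : ContinuousOn H K) :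
    Integrable (fun c => ∫ u in K, potential f c u * H u) (gaussian d) ∧
    ∫ c, (∫ u in K, potential f c u * H u) ∂gaussian d = ∫ u in K, meanPotential f u * H u := by
  have h := integrable_potential_mul (d := d) hK hf h0 hH
  refine ⟨h.integral_prod_left, ?_⟩
  rw [integral_integral_swap h]
  refine setIntegral_congr_fun hK.measurableSet fun u hu => ?_
  rw [integral_mul_const, integral_potential (h0 u hu)]

theorem integral_triple_swap {F : (Fin d → ℂ) × Cn l × Cn k → ℂ}
    (hF : Integrable F ((gaussian d).prod (volume.restrict (K' ×ˢ K)))) :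
    Integrable (fun c => ∫ y in K', ∫ x in K, F (c, y, x)) (gaussian d) ∧
    ∫ c, (∫ y in K', ∫ x in K, F (c, y, x)) ∂gaussian d
      = ∫ y in K', ∫ x in K, (∫ c, F (c, y, x) ∂gaussian d) := by
  have hv : (volume : Measure (Cn l × Cn k)).restrict (K' ×ˢ K)
      = (volume.restrict K').prod (volume.restrict K) := (Measure.prod_restrict K' K).symm
  rw [hv] at hF
  have h1 : ∀ᵐ c ∂gaussian d, ∫ q, F (c, q) ∂((volume.restrict K').prod (volume.restrict K))
      = ∫ y in K', ∫ x in K, F (c, y, x) := by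
    filter_upwards [hF.prod_right_ae] with c hc
    exact integral_prod _ hc
  refine ⟨hF.integral_prod_left.congr h1, ?_⟩
  rw [← integral_congr_ae h1, integral_integral_swap (f := fun c q => F (c, q)) hF]
  exact integral_prod _ hF.integral_prod_right

theorem integral_potential_potential_pairing (hK : IsCompact K) (hf : ∀ j, ContinuousOn (f j) K)
    (h0 : ∀ u ∈ K, ∃ j, f j u ≠ 0) (hK' : IsCompact K') (hg : ∀ j, ContinuousOn (g j) K')
    (h0' : ∀ u ∈ K', ∃ j, g j u ≠ 0) {H : Cn k × Cn l → ℂ} (hH : ContinuousOn H (K ×ˢ K')) :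
    Integrable (fun c => ∫ y in K', ∫ x in K, potential f c x * potential g c y * H (x, y))
      (gaussian d) ∧
    ∫ c, (∫ y in K', ∫ x in K, potential f c x * potential g c y * H (x, y)) ∂gaussian d
      = ∫ y in K', ∫ x in K, (meanPotential f x * meanPotential g y +
        ((1 / (4 * Real.pi ^ 2) * dilog (‖herm (fun j => f j x) fun j => g j y‖ ^ 2 /
          (nsq (fun j => f j x) * nsq fun j => g j y)) : ℝ) : ℂ)) * H (x, y) := by
  obtain ⟨C, hC⟩ := exists_moment_bound hK hf h0
  obtain ⟨C', hC'⟩ := exists_moment_bound hK' hg h0'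
  obtain ⟨B, hB⟩ := (hK.prod hK').exists_bound_of_continuousOn hH
  have hKK := hK'.prod hK
  have hF : Integrable (fun q : (Fin d → ℂ) × Cn l × Cn k =>
      potential f q.1 q.2.2 * potential g q.1 q.2.1 * H (q.2.2, q.2.1))
      ((gaussian d).prod (volume.restrict (K' ×ˢ K))) := by
    refine integrable_gaussian_prod (C := (|C| + |C'|) * |B|) hKK.measurableSet
      hKK.measure_lt_top.ne ?_ ?_ ?_
    · rw [gaussian_prod_restrict]
      have hm : MeasurableSet ((Set.univ : Set (Fin d → ℂ)) ×ˢ (K' ×ˢ K)) :=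
        MeasurableSet.univ.prod hKK.measurableSet
      refine ((aestronglyMeasurable_potential hm hf continuousOn_fst
        (continuous_snd.comp continuous_snd).continuousOn fun q hq => hq.2.2).mul
        (aestronglyMeasurable_potential hm hg continuousOn_fst
        (continuous_fst.comp continuous_snd).continuousOn fun q hq => hq.2.1)).mul ?_
      exact (hH.comp (((continuous_snd.comp continuous_snd).prodMk
        (continuous_fst.comp continuous_snd)).continuousOn)
        fun q hq => ⟨hq.2.2, hq.2.1⟩).aestronglyMeasurable hm
    · rintro ⟨y, x⟩ ⟨hy, hx⟩
      have h3 : Integrable (fun c => potential f c x * potential g c y) (gaussian d) :=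
        (memLp_potential (h0 x hx)).integrable_mul (memLp_potential (h0' y hy))
      exact h3.mul_const (H (x, y))
    · rintro ⟨y, x⟩ ⟨hy, hx⟩
      simp only [norm_mul _ (H _)]
      rw [integral_mul_const]
      exact mul_le_mul (integral_norm_mul_le_of_memLp (memLp_potential (h0 x hx))
        (memLp_potential (h0' y hy)) ((hC x hx).trans (le_abs_self _))
        ((hC' y hy).trans (le_abs_self _))) ((hB (x, y) ⟨hx, hy⟩).trans (le_abs_self B))
        (norm_nonneg _) (by positivity)
  obtain ⟨h1, h2⟩ := integral_triple_swap hF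
  refine ⟨h1, h2.trans ?_⟩
  refine setIntegral_congr_fun hK'.measurableSet fun y hy => ?_
  refine setIntegral_congr_fun hK.measurableSet fun x hx => ?_
  dsimp only
  rw [integral_mul_const, integral_potential_mul (h0 x hx) (h0' y hy)]

theorem integral_potential_mean_pairing (hK : IsCompact K) (hf : ∀ j, ContinuousOn (f j) K)
    (h0 : ∀ u ∈ K, ∃ j, f j u ≠ 0) (hK' : IsCompact K') (hg : ∀ j, ContinuousOn (g j) K')
    (h0' : ∀ u ∈ K', ∃ j, g j u ≠ 0) {H : Cn k × Cn l → ℂ} (hH : ContinuousOn H (K ×ˢ K')) :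
    Integrable (fun c => ∫ y in K', ∫ x in K, potential f c x * (meanPotential g y * H (x, y)))
      (gaussian d) ∧
    ∫ c, (∫ y in K', ∫ x in K, potential f c x * (meanPotential g y * H (x, y))) ∂gaussian d
      = ∫ y in K', ∫ x in K, meanPotential f x * (meanPotential g y * H (x, y)) := by
  obtain ⟨C, hC⟩ := exists_moment_bound hK hf h0
  have hH' : ContinuousOn (fun q : Cn l × Cn k => meanPotential g q.1 * H (q.2, q.1))
      (K' ×ˢ K) :=
    ((continuousOn_meanPotential hg h0').comp continuousOn_fst fun q hq => hq.1).mul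
      (hH.comp continuous_swap.continuousOn fun q hq => ⟨hq.2, hq.1⟩)
  obtain ⟨B, hB⟩ := (hK'.prod hK).exists_bound_of_continuousOn hH'
  have hKK := hK'.prod hK
  have hF : Integrable (fun q : (Fin d → ℂ) × Cn l × Cn k =>
      potential f q.1 q.2.2 * (meanPotential g q.2.1 * H (q.2.2, q.2.1)))
      ((gaussian d).prod (volume.restrict (K' ×ˢ K))) := by
    refine integrable_gaussian_prod (C := (1 + |C|) * |B|) hKK.measurableSet
      hKK.measure_lt_top.ne ?_ ?_ ?_
    · rw [gaussian_prod_restrict]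
      have hm : MeasurableSet ((Set.univ : Set (Fin d → ℂ)) ×ˢ (K' ×ˢ K)) :=
        MeasurableSet.univ.prod hKK.measurableSet
      refine (aestronglyMeasurable_potential hm hf continuousOn_fst
        (continuous_snd.comp continuous_snd).continuousOn fun q hq => hq.2.2).mul ?_
      exact (hH'.comp continuousOn_snd fun q hq => hq.2).aestronglyMeasurable hm
    · rintro ⟨y, x⟩ ⟨hy, hx⟩
      exact (integrable_potential (h0 x hx)).mul_const (meanPotential g y * H (x, y))
    · rintro ⟨y, x⟩ ⟨hy, hx⟩
      simp only [norm_mul _ (_ * _)]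
      rw [integral_mul_const]
      exact mul_le_mul (integral_norm_le_of_memLp (memLp_potential (h0 x hx))
        ((hC x hx).trans (le_abs_self _))) ((hB (y, x) ⟨hy, hx⟩).trans (le_abs_self B))
        (norm_nonneg _) (by positivity)
  obtain ⟨h1, h2⟩ := integral_triple_swap hF
  refine ⟨h1, h2.trans ?_⟩
  refine setIntegral_congr_fun hK'.measurableSet fun y hy => ?_
  refine setIntegral_congr_fun hK.measurableSet fun x hx => ?_
  dsimp only
  rw [integral_mul_const, integral_potential (h0 x hx)]

end Potentials

/-! ### The variance current -/

section Variance

variable {n : ℕ} {M : Type*} [TopologicalSpace M] [CompactSpace M] [T2Space M]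
  [ChartedSpace (Cn (n + 1)) M] [IsManifold 𝓘(ℂ, Cn (n + 1)) ω M]

section CutoffSums

variable {U : M → Set (Cn (n + 1))} {P : Finset M} {χ : M → M → ℝ} {K : M → Set (Cn (n + 1))}
  {Φ : M × M → (Cn (n + 1) × Cn (n + 1)) [⋀^Fin (2 * n + 2 * n)]→L[ℝ] ℂ}

theorem continuousOn_cutCoeff (hχ : IsCutoff n U P χ K)
    (hUt : ∀ p, U p ⊆ (chartAt (Cn (n + 1)) p).target) (hΦ : IsSmoothForm (I₂ n) Φ) (p q : M) :
    ContinuousOn (cutCoeff χ Φ p q) (K p ×ˢ K q) := by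
  have h1 := ((isSmoothForm_cutZW hχ hΦ p q).contDiffOn_target₂ p q).continuousOn.mono
    (Set.prod_mono ((hχ.subset p).trans (hUt p)) ((hχ.subset q).trans (hUt q)))
  exact ContinuousOn.form_apply (g := fun _ => splitVec (degree_cutZW n)
    (stdFrame (n + 1)) (stdFrame (n + 1))) h1 fun _ => continuousOn_const

theorem continuousOn_cutW_slice (hχ : IsCutoff n U P χ K)
    (hUt : ∀ p, U p ⊆ (chartAt (Cn (n + 1)) p).target) (hΦ : IsSmoothForm (I₂ n) Φ) (z q : M)
    (v : Fin (2 * n) → Cn (n + 1)) :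
    ContinuousOn (fun y => cutW χ Φ q (z, (chartAt (Cn (n + 1)) q).symm y)
      (splitVec (degree_cutW n) v (tframe q y))) (K q) := by
  have h1 := (contDiffOn_formInChart_sliceSnd (isSmoothForm_cutW hχ hΦ q)
    (degree_cutW n) z q v).continuousOn.mono ((hχ.subset q).trans (hUt q))
  exact ContinuousOn.form_apply (g := fun _ => stdFrame (n + 1)) h1 fun _ => continuousOn_const

theorem integrable_mul_mul {k l : ℕ} {K : Set (Cn k)} {K' : Set (Cn l)} (hK : IsCompact K)
    (hK' : IsCompact K') {a : Cn k → ℂ} (ha : IntegrableOn a K) {b : Cn l → ℂ}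
    (hb : IntegrableOn b K') {H : Cn k × Cn l → ℂ} (hH : ContinuousOn H (K ×ˢ K')) :
    Integrable (fun q : Cn l × Cn k => a q.2 * (b q.1 * H (q.2, q.1)))
      ((volume.restrict K').prod (volume.restrict K)) := by
  have hH' : ContinuousOn (fun q : Cn l × Cn k => H (q.2, q.1)) (K' ×ˢ K) :=
    hH.comp continuous_swap.continuousOn fun q hq => ⟨hq.2, hq.1⟩
  obtain ⟨B, hB⟩ := (hK'.prod hK).exists_bound_of_continuousOn hH'
  have h1 := hb.mul_prod ha
  rw [Measure.prod_restrict] at h1 ⊢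
  have h2 := h1.bdd_mul (c := B) (hH'.aestronglyMeasurable (hK'.prod hK).measurableSet)
    ((ae_restrict_iff' (hK'.prod hK).measurableSet).2 (Filter.Eventually.of_forall hB))
  refine h2.congr (Filter.Eventually.of_forall fun q => ?_)
  beta_reduce
  ring

/-- The weight `b` is a potential of the second factor. It is the random potential in the expansion
of `Z_s ⊠ Z_s`, and the mean potential in that of `E(Z_s) ⊠ E(Z_s)`. -/
theorem integrationCurrent_integral_eq_sum (hχ : IsCutoff n U P χ K) (hU : ∀ p, IsOpen (U p))
    (hUt : ∀ p, U p ⊆ (chartAt (Cn (n + 1)) p).target) (hΦ : IsSmoothForm (I₂ n) Φ) {Z : Set M}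
    {F : M → Cn (n + 1) → ℂ} (hZ : IsLocalEquation Z P U K F) {b : M → Cn (n + 1) → ℂ}
    (hb : ∀ q ∈ P, IntegrableOn (b q) (K q)) :
    integrationCurrent Z (fun z v => ∑ q ∈ P, ∫ y in K q, b q y *
        cutW χ Φ q (z, (chartAt (Cn (n + 1)) q).symm y)
          (splitVec (degree_cutW n) v (tframe q y)))
      = ∑ i ∈ P ×ˢ P, ∫ y in K i.2, ∫ x in K i.1,
        (1 / (2 * Real.pi) * ((Real.log (‖F i.1 x‖ ^ 2) : ℝ) : ℂ)) *
          (b i.2 y * cutCoeff χ Φ i.1 i.2 (x, y)) := by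
  rw [integrationCurrent_integral hχ hU hUt hΦ hZ hb, Finset.sum_product_right]
  refine Finset.sum_congr rfl fun q hq => ?_
  have h1 := fun p (hp : p ∈ P) => (integrable_mul_mul (hχ.compact p) (hχ.compact q)
    (Integrable.const_mul (hZ.integrable p hp) (1 / (2 * Real.pi))) (hb q hq)
    (continuousOn_cutCoeff hχ hUt hΦ p q)).integral_prod_left
  rw [← integral_finsetSum _ h1]
  refine integral_congr_ae (Filter.Eventually.of_forall fun y => ?_)
  beta_reduce
  rw [Finset.mul_sum]
  refine Finset.sum_congr rfl fun p _ => ?_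
  rw [← integral_const_mul]
  refine integral_congr_ae (Filter.Eventually.of_forall fun x => ?_)
  beta_reduce
  ring

end CutoffSums

variable {L : M → Type*} [TopologicalSpace (Bundle.TotalSpace ℂ L)] [∀ x, AddCommGroup (L x)]
  [∀ x, Module ℂ (L x)] [∀ x, TopologicalSpace (L x)] [FiberBundle ℂ L] [VectorBundle ℂ ℂ L]
  {N d : ℕ} {P : Finset M} {χ : M → M → ℝ} {K : M → Set (Cn (n + 1))}
  {Φ : M × M → (Cn (n + 1) × Cn (n + 1)) [⋀^Fin (2 * n + 2 * n)]→L[ℝ] ℂ}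

theorem trivTarget_subset (p : M) : trivTarget n L p ⊆ (chartAt (Cn (n + 1)) p).target :=
  Set.inter_subset_left

theorem exists_isCutoff_trivTarget (n : ℕ) {M : Type*} [TopologicalSpace M] [CompactSpace M]
    [T2Space M] [ChartedSpace (Cn (n + 1)) M] [IsManifold 𝓘(ℂ, Cn (n + 1)) ω M]
    (L : M → Type*) [TopologicalSpace (Bundle.TotalSpace ℂ L)] [∀ x, AddCommGroup (L x)]
    [∀ x, Module ℂ (L x)] [∀ x, TopologicalSpace (L x)] [FiberBundle ℂ L]
    [VectorBundle ℂ ℂ L] : ∃ P χ K, IsCutoff n (trivTarget n L) P χ K := by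
  refine exists_isCutoff isOpen_trivTarget fun p => ⟨mem_chart_target _ p, ?_⟩
  rw [Set.mem_preimage, (chartAt (Cn (n + 1)) p).left_inv (mem_chart_source _ p)]
  exact FiberBundle.mem_baseSet_trivializationAt' p

theorem continuousOn_localComps (hχ : IsCutoff n (trivTarget n L) P χ K) (S : Fin d → H0 n L N)
    (p : M) (j : Fin d) : ContinuousOn (localComps S p j) (K p) :=
  (contDiffOn_localComps S p j).continuousOn.mono (hχ.subset p)

theorem exists_localComps_ne_zero (hχ : IsCutoff n (trivTarget n L) P χ K)
    (hN : BasePointFree n L N) (S : Module.Basis (Fin d) ℂ (H0 n L N)) (p : M) (u : Cn (n + 1))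
    (hu : u ∈ K p) : ∃ j, localComps S p j u ≠ 0 :=
  Function.ne_iff.1 (comps_ne_zero hN S (hχ.subset p hu).2)

theorem ae_isLocalEquation (hχ : IsCutoff n (trivTarget n L) P χ K) (hN : BasePointFree n L N)
    (S : Module.Basis (Fin d) ℂ (H0 n L N)) : ∀ᵐ c ∂gaussian d,
    IsLocalEquation (zeroSet S c) P (trivTarget n L) K fun p => lincomb (localComps S p) c := by
  have h1 : ∀ᵐ c ∂gaussian d, ∀ p ∈ P, IntegrableOn
      (fun u => ((Real.log (‖lincomb (localComps S p) c u‖ ^ 2) : ℝ) : ℂ)) (K p) :=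
    (Filter.eventually_all_finset P).2 fun p _ => ae_integrableOn_potential (hχ.compact p)
      (continuousOn_localComps hχ S p) (exists_localComps_ne_zero hχ hN S p)
  have hP : ∀ z, ∃ p ∈ P, z ∈ trivSource n L p := by
    intro z
    have h2 : ∑ p ∈ P, χ p z ≠ 0 := by
      rw [hχ.sum_eq_one]
      exact one_ne_zero
    obtain ⟨p, hp, hne⟩ := Finset.exists_ne_zero_of_sum_ne_zero h2
    obtain ⟨u, hu, rfl⟩ := hχ.support p z hne
    exact ⟨p, hp, (chartAt (Cn (n + 1)) p).map_target (hχ.subset p hu).1, (hχ.subset p hu).2⟩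
  filter_upwards [h1, ae_isRegularOn hN S P] with c hc hreg
  exact ⟨isHypersurface_zeroSet S hP hreg,
    fun p _ => contDiffOn_lincomb (contDiffOn_localComps S p) c,
    fun p _ u hu => mem_zeroSet_iff S c hu.2, hreg, hc⟩

/-- Almost surely the pairing is a finite sum of integrals of potentials against continuous
functions on compact sets, and each of these is integrable in `c`. -/
theorem integrable_zeroCurrent (hN : BasePointFree n L N)
    (S : Module.Basis (Fin d) ℂ (H0 n L N)) {φ : M → Cn (n + 1) [⋀^Fin (2 * n)]→L[ℝ] ℂ}
    (hφ : IsSmoothForm 𝓘(ℝ, Cn (n + 1)) φ) :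
    Integrable (fun c => zeroCurrent S c fun x v => φ x v) (gaussian d) := by
  obtain ⟨P, χ, K, hχ⟩ := exists_isCutoff_trivTarget n L
  have hs : ∀ p, ContDiffOn ℝ ∞ (formInChart 𝓘(ℝ, Cn (n + 1)) (fun z => χ p z • φ z) p)
      (chartAt (Cn (n + 1)) p).target := fun p => by
    have h1 := hφ p
    rw [extChartAt_target_eq] at h1
    exact (hχ.smooth p p).smul h1
  have h1 : Integrable (fun c => ∑ p ∈ P, ∫ u in K p, potential (localComps S p) c u *
      ddcTop (formInChart 𝓘(ℝ, Cn (n + 1)) (fun z => χ p z • φ z) p) u) (gaussian d) :=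
    integrable_finsetSum _ fun p _ => (integral_potential_pairing (hχ.compact p)
      (continuousOn_localComps hχ S p) (exists_localComps_ne_zero hχ hN S p)
      ((continuousOn_ddcTop (chartAt (Cn (n + 1)) p).open_target (hs p)).mono
        ((hχ.subset p).trans (trivTarget_subset p)))).1
  refine h1.congr ?_
  filter_upwards [ae_isLocalEquation hχ hN S] with c hc
  rw [zeroCurrent, poincareLelong isOpen_trivTarget trivTarget_subset hχ.compact hχ.subset hc
    (φ := fun p z => χ p z • φ z) (fun p _ => hs p)]
  · refine Finset.sum_congr rfl fun p _ => ?_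
    rw [← integral_const_mul]
    simp only [potential, mul_assoc]
  · intro p _ z hz
    refine hχ.support p z fun h0 => hz ?_
    rw [h0]
    exact zero_smul ℝ (φ z)
  · intro z v
    have h1 := congrArg (fun α => α v) (sum_smul_eq hχ z (φ z))
    simp only [ContinuousAlternatingMap.sum_apply] at h1
    exact h1

theorem ae_boxtimes_zeroCurrent_eq (hχ : IsCutoff n (trivTarget n L) P χ K)
    (hN : BasePointFree n L N) (S : Module.Basis (Fin d) ℂ (H0 n L N))
    (hΦ : IsSmoothForm (I₂ n) Φ) : ∀ᵐ c ∂gaussian d,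
    boxtimes rfl (zeroCurrent S c) (zeroCurrent S c) Φ = ∑ i ∈ P ×ˢ P, ∫ y in K i.2, ∫ x in K i.1,
      potential (localComps S i.1) c x * potential (localComps S i.2) c y *
        cutCoeff χ Φ i.1 i.2 (x, y) := by
  filter_upwards [ae_isLocalEquation hχ hN S] with c hc
  rw [boxtimes]
  simp only [zeroCurrent, integrationCurrent_slice hχ isOpen_trivTarget trivTarget_subset hΦ hc]
  rw [integrationCurrent_integral_eq_sum hχ isOpen_trivTarget trivTarget_subset hΦ hc
    (b := fun q y => 1 / (2 * Real.pi) *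
      ((Real.log (‖lincomb (localComps S q) c y‖ ^ 2) : ℝ) : ℂ))
    fun q hq => Integrable.const_mul (hc.integrable q hq) _]
  simp only [potential, mul_assoc]

theorem expectedCurrent_slice (hχ : IsCutoff n (trivTarget n L) P χ K)
    (hN : BasePointFree n L N) (S : Module.Basis (Fin d) ℂ (H0 n L N))
    (hΦ : IsSmoothForm (I₂ n) Φ) (z : M) (v : Fin (2 * n) → Cn (n + 1)) :
    expectedCurrent S (fun w v' => splitForm rfl Φ z w v v')
      = ∑ q ∈ P, ∫ y in K q, meanPotential (localComps S q) y *
        cutW χ Φ q (z, (chartAt (Cn (n + 1)) q).symm y)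
          (splitVec (degree_cutW n) v (tframe q y)) := by
  have h1 : ∀ᵐ c ∂gaussian d, zeroCurrent S c (fun w v' => splitForm rfl Φ z w v v')
      = ∑ q ∈ P, ∫ y in K q, potential (localComps S q) c y *
        cutW χ Φ q (z, (chartAt (Cn (n + 1)) q).symm y)
          (splitVec (degree_cutW n) v (tframe q y)) := by
    filter_upwards [ae_isLocalEquation hχ hN S] with c hc
    exact integrationCurrent_slice hχ isOpen_trivTarget trivTarget_subset hΦ hc z v
  have h2 := fun q => integral_potential_pairing (hχ.compact q)
      (continuousOn_localComps hχ S q) (exists_localComps_ne_zero hχ hN S q)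
      (continuousOn_cutW_slice hχ trivTarget_subset hΦ z q v)
  rw [expectedCurrent, integral_congr_ae h1, integral_finsetSum _ fun q _ => (h2 q).1]
  exact Finset.sum_congr rfl fun q _ => (h2 q).2

/-- The expectation over `w` is taken first and leaves the deterministic weight `meanPotential`.
With this weight fixed, the zero current in `z` is expanded and averaged in turn. -/
theorem boxtimes_expectedCurrent_eq (hχ : IsCutoff n (trivTarget n L) P χ K)
    (hN : BasePointFree n L N) (S : Module.Basis (Fin d) ℂ (H0 n L N))
    (hΦ : IsSmoothForm (I₂ n) Φ) :
    boxtimes rfl (expectedCurrent S) (expectedCurrent S) Φ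
      = ∑ i ∈ P ×ˢ P, ∫ y in K i.2, ∫ x in K i.1, meanPotential (localComps S i.1) x *
        (meanPotential (localComps S i.2) y * cutCoeff χ Φ i.1 i.2 (x, y)) := by
  rw [boxtimes]
  simp only [expectedCurrent_slice hχ hN S hΦ]
  have h1 : ∀ᵐ c ∂gaussian d, zeroCurrent S c (fun z v => ∑ q ∈ P, ∫ y in K q,
        meanPotential (localComps S q) y * cutW χ Φ q (z, (chartAt (Cn (n + 1)) q).symm y)
          (splitVec (degree_cutW n) v (tframe q y)))
      = ∑ i ∈ P ×ˢ P, ∫ y in K i.2, ∫ x in K i.1, potential (localComps S i.1) c x *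
        (meanPotential (localComps S i.2) y * cutCoeff χ Φ i.1 i.2 (x, y)) := by
    filter_upwards [ae_isLocalEquation hχ hN S] with c hc
    exact integrationCurrent_integral_eq_sum hχ isOpen_trivTarget trivTarget_subset hΦ hc
      fun q _ => (continuousOn_meanPotential (continuousOn_localComps hχ S q)
        (exists_localComps_ne_zero hχ hN S q)).integrableOn_compact (hχ.compact q)
  have h2 := fun i : M × M => integral_potential_mean_pairing (hχ.compact i.1)
    (continuousOn_localComps hχ S i.1) (exists_localComps_ne_zero hχ hN S i.1) (hχ.compact i.2)
    (continuousOn_localComps hχ S i.2) (exists_localComps_ne_zero hχ hN S i.2)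
    (continuousOn_cutCoeff hχ trivTarget_subset hΦ i.1 i.2)
  rw [expectedCurrent, integral_congr_ae h1, integral_finsetSum _ fun i _ => (h2 i).1]
  exact Finset.sum_congr rfl fun i _ => (h2 i).2

theorem integrable_boxtimes_zeroCurrent (hN : BasePointFree n L N)
    (S : Module.Basis (Fin d) ℂ (H0 n L N)) (hΦ : IsSmoothForm (I₂ n) Φ) :
    Integrable (fun c => boxtimes rfl (zeroCurrent S c) (zeroCurrent S c) Φ) (gaussian d) := by
  obtain ⟨P, χ, K, hχ⟩ := exists_isCutoff_trivTarget n L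
  refine (integrable_finsetSum (P ×ˢ P) fun i _ => ?_).congr
    ((ae_boxtimes_zeroCurrent_eq hχ hN S hΦ).mono fun c hc => hc.symm)
  exact (integral_potential_potential_pairing (hχ.compact i.1)
    (continuousOn_localComps hχ S i.1) (exists_localComps_ne_zero hχ hN S i.1) (hχ.compact i.2)
    (continuousOn_localComps hχ S i.2) (exists_localComps_ne_zero hχ hN S i.2)
    (continuousOn_cutCoeff hχ trivTarget_subset hΦ i.1 i.2)).1

-- All three currents are sums over the same pairs of charts with the same coefficient `cutCoeff`,
-- so only the weights matter. The product of the mean potentials cancels, and the remaining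
-- covariance is the bipotential by `bipotential_eq`.
set_option maxHeartbeats 1000000 in
theorem varianceCurrent_eq (h : HermitianMetric n L) (hN : BasePointFree n L N)
    (S : Module.Basis (Fin d) ℂ (H0 n L N)) (hΦ : IsSmoothForm (I₂ n) Φ) :
    varianceCurrent S Φ = bipotentialCurrent (h.bipotential S) Φ := by
  obtain ⟨P, χ, K, hχ⟩ := exists_isCutoff_trivTarget n L
  have hQ := continuous_bipotential h hN S
  have h2 := fun i : M × M => integral_potential_potential_pairing (hχ.compact i.1)
    (continuousOn_localComps hχ S i.1) (exists_localComps_ne_zero hχ hN S i.1) (hχ.compact i.2)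
    (continuousOn_localComps hχ S i.2) (exists_localComps_ne_zero hχ hN S i.2)
    (continuousOn_cutCoeff hχ trivTarget_subset hΦ i.1 i.2)
  rw [varianceCurrent, integral_congr_ae (ae_boxtimes_zeroCurrent_eq hχ hN S hΦ),
    integral_finsetSum _ fun i _ => (h2 i).1, boxtimes_expectedCurrent_eq hχ hN S hΦ,
    bipotentialCurrent_eq hχ trivTarget_subset hΦ hQ, ← Finset.sum_sub_distrib]
  refine Finset.sum_congr rfl fun i _ => ?_
  rw [(h2 i).2]
  have hKt := fun p => (hχ.subset p).trans (trivTarget_subset (n := n) (L := L) p)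
  have hKK := (hχ.compact i.2).prod (hχ.compact i.1)
  have hm := fun p => continuousOn_meanPotential (continuousOn_localComps hχ S p)
    (exists_localComps_ne_zero hχ hN S p)
  have c1 : ContinuousOn (fun q : Cn (n + 1) × Cn (n + 1) => cutCoeff χ Φ i.1 i.2 (q.2, q.1))
      (K i.2 ×ˢ K i.1) := (continuousOn_cutCoeff hχ trivTarget_subset hΦ i.1 i.2).comp
    continuous_swap.continuousOn fun q hq => ⟨hq.2, hq.1⟩
  have c2 : ContinuousOn (fun q : Cn (n + 1) × Cn (n + 1) => meanPotential (localComps S i.1) q.2 *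
      (meanPotential (localComps S i.2) q.1 * cutCoeff χ Φ i.1 i.2 (q.2, q.1)))
      (K i.2 ×ˢ K i.1) :=
    ((hm i.1).comp continuousOn_snd fun q hq => hq.2).mul
      (((hm i.2).comp continuousOn_fst fun q hq => hq.1).mul c1)
  have hQc : Continuous fun x : M × M => (h.bipotential S x.1 x.2 : ℂ) :=
    Complex.continuous_ofReal.comp hQ
  have hpair : ContinuousOn (fun q : Cn (n + 1) × Cn (n + 1) =>
      ((chartAt (Cn (n + 1)) i.1).symm q.2, (chartAt (Cn (n + 1)) i.2).symm q.1))
      (K i.2 ×ˢ K i.1) :=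
    ((chartAt (Cn (n + 1)) i.1).continuousOn_symm.comp continuousOn_snd
      fun q hq => hKt i.1 hq.2).prodMk
      ((chartAt (Cn (n + 1)) i.2).continuousOn_symm.comp continuousOn_fst
        fun q hq => hKt i.2 hq.1)
  have c3 : ContinuousOn (fun q : Cn (n + 1) × Cn (n + 1) =>
      (h.bipotential S ((chartAt (Cn (n + 1)) i.1).symm q.2)
        ((chartAt (Cn (n + 1)) i.2).symm q.1) : ℂ) * cutCoeff χ Φ i.1 i.2 (q.2, q.1))
      (K i.2 ×ˢ K i.1) := by
    exact (hQc.comp_continuousOn hpair).mul c1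
  have i2 := c2.integrableOn_compact (μ := volume.prod volume) hKK
  have i3 := c3.integrableOn_compact (μ := volume.prod volume) hKK
  rw [IntegrableOn, ← Measure.prod_restrict] at i2 i3
  rw [sub_eq_iff_eq_add, ← integral_integral_add i3 i2]
  refine setIntegral_congr_fun (hχ.compact i.2).measurableSet fun y hy => ?_
  refine setIntegral_congr_fun (hχ.compact i.1).measurableSet fun x hx => ?_
  have h3 := bipotential_eq h hN S (hχ.subset _ hx).2 (hχ.subset _ hy).2
  dsimp only
  rw [h3, add_mul, add_comm, mul_assoc]
  rfl

end Variance

end Bipot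

end

theorem theorem3p1 {n : ℕ} {M : Type*} [TopologicalSpace M] [CompactSpace M] [T2Space M]
    [ChartedSpace (Bipot.Cn (n + 1)) M] [IsManifold 𝓘(ℂ, Bipot.Cn (n + 1)) ω M]
    {L : M → Type*} [TopologicalSpace (Bundle.TotalSpace ℂ L)] [∀ x, AddCommGroup (L x)]
    [∀ x, Module ℂ (L x)] [∀ x, TopologicalSpace (L x)] [FiberBundle ℂ L] [VectorBundle ℂ ℂ L]
    [ContMDiffVectorBundle ω ℂ L 𝓘(ℂ, Bipot.Cn (n + 1))]
    (h : Bipot.HermitianMetric n L) (hpos : h.IsPositive)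
    (N : ℕ) (hN : Bipot.BasePointFree n L N)
    {d : ℕ} (S : Module.Basis (Fin d) ℂ (Bipot.H0 n L N)) (hS : h.IsOrthonormal S) :
    -- the zero current of almost every section, and its moments, are well defined
    (∀ᵐ c ∂Bipot.gaussian d, Bipot.IsHypersurface n (Bipot.zeroSet S c)) ∧
    (∀ φ : M → Bipot.Cn (n + 1) [⋀^Fin (2 * n)]→L[ℝ] ℂ, Bipot.IsTestForm φ →
      Integrable (fun c => Bipot.zeroCurrent S c (fun x v => φ x v)) (Bipot.gaussian d)) ∧
    (∀ Φ : M × M → (Bipot.Cn (n + 1) × Bipot.Cn (n + 1)) [⋀^Fin (2 * n + 2 * n)]→L[ℝ] ℂ,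
      Bipot.IsTestForm₂ Φ →
      Integrable (fun c =>
        Bipot.boxtimes rfl (Bipot.zeroCurrent S c) (Bipot.zeroCurrent S c) Φ)
        (Bipot.gaussian d)) ∧
    -- the bipotential is a continuous function with values in `[0, ∞)`
    (∀ z w, 0 ≤ h.bipotential S z w) ∧
    Continuous (fun p : M × M => h.bipotential S p.1 p.2) ∧
    -- the variance current equals `(i∂∂̄)_z (i∂∂̄)_w Q_N`
    (∀ Φ : M × M → (Bipot.Cn (n + 1) × Bipot.Cn (n + 1)) [⋀^Fin (2 * n + 2 * n)]→L[ℝ] ℂ,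
      Bipot.IsTestForm₂ Φ →
      Bipot.varianceCurrent S Φ = Bipot.bipotentialCurrent (h.bipotential S) Φ) := by
  obtain ⟨P, χ, K, hχ⟩ := Bipot.exists_isCutoff_trivTarget n L
  exact ⟨(Bipot.ae_isLocalEquation hχ hN S).mono fun c hc => hc.hypersurface,
    fun φ hφ => Bipot.integrable_zeroCurrent hN S hφ.1,
    fun Φ hΦ => Bipot.integrable_boxtimes_zeroCurrent hN S hΦ.1,
    Bipot.bipotential_nonneg h hN S, Bipot.continuous_bipotential h hN S,
    fun Φ hΦ => Bipot.varianceCurrent_eq h hN S hΦ.1⟩
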